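/- Let $Q=(0,1)^2$, let $f_1,f_2:\mathbb R^2\to(0,+\infty)$ be Lipschitz continuous, $1$-periodic in each of the two coordinates, with $f_1<f_2$ everywhere, let $\omega\subset\mathbb R^2$ be a bounded connected open set with Lipschitz boundary, and let $d>0$. Write $x=(x',x_3)\in\mathbb R^2\times\mathbb R$ and, for $\varepsilon>0$, $$\Omega_\varepsilon=\{(x',x_3): x'\in\omega,\ f_1(x'/\varepsilon)<x_3<f_2(x'/\varepsilon)\},\qquad V_\varepsilon=\{(x',x_3): x'\in\omega,\ \varepsilon f_1(x'/\varepsilon)<x_3<\varepsilon f_2(x'/\varepsilon)\}.$$ For $m\in H^1(\Omega_\varepsilon;\mathbb S^2)$ let $$E_\varepsilon(m)=d^2\int_{\Omega_\varepsilon}\Big(|\nabla_{x'}m|^2+\frac1{\varepsilon^2}|\partial_{x_3}m|^2\Big)\,dx+\frac1\varepsilon\int_{\mathbb R^3}|\nabla u|^2\,dx,$$ where $u$ is the unique solution of $\Delta u=\operatorname{div}(M\chi_{V_\varepsilon})$ in $\dot H^1(\mathbb R^3)$ (the completion of $C_c^\infty(\mathbb R^3)$ for the norm $\|\nabla u\|_{L^2(\mathbb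 R^3)}$), with $M(x',x_3)=m(x',x_3/\varepsilon)$. With $n_i(x')=(-\nabla f_i(x'),1)$ and $\mathbf e_3=(0,0,1)$, let $A_{\mathrm{hom}}$ be the $3\times3$ matrix $$\begin{aligned}A_{\mathrm{hom}}={}&\frac1{4\pi}\sum_{i=1}^2\int_Q\int_{\mathbb R^2}\Big(\frac{n_i(x')\otimes n_i(z'+x')}{\sqrt{|z'|^2+|f_i(z'+x')-f_i(x')|^2}}-\frac{n_i(x')\otimes n_i(z'+x')}{\sqrt{|z'|^2+1}}\Big)dz'dx'\\&-\frac1{2\pi}\int_Q\int_{\mathbb R^2}\Big(\frac{n_1(x')\otimes n_2(z'+x')}{\sqrt{|z'|^2+|f_2(z'+x')-f_1(x')|^2}}-\frac{n_1(x')\otimes n_2(z'+x')}{\sqrt{|z'|^2+1}}\Big)dz'dx'\\&+\frac1{4\pi}\int_Q\int_{\mathbb R^2}\Big(\frac{I-\mathbf e_3\otimes\mathbf e_3}{(|z'|^2+1)^{3/2}}-\frac{3(z',0)\otimes(z',0)}{(|z'|^2+1)^{5/2}}\Big)(f_2-f_1)(z'+x')\,(f_2-f_1)(x')\,dz'dx'.\end{aligned}$$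 Let $\varepsilon_n>0$ with $\varepsilon_n\to0$ and, for each $n$, let $m_n\in H^1(\Omega_{\varepsilon_n};\mathbb S^2)$ be a minimizer of $E_{\varepsilon_n}$ over $H^1(\Omega_{\varepsilon_n};\mathbb S^2)$. Then there are a subsequence $(n_k)$ and a constant vector $e_0\in\mathbb S^2$ such that $$\int_{\Omega_{\varepsilon_{n_k}}}|m_{n_k}(x)-e_0|^2\,dx\to0\quad(k\to\infty)\qquad\text{and}\qquad A_{\mathrm{hom}}e_0\cdot e_0=\min_{e\in\mathbb S^2}A_{\mathrm{hom}}e\cdot e.$$ -/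

import Mathlib

open MeasureTheory Filter Topology Matrix

namespace ThinFilm

/-- The Euclidean plane, with generic point `x'`. -/
abbrev E2 := EuclideanSpace ℝ (Fin 2)

/-- Euclidean three-space, with generic point `x = (x', x₃)`. -/
abbrev E3 := EuclideanSpace ℝ (Fin 3)

/-- The horizontal part `x' = (x₁, x₂)` of `x = (x', x₃)`. -/
noncomputable def horiz (x : E3) : E2 := !₂[x 0, x 1]

/-! ### Geometry -/

/-- The open unit cell `Q = (0,1) × (0,1)`. -/
def cellQ : Set E2 := {x | ∀ k : Fin 2, 0 < x k ∧ x k < 1}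

/-- `Q`-periodicity: period one in each of the two coordinate directions. -/
def IsQPeriodic (f : E2 → ℝ) : Prop :=
  ∀ (x : E2) (k : Fin 2), f (x + EuclideanSpace.single k 1) = f x

/-- Lipschitz boundary of a planar open set `ω`: near each boundary point `p`, in suitable
orthonormal coordinates centred at `p`, the set `ω` is the region above the graph of a Lipschitz
function. -/
def HasLipschitzBoundary (ω : Set E2) : Prop :=
  ∀ p ∈ frontier ω, ∃ (R : E2 ≃ₗᵢ[ℝ] E2) (γ : ℝ → ℝ) (K : NNReal) (r : ℝ),
    LipschitzWith K γ ∧ 0 < r ∧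
      ∀ x ∈ Metric.ball p r, (x ∈ ω ↔ γ (R (x - p) 0) < R (x - p) 1)

/-- The thin film
`V_ε = {(x', x₃) : x' ∈ ω, ε f₁(x'/ε) < x₃ < ε f₂(x'/ε)}`. -/
def filmV (f₁ f₂ : E2 → ℝ) (ω : Set E2) (ε : ℝ) : Set E3 :=
  {x | horiz x ∈ ω ∧ ε * f₁ (ε⁻¹ • horiz x) < x 2 ∧ x 2 < ε * f₂ (ε⁻¹ • horiz x)}

/-- The rescaled film
`Ω_ε = {(x', x₃) : x' ∈ ω, f₁(x'/ε) < x₃ < f₂(x'/ε)}`. -/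
def filmΩ (f₁ f₂ : E2 → ℝ) (ω : Set E2) (ε : ℝ) : Set E3 :=
  {x | horiz x ∈ ω ∧ f₁ (ε⁻¹ • horiz x) < x 2 ∧ x 2 < f₂ (ε⁻¹ • horiz x)}

/-! ### The space `H¹(U; 𝕊²)` -/

/-- `φ` is a (real-valued) test function on `ℝ³`, i.e. `φ ∈ C_c^∞(ℝ³)`. -/
def IsTest (φ : E3 → ℝ) : Prop := ContDiff ℝ ((⊤ : ℕ∞) : WithTop ℕ∞) φ ∧ HasCompactSupport φ

/-- `g` is the weak partial derivative `∂ᵢ m` on `U`: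
`∫_U (∂ᵢ φ) m = - ∫_U φ g` for all `φ ∈ C_c^∞(U)`. -/
def IsWeakPartial (U : Set E3) (i : Fin 3) (m g : E3 → E3) : Prop :=
  ∀ φ : E3 → ℝ, IsTest φ → tsupport φ ⊆ U →
    ∫ x in U, fderiv ℝ φ x (EuclideanSpace.single i 1) • m x = - ∫ x in U, φ x • g x

/-- An element of `H¹(U; 𝕊²)`: a map in `L²(U; ℝ³)`, of unit length almost everywhere in `U`,
together with its weak partial derivatives (unique up to null sets), which lie in
`L²(U; ℝ³)`. The values outside `U` are irrelevant. -/
structure H1Sphere (U : Set E3) where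
  /-- the map -/
  toFun : E3 → E3
  /-- its weak partial derivatives -/
  partials : Fin 3 → E3 → E3
  memLp_toFun : MemLp toFun 2 (volume.restrict U)
  memLp_partials : ∀ i, MemLp (partials i) 2 (volume.restrict U)
  isWeakPartial : ∀ i, IsWeakPartial U i toFun (partials i)
  norm_eq_one : ∀ᵐ x ∂(volume.restrict U), ‖toFun x‖ = 1

/-! ### The magnetostatic potential -/

theorem IsTest.contDiff_one {φ : E3 → ℝ} (h : IsTest φ) : ContDiff ℝ 1 φ :=
  h.1.of_le (by exact_mod_cast le_top)

theorem IsTest.memLp_gradient {φ : E3 → ℝ} (h : IsTest φ) :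
    MemLp (gradient φ) 2 (volume : Measure E3) := by
  have hc : Continuous (gradient φ) :=
    (InnerProductSpace.toDual ℝ E3).symm.continuous.comp (h.contDiff_one.continuous_fderiv one_ne_zero)
  have hs : HasCompactSupport (gradient φ) :=
    (h.2.fderiv ℝ).comp_left (g := (InnerProductSpace.toDual ℝ E3).symm) (map_zero _)
  exact hc.memLp_of_hasCompactSupport hs

/-- The gradients of test functions, as a subspace of `L²(ℝ³; ℝ³)`. -/
def gradTest : Submodule ℝ (Lp E3 2 (volume : Measure E3)) where
  carrier := {G | ∃ φ : E3 → ℝ, IsTest φ ∧ G =ᵐ[volume] gradient φ}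
  zero_mem' := by
    refine ⟨fun _ => 0, ⟨contDiff_const, HasCompactSupport.zero⟩, ?_⟩
    filter_upwards [Lp.coeFn_zero E3 2 (volume : Measure E3)] with x hx
    rw [hx]
    simp [gradient]
  add_mem' := by
    rintro F G ⟨φ, hφ, hF⟩ ⟨ψ, hψ, hG⟩
    refine ⟨φ + ψ, ⟨hφ.1.add hψ.1, hφ.2.add hψ.2⟩, ?_⟩
    filter_upwards [Lp.coeFn_add F G, hF, hG] with x hx h1 h2
    rw [hx, Pi.add_apply, h1, h2]
    simp only [gradient]
    rw [fderiv_add (hφ.contDiff_one.differentiable one_ne_zero x)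
      (hψ.contDiff_one.differentiable one_ne_zero x), map_add]
  smul_mem' := by
    rintro c F ⟨φ, hφ, hF⟩
    refine ⟨c • φ, ⟨hφ.1.const_smul c, hφ.2.smul_left (f := fun _ => c)⟩, ?_⟩
    filter_upwards [Lp.coeFn_smul c F, hF] with x hx h1
    rw [hx, Pi.smul_apply, h1]
    simp only [gradient]
    rw [fderiv_const_smul (hφ.contDiff_one.differentiable one_ne_zero x)]
    simp

/-- The homogeneous Sobolev space `Ḣ¹(ℝ³)`, the completion of `C_c^∞(ℝ³)` for the norm
`‖∇u‖_{L²(ℝ³)}`. Since `φ ↦ ∇φ` is an isometry from `C_c^∞(ℝ³)`, with this norm, into the complete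
space `L²(ℝ³; ℝ³)`, the completion is the `L²`-closure of the gradients of test functions; the
potential `u` is represented by its gradient `∇u`. -/
noncomputable def homogeneousH1 : Submodule ℝ (Lp E3 2 (volume : Measure E3)) :=
  gradTest.topologicalClosure

/-- `G = ∇u` for a solution `u ∈ Ḣ¹(ℝ³)` of `Δu = div F` in the sense of distributions:
`∫ ∇u · ∇φ = ∫ F · ∇φ` for all test functions `φ`. -/
def IsStrayGradient (F : E3 → E3) (G : Lp E3 2 (volume : Measure E3)) : Prop :=
  G ∈ homogeneousH1 ∧
    ∀ φ : E3 → ℝ, IsTest φ →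
      ∫ x, inner ℝ (G x) (gradient φ x) = ∫ x, inner ℝ (F x) (gradient φ x)

/-- For `F ∈ L²(ℝ³; ℝ³)`, the equation `Δu = div F` has exactly one solution in `Ḣ¹(ℝ³)`. -/
theorem existsUnique_isStrayGradient {F : E3 → E3} (hF : MemLp F 2 volume) :
    ∃! G : Lp E3 2 (volume : Measure E3), IsStrayGradient F G := by
  have : CompleteSpace homogeneousH1 := gradTest.isClosed_topologicalClosure.completeSpace_coe
  have key : ∀ G : Lp E3 2 (volume : Measure E3),
      (∀ φ : E3 → ℝ, IsTest φ →
        ∫ x, inner ℝ (G x) (gradient φ x) = ∫ x, inner ℝ (F x) (gradient φ x)) ↔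
      hF.toLp F - G ∈ homogeneousH1ᗮ := by
    intro G
    rw [homogeneousH1, Submodule.orthogonal_closure, Submodule.mem_orthogonal']
    have conv : ∀ (A : Lp E3 2 (volume : Measure E3)) (φ : E3 → ℝ) (P : Lp E3 2 volume),
        P =ᵐ[volume] gradient φ → inner ℝ A P = ∫ x, inner ℝ (A x) (gradient φ x) := by
      intro A φ P hP
      rw [L2.inner_def]
      refine integral_congr_ae ?_
      filter_upwards [hP] with x hx
      rw [hx]
    have convF : ∀ φ : E3 → ℝ, ∫ x, inner ℝ (hF.toLp F x) (gradient φ x)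
        = ∫ x, inner ℝ (F x) (gradient φ x) := by
      intro φ
      refine integral_congr_ae ?_
      filter_upwards [hF.coeFn_toLp] with x hx
      rw [hx]
    constructor
    · rintro h P ⟨φ, hφ, hP⟩
      rw [inner_sub_left, conv _ φ P hP, conv _ φ P hP, convF, h φ hφ, sub_self]
    · intro h φ hφ
      have hP := hφ.memLp_gradient.coeFn_toLp
      have := h _ ⟨φ, hφ, hP⟩
      rw [inner_sub_left, conv _ φ _ hP, conv _ φ _ hP, convF] at this
      linarith
  refine ⟨homogeneousH1.starProjection (hF.toLp F),
    ⟨Submodule.starProjection_apply_mem _ _, (key _).2 ?_⟩, ?_⟩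
  · exact homogeneousH1.sub_starProjection_mem_orthogonal _
  · rintro G ⟨hG, hG'⟩
    exact (Submodule.eq_starProjection_of_mem_orthogonal hG ((key G).1 hG')).symm

open Classical in
/-- The gradient `∇u` of the unique solution `u ∈ Ḣ¹(ℝ³)` of `Δu = div F`, for
`F ∈ L²(ℝ³; ℝ³)`. -/
noncomputable def strayGradient (F : E3 → E3) : Lp E3 2 (volume : Measure E3) :=
  if hF : MemLp F 2 volume then (existsUnique_isStrayGradient hF).choose else 0

theorem isStrayGradient_strayGradient {F : E3 → E3} (hF : MemLp F 2 volume) :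
    IsStrayGradient F (strayGradient F) := by
  rw [strayGradient, dif_pos hF]
  exact (existsUnique_isStrayGradient hF).choose_spec.1

/-! ### The rescaled micromagnetic energy -/

/-- The vertical rescaling `(x', x₃) ↦ (x', x₃ / ε)`. -/
noncomputable def rescale (ε : ℝ) (x : E3) : E3 := !₂[x 0, x 1, x 2 / ε]

/-- The field `M χ_{V_ε}` on `ℝ³`, where `M(x', x₃) = m(x', x₃/ε)`. -/
noncomputable def magnetization (f₁ f₂ : E2 → ℝ) (ω : Set E2) (ε : ℝ) (m : E3 → E3) : E3 → E3 :=
  (filmV f₁ f₂ ω ε).indicator fun x => m (rescale ε x)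

/-- The rescaled energy
`E_ε(m) = d² ∫_{Ω_ε} (|∇_{x'} m|² + ε⁻² |∂₃ m|²) dx + ε⁻¹ ∫_{ℝ³} |∇u|²`. -/
noncomputable def energy (d : ℝ) (f₁ f₂ : E2 → ℝ) (ω : Set E2) (ε : ℝ)
    (m : H1Sphere (filmΩ f₁ f₂ ω ε)) : ℝ :=
  d ^ 2 * (∫ x in filmΩ f₁ f₂ ω ε,
      (‖m.partials 0 x‖ ^ 2 + ‖m.partials 1 x‖ ^ 2 + 1 / ε ^ 2 * ‖m.partials 2 x‖ ^ 2))
    + 1 / ε * ∫ x, ‖strayGradient (magnetization f₁ f₂ ω ε m.toFun) x‖ ^ 2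

/-- The magnetization is square integrable, so that the magnetostatic potential exists and is
unique for every competitor. -/
theorem memLp_magnetization {f₁ f₂ : E2 → ℝ} {ω : Set E2} {ε : ℝ} (hε : 0 < ε)
    (hf₁ : Continuous f₁) (hf₂ : Continuous f₂) (hω : IsOpen ω)
    (m : H1Sphere (filmΩ f₁ f₂ ω ε)) :
    MemLp (magnetization f₁ f₂ ω ε m.toFun) 2 volume := by
  have hh : Continuous horiz := by unfold horiz; fun_prop
  have hΩ : MeasurableSet (filmΩ f₁ f₂ ω ε) := by
    refine IsOpen.measurableSet ?_
    refine (hω.preimage hh).inter (IsOpen.inter ?_ ?_)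
    · exact isOpen_lt (f := fun x : E3 => f₁ (ε⁻¹ • horiz x)) (g := fun x : E3 => x 2)
        (by fun_prop) (by fun_prop)
    · exact isOpen_lt (f := fun x : E3 => x 2) (g := fun x : E3 => f₂ (ε⁻¹ • horiz x))
        (by fun_prop) (by fun_prop)
  let L : E3 →ₗ[ℝ] E3 :=
    { toFun := rescale ε
      map_add' := fun x y => by
        ext i; fin_cases i <;> simp [rescale, add_div]
      map_smul' := fun c x => by
        ext i; fin_cases i <;> simp [rescale, mul_div_assoc] }
  have hinj : LinearMap.ker L = ⊥ := by
    rw [LinearMap.ker_eq_bot']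
    intro x hx
    have h0 := congrArg (fun v : E3 => v 0) hx
    have h1 := congrArg (fun v : E3 => v 1) hx
    have h2 := congrArg (fun v : E3 => v 2) hx
    simp [L, rescale, hε.ne'] at h0 h1 h2
    ext i; fin_cases i <;> simp [h0, h1, h2]
  have hdet : LinearMap.det L ≠ 0 := by
    have := (LinearEquiv.ofInjectiveEndo L (LinearMap.ker_eq_bot.1 hinj)).isUnit_det'
    exact this.ne_zero
  have hL : Measurable L := L.continuous_of_finiteDimensional.measurable
  have heq : magnetization f₁ f₂ ω ε m.toFun
      = (filmΩ f₁ f₂ ω ε).indicator m.toFun ∘ L := by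
    have hmem : ∀ x, x ∈ filmV f₁ f₂ ω ε ↔ L x ∈ filmΩ f₁ f₂ ω ε := by
      intro x
      have e1 : horiz (L x) = horiz x := by
        ext i; fin_cases i <;> simp [horiz, L, rescale]
      have e2 : L x 2 = x 2 / ε := by simp [L, rescale]
      simp only [filmV, filmΩ, Set.mem_ofPred_eq, e1, e2, lt_div_iff₀ hε, div_lt_iff₀ hε,
        mul_comm ε]
    funext x
    by_cases hx : x ∈ filmV f₁ f₂ ω ε
    · rw [magnetization, Set.indicator_of_mem hx, Function.comp_apply,
        Set.indicator_of_mem ((hmem x).1 hx)]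
      rfl
    · rw [magnetization, Set.indicator_of_notMem hx, Function.comp_apply,
        Set.indicator_of_notMem fun h => hx ((hmem x).2 h)]
  rw [heq]
  refine MemLp.comp_of_map ?_ hL.aemeasurable
  rw [Measure.map_linearMap_addHaar_eq_smul_addHaar _ hdet]
  exact ((memLp_indicator_iff_restrict hΩ).2 m.memLp_toFun).smul_measure ENNReal.ofReal_ne_top

/-- `m` is a (global) minimizer of `E_ε` over `H¹(Ω_ε; 𝕊²)`. -/
def IsEnergyMinimizer (d : ℝ) (f₁ f₂ : E2 → ℝ) (ω : Set E2) (ε : ℝ)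
    (m : H1Sphere (filmΩ f₁ f₂ ω ε)) : Prop :=
  ∀ m' : H1Sphere (filmΩ f₁ f₂ ω ε), energy d f₁ f₂ ω ε m ≤ energy d f₁ f₂ ω ε m'

/-! ### The effective matrix -/

/-- The vector `n(x') = (-∇f(x'), 1)`, defined for almost every `x'` when `f` is Lipschitz. -/
noncomputable def normalVec (f : E2 → ℝ) (x : E2) : E3 :=
  !₂[-(gradient f x 0), -(gradient f x 1), 1]

/-- The tensor product `a ⊗ b`, with entries `aᵢ bⱼ`. -/
def tensor (a b : E3) : Matrix (Fin 3) (Fin 3) ℝ := vecMulVec a.ofLp b.ofLp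

/-- The charge-charge interaction matrix of two profiles,
`∫_Q ∫_{ℝ²} ( n_f(x') ⊗ n_h(z'+x') / √(|z'|² + |h(z'+x') - f(x')|²)
  - n_f(x') ⊗ n_h(z'+x') / √(|z'|² + 1) ) dz' dx'`, entry by entry. -/
noncomputable def surfaceMatrix (f h : E2 → ℝ) : Matrix (Fin 3) (Fin 3) ℝ := fun i j =>
  ∫ x in cellQ, ∫ z : E2,
    (tensor (normalVec f x) (normalVec h (z + x)) i j
        / Real.sqrt (‖z‖ ^ 2 + |h (z + x) - f x| ^ 2)
      - tensor (normalVec f x) (normalVec h (z + x)) i j / Real.sqrt (‖z‖ ^ 2 + 1))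

/-- The third basis vector `e₃ = (0,0,1)`. -/
noncomputable def vecE3 : E3 := !₂[0, 0, 1]

/-- The vector `(z', 0)`. -/
noncomputable def liftHoriz (z : E2) : E3 := !₂[z 0, z 1, 0]

/-- The matrix
`∫_Q ∫_{ℝ²} ( (I - e₃ ⊗ e₃) / (|z'|²+1)^{3/2} - 3 (z',0) ⊗ (z',0) / (|z'|²+1)^{5/2} )
  (f₂(z'+x') - f₁(z'+x')) (f₂(x') - f₁(x')) dz' dx'`, entry by entry. -/
noncomputable def thicknessMatrix (f₁ f₂ : E2 → ℝ) : Matrix (Fin 3) (Fin 3) ℝ := fun i j =>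
  ∫ x in cellQ, ∫ z : E2,
    (((1 : Matrix (Fin 3) (Fin 3) ℝ) - tensor vecE3 vecE3) i j
        / (‖z‖ ^ 2 + 1) ^ (3 / 2 : ℝ)
      - 3 * tensor (liftHoriz z) (liftHoriz z) i j / (‖z‖ ^ 2 + 1) ^ (5 / 2 : ℝ))
      * ((f₂ (z + x) - f₁ (z + x)) * (f₂ x - f₁ x))

/-- The effective matrix `A_hom`. -/
noncomputable def Ahom (f₁ f₂ : E2 → ℝ) : Matrix (Fin 3) (Fin 3) ℝ :=
  (1 / (4 * Real.pi)) • surfaceMatrix f₁ f₁ + (1 / (4 * Real.pi)) • surfaceMatrix f₂ f₂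
    - (1 / (2 * Real.pi)) • surfaceMatrix f₁ f₂ + (1 / (4 * Real.pi)) • thicknessMatrix f₁ f₂

/-- The quadratic form `A e · e`. -/
noncomputable def quadForm (A : Matrix (Fin 3) (Fin 3) ℝ) (e : E3) : ℝ :=
  (A *ᵥ e.ofLp) ⬝ᵥ e.ofLp

end ThinFilm

/-! The gradient of the magnetostatic potential is the orthogonal projection of the magnetization
onto the closed space of gradients, so the square root of the magnetostatic energy is 1-Lipschitz in
L². In a film of thickness of order ε the prefactor 1/ε compensates the small volume. The rescaled
square root is therefore Lipschitz in L² uniformly in ε (`abs_layerNorm_sub_le`,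
`IsFilm.abs_magNorm_sub_layerNorm_le`). This leaves two tasks: the limit of the energy for a fixed
planar field, and strong compactness of minimizers.

Limit for a fixed field m(x') (`tendsto_magEnergy_layerField`). By density m may be taken smooth
with compact support. Subtracting (x₃ - h₁) div m from the vertical component changes the field only
by O(ε) and makes it divergence free inside the film. Its charges then sit on the two graphs, and
its energy is their Coulomb energy (`magEnergy_filmField`), obtained by replacing 1/(4π|x|) with
smooth compactly supported kernels and passing to the limit. In the variable z = (y - x)/ε the
interaction is a slowly varying density times a periodic coefficient times a kernel of order 1/|z|,
which is not integrable at infinity. Subtracting the kernel of two planes at distance one leaves a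
remainder of order |z|⁻³ at infinity, and two-scale averaging of that remainder yields the surface
matrices (`tendsto_surface`). The subtracted terms all share one kernel, so they combine into the
self-interaction of the top charge minus the bottom charge. This difference is minus the divergence
of (thickness) m', and the thickness is O(ε). Two integrations by parts move the derivatives to the
kernel, the powers of ε cancel, and the thickness matrix appears (`tendsto_thickness`).

Compactness. Flattening the film gives a Poincaré inequality over a ball of radius r with constant
of order (r + ε)², so there m is close to one unit vector (`IsFilm.exists_unit_lintegral_ball_le`).
Finitely many small disjoint balls fill ω up to a small area, on which |m| = 1 is enough. Hence
bounded exchange energy makes m close to a step function with unit values, and the magnetostatic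
energy is asymptotically at least |ω| times the minimum of the quadratic form of `Ahom` on the
sphere (`sqrt_le_of_magNorm_le`).

Conclusion. A constant map at a minimizing direction has no exchange energy, and its energy tends to
exactly that bound. So the exchange energy of the minimizers tends to zero (`tendsto_exchange`). On
each ball they approach a unit vector; overlapping balls and the connectedness of ω force a single
vector e₀ along a subsequence. The uniform Lipschitz bound then compares e₀ with the minimizing
direction. -/

open MeasureTheory Filter Topology Matrix

namespace ThinFilm

/-! ### Coordinates on three-space -/

/-- The point `(y, t)` of `ℝ³` with horizontal part `y` and height `t`. -/
noncomputable def join (y : E2) (t : ℝ) : E3 := !₂[y 0, y 1, t]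

@[simp] theorem join_zero (y : E2) (t : ℝ) : join y t 0 = y 0 := by simp [join]
@[simp] theorem join_one (y : E2) (t : ℝ) : join y t 1 = y 1 := by simp [join]
@[simp] theorem join_two (y : E2) (t : ℝ) : join y t 2 = t := by simp [join]
@[simp] theorem horiz_zero (x : E3) : horiz x 0 = x 0 := by simp [horiz]
@[simp] theorem horiz_one (x : E3) : horiz x 1 = x 1 := by simp [horiz]

@[simp] theorem horiz_join (y : E2) (t : ℝ) : horiz (join y t) = y := by
  ext i; fin_cases i <;> simp

@[simp] theorem join_horiz (x : E3) : join (horiz x) (x 2) = x := by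
  ext i; fin_cases i <;> simp

theorem continuous_horiz : Continuous horiz := by unfold horiz; fun_prop

theorem continuous_join : Continuous fun p : E2 × ℝ => join p.1 p.2 := by
  unfold join; fun_prop

@[fun_prop] theorem Continuous.join' {X : Type*} [TopologicalSpace X] {a : X → E2} {b : X → ℝ}
    (ha : Continuous a) (hb : Continuous b) : Continuous fun x => join (a x) (b x) :=
  continuous_join.comp (ha.prodMk hb)

@[fun_prop] theorem Continuous.horiz' {X : Type*} [TopologicalSpace X] {a : X → E3}
    (ha : Continuous a) : Continuous fun x => horiz (a x) :=
  continuous_horiz.comp ha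

@[fun_prop] theorem Measurable.join' {X : Type*} [MeasurableSpace X] {a : X → E2} {b : X → ℝ}
    (ha : Measurable a) (hb : Measurable b) : Measurable fun x => join (a x) (b x) :=
  continuous_join.measurable.comp (ha.prodMk hb)

@[fun_prop] theorem Measurable.horiz' {X : Type*} [MeasurableSpace X] {a : X → E3}
    (ha : Measurable a) : Measurable fun x => horiz (a x) :=
  continuous_horiz.measurable.comp ha

theorem norm_sq_join (y : E2) (t : ℝ) : ‖join y t‖ ^ 2 = ‖y‖ ^ 2 + t ^ 2 := by
  simp [EuclideanSpace.norm_sq_eq, Fin.sum_univ_three]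

theorem join_sub (y z : E2) (s t : ℝ) : join y s - join z t = join (y - z) (s - t) := by
  ext i; fin_cases i <;> simp

theorem join_add (y z : E2) (s t : ℝ) : join y s + join z t = join (y + z) (s + t) := by
  ext i; fin_cases i <;> simp

/-- `ℝ³` as the product of the horizontal plane and the vertical axis. -/
noncomputable def joinEquiv : E2 × ℝ ≃ᵐ E3 where
  toFun p := join p.1 p.2
  invFun x := (horiz x, x 2)
  left_inv p := by simp
  right_inv x := by simp
  measurable_toFun := continuous_join.measurable
  measurable_invFun := by
    have : Continuous fun x : E3 => (horiz x, x 2) := by fun_prop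
    exact this.measurable

theorem measurePreserving_joinEquiv :
    MeasurePreserving joinEquiv (volume : Measure (E2 × ℝ)) (volume : Measure E3) := by
  have h1 := PiLp.volume_preserving_toLp (Fin 3)
  have h2 := (volume_preserving_piFinSuccAbove (fun _ : Fin 3 => ℝ) 2).symm
  have h3 : MeasurePreserving (Prod.swap : (Fin 2 → ℝ) × ℝ → ℝ × (Fin 2 → ℝ)) volume volume :=
    Measure.measurePreserving_swap
  have h4 : MeasurePreserving (Prod.map (@WithLp.ofLp 2 (Fin 2 → ℝ)) (id : ℝ → ℝ))
      (volume : Measure (E2 × ℝ)) volume :=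
    (PiLp.volume_preserving_ofLp (Fin 2)).prod (MeasurePreserving.id _)
  have h5 := h1.comp (h2.comp (h3.comp h4))
  have e : (joinEquiv : E2 × ℝ → E3) = WithLp.toLp 2 ∘
      (MeasurableEquiv.piFinSuccAbove (fun _ : Fin 3 => ℝ) 2).symm ∘
        Prod.swap ∘ Prod.map (@WithLp.ofLp 2 (Fin 2 → ℝ)) id := by
    funext p
    ext i
    fin_cases i
    · simp [joinEquiv]; rfl
    · simp [joinEquiv]; rfl
    · simp [joinEquiv]
  rw [e]
  exact h5

theorem lintegral_join (ψ : E3 → ENNReal) (hψ : Measurable ψ) :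
    ∫⁻ x, ψ x = ∫⁻ y : E2, ∫⁻ t : ℝ, ψ (join y t) := by
  rw [← measurePreserving_joinEquiv.lintegral_comp_emb joinEquiv.measurableEmbedding]
  rw [Measure.volume_eq_prod, lintegral_prod]
  · rfl
  · exact (hψ.comp joinEquiv.measurable).aemeasurable

theorem integrable_join {V : Type*} [NormedAddCommGroup V] {ψ : E3 → V}
    (hψ : Integrable ψ) : Integrable fun p : E2 × ℝ => ψ (join p.1 p.2) :=
  (measurePreserving_joinEquiv.integrable_comp_emb joinEquiv.measurableEmbedding).2 hψ

theorem integral_join {V : Type*} [NormedAddCommGroup V] [NormedSpace ℝ V] {ψ : E3 → V}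
    (hψ : Integrable ψ) : ∫ x, ψ x = ∫ y : E2, ∫ t : ℝ, ψ (join y t) := by
  rw [← measurePreserving_joinEquiv.integral_comp joinEquiv.measurableEmbedding]
  rw [Measure.volume_eq_prod, integral_prod]
  · rfl
  · exact integrable_join hψ

theorem ae_join {p : E3 → Prop} (hp : MeasurableSet {x | p x})
    (h : ∀ y : E2, ∀ᵐ t : ℝ, p (join y t)) : ∀ᵐ x, p x := by
  rw [← measurePreserving_joinEquiv.map_eq, ae_map_iff joinEquiv.measurable.aemeasurable hp,
    Measure.volume_eq_prod]
  exact (Measure.ae_prod_iff_ae_ae (joinEquiv.measurable hp)).2 (Eventually.of_forall h)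

/-! ### Layers between two graphs -/

/-- The layer between the graphs of `h₁` and `h₂`. -/
def layer (h₁ h₂ : E2 → ℝ) : Set E3 := {x | h₁ (horiz x) < x 2 ∧ x 2 < h₂ (horiz x)}

theorem isOpen_layer {h₁ h₂ : E2 → ℝ} (c₁ : Continuous h₁) (c₂ : Continuous h₂) :
    IsOpen (layer h₁ h₂) :=
  IsOpen.inter (isOpen_lt (f := fun x : E3 => h₁ (horiz x)) (g := fun x : E3 => x 2)
      (by fun_prop) (by fun_prop))
    (isOpen_lt (f := fun x : E3 => x 2) (g := fun x : E3 => h₂ (horiz x))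
      (by fun_prop) (by fun_prop))

theorem lintegral_Ioo_affine (a b : ℝ) (hab : a < b) (ψ : ℝ → ENNReal) (hψ : Measurable ψ) :
    ∫⁻ s in Set.Ioo a b, ψ s
      = ENNReal.ofReal (b - a) * ∫⁻ t in Set.Ioo (0 : ℝ) 1, ψ (a + t * (b - a)) := by
  have hab' : 0 < b - a := sub_pos.2 hab
  have himg : (fun t : ℝ => a + t * (b - a)) '' Set.Ioo 0 1 = Set.Ioo a b := by
    ext s
    constructor
    · rintro ⟨t, ⟨h0, h1⟩, rfl⟩
      constructor <;> simp only <;> nlinarith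
    · rintro ⟨h0, h1⟩
      refine ⟨(s - a) / (b - a), ⟨by apply div_pos <;> linarith, by
        rw [div_lt_one hab']; linarith⟩, ?_⟩
      field_simp; ring
  have hd : ∀ t ∈ Set.Ioo (0 : ℝ) 1,
      HasDerivWithinAt (fun t : ℝ => a + t * (b - a)) (b - a) (Set.Ioo 0 1) t := by
    intro t _
    simpa using (((hasDerivAt_id t).mul_const (b - a)).const_add a).hasDerivWithinAt
  have hinj : Set.InjOn (fun t : ℝ => a + t * (b - a)) (Set.Ioo 0 1) := by
    intro s _ t _ hst
    have : s * (b - a) = t * (b - a) := by simpa using hst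
    exact mul_right_cancel₀ hab'.ne' this
  rw [← himg, lintegral_image_eq_lintegral_abs_deriv_mul measurableSet_Ioo hd hinj,
    lintegral_const_mul _ (by fun_prop), abs_of_pos hab']

theorem lintegral_layer {h₁ h₂ : E2 → ℝ} (c₁ : Continuous h₁) (c₂ : Continuous h₂)
    (h : ∀ y, h₁ y < h₂ y) {D : Set E2} (hD : MeasurableSet D) {ψ : E3 → ENNReal}
    (hψ : Measurable ψ) :
    ∫⁻ x in horiz ⁻¹' D ∩ layer h₁ h₂, ψ x
      = ∫⁻ y in D, ENNReal.ofReal (h₂ y - h₁ y) *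
          ∫⁻ t in Set.Ioo (0 : ℝ) 1, ψ (join y (h₁ y + t * (h₂ y - h₁ y))) := by
  have hS : MeasurableSet (horiz ⁻¹' D ∩ layer h₁ h₂) :=
    (continuous_horiz.measurable hD).inter (isOpen_layer c₁ c₂).measurableSet
  rw [← lintegral_indicator hS, lintegral_join _ (hψ.indicator hS), ← lintegral_indicator hD]
  refine lintegral_congr fun y => ?_
  by_cases hy : y ∈ D
  · rw [Set.indicator_of_mem hy, ← lintegral_Ioo_affine _ _ (h y) (fun s => ψ (join y s))
      (by fun_prop), ← lintegral_indicator measurableSet_Ioo]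
    refine lintegral_congr fun t => ?_
    simp only [Set.indicator, Set.mem_inter_iff, Set.mem_preimage, horiz_join, hy, true_and,
      layer, Set.mem_ofPred_eq, join_two, Set.mem_Ioo]
  · rw [Set.indicator_of_notMem hy]
    simp [Set.indicator, hy]

/-! ### The magnetostatic energy as the squared norm of a projection -/

/-- The magnetostatic energy `∫ |∇u|²` of the field `F`. -/
noncomputable def magEnergy (F : E3 → E3) : ℝ := ∫ x, ‖strayGradient F x‖ ^ 2

theorem Lp_norm_sq (G : Lp E3 2 (volume : Measure E3)) : ‖G‖ ^ 2 = ∫ x, ‖G x‖ ^ 2 := by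
  rw [← real_inner_self_eq_norm_sq, L2.inner_def]
  simp

theorem magEnergy_eq_norm_sq (F : E3 → E3) : magEnergy F = ‖strayGradient F‖ ^ 2 :=
  (Lp_norm_sq _).symm

theorem inner_toLp_gradient {φ : E3 → ℝ} (h : IsTest φ) (A : Lp E3 2 (volume : Measure E3)) :
    inner ℝ A h.memLp_gradient.toLp = ∫ x, inner ℝ (A x) (gradient φ x) := by
  rw [L2.inner_def]
  refine integral_congr_ae ?_
  filter_upwards [h.memLp_gradient.coeFn_toLp] with x hx
  rw [hx]

theorem mem_homogeneousH1_orthogonal {A : Lp E3 2 (volume : Measure E3)}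
    (h : ∀ φ : E3 → ℝ, IsTest φ → ∫ x, inner ℝ (A x) (gradient φ x) = 0) :
    A ∈ homogeneousH1ᗮ := by
  rw [homogeneousH1, Submodule.orthogonal_closure, Submodule.mem_orthogonal']
  rintro B ⟨φ, hφ, hB⟩
  rw [L2.inner_def, ← h φ hφ]
  refine integral_congr_ae ?_
  filter_upwards [hB] with x hx
  rw [hx]

instance : CompleteSpace homogeneousH1 := gradTest.isClosed_topologicalClosure.completeSpace_coe

/-- The weak equation says that F minus the stray gradient is orthogonal to all gradients of test
functions. Together with membership in their closure this characterises the projection. -/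
theorem strayGradient_eq_starProjection {F : E3 → E3} (hF : MemLp F 2 volume) :
    strayGradient F = homogeneousH1.starProjection (hF.toLp F) := by
  obtain ⟨h1, h2⟩ := isStrayGradient_strayGradient hF
  refine (Submodule.eq_starProjection_of_mem_orthogonal h1 ?_).symm
  refine mem_homogeneousH1_orthogonal fun φ hφ => ?_
  have e1 := inner_toLp_gradient hφ (hF.toLp F - strayGradient F)
  rw [← e1, inner_sub_left, inner_toLp_gradient hφ, inner_toLp_gradient hφ, h2 φ hφ, sub_eq_zero]
  refine integral_congr_ae ?_
  filter_upwards [hF.coeFn_toLp] with x hx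
  rw [hx]

/-- Projections are linear contractions. This is the stability estimate behind every replacement of
one magnetization by another. -/
theorem norm_strayGradient_sub_le {F G : E3 → E3} (hF : MemLp F 2 volume) (hG : MemLp G 2 volume) :
    |‖strayGradient F‖ - ‖strayGradient G‖| ≤ √(∫ x, ‖F x - G x‖ ^ 2) := by
  refine (abs_norm_sub_norm_le _ _).trans ?_
  rw [strayGradient_eq_starProjection hF, strayGradient_eq_starProjection hG, ← map_sub]
  refine (Submodule.norm_starProjection_apply_le _ _).trans ?_
  rw [← MemLp.toLp_sub]
  refine Real.le_sqrt_of_sq_le ?_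
  rw [Lp_norm_sq]
  refine le_of_eq (integral_congr_ae ?_)
  filter_upwards [(hF.sub hG).coeFn_toLp] with x hx
  rw [hx]; rfl

/-! ### Partial derivatives of test functions -/

/-- The partial derivative `∂ᵢ f`. -/
noncomputable def pd (i : Fin 3) (f : E3 → ℝ) (x : E3) : ℝ :=
  fderiv ℝ f x (EuclideanSpace.single i 1)

theorem gradient_apply (f : E3 → ℝ) (x : E3) (i : Fin 3) : gradient f x i = pd i f x := by
  have : inner ℝ (gradient f x) (EuclideanSpace.single i (1 : ℝ)) = pd i f x := by
    rw [gradient, InnerProductSpace.toDual_symm_apply]; rfl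
  rw [← this, EuclideanSpace.inner_single_right]
  simp

theorem inner_gradient (v : E3) (f : E3 → ℝ) (x : E3) :
    inner ℝ v (gradient f x) = ∑ i, v i * pd i f x := by
  simp only [PiLp.inner_apply, gradient_apply]
  refine Finset.sum_congr rfl fun i _ => ?_
  simp [mul_comm]

theorem IsTest.differentiable {f : E3 → ℝ} (h : IsTest f) : Differentiable ℝ f :=
  h.contDiff_one.differentiable one_ne_zero

theorem IsTest.pd {f : E3 → ℝ} (h : IsTest f) (i : Fin 3) : IsTest (pd i f) := by
  refine ⟨?_, h.2.fderiv_apply ℝ _⟩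
  have : ContDiff ℝ ((⊤ : ℕ∞) : WithTop ℕ∞) (fderiv ℝ f) := h.1.fderiv_right (by simp)
  exact this.clm_apply contDiff_const

theorem IsTest.neg {f : E3 → ℝ} (h : IsTest f) : IsTest (fun x => -f x) :=
  ⟨h.1.neg, h.2.comp_left (g := fun y : ℝ => -y) neg_zero⟩

theorem IsTest.add {f g : E3 → ℝ} (hf : IsTest f) (hg : IsTest g) : IsTest (fun x => f x + g x) :=
  ⟨hf.1.add hg.1, hf.2.add hg.2⟩

theorem IsTest.sum {f : Fin 3 → E3 → ℝ} (hf : ∀ i, IsTest (f i)) :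
    IsTest (fun x => ∑ i, f i x) := by
  simp only [Fin.sum_univ_three]
  exact ((hf 0).add (hf 1)).add (hf 2)

theorem IsTest.continuous {f : E3 → ℝ} (h : IsTest f) : Continuous f := h.1.continuous

theorem IsTest.integrable {f : E3 → ℝ} (h : IsTest f) : Integrable f :=
  h.continuous.integrable_of_hasCompactSupport h.2

theorem IsTest.integrable_mul {f g : E3 → ℝ} (hf : IsTest f) (hg : Continuous g) :
    Integrable (fun x => f x * g x) :=
  (hf.continuous.mul hg).integrable_of_hasCompactSupport hf.2.mul_right

theorem IsTest.memLp {f : E3 → ℝ} (h : IsTest f) (p : ENNReal) : MemLp f p :=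
  h.continuous.memLp_of_hasCompactSupport h.2

theorem IsTest.bounded {f : E3 → ℝ} (h : IsTest f) : ∃ C, 0 ≤ C ∧ ∀ x, |f x| ≤ C := by
  obtain ⟨C, hC⟩ := h.2.exists_bound_of_continuous h.continuous
  exact ⟨|C|, abs_nonneg C, fun x => (hC x).trans (le_abs_self C)⟩

theorem pd_neg (i : Fin 3) (f : E3 → ℝ) (x : E3) : pd i (fun x => -f x) x = -pd i f x := by
  simp [pd]

theorem pd_sum {f : Fin 3 → E3 → ℝ} (hf : ∀ i, IsTest (f i)) (i : Fin 3) (x : E3) :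
    pd i (fun x => ∑ j, f j x) x = ∑ j, pd i (f j) x := by
  simp only [pd]
  rw [fderiv_fun_sum fun j _ => (hf j).differentiable x]
  simp

theorem pd_comm {f : E3 → ℝ} (h : IsTest f) (i j : Fin 3) : pd i (pd j f) = pd j (pd i f) := by
  funext x
  have h2 : ContDiff ℝ 2 f := h.1.of_le (WithTop.coe_le_coe.2 le_top)
  have hd : DifferentiableAt ℝ (fderiv ℝ f) x :=
    (h2.fderiv_right (m := 1) (by norm_num)).differentiable one_ne_zero x
  have key : ∀ v w : E3, fderiv ℝ (fun y => fderiv ℝ f y v) x w = fderiv ℝ (fderiv ℝ f) x w v := by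
    intro v w
    rw [fderiv_clm_apply hd (differentiableAt_const _)]
    simp
  have hs : IsSymmSndFDerivAt ℝ f x :=
    h2.contDiffAt.isSymmSndFDerivAt (by simp)
  change fderiv ℝ (fun y => fderiv ℝ f y _) x _ = fderiv ℝ (fun y => fderiv ℝ f y _) x _
  rw [key, key]
  exact hs _ _

theorem integral_mul_pd {f g : E3 → ℝ} (hf : IsTest f) (hg : IsTest g) (i : Fin 3) :
    ∫ x, f x * pd i g x = -∫ x, pd i f x * g x :=
  integral_mul_fderiv_eq_neg_fderiv_mul_of_integrable
    ((hf.pd i).integrable_mul hg.continuous) (hf.integrable_mul (hg.pd i).continuous)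
    (hf.integrable_mul hg.continuous) (fun x _ => hf.differentiable x)
    (fun x _ => hg.differentiable x)

/-- Both sides equal -∫ ∂ᵢf ∂ᵢ∂ⱼg. It is the weak form of the exchange of ∇ div with the Laplacian.
-/
theorem integral_pd_pd_mul_pd {f g : E3 → ℝ} (hf : IsTest f) (hg : IsTest g) (i j : Fin 3) :
    ∫ x, pd i (pd j f) x * pd i g x = ∫ x, pd i (pd i f) x * pd j g x := by
  rw [pd_comm hf i j]
  have h1 := integral_mul_pd (hf.pd i) ((hg.pd i)) j
  have h2 := integral_mul_pd (hf.pd i) ((hg.pd j)) i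
  rw [pd_comm hg j i] at h1
  linarith

/-! ### Convolution with a test function -/

/-- The convolution `F ⋆ N`. -/
noncomputable def conv (F N : E3 → ℝ) (x : E3) : ℝ := ∫ y, F y * N (x - y)

theorem conv_eq_convolution (F N : E3 → ℝ) :
    conv F N = convolution F N (ContinuousLinearMap.mul ℝ ℝ) volume := rfl

theorem IsTest.conv {F N : E3 → ℝ} (hF : LocallyIntegrable F) (hFc : HasCompactSupport F)
    (hN : IsTest N) : IsTest (conv F N) := by
  rw [conv_eq_convolution]
  exact ⟨hN.2.contDiff_convolution_right _ hF hN.1, hFc.convolution _ hN.2⟩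

theorem pd_conv {F N : E3 → ℝ} (hF : LocallyIntegrable F) (hN : IsTest N) (i : Fin 3) :
    pd i (conv F N) = conv F (pd i N) := by
  funext x
  have h := hN.2.hasFDerivAt_convolution_right (ContinuousLinearMap.mul ℝ ℝ) hF hN.contDiff_one x
  rw [pd, conv_eq_convolution, h.fderiv]
  have hc : ConvolutionExistsAt F (fderiv ℝ N) x
      ((ContinuousLinearMap.mul ℝ ℝ).precompR E3) volume :=
    (hN.2.fderiv ℝ).convolutionExists_right _ hF
      (hN.contDiff_one.continuous_fderiv one_ne_zero) x
  rw [convolution, ContinuousLinearMap.integral_apply hc]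
  rfl

theorem conv_neg (F N : E3 → ℝ) (x : E3) : conv F (fun y => -N y) x = -conv F N x := by
  simp [conv, integral_neg]

theorem integrable_conv {F N : E3 → ℝ} (hF : LocallyIntegrable F) (hN : IsTest N) (x : E3) :
    Integrable fun y => F y * N (x - y) :=
  hN.2.convolutionExists_right (ContinuousLinearMap.mul ℝ ℝ) hF hN.continuous x

theorem conv_sum {F : E3 → ℝ} {N : Fin 3 → E3 → ℝ} (hF : LocallyIntegrable F)
    (hN : ∀ i, IsTest (N i)) (x : E3) :
    conv F (fun y => ∑ i, N i y) x = ∑ i, conv F (N i) x := by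
  simp only [conv, Finset.mul_sum]
  exact integral_finsetSum _ fun i _ => integrable_conv hF (hN i) x

/-- The negative Laplacian of a test function. -/
noncomputable def negLaplacian (N : E3 → ℝ) (x : E3) : ℝ := -∑ i, pd i (pd i N) x

theorem IsTest.negLaplacian {N : E3 → ℝ} (hN : IsTest N) : IsTest (negLaplacian N) :=
  (IsTest.sum fun i => (hN.pd i).pd i).neg

/-- Componentwise convolution of a vector field with a scalar kernel. -/
noncomputable def vconv (F : E3 → E3) (N : E3 → ℝ) (x : E3) : E3 :=
  WithLp.toLp 2 fun j => conv (fun y => F y j) N x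

@[simp] theorem vconv_apply (F : E3 → E3) (N : E3 → ℝ) (x : E3) (j : Fin 3) :
    vconv F N x j = conv (fun y => F y j) N x := rfl

/-- The potential `-div (F ⋆ N)`. -/
noncomputable def potential (F : E3 → E3) (N : E3 → ℝ) (x : E3) : ℝ :=
  -∑ j, conv (fun y => F y j) (pd j N) x

/-! ### The weak equation of the regularised potential -/

section
variable {F : E3 → E3} {N : E3 → ℝ} (hF : ∀ j, LocallyIntegrable fun y => F y j)
  (hFc : ∀ j, HasCompactSupport fun y => F y j) (hN : IsTest N)
include hF hFc hN

theorem IsTest.potential : IsTest (potential F N) :=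
  (IsTest.sum fun j => IsTest.conv (hF j) (hFc j) (hN.pd j)).neg

theorem pd_potential (i : Fin 3) (x : E3) :
    pd i (ThinFilm.potential F N) x = -∑ j, pd i (pd j (conv (fun y => F y j) N)) x := by
  have : ThinFilm.potential F N = fun x => -∑ j, conv (fun y => F y j) (ThinFilm.pd j N) x := rfl
  rw [this, pd_neg, pd_sum fun j => IsTest.conv (hF j) (hFc j) (hN.pd j)]
  simp only [pd_conv (hF _) hN]

/-- Formally ∇ div is traded for the Laplacian by `integral_pd_pd_mul_pd`: the potential u = -div(F
⋆ N) solves Δu = div(F ⋆ (-ΔN)) weakly. -/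
theorem integral_pd_potential {φ : E3 → ℝ} (hφ : IsTest φ) :
    ∑ i, ∫ x, pd i (ThinFilm.potential F N) x * pd i φ x
      = ∑ j, ∫ x, conv (fun y => F y j) (ThinFilm.negLaplacian N) x * pd j φ x := by
  have hw : ∀ j, IsTest (conv (fun y => F y j) N) := fun j => IsTest.conv (hF j) (hFc j) hN
  have l : ∀ i, ∫ x, pd i (ThinFilm.potential F N) x * pd i φ x
      = -∑ j, ∫ x, pd i (pd i (conv (fun y => F y j) N)) x * pd j φ x := by
    intro i
    simp only [pd_potential hF hFc hN, neg_mul, Finset.sum_mul, integral_neg]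
    rw [integral_finsetSum _ fun j _ => (((hw j).pd j).pd i).integrable_mul (hφ.pd i).continuous]
    exact congrArg _ (Finset.sum_congr rfl fun j _ => integral_pd_pd_mul_pd (hw j) hφ i j)
  have r : ∀ j, ∫ x, conv (fun y => F y j) (ThinFilm.negLaplacian N) x * pd j φ x
      = -∑ i, ∫ x, pd i (pd i (conv (fun y => F y j) N)) x * pd j φ x := by
    intro j
    have e : ∀ x, conv (fun y => F y j) (ThinFilm.negLaplacian N) x
        = -∑ i, pd i (pd i (conv (fun y => F y j) N)) x := by
      intro x
      have : ThinFilm.negLaplacian N = fun x => -∑ i, pd i (pd i N) x := rfl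
      rw [this, conv_neg, conv_sum (hF j) fun i => (hN.pd i).pd i]
      simp only [pd_conv (hF j) hN, pd_conv (hF j) (hN.pd _)]
    simp only [e, neg_mul, Finset.sum_mul, integral_neg]
    rw [integral_finsetSum _ fun i _ => (((hw j).pd i).pd i).integrable_mul (hφ.pd j).continuous]
  simp only [l, r, Finset.sum_neg_distrib]
  rw [Finset.sum_comm]

theorem memLp_vconv : MemLp (vconv F N) 2 volume := by
  refine MemLp.of_eval_piLp fun j => ?_
  exact (IsTest.conv (hF j) (hFc j) hN).memLp 2

/-- The field F ⋆ (-ΔN) - ∇(potential) is orthogonal to gradients, while the stray gradient lies in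
their closure and has the same pairing with ∇(potential) as F. When -ΔN approximates a Dirac mass,
the right side approaches the magnetostatic energy and the left side becomes a Coulomb interaction.
-/
theorem integral_inner_potential (hF2 : MemLp F 2 volume) :
    ∫ x, inner ℝ (F x) (gradient (ThinFilm.potential F N) x)
      = ∫ x, inner ℝ (strayGradient F x) (vconv F (ThinFilm.negLaplacian N) x) := by
  have hu := IsTest.potential hF hFc hN
  obtain ⟨h1, h2⟩ := isStrayGradient_strayGradient hF2
  rw [← h2 _ hu]
  have hv := memLp_vconv hF hFc hN.negLaplacian
  have horth : hv.toLp - hu.memLp_gradient.toLp ∈ homogeneousH1ᗮ := by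
    refine mem_homogeneousH1_orthogonal fun φ hφ => ?_
    rw [← inner_toLp_gradient hφ, inner_sub_left, inner_toLp_gradient hφ, inner_toLp_gradient hφ,
      sub_eq_zero]
    have e1 : ∫ x, inner ℝ ((hv.toLp : Lp E3 2 volume) x) (gradient φ x)
        = ∫ x, ∑ i, vconv F (ThinFilm.negLaplacian N) x i * pd i φ x := by
      refine integral_congr_ae ?_
      filter_upwards [hv.coeFn_toLp] with x hx
      rw [hx, inner_gradient]
    have e2 : ∫ x, inner ℝ ((hu.memLp_gradient.toLp : Lp E3 2 volume) x) (gradient φ x)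
        = ∫ x, ∑ i, pd i (ThinFilm.potential F N) x * pd i φ x := by
      refine integral_congr_ae ?_
      filter_upwards [hu.memLp_gradient.coeFn_toLp] with x hx
      rw [hx, inner_gradient]
      simp only [gradient_apply]
    rw [e1, e2, integral_finsetSum, integral_finsetSum, integral_pd_potential hF hFc hN hφ]
    · rfl
    · exact fun i _ => (hu.pd i).integrable_mul (hφ.pd i).continuous
    · exact fun i _ => (IsTest.conv (hF i) (hFc i) hN.negLaplacian).integrable_mul
        (hφ.pd i).continuous
  have h0 : inner ℝ (strayGradient F) (hv.toLp - hu.memLp_gradient.toLp) = 0 :=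
    Submodule.inner_right_of_mem_orthogonal h1 horth
  rw [inner_sub_right, inner_toLp_gradient hu, sub_eq_zero] at h0
  rw [← h0, L2.inner_def]
  refine integral_congr_ae ?_
  filter_upwards [hv.coeFn_toLp] with x hx
  rw [hx]

end

/-! ### A regularised Newtonian kernel -/

/-- A smooth positive function equal to `s` for `s ≥ 1`. -/
noncomputable def radiusProfile (s : ℝ) : ℝ :=
  Real.smoothTransition s * s + (1 - Real.smoothTransition s)

theorem radiusProfile_pos (s : ℝ) : 0 < radiusProfile s := by
  unfold radiusProfile
  rcases le_or_gt s 0 with h | h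
  · rw [Real.smoothTransition.zero_of_nonpos h]; norm_num
  · have h0 := Real.smoothTransition.nonneg s
    have h1 := Real.smoothTransition.le_one s
    rcases h1.eq_or_lt with h2 | h2
    · rw [h2]; linarith
    · have := mul_nonneg h0 h.le
      linarith

theorem radiusProfile_of_one_le {s : ℝ} (hs : 1 ≤ s) : radiusProfile s = s := by
  simp [radiusProfile, Real.smoothTransition.one_of_one_le hs]

theorem le_radiusProfile (s : ℝ) : s ≤ radiusProfile s := by
  rcases le_or_gt 1 s with h | h
  · rw [radiusProfile_of_one_le h]
  · unfold radiusProfile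
    have h1 := Real.smoothTransition.le_one s
    nlinarith

theorem contDiff_radiusProfile : ContDiff ℝ ((⊤ : ℕ∞) : WithTop ℕ∞) radiusProfile :=
  (Real.smoothTransition.contDiff.mul contDiff_id).add
    (contDiff_const.sub Real.smoothTransition.contDiff)

/-- The profile `s ↦ 1 / (4π √s)`, smoothed out for `s < 1`. -/
noncomputable def newtonProfile (s : ℝ) : ℝ := (4 * Real.pi)⁻¹ * (√(radiusProfile s))⁻¹

theorem contDiff_newtonProfile : ContDiff ℝ ((⊤ : ℕ∞) : WithTop ℕ∞) newtonProfile := by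
  refine contDiff_const.mul (ContDiff.inv (contDiff_radiusProfile.sqrt fun s => ?_) fun s => ?_)
  · exact (radiusProfile_pos s).ne'
  · exact (Real.sqrt_pos.2 (radiusProfile_pos s)).ne'

theorem newtonProfile_of_one_le {s : ℝ} (hs : 1 ≤ s) :
    newtonProfile s = (4 * Real.pi)⁻¹ * s ^ (-(1 / 2) : ℝ) := by
  rw [newtonProfile, radiusProfile_of_one_le hs, Real.sqrt_eq_rpow, Real.rpow_neg (by linarith)]

theorem newtonProfile_sq_of_one_le {r : ℝ} (hr : 1 ≤ r) :
    newtonProfile (r ^ 2) = (4 * Real.pi)⁻¹ * r⁻¹ := by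
  rw [newtonProfile, radiusProfile_of_one_le (by nlinarith), Real.sqrt_sq (by linarith)]

theorem newtonProfile_nonneg (s : ℝ) : 0 ≤ newtonProfile s := by
  unfold newtonProfile; have := Real.pi_pos; positivity

theorem newtonProfile_sq_le {r : ℝ} (hr : 0 < r) :
    newtonProfile (r ^ 2) ≤ (4 * Real.pi)⁻¹ * r⁻¹ := by
  have := Real.pi_pos
  unfold newtonProfile
  gcongr
  exact Real.le_sqrt_of_sq_le (le_radiusProfile _)

theorem deriv_newtonProfile {s : ℝ} (hs : 1 < s) :
    deriv newtonProfile s = (4 * Real.pi)⁻¹ * (-(1 / 2) * s ^ (-(3 / 2) : ℝ)) := by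
  have h1 : newtonProfile =ᶠ[𝓝 s] fun s => (4 * Real.pi)⁻¹ * s ^ (-(1 / 2) : ℝ) := by
    filter_upwards [lt_mem_nhds hs] with t ht using newtonProfile_of_one_le ht.le
  rw [h1.deriv_eq]
  have := (Real.hasDerivAt_rpow_const (x := s) (p := -(1 / 2)) (Or.inl (by linarith))).const_mul
    (4 * Real.pi)⁻¹
  rw [this.deriv]
  norm_num

theorem deriv_deriv_newtonProfile {s : ℝ} (hs : 1 < s) :
    deriv (deriv newtonProfile) s = (4 * Real.pi)⁻¹ * (3 / 4 * s ^ (-(5 / 2) : ℝ)) := by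
  have h1 : deriv newtonProfile
      =ᶠ[𝓝 s] fun s => (4 * Real.pi)⁻¹ * (-(1 / 2) * s ^ (-(3 / 2) : ℝ)) := by
    filter_upwards [lt_mem_nhds hs] with t ht using deriv_newtonProfile ht
  rw [h1.deriv_eq]
  have := ((Real.hasDerivAt_rpow_const (x := s) (p := -(3 / 2))
    (Or.inl (by linarith))).const_mul (-(1 / 2))).const_mul (4 * Real.pi)⁻¹
  rw [this.deriv]
  norm_num
  ring

/-- The smoothed Newtonian kernel at unit scale. -/
noncomputable def newton (x : E3) : ℝ := newtonProfile (‖x‖ ^ 2)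

theorem contDiff_newton : ContDiff ℝ ((⊤ : ℕ∞) : WithTop ℕ∞) newton :=
  contDiff_newtonProfile.comp (contDiff_norm_sq ℝ)

theorem pd_radial {Q : ℝ → ℝ} (hQ : Differentiable ℝ Q) (i : Fin 3) :
    pd i (fun x => Q (‖x‖ ^ 2)) = fun x => x i * (2 * deriv Q (‖x‖ ^ 2)) := by
  funext x
  have h1 : HasFDerivAt (fun x : E3 => ‖x‖ ^ 2) (2 • innerSL ℝ x) x :=
    (hasStrictFDerivAt_norm_sq x).hasFDerivAt
  have h2 := (hQ (‖x‖ ^ 2)).hasDerivAt.comp_hasFDerivAt x h1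
  rw [pd]
  rw [show (fun x : E3 => Q (‖x‖ ^ 2)) = Q ∘ fun x => ‖x‖ ^ 2 from rfl, h2.fderiv]
  simp [EuclideanSpace.inner_single_right]
  ring

theorem pd_coord_mul_radial {Q : ℝ → ℝ} (hQ : Differentiable ℝ Q) (i : Fin 3) (x : E3) :
    pd i (fun x => x i * Q (‖x‖ ^ 2)) x
      = Q (‖x‖ ^ 2) + 2 * x i ^ 2 * deriv Q (‖x‖ ^ 2) := by
  have hd : DifferentiableAt ℝ (fun x : E3 => Q (‖x‖ ^ 2)) x :=
    (hQ _).comp x ((contDiff_norm_sq ℝ (n := 1)).differentiable one_ne_zero x)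
  have hc : HasFDerivAt (fun x : E3 => x i) (EuclideanSpace.proj i : E3 →L[ℝ] ℝ) x :=
    (EuclideanSpace.proj i : E3 →L[ℝ] ℝ).hasFDerivAt
  have h : HasFDerivAt (fun x : E3 => x i * Q (‖x‖ ^ 2)) _ x := hc.mul hd.hasFDerivAt
  have e : fderiv ℝ (fun x : E3 => Q (‖x‖ ^ 2)) x (EuclideanSpace.single i 1)
      = x i * (2 * deriv Q (‖x‖ ^ 2)) := congrFun (pd_radial hQ i) x
  rw [pd, h.fderiv]
  simp [e]
  ring

/-- The charge density generating the smoothed Newtonian kernel, as a function of the radius. -/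
noncomputable def chargeProfile (r : ℝ) : ℝ :=
  -(6 * deriv newtonProfile (r ^ 2) + 4 * r ^ 2 * deriv (deriv newtonProfile) (r ^ 2))

theorem contDiff_deriv_newtonProfile :
    ContDiff ℝ ((⊤ : ℕ∞) : WithTop ℕ∞) (deriv newtonProfile) :=
  (contDiff_infty_iff_deriv.1 contDiff_newtonProfile).2

theorem continuous_chargeProfile : Continuous chargeProfile := by
  have h1 : Continuous (deriv newtonProfile) := contDiff_deriv_newtonProfile.continuous
  have h2 : Continuous (deriv (deriv newtonProfile)) :=
    (contDiff_infty_iff_deriv.1 contDiff_deriv_newtonProfile).2.continuous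
  unfold chargeProfile
  fun_prop

/-- For a radial function Q(|x|²) in dimension three, the Laplacian is 6Q' + 4|x|²Q''. -/
theorem negLaplacian_newton (x : E3) : negLaplacian newton x = chargeProfile ‖x‖ := by
  have h1 : Differentiable ℝ newtonProfile := contDiff_newtonProfile.differentiable (by simp)
  have h2 : Differentiable ℝ (deriv newtonProfile) :=
    contDiff_deriv_newtonProfile.differentiable (by simp)
  have e : ∀ i, pd i (pd i newton) x
      = 2 * deriv newtonProfile (‖x‖ ^ 2)
        + 2 * x i ^ 2 * (2 * deriv (deriv newtonProfile) (‖x‖ ^ 2)) := by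
    intro i
    have : pd i newton = fun x => x i * (2 * deriv newtonProfile (‖x‖ ^ 2)) := pd_radial h1 i
    rw [this, pd_coord_mul_radial (Q := fun s => 2 * deriv newtonProfile s) (by fun_prop),
      deriv_const_mul _ (h2 _)]
  simp only [negLaplacian, e, chargeProfile, Fin.sum_univ_three]
  rw [EuclideanSpace.norm_sq_eq, Fin.sum_univ_three]
  simp only [Real.norm_eq_abs, sq_abs]
  ring

/-- Beyond radius one the kernel is exactly 1/(4π|x|), which is harmonic. -/
theorem chargeProfile_eq_zero {r : ℝ} (hr : 1 < r) : chargeProfile r = 0 := by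
  have h : 1 < r ^ 2 := by nlinarith
  have h0 : 0 < r ^ 2 := by linarith
  rw [chargeProfile, deriv_newtonProfile h, deriv_deriv_newtonProfile h]
  have : (r ^ 2) ^ (-(3 / 2) : ℝ) = r ^ 2 * (r ^ 2) ^ (-(5 / 2) : ℝ) := by
    nth_rw 2 [← Real.rpow_one (r ^ 2)]
    rw [← Real.rpow_add h0]; norm_num
  rw [this]; ring

/-- Gauss's law in radial form: r² times the charge density is the derivative of the flux term
-2r³Q'(r²), which is constantly 1/(4π) for r > 1; the angular integration supplies the factor 4π. -/
theorem integral_chargeProfile : ∫ x : E3, chargeProfile ‖x‖ = 1 := by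
  have hc := continuous_chargeProfile
  have hsupp : HasCompactSupport fun x : E3 => chargeProfile ‖x‖ := by
    refine HasCompactSupport.intro (isCompact_closedBall (0 : E3) 1) fun x hx => ?_
    exact chargeProfile_eq_zero (by simpa using hx)
  have hint : Integrable fun x : E3 => chargeProfile ‖x‖ :=
    (hc.comp continuous_norm).integrable_of_hasCompactSupport hsupp
  have hint' := (integrable_fun_norm_addHaar (volume : Measure E3)).1 hint
  rw [integral_fun_norm_addHaar]
  simp only [finrank_euclideanSpace, Fintype.card_fin] at hint' ⊢
  have h2 : Differentiable ℝ (deriv newtonProfile) :=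
    contDiff_deriv_newtonProfile.differentiable (by simp)
  have hder : ∀ r ∈ Set.Ioi (0 : ℝ),
      HasDerivAt (fun r => -(2 * r ^ 3 * deriv newtonProfile (r ^ 2)))
        (r ^ (3 - 1) • chargeProfile r) r := by
    intro r _
    have a1 : HasDerivAt (fun r : ℝ => r ^ 2) (2 * r) r := by simpa using hasDerivAt_pow 2 r
    have a2 : HasDerivAt (fun r : ℝ => 2 * r ^ 3) (2 * (3 * r ^ 2)) r := by
      simpa using (hasDerivAt_pow 3 r).const_mul 2
    have a3 : HasDerivAt (fun r : ℝ => deriv newtonProfile (r ^ 2))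
        (deriv (deriv newtonProfile) (r ^ 2) * (2 * r)) r :=
      HasDerivAt.comp (h₂ := deriv newtonProfile) (h := fun r : ℝ => r ^ 2) r
        (h2 (r ^ 2)).hasDerivAt a1
    refine HasDerivAt.congr_deriv (a2.mul a3).neg ?_
    simp only [chargeProfile, smul_eq_mul]; ring
  have hlim : Tendsto (fun r => -(2 * r ^ 3 * deriv newtonProfile (r ^ 2))) atTop
      (𝓝 (4 * Real.pi)⁻¹) := by
    refine tendsto_const_nhds.congr' ?_
    filter_upwards [eventually_gt_atTop 1] with r hr
    have h0 : 0 < r := by linarith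
    rw [deriv_newtonProfile (by nlinarith), ← Real.rpow_natCast r 2, ← Real.rpow_mul h0.le,
      ← Real.rpow_natCast r 3]
    have : r ^ ((3 : ℕ) : ℝ) * r ^ (((2 : ℕ) : ℝ) * -(3 / 2)) = 1 := by
      rw [← Real.rpow_add h0]; norm_num
    linear_combination (-(4 * Real.pi)⁻¹) * this
  have hcont : ContinuousWithinAt (fun r => -(2 * r ^ 3 * deriv newtonProfile (r ^ 2)))
      (Set.Ici 0) 0 := by
    have h1 : Continuous (deriv newtonProfile) := contDiff_deriv_newtonProfile.continuous
    exact Continuous.continuousWithinAt (by fun_prop)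
  rw [integral_Ioi_of_hasDerivAt_of_tendsto hcont hder hint' hlim]
  rw [Measure.real, EuclideanSpace.volume_ball_fin_three]
  have := Real.pi_pos
  simp
  field_simp
  rw [ENNReal.toReal_ofReal (by positivity)]
  ring

/-- A smooth compactly supported approximation of the Newtonian kernel `1 / (4π |x|)`. -/
noncomputable def kern (a : ℝ) (x : E3) : ℝ := a * newton (a • x) - a⁻¹ * newton (a⁻¹ • x)

theorem newton_scaled_le {a : ℝ} (ha : 0 < a) {x : E3} (hx : x ≠ 0) :
    a * newton (a • x) ≤ (4 * Real.pi)⁻¹ * ‖x‖⁻¹ := by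
  have hx' : 0 < ‖x‖ := norm_pos_iff.2 hx
  have h := newtonProfile_sq_le (r := ‖a • x‖) (by rw [norm_smul, Real.norm_of_nonneg ha.le]; positivity)
  rw [newton]
  calc a * newtonProfile (‖a • x‖ ^ 2) ≤ a * ((4 * Real.pi)⁻¹ * ‖a • x‖⁻¹) := by gcongr
    _ = (4 * Real.pi)⁻¹ * ‖x‖⁻¹ := by
      rw [norm_smul, Real.norm_of_nonneg ha.le]; field_simp

theorem newton_scaled_eq {a : ℝ} (ha : 0 < a) {x : E3} (hx : 1 ≤ a * ‖x‖) :
    a * newton (a • x) = (4 * Real.pi)⁻¹ * ‖x‖⁻¹ := by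
  have e : ‖a • x‖ = a * ‖x‖ := by rw [norm_smul, Real.norm_of_nonneg ha.le]
  have hx' : 0 < ‖x‖ := by
    by_contra h
    have := norm_nonneg x
    have : ‖x‖ = 0 := by linarith
    rw [this] at hx; norm_num at hx
  rw [newton, e, newtonProfile_sq_of_one_le hx]
  have := Real.pi_pos
  field_simp

theorem newton_nonneg (x : E3) : 0 ≤ newton x := newtonProfile_nonneg _

/-- A difference of two numbers between 0 and 1/(4π|x|). The bound does not depend on `a`, so it
serves as majorant in the limit. -/
theorem abs_kern_le {a : ℝ} (ha : 0 < a) {x : E3} (hx : x ≠ 0) :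
    |kern a x| ≤ (4 * Real.pi)⁻¹ * ‖x‖⁻¹ := by
  have h1 := newton_scaled_le ha hx
  have h2 := newton_scaled_le (inv_pos.2 ha) hx
  have h3 := mul_nonneg ha.le (newton_nonneg (a • x))
  have h4 := mul_nonneg (inv_pos.2 ha).le (newton_nonneg (a⁻¹ • x))
  rw [kern, abs_le]
  constructor <;> linarith

theorem tendsto_kern {x : E3} (hx : x ≠ 0) :
    Tendsto (fun a => kern a x) atTop (𝓝 ((4 * Real.pi)⁻¹ * ‖x‖⁻¹)) := by
  have hx' : 0 < ‖x‖ := norm_pos_iff.2 hx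
  have h1 : Tendsto (fun a : ℝ => a * newton (a • x)) atTop (𝓝 ((4 * Real.pi)⁻¹ * ‖x‖⁻¹)) := by
    refine tendsto_const_nhds.congr' ?_
    filter_upwards [eventually_ge_atTop ‖x‖⁻¹, eventually_gt_atTop 0] with a ha h0
    rw [newton_scaled_eq h0]
    rwa [inv_le_iff_one_le_mul₀ hx'] at ha
  have h2 : Tendsto (fun a : ℝ => a⁻¹ * newton (a⁻¹ • x)) atTop (𝓝 (0 * newton ((0 : ℝ) • x))) := by
    refine tendsto_inv_atTop_zero.mul ?_
    exact (contDiff_newton.continuous.tendsto _).comp (tendsto_inv_atTop_zero.smul_const x)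
  simpa [kern] using h1.sub h2

/-- Beyond radius `a` both scaled copies of the kernel equal 1/(4π|x|), so they cancel: the second
copy is subtracted to gain compact support. -/
theorem isTest_kern {a : ℝ} (ha : 1 ≤ a) : IsTest (kern a) := by
  have ha0 : 0 < a := by linarith
  refine ⟨?_, ?_⟩
  · exact (contDiff_const.mul (contDiff_newton.comp (contDiff_const_smul a))).sub
      (contDiff_const.mul (contDiff_newton.comp (contDiff_const_smul a⁻¹)))
  · refine HasCompactSupport.intro (isCompact_closedBall (0 : E3) a) fun x hx => ?_
    have hx' : a < ‖x‖ := by simpa using hx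
    rw [kern, newton_scaled_eq ha0 (by nlinarith), newton_scaled_eq (inv_pos.2 ha0), sub_self]
    rw [← div_eq_inv_mul, one_le_div ha0]; exact hx'.le

theorem pd_comp_smul (i : Fin 3) (c a : ℝ) {f : E3 → ℝ} (hf : Differentiable ℝ f) :
    pd i (fun x => c * f (a • x)) = fun x => (c * a) * pd i f (a • x) := by
  funext x
  have h1 : HasFDerivAt (fun x : E3 => a • x) (a • ContinuousLinearMap.id ℝ E3) x :=
    (hasFDerivAt_id x).const_smul a
  have h2 : HasFDerivAt (fun x : E3 => f (a • x)) _ x := (hf (a • x)).hasFDerivAt.comp x h1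
  have h3 := h2.const_mul c
  rw [pd, h3.fderiv]
  simp [pd]
  ring

/-- The charge of `kern a` is a unit charge concentrated at scale 1/a, which tends to a Dirac mass,
minus a unit charge spread over radius `a`, whose effect disappears in the limit. -/
theorem negLaplacian_kern (a : ℝ) (x : E3) :
    negLaplacian (kern a) x = a ^ 3 * chargeProfile ‖a • x‖ - a⁻¹ ^ 3 * chargeProfile ‖a⁻¹ • x‖ := by
  have hd : Differentiable ℝ newton := contDiff_newton.differentiable (by simp)
  have hs : ∀ b : ℝ, Differentiable ℝ fun x : E3 => b * newton (b • x) := by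
    intro b; fun_prop
  have hpd : ∀ i, Differentiable ℝ (pd i newton) := by
    intro i
    have : ContDiff ℝ ((⊤ : ℕ∞) : WithTop ℕ∞) (fderiv ℝ newton) :=
      contDiff_newton.fderiv_right (by simp)
    exact (this.clm_apply contDiff_const).differentiable (by simp)
  have hsub : ∀ (i : Fin 3) {f g : E3 → ℝ}, Differentiable ℝ f → Differentiable ℝ g →
      pd i (fun x => f x - g x) = fun x => pd i f x - pd i g x := by
    intro i f g hf hg
    funext x
    simp only [pd]
    rw [fderiv_fun_sub (hf x) (hg x)]; rfl
  have e : ∀ i, pd i (pd i (kern a)) x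
      = (a * a * a) * pd i (pd i newton) (a • x)
        - (a⁻¹ * a⁻¹ * a⁻¹) * pd i (pd i newton) (a⁻¹ • x) := by
    intro i
    have h1 : pd i (kern a)
        = fun x => (a * a) * pd i newton (a • x) - (a⁻¹ * a⁻¹) * pd i newton (a⁻¹ • x) := by
      have : kern a = fun x => a * newton (a • x) - a⁻¹ * newton (a⁻¹ • x) := rfl
      rw [this, hsub i (hs a) (hs a⁻¹), pd_comp_smul i a a hd, pd_comp_smul i a⁻¹ a⁻¹ hd]
    have hpi := hpd i
    rw [h1, hsub i (by fun_prop) (by fun_prop), pd_comp_smul i _ a hpi, pd_comp_smul i _ a⁻¹ hpi]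
  rw [← negLaplacian_newton, ← negLaplacian_newton]
  simp only [negLaplacian, e, Fin.sum_univ_three]
  ring

/-! ### Convergence of the regularisation -/

theorem exists_bound_chargeProfile : ∃ C, 0 ≤ C ∧ ∀ x : E3, |chargeProfile ‖x‖| ≤ C := by
  have hsupp : HasCompactSupport fun x : E3 => chargeProfile ‖x‖ := by
    refine HasCompactSupport.intro (isCompact_closedBall (0 : E3) 1) fun x hx => ?_
    exact chargeProfile_eq_zero (by simpa using hx)
  obtain ⟨C, hC⟩ := hsupp.exists_bound_of_continuous (continuous_chargeProfile.comp continuous_norm)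
  exact ⟨|C|, abs_nonneg C, fun x => (hC x).trans (le_abs_self C)⟩

theorem integrable_chargeProfile : Integrable fun x : E3 => chargeProfile ‖x‖ := by
  have hsupp : HasCompactSupport fun x : E3 => chargeProfile ‖x‖ := by
    refine HasCompactSupport.intro (isCompact_closedBall (0 : E3) 1) fun x hx => ?_
    exact chargeProfile_eq_zero (by simpa using hx)
  exact (continuous_chargeProfile.comp continuous_norm).integrable_of_hasCompactSupport hsupp

theorem conv_charge_eq (f : E3 → ℝ) {a : ℝ} (ha : 0 < a) (x : E3) :
    conv f (fun y => a ^ 3 * chargeProfile ‖a • y‖) x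
      = ∫ w, f (x - a⁻¹ • w) * chargeProfile ‖w‖ := by
  have h1 : conv f (fun y => a ^ 3 * chargeProfile ‖a • y‖) x
      = ∫ y, f (x - y) * (a ^ 3 * chargeProfile ‖a • y‖) := by
    rw [conv, ← integral_sub_left_eq_self _ _ x]
    simp
  have h2 := Measure.integral_comp_smul (volume : Measure E3)
    (fun w => f (x - a⁻¹ • w) * chargeProfile ‖w‖) a
  simp only [finrank_euclideanSpace, Fintype.card_fin, smul_smul, inv_mul_cancel₀ ha.ne',
    one_smul] at h2
  rw [h1]
  have h3 : ∀ y, f (x - y) * (a ^ 3 * chargeProfile ‖a • y‖)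
      = a ^ 3 * (f (x - y) * chargeProfile ‖a • y‖) := fun y => by ring
  simp only [h3]
  rw [integral_const_mul, h2, abs_of_pos (by positivity), smul_eq_mul, ← mul_assoc,
    mul_inv_cancel₀ (by positivity), one_mul]

section
variable {f : E3 → ℝ} {M R : ℝ} (hfm : Measurable f) (hM : ∀ x, |f x| ≤ M)
  (hR : ∀ x, R < ‖x‖ → f x = 0)
include hM

include hfm in
-- Approximate identity at a point of continuity. The charge density has total mass one but no sign
-- is known, so domination uses its absolute value.
theorem tendsto_conv_charge {x : E3} (hx : ContinuousAt f x) :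
    Tendsto (fun a : ℝ => conv f (fun y => a ^ 3 * chargeProfile ‖a • y‖) x) atTop (𝓝 (f x)) := by
  have hlim : Tendsto (fun a : ℝ => ∫ w, f (x - a⁻¹ • w) * chargeProfile ‖w‖) atTop
      (𝓝 (∫ w : E3, f x * chargeProfile ‖w‖)) := by
    refine tendsto_integral_filter_of_dominated_convergence (fun w => M * |chargeProfile ‖w‖|)
      ?_ ?_ ?_ ?_
    · refine Eventually.of_forall fun a => ?_
      have := continuous_chargeProfile.measurable
      exact Measurable.aestronglyMeasurable (by fun_prop)
    · refine Eventually.of_forall fun a => Eventually.of_forall fun w => ?_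
      rw [norm_mul]
      exact mul_le_mul_of_nonneg_right (hM _) (abs_nonneg _)
    · exact integrable_chargeProfile.abs.const_mul M
    · refine Eventually.of_forall fun w => Tendsto.mul_const _ ?_
      have : Tendsto (fun a : ℝ => x - a⁻¹ • w) atTop (𝓝 (x - (0 : ℝ) • w)) :=
        tendsto_const_nhds.sub (tendsto_inv_atTop_zero.smul_const w)
      rw [zero_smul, sub_zero] at this
      exact hx.tendsto.comp this
  rw [integral_const_mul, integral_chargeProfile, mul_one] at hlim
  refine hlim.congr' ?_
  filter_upwards [eventually_gt_atTop 0] with a ha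
  rw [conv_charge_eq f ha]

include hR

theorem abs_conv_charge_le {a : ℝ} (ha : 1 ≤ a) (x : E3) :
    |conv f (fun y => a ^ 3 * chargeProfile ‖a • y‖) x|
      ≤ (Metric.closedBall (0 : E3) (R + 1)).indicator
          (fun _ => M * ∫ w : E3, |chargeProfile ‖w‖|) x := by
  have ha0 : 0 < a := by linarith
  rw [conv_charge_eq f ha0]
  by_cases hx : x ∈ Metric.closedBall (0 : E3) (R + 1)
  · rw [Set.indicator_of_mem hx, ← integral_const_mul]
    refine abs_integral_le_integral_abs.trans ?_
    refine integral_mono_of_nonneg (Eventually.of_forall fun w => abs_nonneg _)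
      (integrable_chargeProfile.abs.const_mul M) (Eventually.of_forall fun w => ?_)
    simp only [abs_mul]
    exact mul_le_mul_of_nonneg_right (hM _) (abs_nonneg _)
  · rw [Set.indicator_of_notMem hx]
    have hx' : R + 1 < ‖x‖ := by simpa using hx
    have : ∀ w : E3, f (x - a⁻¹ • w) * chargeProfile ‖w‖ = 0 := by
      intro w
      rcases lt_or_ge 1 ‖w‖ with hw | hw
      · rw [chargeProfile_eq_zero hw, mul_zero]
      · rw [hR, zero_mul]
        have h1 : ‖a⁻¹ • w‖ ≤ 1 := by
          rw [norm_smul, Real.norm_of_nonneg (inv_pos.2 ha0).le]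
          have := inv_le_one_of_one_le₀ ha
          have := norm_nonneg w
          have := (inv_pos.2 ha0).le
          nlinarith
        have := norm_sub_norm_le x (a⁻¹ • w)
        linarith
    simp [this]

include hfm

theorem integrable_of_bounded : Integrable f := by
  have h : Integrable ((Metric.closedBall (0 : E3) R).indicator fun _ => M) := by
    rw [integrable_indicator_iff measurableSet_closedBall]
    exact integrableOn_const (measure_closedBall_lt_top.ne)
  refine h.mono' hfm.aestronglyMeasurable (Eventually.of_forall fun x => ?_)
  by_cases hx : x ∈ Metric.closedBall (0 : E3) R
  · rw [Set.indicator_of_mem hx]; exact hM x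
  · rw [Set.indicator_of_notMem hx, hR x (by simpa using hx)]; simp

theorem tendsto_integral_mul_conv_charge {g : E3 → ℝ} (hg : MemLp g 2)
    (hc : ∀ᵐ x, ContinuousAt f x) :
    Tendsto (fun a : ℝ => ∫ x, g x * conv f (fun y => a ^ 3 * chargeProfile ‖a • y‖) x) atTop
      (𝓝 (∫ x, g x * f x)) := by
  set B := Metric.closedBall (0 : E3) (R + 1)
  set C := M * ∫ w : E3, |chargeProfile ‖w‖|
  have hball : MemLp (B.indicator fun _ => C) 2 (volume : Measure E3) :=
    memLp_indicator_const 2 measurableSet_closedBall C (Or.inr measure_closedBall_lt_top.ne)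
  have hm := continuous_chargeProfile.measurable
  refine tendsto_integral_filter_of_dominated_convergence
    (fun x => |g x| * B.indicator (fun _ => C) x) ?_ ?_ ?_ ?_
  · filter_upwards with a
    refine hg.1.mul ?_
    refine StronglyMeasurable.aestronglyMeasurable ?_
    exact StronglyMeasurable.integral_prod_right
      (f := fun x : E3 => fun y : E3 => f y * (a ^ 3 * chargeProfile ‖a • (x - y)‖))
      (Measurable.stronglyMeasurable (by fun_prop))
  · filter_upwards [eventually_ge_atTop 1] with a ha
    refine Eventually.of_forall fun x => ?_
    rw [norm_mul]
    exact mul_le_mul_of_nonneg_left (abs_conv_charge_le hM hR ha x) (abs_nonneg _)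
  · exact hg.abs.integrable_mul hball
  · filter_upwards [hc] with x hx
    exact (tendsto_conv_charge hfm hM hx).const_mul _

/-- The spread charge has density of order a⁻³ and is supported in a ball of radius `a`; convolution
adds the radius of the support of `f`. -/
theorem abs_conv_wide_charge_le {C : ℝ} (hC : ∀ x : E3, |chargeProfile ‖x‖| ≤ C) {a : ℝ}
    (ha : 1 ≤ a) (x : E3) :
    |conv f (fun y => a⁻¹ ^ 3 * chargeProfile ‖a⁻¹ • y‖) x|
      ≤ (Metric.closedBall (0 : E3) (R + a)).indicator
          (fun _ => a⁻¹ ^ 3 * (C * ∫ w : E3, |f w|)) x := by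
  have ha0 : 0 < a := by linarith
  have hf := integrable_of_bounded hfm hM hR
  rw [conv]
  by_cases hx : x ∈ Metric.closedBall (0 : E3) (R + a)
  · rw [Set.indicator_of_mem hx, ← integral_const_mul, ← integral_const_mul]
    refine abs_integral_le_integral_abs.trans ?_
    refine integral_mono_of_nonneg (Eventually.of_forall fun w => abs_nonneg _)
      ((hf.abs.const_mul C).const_mul _) (Eventually.of_forall fun w => ?_)
    simp only [abs_mul]
    rw [abs_of_pos (by positivity : 0 < a⁻¹ ^ 3)]
    have h1 := hC (a⁻¹ • (x - w))
    have h2 : |f w| * |chargeProfile ‖a⁻¹ • (x - w)‖| ≤ |f w| * C := by gcongr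
    have h3 : 0 ≤ a⁻¹ ^ 3 := by positivity
    nlinarith
  · rw [Set.indicator_of_notMem hx]
    have hx' : R + a < ‖x‖ := by simpa using hx
    have : ∀ w : E3, f w * (a⁻¹ ^ 3 * chargeProfile ‖a⁻¹ • (x - w)‖) = 0 := by
      intro w
      rcases le_or_gt ‖w‖ R with hw | hw
      · rw [chargeProfile_eq_zero, mul_zero, mul_zero]
        rw [norm_smul, Real.norm_of_nonneg (inv_pos.2 ha0).le, ← div_eq_inv_mul, one_lt_div ha0]
        have := norm_sub_norm_le x w
        linarith
      · rw [hR w hw, zero_mul]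
    simp only [this, integral_zero, abs_zero, le_refl]

theorem tendsto_integral_mul_conv_wide_charge {g : E3 → ℝ} (hg : MemLp g 2) :
    Tendsto (fun a : ℝ => ∫ x, g x * conv f (fun y => a⁻¹ ^ 3 * chargeProfile ‖a⁻¹ • y‖) x) atTop
      (𝓝 0) := by
  obtain ⟨C, hC0, hC⟩ := exists_bound_chargeProfile
  set D := C * ∫ w : E3, |f w|
  have hD : 0 ≤ D := mul_nonneg hC0 (integral_nonneg fun _ => abs_nonneg _)
  set G := ∫ x, g x ^ 2
  -- Young's inequality with weights a⁻¹ and a: the first term is a⁻¹ times half the integral of g².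
  -- The second is a · (a⁻³D)² times the volume of a ball of radius at most 2a, hence of order a⁻².
  -- The constant 16π/3 is half of 8 · 4π/3.
  have key : ∀ a : ℝ, 1 ≤ a → R ≤ a →
      |∫ x, g x * conv f (fun y => a⁻¹ ^ 3 * chargeProfile ‖a⁻¹ • y‖) x|
        ≤ a⁻¹ * (G / 2 + D ^ 2 * (16 * Real.pi / 3)) := by
    intro a ha hRa
    have ha0 : 0 < a := by linarith
    set B := Metric.closedBall (0 : E3) (R + a)
    have hB : MeasurableSet B := measurableSet_closedBall
    have i1 : Integrable fun x => a⁻¹ * g x ^ 2 / 2 := (hg.integrable_sq.const_mul _).div_const 2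
    have i2 : Integrable fun x => B.indicator (fun _ => a * (a⁻¹ ^ 3 * D) ^ 2 / 2) x := by
      rw [integrable_indicator_iff hB]
      exact integrableOn_const measure_closedBall_lt_top.ne
    have hle : |∫ x, g x * conv f (fun y => a⁻¹ ^ 3 * chargeProfile ‖a⁻¹ • y‖) x|
        ≤ ∫ x, (a⁻¹ * g x ^ 2 / 2 + B.indicator (fun _ => a * (a⁻¹ ^ 3 * D) ^ 2 / 2) x) := by
      refine abs_integral_le_integral_abs.trans ?_
      refine integral_mono_of_nonneg (Eventually.of_forall fun w => abs_nonneg _)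
        (i1.add i2) (Eventually.of_forall fun x => ?_)
      have h := abs_conv_wide_charge_le hfm hM hR hC ha x
      change _ ≤ B.indicator (fun _ => a⁻¹ ^ 3 * D) x at h
      simp only [abs_mul]
      by_cases hx : x ∈ B
      · simp only [Set.indicator_of_mem hx] at h ⊢
        set u := |conv f (fun y => a⁻¹ ^ 3 * chargeProfile ‖a⁻¹ • y‖) x|
        have hu : 0 ≤ u := abs_nonneg _
        have e1 : u ^ 2 ≤ (a⁻¹ ^ 3 * D) ^ 2 := by gcongr
        have e2 : |g x| * u ≤ a⁻¹ * g x ^ 2 / 2 + a * u ^ 2 / 2 := by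
          have := sq_nonneg (|g x| - a * u)
          have h3 : 0 ≤ a⁻¹ * (|g x| - a * u) ^ 2 := by positivity
          have h4 : a⁻¹ * (|g x| - a * u) ^ 2 = a⁻¹ * |g x| ^ 2 - 2 * |g x| * u + a * u ^ 2 := by
            field_simp; ring
          rw [sq_abs] at h4
          linarith
        have e3 : a * u ^ 2 ≤ a * (a⁻¹ ^ 3 * D) ^ 2 := by gcongr
        linarith
      · simp only [Set.indicator_of_notMem hx] at h ⊢
        have : |conv f (fun y => a⁻¹ ^ 3 * chargeProfile ‖a⁻¹ • y‖) x| = 0 :=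
          le_antisymm h (abs_nonneg _)
        rw [this, mul_zero]
        positivity
    refine hle.trans ?_
    rw [integral_add i1 i2, integral_indicator hB, setIntegral_const, integral_div,
      integral_const_mul]
    have hvol : volume.real B ≤ 8 * a ^ 3 * (4 * Real.pi / 3) := by
      have h1 : volume.real B ≤ volume.real (Metric.closedBall (0 : E3) (2 * a)) := by
        refine measureReal_mono (Metric.closedBall_subset_closedBall (by linarith))
          measure_closedBall_lt_top.ne
      refine h1.trans (le_of_eq ?_)
      rw [Measure.real, EuclideanSpace.volume_closedBall_fin_three, ENNReal.toReal_mul,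
        ENNReal.toReal_pow, ENNReal.toReal_ofReal (by positivity),
        ENNReal.toReal_ofReal (by have := Real.pi_pos; positivity)]
      ring
    have h5 : volume.real B • (a * (a⁻¹ ^ 3 * D) ^ 2 / 2)
        ≤ 8 * a ^ 3 * (4 * Real.pi / 3) * (a * (a⁻¹ ^ 3 * D) ^ 2 / 2) := by
      rw [smul_eq_mul]; gcongr
    have h6 : 8 * a ^ 3 * (4 * Real.pi / 3) * (a * (a⁻¹ ^ 3 * D) ^ 2 / 2)
        = a⁻¹ ^ 2 * (D ^ 2 * (16 * Real.pi / 3)) := by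
      field_simp; ring
    have h7 : a⁻¹ ^ 2 * (D ^ 2 * (16 * Real.pi / 3)) ≤ a⁻¹ * (D ^ 2 * (16 * Real.pi / 3)) := by
      have := inv_le_one_of_one_le₀ ha
      have h0 : 0 < a⁻¹ := inv_pos.2 ha0
      have := Real.pi_pos
      gcongr
      nlinarith
    have h8 : a⁻¹ * (∫ x, g x ^ 2) / 2 = a⁻¹ * (G / 2) := by ring
    rw [mul_add]
    linarith
  have hz : Tendsto (fun a : ℝ => a⁻¹ * (G / 2 + D ^ 2 * (16 * Real.pi / 3))) atTop (𝓝 0) := by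
    have h := (tendsto_inv_atTop_zero (𝕜 := ℝ)).mul_const (G / 2 + D ^ 2 * (16 * Real.pi / 3))
    rwa [zero_mul] at h
  refine squeeze_zero_norm' ?_ hz
  filter_upwards [eventually_ge_atTop 1, eventually_ge_atTop R] with a h1 h2 using key a h1 h2

/-- The concentrated charge reproduces `f` and the spread charge contributes zero in the limit. -/
theorem tendsto_integral_mul_conv_negLaplacian {g : E3 → ℝ} (hg : MemLp g 2)
    (hc : ∀ᵐ x, ContinuousAt f x) :
    Tendsto (fun a : ℝ => ∫ x, g x * conv f (negLaplacian (kern a)) x) atTop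
      (𝓝 (∫ x, g x * f x)) := by
  have h1 := (tendsto_integral_mul_conv_charge hfm hM hR hg hc).sub
    (tendsto_integral_mul_conv_wide_charge hfm hM hR hg)
  rw [sub_zero] at h1
  refine h1.congr' ?_
  have hf := integrable_of_bounded hfm hM hR
  obtain ⟨C, hC0, hC⟩ := exists_bound_chargeProfile
  have hm := continuous_chargeProfile.measurable
  filter_upwards [eventually_ge_atTop 1] with a ha
  have ha0 : 0 < a := by linarith
  have hi : ∀ (b : ℝ) (x : E3),
      Integrable fun y => f y * (b ^ 3 * chargeProfile ‖b • (x - y)‖) := by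
    intro b x
    refine hf.mul_bdd (c := |b ^ 3| * C) (Measurable.aestronglyMeasurable (by fun_prop))
      (Eventually.of_forall fun y => ?_)
    rw [norm_mul]
    exact mul_le_mul_of_nonneg_left (hC _) (abs_nonneg _)
  have e : ∀ x, conv f (negLaplacian (kern a)) x
      = conv f (fun y => a ^ 3 * chargeProfile ‖a • y‖) x
        - conv f (fun y => a⁻¹ ^ 3 * chargeProfile ‖a⁻¹ • y‖) x := by
    intro x
    simp only [conv, negLaplacian_kern a, mul_sub]
    rw [integral_sub (hi a x) (hi a⁻¹ x)]
  simp only [e, mul_sub]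
  rw [integral_sub]
  · refine (hg.integrable_mul (q := 2) ?_)
    refine MemLp.mono (memLp_indicator_const 2 (measurableSet_closedBall (x := (0 : E3)) (ε := R + 1))
      (M * ∫ w : E3, |chargeProfile ‖w‖|) (Or.inr measure_closedBall_lt_top.ne)) ?_
      (Eventually.of_forall fun x =>
        (abs_conv_charge_le hM hR ha x).trans (le_abs_self _))
    exact (StronglyMeasurable.integral_prod_right
      (f := fun x : E3 => fun y : E3 => f y * (a ^ 3 * chargeProfile ‖a • (x - y)‖))
      (Measurable.stronglyMeasurable (by fun_prop))).aestronglyMeasurable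
  · refine (hg.integrable_mul (q := 2) ?_)
    refine MemLp.mono (memLp_indicator_const 2 (measurableSet_closedBall (x := (0 : E3)) (ε := R + a))
      (a⁻¹ ^ 3 * (C * ∫ w : E3, |f w|)) (Or.inr measure_closedBall_lt_top.ne)) ?_
      (Eventually.of_forall fun x =>
        (abs_conv_wide_charge_le hfm hM hR hC ha x).trans (le_abs_self _))
    exact (StronglyMeasurable.integral_prod_right
      (f := fun x : E3 => fun y : E3 => f y * (a⁻¹ ^ 3 * chargeProfile ‖a⁻¹ • (x - y)‖))
      (Measurable.stronglyMeasurable (by fun_prop))).aestronglyMeasurable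

end

/-! ### Lipschitz profiles in the plane -/

/-- The partial derivative `∂ₐ f` in the plane. -/
noncomputable def hpd (a : Fin 2) (f : E2 → ℝ) (y : E2) : ℝ :=
  fderiv ℝ f y (EuclideanSpace.single a 1)

/-- A bounded Lipschitz function on the plane. -/
structure IsProfile (h : E2 → ℝ) : Prop where
  lip : ∃ K : NNReal, LipschitzWith K h
  bdd : ∃ B : ℝ, ∀ y, |h y| ≤ B

theorem gradient_apply_plane (f : E2 → ℝ) (y : E2) (a : Fin 2) : gradient f y a = hpd a f y := by
  have : inner ℝ (gradient f y) (EuclideanSpace.single a (1 : ℝ)) = hpd a f y := by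
    rw [gradient, InnerProductSpace.toDual_symm_apply]; rfl
  rw [← this, EuclideanSpace.inner_single_right]
  simp

theorem measurable_hpd (a : Fin 2) (f : E2 → ℝ) : Measurable (hpd a f) :=
  measurable_fderiv_apply_const ℝ f _

theorem abs_hpd_le {f : E2 → ℝ} {K : NNReal} (hf : LipschitzWith K f) (a : Fin 2) (y : E2) :
    |hpd a f y| ≤ K := by
  have h1 := (fderiv ℝ f y).le_opNorm (EuclideanSpace.single a 1)
  have h2 := norm_fderiv_le_of_lipschitz ℝ hf (x₀ := y)
  simp only [PiLp.norm_single, norm_one, mul_one] at h1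
  exact h1.trans h2

theorem IsProfile.continuous {h : E2 → ℝ} (hh : IsProfile h) : Continuous h :=
  hh.lip.choose_spec.continuous

theorem IsProfile.ae_differentiableAt {h : E2 → ℝ} (hh : IsProfile h) :
    ∀ᵐ y, DifferentiableAt ℝ h y :=
  hh.lip.choose_spec.ae_differentiableAt

theorem IsProfile.hpd_bdd {h : E2 → ℝ} (hh : IsProfile h) (a : Fin 2) :
    ∃ B : ℝ, ∀ y, |hpd a h y| ≤ B :=
  ⟨_, fun y => abs_hpd_le hh.lip.choose_spec a y⟩

theorem IsProfile.sub {f g : E2 → ℝ} (hf : IsProfile f) (hg : IsProfile g) :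
    IsProfile fun y => f y - g y := by
  obtain ⟨K, hK⟩ := hf.lip
  obtain ⟨L, hL⟩ := hg.lip
  obtain ⟨A, hA⟩ := hf.bdd
  obtain ⟨B, hB⟩ := hg.bdd
  exact ⟨⟨_, hK.sub hL⟩, ⟨A + B, fun y => (abs_sub _ _).trans (add_le_add (hA y) (hB y))⟩⟩

theorem IsProfile.mul {f g : E2 → ℝ} (hf : IsProfile f) (hg : IsProfile g) :
    IsProfile fun y => f y * g y := by
  obtain ⟨K, hK⟩ := hf.lip
  obtain ⟨L, hL⟩ := hg.lip
  obtain ⟨A, hA⟩ := hf.bdd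
  obtain ⟨B, hB⟩ := hg.bdd
  have hA0 : 0 ≤ A := (abs_nonneg _).trans (hA 0)
  have hB0 : 0 ≤ B := (abs_nonneg _).trans (hB 0)
  refine ⟨⟨Real.toNNReal (A * L + B * K), ?_⟩, ⟨A * B, fun y => ?_⟩⟩
  · refine LipschitzWith.of_dist_le_mul fun x y => ?_
    rw [Real.coe_toNNReal _ (by positivity), Real.dist_eq]
    have h1 := hK.dist_le_mul x y
    have h2 := hL.dist_le_mul x y
    rw [Real.dist_eq] at h1 h2
    calc |f x * g x - f y * g y| = |f x * (g x - g y) + g y * (f x - f y)| := by ring_nf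
      _ ≤ |f x| * |g x - g y| + |g y| * |f x - f y| := by
        rw [← abs_mul, ← abs_mul]; exact abs_add_le _ _
      _ ≤ A * (L * dist x y) + B * (K * dist x y) := by
        gcongr
        · exact hA x
        · exact hB y
      _ = _ := by ring
  · rw [abs_mul]; exact mul_le_mul (hA y) (hB y) (abs_nonneg _) hA0

theorem IsProfile.add {f g : E2 → ℝ} (hf : IsProfile f) (hg : IsProfile g) :
    IsProfile fun y => f y + g y := by
  obtain ⟨K, hK⟩ := hf.lip
  obtain ⟨L, hL⟩ := hg.lip
  obtain ⟨A, hA⟩ := hf.bdd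
  obtain ⟨B, hB⟩ := hg.bdd
  exact ⟨⟨_, hK.add hL⟩, ⟨A + B, fun y => (abs_add_le _ _).trans (add_le_add (hA y) (hB y))⟩⟩

theorem isProfile_const (c : ℝ) : IsProfile fun _ => c :=
  ⟨⟨0, LipschitzWith.const c⟩, ⟨|c|, fun _ => le_rfl⟩⟩

/-- Two bounded Lipschitz profiles, one below the other. -/
structure IsFilm (h₁ h₂ : E2 → ℝ) : Prop where
  bot : IsProfile h₁
  top : IsProfile h₂
  lt : ∀ y, h₁ y < h₂ y

theorem isProfile_of_contDiff {f : E2 → ℝ} (hf : ContDiff ℝ 1 f) (hc : HasCompactSupport f) :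
    IsProfile f := by
  obtain ⟨C, hC⟩ := hf.lipschitzWith_of_hasCompactSupport hc one_ne_zero
  obtain ⟨B, hB⟩ := hc.exists_bound_of_continuous hf.continuous
  exact ⟨⟨C, hC⟩, ⟨B, hB⟩⟩

/-- By Rademacher's theorem partial derivatives agree almost everywhere with line derivatives, for
which Lipschitz functions can be integrated by parts. -/
theorem integral_hpd_mul {f g : E2 → ℝ} (hf : ∃ K : NNReal, LipschitzWith K f)
    (hg : ∃ K : NNReal, LipschitzWith K g) (hc : HasCompactSupport g) (a : Fin 2) :
    ∫ y, hpd a f y * g y = -∫ y, hpd a g y * f y := by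
  obtain ⟨K, hK⟩ := hf
  obtain ⟨L, hL⟩ := hg
  have h := hK.integral_lineDeriv_mul_eq (μ := volume) hL hc (EuclideanSpace.single a 1)
  have e1 : ∫ y, hpd a f y * g y = ∫ y, lineDeriv ℝ f y (EuclideanSpace.single a 1) * g y := by
    refine integral_congr_ae ?_
    filter_upwards [hK.ae_differentiableAt] with y hy
    rw [hy.lineDeriv_eq_fderiv]; rfl
  have e2 : ∫ y, hpd a g y * f y = -∫ y, lineDeriv ℝ g y (-EuclideanSpace.single a 1) * f y := by
    rw [← integral_neg]
    refine integral_congr_ae ?_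
    filter_upwards [hL.ae_differentiableAt] with y hy
    rw [hy.lineDeriv_eq_fderiv]; simp [hpd]
  rw [e1, e2, h, neg_neg]

/-! ### The divergence theorem in a layer -/

theorem join_single (a : Fin 2) (σ : ℝ) :
    join (EuclideanSpace.single a 1) σ
      = EuclideanSpace.single a.castSucc 1 + σ • EuclideanSpace.single 2 1 := by
  ext i; fin_cases a <;> fin_cases i <;> simp [join]

/-- `join` as a continuous linear map. -/
noncomputable def joinL : E2 × ℝ →L[ℝ] E3 :=
  LinearMap.toContinuousLinearMap
    { toFun := fun p => join p.1 p.2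
      map_add' := fun p q => by simp [join_add]
      map_smul' := fun c p => by ext i; fin_cases i <;> simp }

theorem joinL_apply (p : E2 × ℝ) : joinL p = join p.1 p.2 := rfl

theorem hpd_comp_join {ψ : E3 → ℝ} (hψ : Differentiable ℝ ψ) {s : E2 → ℝ} {y : E2}
    (hs : DifferentiableAt ℝ s y) (a : Fin 2) :
    hpd a (fun y => ψ (join y (s y))) y
      = pd a.castSucc ψ (join y (s y)) + hpd a s y * pd 2 ψ (join y (s y)) := by
  have h1 : HasFDerivAt (fun y => join y (s y))
      (joinL.comp ((ContinuousLinearMap.id ℝ E2).prod (fderiv ℝ s y))) y :=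
    joinL.hasFDerivAt.comp y ((hasFDerivAt_id y).prodMk hs.hasFDerivAt)
  have h2 : HasFDerivAt (fun y => ψ (join y (s y))) _ y := (hψ _).hasFDerivAt.comp y h1
  rw [hpd, h2.fderiv]
  simp [joinL_apply, join_single, pd, hpd]

theorem hasDerivAt_comp_join {ψ : E3 → ℝ} (hψ : Differentiable ℝ ψ) (y : E2) (c d t : ℝ) :
    HasDerivAt (fun t => ψ (join y (c + d * t))) (d * pd 2 ψ (join y (c + d * t))) t := by
  have h0 : HasDerivAt (fun t : ℝ => c + d * t) d t := by
    simpa using ((hasDerivAt_id t).const_mul d).const_add c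
  have h1 : HasDerivAt (fun t : ℝ => join y (c + d * t)) (joinL (0, d)) t :=
    joinL.hasFDerivAt.comp_hasDerivAt t ((hasDerivAt_const t y).prodMk h0)
  have h2 : HasDerivAt (fun t => ψ (join y (c + d * t))) _ t :=
    (hψ _).hasFDerivAt.comp_hasDerivAt t h1
  convert h2 using 1
  have : joinL (0, d) = d • EuclideanSpace.single (2 : Fin 3) (1 : ℝ) := by
    ext i; fin_cases i <;> simp [joinL_apply, join]
  rw [this, map_smul]; rfl

theorem lipschitz_comp_join {ψ : E3 → ℝ} (hψ : IsTest ψ) {s : E2 → ℝ}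
    (hs : ∃ K : NNReal, LipschitzWith K s) :
    ∃ K : NNReal, LipschitzWith K fun y => ψ (join y (s y)) := by
  obtain ⟨K, hK⟩ := hs
  obtain ⟨C, hC⟩ := hψ.contDiff_one.lipschitzWith_of_hasCompactSupport hψ.2 one_ne_zero
  have h1 : LipschitzWith (max 1 K) fun y => (y, s y) := LipschitzWith.id.prodMk hK
  have h2 := hC.comp (joinL.lipschitz.comp h1)
  simp only [Function.comp_def, joinL_apply] at h2
  exact ⟨_, h2⟩

/-! ### The divergence-corrected field and its surface charges -/

/-- The horizontal divergence of a field depending on the horizontal variable. -/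
noncomputable def hdiv (m : E2 → E3) (y : E2) : ℝ :=
  hpd 0 (fun y => m y 0) y + hpd 1 (fun y => m y 1) y

/-- The field `m(x')` in a layer, corrected in the vertical direction so that it is
divergence-free inside the layer. -/
noncomputable def filmField (h₁ h₂ : E2 → ℝ) (m : E2 → E3) : E3 → E3 :=
  (layer h₁ h₂).indicator fun x =>
    !₂[m (horiz x) 0, m (horiz x) 1,
      m (horiz x) 2 - (x 2 - h₁ (horiz x)) * hdiv m (horiz x)]

/-- The charge `m · n_h` on the graph of `h`. -/
noncomputable def graphCharge (h : E2 → ℝ) (m : E2 → E3) (y : E2) : ℝ :=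
  m y 2 - m y 0 * hpd 0 h y - m y 1 * hpd 1 h y

/-- The charge of `filmField` on the upper graph. -/
noncomputable def topCharge (h₁ h₂ : E2 → ℝ) (m : E2 → E3) (y : E2) : ℝ :=
  graphCharge h₂ m y - (h₂ y - h₁ y) * hdiv m y

/-- Smooth compactly supported fields in the plane. -/
def IsTestField (m : E2 → E3) : Prop :=
  ContDiff ℝ ((⊤ : ℕ∞) : WithTop ℕ∞) m ∧ HasCompactSupport m

section
variable {m : E2 → E3} (hm : IsTestField m)
include hm

theorem IsTestField.contDiff_apply (i : Fin 3) :
    ContDiff ℝ ((⊤ : ℕ∞) : WithTop ℕ∞) fun y => m y i :=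
  (EuclideanSpace.proj i : E3 →L[ℝ] ℝ).contDiff.comp hm.1

theorem IsTestField.hasCompactSupport_apply (i : Fin 3) : HasCompactSupport fun y => m y i :=
  hm.2.comp_left (g := fun v : E3 => v i) rfl

theorem IsTestField.continuous : Continuous m := hm.1.continuous

theorem IsTestField.continuous_hpd (i : Fin 3) (a : Fin 2) :
    Continuous (hpd a fun y => m y i) :=
  ((hm.contDiff_apply i).continuous_fderiv (by simp)).clm_apply continuous_const

theorem IsTestField.continuous_hdiv : Continuous (hdiv m) :=
  (hm.continuous_hpd 0 0).add (hm.continuous_hpd 1 1)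

theorem IsTestField.hasCompactSupport_hdiv : HasCompactSupport (hdiv m) :=
  ((hm.hasCompactSupport_apply 0).fderiv_apply ℝ _).add
    ((hm.hasCompactSupport_apply 1).fderiv_apply ℝ _)

theorem IsTestField.isProfile (i : Fin 3) : IsProfile fun y => m y i :=
  isProfile_of_contDiff ((hm.contDiff_apply i).of_le (by exact_mod_cast le_top))
    (hm.hasCompactSupport_apply i)

/-- A common bound for a test field and its divergence, and for the radius of their supports. -/
theorem IsTestField.exists_bound : ∃ C R : ℝ, 0 ≤ C ∧ 0 ≤ R ∧ (∀ y i, |m y i| ≤ C) ∧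
    (∀ y, |hdiv m y| ≤ C) ∧ (∀ y, R < ‖y‖ → m y = 0) ∧ (∀ y, R < ‖y‖ → hdiv m y = 0) := by
  obtain ⟨C₁, h1⟩ := hm.2.exists_bound_of_continuous hm.continuous
  obtain ⟨C₂, h2⟩ := hm.hasCompactSupport_hdiv.exists_bound_of_continuous hm.continuous_hdiv
  obtain ⟨R₁, h3⟩ := hm.2.isCompact.isBounded.subset_closedBall 0
  obtain ⟨R₂, h4⟩ := hm.hasCompactSupport_hdiv.isCompact.isBounded.subset_closedBall 0
  refine ⟨max |C₁| |C₂|, max |R₁| |R₂|, by positivity, by positivity, fun y i => ?_, fun y => ?_,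
    fun y hy => ?_, fun y hy => ?_⟩
  · have := (PiLp.norm_apply_le (m y) i).trans (h1 y)
    exact this.trans ((le_abs_self _).trans (le_max_left _ _))
  · exact (h2 y).trans ((le_abs_self _).trans (le_max_right _ _))
  · refine image_eq_zero_of_notMem_tsupport fun h => ?_
    have := h3 h
    have h5 : ‖y‖ ≤ R₁ := by simpa using this
    linarith [le_abs_self R₁, le_max_left |R₁| |R₂|]
  · refine image_eq_zero_of_notMem_tsupport fun h => ?_
    have := h4 h
    have h5 : ‖y‖ ≤ R₂ := by simpa using this
    linarith [le_abs_self R₂, le_max_right |R₁| |R₂|]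

end

/-- Bounded measurable functions on `ℝ² × (0,1]` that vanish for large `x'` are integrable. -/
theorem integrable_slab {g : E2 × ℝ → ℝ} (hg : Measurable g) {C R : ℝ}
    (hC : ∀ p : E2 × ℝ, p.2 ∈ Set.Ioc (0 : ℝ) 1 → |g p| ≤ C)
    (hR : ∀ p : E2 × ℝ, R < ‖p.1‖ → g p = 0) :
    Integrable g ((volume : Measure E2).prod (volume.restrict (Set.Ioc (0 : ℝ) 1))) := by
  set B : Set (E2 × ℝ) := Metric.closedBall 0 R ×ˢ Set.univ
  have hB : MeasurableSet B := measurableSet_closedBall.prod MeasurableSet.univ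
  have h : Integrable (B.indicator fun _ => C)
      ((volume : Measure E2).prod (volume.restrict (Set.Ioc (0 : ℝ) 1))) := by
    rw [integrable_indicator_iff hB]
    refine integrableOn_const ?_
    rw [Measure.prod_prod]
    exact ENNReal.mul_ne_top measure_closedBall_lt_top.ne (measure_ne_top _ _)
  have hmem : ∀ᵐ p ∂((volume : Measure E2).prod (volume.restrict (Set.Ioc (0 : ℝ) 1))),
      p.2 ∈ Set.Ioc (0 : ℝ) 1 := by
    have : MeasurableSet {p : E2 × ℝ | p.2 ∈ Set.Ioc (0 : ℝ) 1} :=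
      measurable_snd measurableSet_Ioc
    refine (Measure.ae_prod_iff_ae_ae this).2 (Eventually.of_forall fun y => ?_)
    exact ae_restrict_mem measurableSet_Ioc
  refine h.mono' hg.aestronglyMeasurable ?_
  filter_upwards [hmem] with p hp
  by_cases hx : p ∈ B
  · rw [Set.indicator_of_mem hx]; exact hC p hp
  · rw [Set.indicator_of_notMem hx, hR p]
    · simp
    · by_contra h'
      exact hx ⟨by simpa using h', Set.mem_univ _⟩

section
variable {h₁ h₂ : E2 → ℝ} (H : IsFilm h₁ h₂) {m : E2 → E3} (hm : IsTestField m)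
include H hm

theorem measurable_filmField : Measurable (filmField h₁ h₂ m) := by
  have c1 := H.bot.continuous
  have c2 := hm.continuous
  have c3 := hm.continuous_hdiv
  refine Measurable.indicator ?_ (isOpen_layer H.bot.continuous H.top.continuous).measurableSet
  exact Continuous.measurable (by fun_prop)

theorem exists_bound_filmField : ∃ C R : ℝ, 0 ≤ C ∧ (∀ x i, |filmField h₁ h₂ m x i| ≤ C) ∧
    ∀ x, R < ‖x‖ → filmField h₁ h₂ m x = 0 := by
  obtain ⟨C, R, hC, hR, hC1, hC2, hR1, hR2⟩ := hm.exists_bound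
  obtain ⟨B₁, hB₁⟩ := H.bot.bdd
  obtain ⟨B₂, hB₂⟩ := H.top.bdd
  have hB10 : 0 ≤ B₁ := (abs_nonneg _).trans (hB₁ 0)
  have hB20 : 0 ≤ B₂ := (abs_nonneg _).trans (hB₂ 0)
  refine ⟨C + (B₂ + B₁) * C, R + (B₁ + B₂), by positivity, fun x i => ?_, fun x hx => ?_⟩
  · by_cases hx : x ∈ layer h₁ h₂
    · rw [filmField, Set.indicator_of_mem hx]
      have e : |x 2 - h₁ (horiz x)| ≤ B₂ + B₁ := by
        have := hx.1; have := hx.2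
        have a1 := abs_le.1 (hB₁ (horiz x)); have a2 := abs_le.1 (hB₂ (horiz x))
        rw [abs_le]; constructor <;> linarith
      have p : 0 ≤ (B₂ + B₁) * C := by positivity
      fin_cases i
      · exact (hC1 (horiz x) 0).trans (by linarith)
      · exact (hC1 (horiz x) 1).trans (by linarith)
      · refine (abs_sub _ _).trans (add_le_add (hC1 _ 2) ?_)
        rw [abs_mul]
        exact mul_le_mul e (hC2 _) (abs_nonneg _) (by positivity)
    · rw [filmField, Set.indicator_of_notMem hx]
      simp; positivity
  · by_cases hl : x ∈ layer h₁ h₂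
    · have e : |x 2| ≤ B₁ + B₂ := by
        have := hl.1; have := hl.2
        have a1 := abs_le.1 (hB₁ (horiz x)); have a2 := abs_le.1 (hB₂ (horiz x))
        rw [abs_le]; constructor <;> linarith
      have hn : R < ‖horiz x‖ := by
        by_contra hcon
        push Not at hcon
        have h1 := norm_sq_join (horiz x) (x 2)
        rw [join_horiz] at h1
        have h2 : ‖x‖ ^ 2 ≤ (R + (B₁ + B₂)) ^ 2 := by
          rw [h1, ← sq_abs (x 2)]
          have := norm_nonneg (horiz x)
          have := abs_nonneg (x 2)
          nlinarith
        have := abs_le_of_sq_le_sq h2 (by positivity)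
        rw [abs_norm] at this
        linarith
      rw [filmField, Set.indicator_of_mem hl, hR1 _ hn, hR2 _ hn]
      ext i; fin_cases i <;> simp
    · rw [filmField, Set.indicator_of_notMem hl]

theorem integrable_filmField_mul {g : E3 → ℝ} (hg : Integrable g) (i : Fin 3) :
    Integrable fun x => filmField h₁ h₂ m x i * g x := by
  obtain ⟨C, R, hC, h1, h2⟩ := exists_bound_filmField H hm
  have hmeas := measurable_filmField H hm
  refine hg.bdd_mul (c := C) ?_ (Eventually.of_forall fun x => h1 x i)
  exact Measurable.aestronglyMeasurable (by fun_prop)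

omit H in
theorem hpd_thickness_mul {a : Fin 2} (i : Fin 3) {y : E2} (d1 : DifferentiableAt ℝ h₁ y)
    (d2 : DifferentiableAt ℝ h₂ y) :
    hpd a (fun y => (h₂ y - h₁ y) * m y i) y
      = (h₂ y - h₁ y) * hpd a (fun y => m y i) y + m y i * (hpd a h₂ y - hpd a h₁ y) := by
  have d3 : DifferentiableAt ℝ (fun y => m y i) y :=
    (hm.contDiff_apply i).differentiable (by simp) y
  have := (d2.hasFDerivAt.sub d1.hasFDerivAt).mul d3.hasFDerivAt
  have h' : HasFDerivAt (fun y => (h₂ y - h₁ y) * m y i) _ y := this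
  rw [hpd, h'.fderiv]
  simp [hpd]

/-- Integration by parts at a fixed relative height `t`. -/
theorem integral_slice {ψ : E3 → ℝ} (hψ : IsTest ψ) (t : ℝ) (a : Fin 2) (i : Fin 3) :
    ∫ y, (h₂ y - h₁ y) * m y i *
        (pd a.castSucc ψ (join y (h₁ y + (h₂ y - h₁ y) * t))
          + (hpd a h₁ y + (hpd a h₂ y - hpd a h₁ y) * t)
            * pd 2 ψ (join y (h₁ y + (h₂ y - h₁ y) * t)))
      = -∫ y, ((h₂ y - h₁ y) * hpd a (fun y => m y i) y + m y i * (hpd a h₂ y - hpd a h₁ y))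
          * ψ (join y (h₁ y + (h₂ y - h₁ y) * t)) := by
  have hs : ∃ K : NNReal, LipschitzWith K fun y => h₁ y + (h₂ y - h₁ y) * t :=
    (H.bot.add ((H.top.sub H.bot).mul (isProfile_const t))).lip
  have hp := (H.top.sub H.bot).mul (hm.isProfile i)
  have key := integral_hpd_mul (lipschitz_comp_join hψ hs) hp.lip
    (hm.hasCompactSupport_apply i).mul_left a
  have e1 : ∀ᵐ y, hpd a (fun y => ψ (join y (h₁ y + (h₂ y - h₁ y) * t))) y
        * ((h₂ y - h₁ y) * m y i) = (h₂ y - h₁ y) * m y i *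
        (pd a.castSucc ψ (join y (h₁ y + (h₂ y - h₁ y) * t))
          + (hpd a h₁ y + (hpd a h₂ y - hpd a h₁ y) * t)
            * pd 2 ψ (join y (h₁ y + (h₂ y - h₁ y) * t))) := by
    filter_upwards [H.bot.ae_differentiableAt, H.top.ae_differentiableAt] with y d1 d2
    have d3 : HasFDerivAt (fun y => h₁ y + (h₂ y - h₁ y) * t) _ y :=
      d1.hasFDerivAt.add ((d2.hasFDerivAt.sub d1.hasFDerivAt).mul_const t)
    rw [hpd_comp_join hψ.differentiable d3.differentiableAt]
    have : hpd a (fun y => h₁ y + (h₂ y - h₁ y) * t) y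
        = hpd a h₁ y + (hpd a h₂ y - hpd a h₁ y) * t := by
      rw [hpd, d3.fderiv]; simp [hpd]; ring
    rw [this]; ring
  rw [← integral_congr_ae e1, key]
  congr 1
  refine integral_congr_ae ?_
  filter_upwards [H.bot.ae_differentiableAt, H.top.ae_differentiableAt] with y d1 d2
  rw [hpd_thickness_mul hm i d1 d2]

end

/-! ### Integrability on the flattened slab -/

/-- Measurable functions on `ℝ² × ℝ` that are bounded on `ℝ² × (0,1]`. -/
structure SlabBounded (g : E2 × ℝ → ℝ) : Prop where
  meas : Measurable g
  bdd : ∃ C : ℝ, ∀ p : E2 × ℝ, p.2 ∈ Set.Ioc (0 : ℝ) 1 → |g p| ≤ C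

theorem SlabBounded.add {f g : E2 × ℝ → ℝ} (hf : SlabBounded f) (hg : SlabBounded g) :
    SlabBounded fun p => f p + g p := by
  obtain ⟨A, hA⟩ := hf.bdd
  obtain ⟨B, hB⟩ := hg.bdd
  exact ⟨hf.meas.add hg.meas,
    ⟨A + B, fun p hp => (abs_add_le _ _).trans (add_le_add (hA p hp) (hB p hp))⟩⟩

theorem SlabBounded.sub {f g : E2 × ℝ → ℝ} (hf : SlabBounded f) (hg : SlabBounded g) :
    SlabBounded fun p => f p - g p := by
  obtain ⟨A, hA⟩ := hf.bdd
  obtain ⟨B, hB⟩ := hg.bdd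
  exact ⟨hf.meas.sub hg.meas,
    ⟨A + B, fun p hp => (abs_sub _ _).trans (add_le_add (hA p hp) (hB p hp))⟩⟩

theorem SlabBounded.mul {f g : E2 × ℝ → ℝ} (hf : SlabBounded f) (hg : SlabBounded g) :
    SlabBounded fun p => f p * g p := by
  obtain ⟨A, hA⟩ := hf.bdd
  obtain ⟨B, hB⟩ := hg.bdd
  refine ⟨hf.meas.mul hg.meas, ⟨|A| * |B|, fun p hp => ?_⟩⟩
  rw [abs_mul]
  exact mul_le_mul ((hA p hp).trans (le_abs_self _)) ((hB p hp).trans (le_abs_self _))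
    (abs_nonneg _) (abs_nonneg _)

theorem slabBounded_fst {f : E2 → ℝ} (hf : Measurable f) (h : ∃ C : ℝ, ∀ y, |f y| ≤ C) :
    SlabBounded fun p => f p.1 :=
  ⟨hf.comp measurable_fst, h.imp fun _ hC p _ => hC p.1⟩

theorem slabBounded_snd : SlabBounded fun p => p.2 :=
  ⟨measurable_snd, ⟨1, fun p hp => by rw [abs_of_pos hp.1]; exact hp.2⟩⟩

theorem IsProfile.slabBounded {h : E2 → ℝ} (hh : IsProfile h) : SlabBounded fun p => h p.1 :=
  slabBounded_fst hh.continuous.measurable hh.bdd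

theorem IsProfile.slabBounded_hpd {h : E2 → ℝ} (hh : IsProfile h) (a : Fin 2) :
    SlabBounded fun p => hpd a h p.1 :=
  slabBounded_fst (measurable_hpd a h) (hh.hpd_bdd a)

/-- The reference measure on the slab `ℝ² × (0,1]`. -/
noncomputable abbrev slabMeasure : Measure (E2 × ℝ) :=
  (volume : Measure E2).prod (volume.restrict (Set.Ioc (0 : ℝ) 1))

/-- The function vanishes when the horizontal variable is large. -/
def VanishesFar (g : E2 × ℝ → ℝ) : Prop := ∃ R : ℝ, ∀ p : E2 × ℝ, R < ‖p.1‖ → g p = 0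

theorem VanishesFar.mul_left {f : E2 × ℝ → ℝ} (hf : VanishesFar f) (g : E2 × ℝ → ℝ) :
    VanishesFar fun p => g p * f p :=
  hf.imp fun _ h p hp => by simp [h p hp]

theorem VanishesFar.mul_right {f : E2 × ℝ → ℝ} (hf : VanishesFar f) (g : E2 × ℝ → ℝ) :
    VanishesFar fun p => f p * g p :=
  hf.imp fun _ h p hp => by simp [h p hp]

theorem VanishesFar.add {f g : E2 × ℝ → ℝ} (hf : VanishesFar f) (hg : VanishesFar g) :
    VanishesFar fun p => f p + g p := by
  obtain ⟨A, hA⟩ := hf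
  obtain ⟨B, hB⟩ := hg
  exact ⟨max A B, fun p hp => by
    simp [hA p ((le_max_left _ _).trans_lt hp), hB p ((le_max_right _ _).trans_lt hp)]⟩

theorem vanishesFar_fst {f : E2 → ℝ} (hf : HasCompactSupport f) :
    VanishesFar fun p => f p.1 := by
  obtain ⟨R, hR⟩ := hf.isCompact.isBounded.subset_closedBall 0
  refine ⟨R, fun p hp => image_eq_zero_of_notMem_tsupport fun h => ?_⟩
  have := hR h
  have h5 : ‖p.1‖ ≤ R := by simpa using this
  linarith

theorem SlabBounded.integrable {g : E2 × ℝ → ℝ} (hg : SlabBounded g) (h : VanishesFar g) :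
    Integrable g slabMeasure := by
  obtain ⟨C, hC⟩ := hg.bdd
  obtain ⟨R, hR⟩ := h
  exact integrable_slab hg.meas hC hR

section
variable {h₁ h₂ : E2 → ℝ} (H : IsFilm h₁ h₂) {m : E2 → E3} (hm : IsTestField m)
include H hm

/-- The divergence theorem for `filmField`: its distributional divergence is carried by the two
bounding graphs. -/
theorem integral_filmField_gradient {ψ : E3 → ℝ} (hψ : IsTest ψ) :
    ∫ x, inner ℝ (filmField h₁ h₂ m x) (gradient ψ x)
      = (∫ y, topCharge h₁ h₂ m y * ψ (join y (h₂ y)))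
        - ∫ y, graphCharge h₁ m y * ψ (join y (h₁ y)) := by
  set h : E2 → ℝ := fun y => h₂ y - h₁ y with hh
  set X : E2 × ℝ → E3 := fun p => join p.1 (h₁ p.1 + h p.1 * p.2) with hX
  have c1 := H.bot.continuous
  have c2 := H.top.continuous
  have cX : Continuous X := by fun_prop
  -- the pieces of the integrand
  set A : Fin 2 → Fin 3 → E2 × ℝ → ℝ := fun a i p => h p.1 * m p.1 i *
    (pd a.castSucc ψ (X p) + (hpd a h₁ p.1 + (hpd a h₂ p.1 - hpd a h₁ p.1) * p.2) * pd 2 ψ (X p))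
    with hA
  set D : Fin 2 → Fin 3 → E2 × ℝ → ℝ := fun a i p =>
    (h p.1 * hpd a (fun y => m y i) p.1 + m p.1 i * (hpd a h₂ p.1 - hpd a h₁ p.1)) * ψ (X p) with hD
  -- Almost everywhere this is the horizontal divergence of (h₂ - h₁) m'. It is the charge that the
  -- flux loses between the lower and the upper graph.
  set e : E2 → ℝ := fun y => (h y * hpd 0 (fun y => m y 0) y + m y 0 * (hpd 0 h₂ y - hpd 0 h₁ y))
    + (h y * hpd 1 (fun y => m y 1) y + m y 1 * (hpd 1 h₂ y - hpd 1 h₁ y)) with he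
  set B : E2 × ℝ → ℝ := fun p => h p.1 * pd 2 ψ (X p) * (graphCharge h₁ m p.1 - p.2 * e p.1)
    - e p.1 * ψ (X p) with hB
  -- integrability
  have bX : ∀ {φ : E3 → ℝ}, IsTest φ → SlabBounded fun p => φ (X p) := fun {φ} hφ =>
    ⟨(hφ.continuous.comp cX).measurable, hφ.bounded.imp fun C hC p _ => hC.2 (X p)⟩
  have bh : SlabBounded fun p => h p.1 := (H.top.sub H.bot).slabBounded
  have bm : ∀ i, SlabBounded fun p => m p.1 i := fun i => (hm.isProfile i).slabBounded
  have fm : ∀ i, VanishesFar fun p => m p.1 i := fun i =>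
    vanishesFar_fst (hm.hasCompactSupport_apply i)
  have fdm : ∀ a i, VanishesFar fun p => hpd a (fun y => m y i) p.1 := fun a i =>
    vanishesFar_fst ((hm.hasCompactSupport_apply i).fderiv_apply ℝ _)
  have b1 := fun a => H.bot.slabBounded_hpd a
  have b2 := fun a => H.top.slabBounded_hpd a
  have iA : ∀ a i, Integrable (A a i) slabMeasure := fun a i =>
    SlabBounded.integrable ((bh.mul (bm i)).mul ((bX (hψ.pd _)).add
      (((b1 a).add (((b2 a).sub (b1 a)).mul slabBounded_snd)).mul (bX (hψ.pd 2)))))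
      (((fm i).mul_left _).mul_right _)
  have bE : ∀ a i, SlabBounded fun p => h p.1 * hpd a (fun y => m y i) p.1
      + m p.1 i * (hpd a h₂ p.1 - hpd a h₁ p.1) := fun a i =>
    (bh.mul ((hm.isProfile i).slabBounded_hpd a)).add ((bm i).mul ((b2 a).sub (b1 a)))
  have fE : ∀ a i, VanishesFar fun p => h p.1 * hpd a (fun y => m y i) p.1
      + m p.1 i * (hpd a h₂ p.1 - hpd a h₁ p.1) := fun a i =>
    ((fdm a i).mul_left _).add ((fm i).mul_right _)
  have iD : ∀ a i, Integrable (D a i) slabMeasure := fun a i =>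
    SlabBounded.integrable ((bE a i).mul (bX hψ)) ((fE a i).mul_right _)
  have be : SlabBounded fun p => e p.1 := (bE 0 0).add (bE 1 1)
  have fe : VanishesFar fun p => e p.1 := (fE 0 0).add (fE 1 1)
  have bc : SlabBounded fun p => graphCharge h₁ m p.1 :=
    ((bm 2).sub ((bm 0).mul (b1 0))).sub ((bm 1).mul (b1 1))
  have fc : VanishesFar fun p => graphCharge h₁ m p.1 := by
    obtain ⟨C, R, -, -, -, -, hR, -⟩ := hm.exists_bound
    exact ⟨R, fun p hp => by simp [graphCharge, hR p.1 hp]⟩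
  have iB : Integrable B slabMeasure := by
    have i1 : Integrable (fun p => h p.1 * pd 2 ψ (X p) * graphCharge h₁ m p.1) slabMeasure :=
      ((bh.mul (bX (hψ.pd 2))).mul bc).integrable (fc.mul_left _)
    have i2 : Integrable (fun p => h p.1 * pd 2 ψ (X p) * (p.2 * e p.1)) slabMeasure :=
      ((bh.mul (bX (hψ.pd 2))).mul (slabBounded_snd.mul be)).integrable
        ((fe.mul_left _).mul_left _)
    have i3 : Integrable (fun p => e p.1 * ψ (X p)) slabMeasure :=
      (be.mul (bX hψ)).integrable (fe.mul_right _)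
    refine ((i1.sub i2).sub i3).congr (Eventually.of_forall fun p => ?_)
    simp only [hB, Pi.sub_apply]; ring
  -- flattening
  have step1 : ∫ x, inner ℝ (filmField h₁ h₂ m x) (gradient ψ x)
      = ∫ y, ∫ t in Set.Ioc (0 : ℝ) 1,
          ((A 0 0 (y, t) + D 0 0 (y, t)) + (A 1 1 (y, t) + D 1 1 (y, t)) + B (y, t)) := by
    have hint : Integrable fun x => ∑ i, filmField h₁ h₂ m x i * pd i ψ x :=
      integrable_finsetSum _ fun i _ => integrable_filmField_mul H hm (hψ.pd i).integrable i
    simp only [inner_gradient]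
    rw [integral_join hint]
    refine integral_congr_ae (Eventually.of_forall fun y => ?_)
    have hy : 0 < h y := sub_pos.2 (H.lt y)
    simp only
    set G : ℝ → ℝ := fun s => m y 0 * pd 0 ψ (join y s) + m y 1 * pd 1 ψ (join y s)
      + (m y 2 - (s - h₁ y) * hdiv m y) * pd 2 ψ (join y s)
    have e1 : ∀ s, ∑ i, filmField h₁ h₂ m (join y s) i * pd i ψ (join y s)
        = (Set.Ioo (h₁ y) (h₂ y)).indicator G s := by
      intro s
      by_cases hs : s ∈ Set.Ioo (h₁ y) (h₂ y)
      · have hl : join y s ∈ layer h₁ h₂ := by simpa [layer] using hs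
        rw [Set.indicator_of_mem hs, filmField, Set.indicator_of_mem hl, Fin.sum_univ_three]
        simp [G]
      · have hl : join y s ∉ layer h₁ h₂ := by simpa [layer] using hs
        rw [Set.indicator_of_notMem hs, filmField, Set.indicator_of_notMem hl]
        simp
    simp only [e1]
    rw [integral_indicator measurableSet_Ioo, ← integral_Ioc_eq_integral_Ioo,
      ← intervalIntegral.integral_of_le (H.lt y).le, ← intervalIntegral.integral_of_le zero_le_one]
    have e2 := intervalIntegral.mul_integral_comp_add_mul (a := 0) (b := 1) (f := G) (h y) (h₁ y)
    have e3 : h₁ y + h y * 1 = h₂ y := by simp [hh]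
    rw [mul_zero, add_zero, e3] at e2
    rw [← e2, ← intervalIntegral.integral_const_mul]
    refine intervalIntegral.integral_congr fun t _ => ?_
    simp only [hA, hD, hB, he, hX, G, hdiv, graphCharge, Fin.castSucc_zero]
    rw [show (Fin.castSucc (1 : Fin 2)) = (1 : Fin 3) from rfl]
    ring
  -- At each relative height t the sum A + D is a total horizontal derivative along the intermediate
  -- graph, so it integrates to zero by `integral_slice`.
  have zero : ∀ a i, ∫ y, ∫ t in Set.Ioc (0 : ℝ) 1, (A a i (y, t) + D a i (y, t)) = 0 := by
    intro a i
    rw [integral_integral_swap (f := fun y t => A a i (y, t) + D a i (y, t)) ((iA a i).add (iD a i))]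
    refine integral_eq_zero_of_ae ?_
    filter_upwards [(iA a i).prod_left_ae, (iD a i).prod_left_ae] with t h1 h2
    rw [integral_add h1 h2]
    have := integral_slice H hm hψ t a i
    simp only [hA, hD, hX, hh, this, Pi.zero_apply]
    ring
  -- The remaining part is an exact derivative in t, of the flux (graphCharge h₁ - t e) through the
  -- graph at relative height t, times ψ. At t = 1 this flux is `topCharge`.
  have column : ∀ y, ∫ t in Set.Ioc (0 : ℝ) 1, B (y, t)
      = topCharge h₁ h₂ m y * ψ (join y (h₂ y)) - graphCharge h₁ m y * ψ (join y (h₁ y)) := by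
    intro y
    rw [← intervalIntegral.integral_of_le zero_le_one]
    have hd : ∀ t ∈ Set.uIcc (0 : ℝ) 1,
        HasDerivAt (fun t => (graphCharge h₁ m y - t * e y) * ψ (join y (h₁ y + h y * t)))
          (B (y, t)) t := by
      intro t _
      have d1 := hasDerivAt_comp_join hψ.differentiable y (h₁ y) (h y) t
      have d2 : HasDerivAt (fun t => graphCharge h₁ m y - t * e y) (-e y) t := by
        simpa using ((hasDerivAt_id t).mul_const (e y)).const_sub (graphCharge h₁ m y)
      refine (d2.mul d1).congr_deriv ?_
      simp only [hB, hX]; ring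
    have hcont : Continuous fun t => B (y, t) := by
      have c3 := hψ.continuous
      have c4 := (hψ.pd 2).continuous
      simp only [hB, hX]
      fun_prop
    rw [intervalIntegral.integral_eq_sub_of_hasDerivAt hd (hcont.intervalIntegrable _ _)]
    have e3 : h₁ y + h y * 1 = h₂ y := by simp [hh]
    rw [e3, mul_zero, add_zero]
    simp only [topCharge, graphCharge, he, hh, hdiv]
    ring
  rw [step1]
  have iy : ∀ {g : E2 × ℝ → ℝ}, Integrable g slabMeasure →
      ∫ y, ∫ t in Set.Ioc (0 : ℝ) 1, g (y, t) = ∫ p, g p ∂slabMeasure := fun {g} hg =>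
    (integral_prod g hg).symm
  have i00 := (iA 0 0).add (iD 0 0)
  have i11 := (iA 1 1).add (iD 1 1)
  have z0 := zero 0 0
  have z1 := zero 1 1
  have t1 := iy ((i00.add i11).add iB)
  have t2 := iy i00
  have t3 := iy i11
  have t4 := iy iB
  simp only [Pi.add_apply] at t1 t2 t3
  rw [t1]
  have t5 : ∫ p, (A 0 0 p + D 0 0 p + (A 1 1 p + D 1 1 p) + B p) ∂slabMeasure
      = ∫ p, (A 0 0 p + D 0 0 p) ∂slabMeasure + ∫ p, (A 1 1 p + D 1 1 p) ∂slabMeasure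
        + ∫ p, B p ∂slabMeasure := by
    rw [integral_add (f := fun p => A 0 0 p + D 0 0 p + (A 1 1 p + D 1 1 p)) (i00.add i11) iB,
      integral_add (f := fun p => A 0 0 p + D 0 0 p) (g := fun p => A 1 1 p + D 1 1 p) i00 i11]
  rw [t5, ← t2, ← t3, ← t4, z0, z1, zero_add, zero_add]
  simp only [column]
  -- The slab has unit height, so a planar function is integrable as soon as its extension constant
  -- in t is integrable on the slab.
  have ib : ∀ {f : E2 → ℝ} {g : E2 × ℝ → ℝ}, Integrable g slabMeasure →
      (∀ p, g p = f p.1) → Integrable f := by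
    intro f g hg hfg
    have h1 := hg.integral_prod_left
    simpa [hfg] using h1
  have j1 : Integrable fun y => topCharge h₁ h₂ m y * ψ (join y (h₂ y)) := by
    refine ib (g := fun p => topCharge h₁ h₂ m p.1 * ψ (join p.1 (h₂ p.1))) ?_ fun p => rfl
    have bψ : SlabBounded fun p => ψ (join p.1 (h₂ p.1)) :=
      ⟨Continuous.measurable (hψ.continuous.comp (by fun_prop)),
        hψ.bounded.imp fun C hC p _ => hC.2 _⟩
    have bt : SlabBounded fun p => topCharge h₁ h₂ m p.1 := by
      have := bc.sub be
      convert this using 2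
      simp only [topCharge, graphCharge, he, hh, hdiv]
      ring
    refine (bt.mul bψ).integrable (VanishesFar.mul_right ?_ _)
    obtain ⟨C, R, -, -, -, -, hR, hR2⟩ := hm.exists_bound
    exact ⟨R, fun p hp => by simp [topCharge, graphCharge, hR p.1 hp, hR2 p.1 hp]⟩
  have j2 : Integrable fun y => graphCharge h₁ m y * ψ (join y (h₁ y)) := by
    refine ib (g := fun p => graphCharge h₁ m p.1 * ψ (join p.1 (h₁ p.1))) ?_ fun p => rfl
    have bψ : SlabBounded fun p => ψ (join p.1 (h₁ p.1)) :=
      ⟨Continuous.measurable (hψ.continuous.comp (by fun_prop)),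
        hψ.bounded.imp fun C hC p _ => hC.2 _⟩
    exact (bc.mul bψ).integrable (fc.mul_right _)
  exact integral_sub j1 j2

end

/-! ### The energy of a film in terms of its surface charges -/

/-- Bounded measurable densities in the plane that vanish far away. -/
structure IsCharge (c : E2 → ℝ) : Prop where
  meas : Measurable c
  bdd : ∃ C : ℝ, 0 ≤ C ∧ ∀ y, |c y| ≤ C
  far : ∃ R : ℝ, 0 ≤ R ∧ ∀ y, R < ‖y‖ → c y = 0

theorem IsCharge.integrable {c : E2 → ℝ} (hc : IsCharge c) : Integrable c := by
  obtain ⟨C, -, hC⟩ := hc.bdd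
  obtain ⟨R, -, hR⟩ := hc.far
  have h : Integrable ((Metric.closedBall (0 : E2) R).indicator fun _ => C) := by
    rw [integrable_indicator_iff measurableSet_closedBall]
    exact integrableOn_const (measure_closedBall_lt_top.ne)
  refine h.mono' hc.meas.aestronglyMeasurable (Eventually.of_forall fun x => ?_)
  by_cases hx : x ∈ Metric.closedBall (0 : E2) R
  · rw [Set.indicator_of_mem hx]; exact hC x
  · rw [Set.indicator_of_notMem hx, hR x (by simpa using hx)]; simp

theorem IsCharge.mul_bdd {c g : E2 → ℝ} (hc : IsCharge c) (hg : Measurable g)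
    (hb : ∃ C : ℝ, ∀ y, |g y| ≤ C) : IsCharge fun y => c y * g y := by
  obtain ⟨C, hC0, hC⟩ := hc.bdd
  obtain ⟨D, hD⟩ := hb
  obtain ⟨R, hR0, hR⟩ := hc.far
  have hD0 : 0 ≤ D := (abs_nonneg _).trans (hD 0)
  refine ⟨hc.meas.mul hg, ⟨C * D, by positivity, fun y => ?_⟩,
    ⟨R, hR0, fun y hy => by rw [hR y hy, zero_mul]⟩⟩
  rw [abs_mul]
  exact mul_le_mul (hC y) (hD y) (abs_nonneg _) hC0

theorem IsCharge.sub {c g : E2 → ℝ} (hc : IsCharge c) (hg : IsCharge g) :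
    IsCharge fun y => c y - g y := by
  obtain ⟨C, hC0, hC⟩ := hc.bdd
  obtain ⟨D, hD0, hD⟩ := hg.bdd
  obtain ⟨R, hR0, hR⟩ := hc.far
  obtain ⟨S, hS0, hS⟩ := hg.far
  refine ⟨hc.meas.sub hg.meas, ⟨C + D, by positivity,
    fun y => (abs_sub _ _).trans (add_le_add (hC y) (hD y))⟩,
    ⟨max R S, by positivity, fun y hy => ?_⟩⟩
  rw [hR y ((le_max_left _ _).trans_lt hy), hS y ((le_max_right _ _).trans_lt hy), sub_zero]

theorem isCharge_of_continuous {c : E2 → ℝ} (hc : Continuous c) (hs : HasCompactSupport c) :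
    IsCharge c := by
  obtain ⟨C, hC⟩ := hs.exists_bound_of_continuous hc
  obtain ⟨R, hR⟩ := hs.isCompact.isBounded.subset_closedBall 0
  refine ⟨hc.measurable, ⟨|C|, abs_nonneg _, fun y => (hC y).trans (le_abs_self _)⟩,
    ⟨|R|, abs_nonneg _, fun y hy => image_eq_zero_of_notMem_tsupport fun h => ?_⟩⟩
  have h5 : ‖y‖ ≤ R := by simpa using hR h
  linarith [le_abs_self R]

theorem isCharge_graphCharge {h : E2 → ℝ} (hh : IsProfile h) {m : E2 → E3} (hm : IsTestField m) :
    IsCharge (graphCharge h m) := by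
  have hc : ∀ i, IsCharge fun y => m y i := fun i =>
    isCharge_of_continuous (hm.contDiff_apply i).continuous (hm.hasCompactSupport_apply i)
  exact ((hc 2).sub ((hc 0).mul_bdd (measurable_hpd 0 h) (hh.hpd_bdd 0))).sub
    ((hc 1).mul_bdd (measurable_hpd 1 h) (hh.hpd_bdd 1))

theorem isCharge_hdiv {m : E2 → E3} (hm : IsTestField m) : IsCharge (hdiv m) :=
  isCharge_of_continuous hm.continuous_hdiv hm.hasCompactSupport_hdiv

theorem isCharge_topCharge {h₁ h₂ : E2 → ℝ} (H : IsFilm h₁ h₂) {m : E2 → E3}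
    (hm : IsTestField m) : IsCharge (topCharge h₁ h₂ m) := by
  have h := (isCharge_graphCharge H.top hm).sub ((isCharge_hdiv hm).mul_bdd
    (H.top.sub H.bot).continuous.measurable (H.top.sub H.bot).bdd)
  simp only [mul_comm (hdiv m _)] at h
  exact h

/-- The interaction, through the kernel `K`, of the charge `c` on the graph of `h` with the charge
`c'` on the graph of `h'`. -/
noncomputable def kernelPair (K : E3 → ℝ) (c h c' h' : E2 → ℝ) : ℝ :=
  ∫ x, c x * ∫ y, c' y * K (join x (h x) - join y (h' y))

/-- The Coulomb interaction of the charge `c` on the graph of `h` with the charge `c'` on the graph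
of `h'`, up to the factor `4π`. -/
noncomputable def coulombPair (c h c' h' : E2 → ℝ) : ℝ :=
  ∫ x, ∫ z, c x * c' (z + x) / √(‖z‖ ^ 2 + |h' (z + x) - h x| ^ 2)

theorem integrable_kernelPair {K : E3 → ℝ} (hK : IsTest K) {c h c' h' : E2 → ℝ} (hc : IsCharge c)
    (hc' : IsCharge c') (hh : Measurable h) (hh' : Measurable h') :
    Integrable (fun p : E2 × E2 => c p.1 * (c' p.2 * K (join p.1 (h p.1) - join p.2 (h' p.2))))
      (volume.prod volume) := by
  obtain ⟨C, hC0, hC⟩ := hK.bounded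
  have h1 := hc.integrable.mul_prod hc'.integrable
  have hm := hK.continuous.measurable
  have h2 := h1.mul_bdd (c := C) (g := fun p : E2 × E2 =>
    K (join p.1 (h p.1) - join p.2 (h' p.2)))
    (Measurable.aestronglyMeasurable (by fun_prop)) (Eventually.of_forall fun p => hC _)
  simpa only [mul_assoc] using h2

theorem kernelPair_comm {K : E3 → ℝ} (hK : IsTest K) (he : ∀ x, K (-x) = K x)
    {c h c' h' : E2 → ℝ} (hc : IsCharge c)
    (hc' : IsCharge c') (hh : Measurable h) (hh' : Measurable h') :
    kernelPair K c h c' h' = kernelPair K c' h' c h := by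
  have hi := integrable_kernelPair hK hc hc' hh hh'
  simp only [kernelPair, ← integral_const_mul]
  rw [integral_integral_swap (f := fun x y => c x * (c' y * K (join x (h x) - join y (h' y)))) hi]
  refine integral_congr_ae (Eventually.of_forall fun y => integral_congr_ae
    (Eventually.of_forall fun x => ?_))
  simp only
  rw [← he, neg_sub]
  ring

/-- In polar coordinates of the plane the Jacobian r cancels the singularity 1/r. -/
theorem integrableOn_inv_norm (R : ℝ) :
    IntegrableOn (fun z : E2 => ‖z‖⁻¹) (Metric.closedBall 0 R) := by
  rw [← integrable_indicator_iff measurableSet_closedBall]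
  have e : (Metric.closedBall (0 : E2) R).indicator (fun z : E2 => ‖z‖⁻¹)
      = fun z => (Set.Iic R).indicator (fun r : ℝ => r⁻¹) ‖z‖ := by
    funext z
    simp [Set.indicator]
  rw [e, integrable_fun_norm_addHaar (volume : Measure E2)]
  simp only [finrank_euclideanSpace, Fintype.card_fin]
  have h : IntegrableOn ((Set.Iic R).indicator fun _ : ℝ => (1 : ℝ)) (Set.Ioi 0) := by
    rw [IntegrableOn, integrable_indicator_iff measurableSet_Iic, IntegrableOn,
      Measure.restrict_restrict measurableSet_Iic, Set.Iic_inter_Ioi]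
    exact integrableOn_const (by simp)
  refine h.congr_fun (fun r hr => ?_) measurableSet_Ioi
  have hr0 : r ≠ 0 := (Set.mem_Ioi.1 hr).ne'
  by_cases hrR : r ∈ Set.Iic R
  · simp [Set.indicator_of_mem hrR, hr0]
  · simp [Set.indicator_of_notMem hrR]

theorem norm_join_eq (y : E2) (t : ℝ) : ‖join y t‖ = √(‖y‖ ^ 2 + |t| ^ 2) := by
  rw [sq_abs, ← norm_sq_join, Real.sqrt_sq (norm_nonneg _)]

theorem norm_le_norm_join (y : E2) (t : ℝ) : ‖y‖ ≤ ‖join y t‖ := by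
  rw [norm_join_eq]
  exact Real.le_sqrt_of_sq_le (by have := sq_nonneg |t|; linarith)

theorem join_ne_zero {z : E2} (hz : z ≠ 0) (t : ℝ) : join z t ≠ 0 := by
  have := norm_le_norm_join z t
  have := norm_pos_iff.2 hz
  exact norm_pos_iff.1 (by linarith)

/-- The distance between points on the two graphs is at least the horizontal distance |z|. So all
regularised kernels are dominated by 1/(4π|z|), which is locally integrable in the plane, and the
charges have bounded support. -/
theorem tendsto_kernelPair {c h c' h' : E2 → ℝ} (hc : IsCharge c)
    (hc' : IsCharge c') (hh : Measurable h) (hh' : Measurable h') :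
    Tendsto (fun a => kernelPair (kern a) c h c' h') atTop
      (𝓝 ((4 * Real.pi)⁻¹ * coulombPair c h c' h')) := by
  obtain ⟨C, hC0, hC⟩ := hc.bdd
  obtain ⟨C', hC0', hC'⟩ := hc'.bdd
  obtain ⟨R, hR0, hR⟩ := hc.far
  obtain ⟨R', hR0', hR'⟩ := hc'.far
  have hmc := hc.meas
  have hmc' := hc'.meas
  set B := Metric.closedBall (0 : E2) (R + R')
  set k : E2 → ℝ := B.indicator fun z => C * C' * (4 * Real.pi)⁻¹ * ‖z‖⁻¹ with hk
  have hpi := Real.pi_pos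
  have hki : Integrable k := by
    rw [hk, integrable_indicator_iff measurableSet_closedBall]
    exact (integrableOn_inv_norm _).const_mul _
  have hne : ∀ᵐ z : E2, z ≠ 0 := by
    rw [ae_iff]; simp
  have meas : ∀ a, Measurable (kern a) := fun a => by
    have := contDiff_newton.continuous.measurable
    unfold kern; fun_prop
  set f : ℝ → E2 → E2 → ℝ := fun a x z =>
    c x * (c' (z + x) * kern a (join x (h x) - join (z + x) (h' (z + x)))) with hf
  have bound : ∀ a, 0 < a → ∀ x z, z ≠ 0 → ‖f a x z‖ ≤ (Metric.closedBall (0 : E2) R).indicator 1 x * k z := by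
    intro a ha x z hz
    by_cases hx : x ∈ Metric.closedBall (0 : E2) R
    · rw [Set.indicator_of_mem hx, Pi.one_apply, one_mul]
      by_cases hzB : z ∈ B
      · rw [hk, Set.indicator_of_mem hzB]
        have h1 : |kern a (join x (h x) - join (z + x) (h' (z + x)))| ≤ (4 * Real.pi)⁻¹ * ‖z‖⁻¹ := by
          rw [join_sub]
          have e : x - (z + x) = -z := by abel
          rw [e]
          refine (abs_kern_le ha (join_ne_zero (neg_ne_zero.2 hz) _)).trans ?_
          have h2 := norm_le_norm_join (-z) (h x - h' (z + x))
          rw [norm_neg] at h2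
          have := norm_pos_iff.2 hz
          gcongr
        simp only [hf, norm_mul, Real.norm_eq_abs]
        calc |c x| * (|c' (z + x)| * |kern a (join x (h x) - join (z + x) (h' (z + x)))|)
            ≤ C * (C' * ((4 * Real.pi)⁻¹ * ‖z‖⁻¹)) := by
              gcongr
              · exact hC x
              · exact hC' _
          _ = _ := by ring
      · have : c' (z + x) = 0 := by
          refine hR' _ ?_
          have h1 : R + R' < ‖z‖ := by simpa [B] using hzB
          have h2 : ‖x‖ ≤ R := by simpa using hx
          have := norm_sub_le (z + x) x
          rw [add_sub_cancel_right] at this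
          linarith
        simp [hf, this, hk, Set.indicator_of_notMem hzB]
    · have : c x = 0 := hR _ (by simpa using hx)
      simp [hf, this, Set.indicator_of_notMem hx]
  have lim : ∀ x z, z ≠ 0 → Tendsto (fun a => f a x z) atTop
      (𝓝 ((4 * Real.pi)⁻¹ * (c x * c' (z + x) / √(‖z‖ ^ 2 + |h' (z + x) - h x| ^ 2)))) := by
    intro x z hz
    have e : join x (h x) - join (z + x) (h' (z + x)) = join (-z) (h x - h' (z + x)) := by
      rw [join_sub]; congr 1; abel
    have h1 := tendsto_kern (join_ne_zero (neg_ne_zero.2 hz) (h x - h' (z + x)))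
    rw [norm_join_eq, norm_neg, abs_sub_comm] at h1
    have h2 := (h1.const_mul (c' (z + x))).const_mul (c x)
    simp only [hf, e]
    convert h2 using 2
    rw [div_eq_mul_inv]; ring
  have inner : ∀ x, Tendsto (fun a => ∫ z, f a x z) atTop
      (𝓝 (∫ z, (4 * Real.pi)⁻¹ * (c x * c' (z + x) / √(‖z‖ ^ 2 + |h' (z + x) - h x| ^ 2)))) := by
    intro x
    refine tendsto_integral_filter_of_dominated_convergence
      (fun z => (Metric.closedBall (0 : E2) R).indicator 1 x * k z) ?_ ?_ ?_ ?_
    · refine Eventually.of_forall fun a => Measurable.aestronglyMeasurable ?_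
      have := meas a
      simp only [hf]; fun_prop
    · filter_upwards [eventually_gt_atTop 0] with a ha
      filter_upwards [hne] with z hz using bound a ha x z hz
    · exact hki.const_mul _
    · filter_upwards [hne] with z hz using lim x z hz
  have outer : Tendsto (fun a => ∫ x, ∫ z, f a x z) atTop
      (𝓝 (∫ x, ∫ z, (4 * Real.pi)⁻¹ *
        (c x * c' (z + x) / √(‖z‖ ^ 2 + |h' (z + x) - h x| ^ 2)))) := by
    refine tendsto_integral_filter_of_dominated_convergence
      (fun x => (Metric.closedBall (0 : E2) R).indicator 1 x * ∫ z, k z) ?_ ?_ ?_ ?_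
    · refine Eventually.of_forall fun a => StronglyMeasurable.aestronglyMeasurable ?_
      refine StronglyMeasurable.integral_prod_right (f := f a) (Measurable.stronglyMeasurable ?_)
      have := meas a
      simp only [hf, Function.uncurry_def]; fun_prop
    · filter_upwards [eventually_gt_atTop 0] with a ha
      refine Eventually.of_forall fun x => ?_
      rw [← integral_const_mul]
      refine norm_integral_le_of_norm_le (hki.const_mul _) ?_
      filter_upwards [hne] with z hz using bound a ha x z hz
    · refine Integrable.mul_const ?_ _
      rw [integrable_indicator_iff measurableSet_closedBall]
      exact integrableOn_const (measure_closedBall_lt_top.ne)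
    · exact Eventually.of_forall inner
  simp only [integral_const_mul] at outer
  refine outer.congr fun a => ?_
  simp only [kernelPair, hf, integral_const_mul]
  refine integral_congr_ae (Eventually.of_forall fun x => ?_)
  simp only
  rw [integral_add_right_eq_self (fun y => c' y * kern a (join x (h x) - join y (h' y)))]

theorem kern_neg (a : ℝ) (x : E3) : kern a (-x) = kern a x := by simp [kern, newton]

/-- Fubini's theorem gives symmetry for the regularised kernels, which are even test functions.
Symmetry passes to the limit. -/
theorem coulombPair_comm {c h c' h' : E2 → ℝ} (hc : IsCharge c)
    (hc' : IsCharge c') (hh : Measurable h) (hh' : Measurable h') :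
    coulombPair c h c' h' = coulombPair c' h' c h := by
  have h1 := tendsto_kernelPair hc hc' hh hh'
  have h2 := tendsto_kernelPair hc' hc hh' hh
  have h3 := tendsto_nhds_unique (h1.congr' ?_) h2
  · have := Real.pi_pos
    exact mul_left_cancel₀ (by positivity) h3
  · filter_upwards [eventually_ge_atTop 1] with a ha
    exact kernelPair_comm (isTest_kern ha) (kern_neg a) hc hc' hh hh'

section
variable {h₁ h₂ : E2 → ℝ} (H : IsFilm h₁ h₂) {m : E2 → E3} (hm : IsTestField m)
include H hm

theorem memLp_filmField : MemLp (filmField h₁ h₂ m) 2 volume := by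
  obtain ⟨C, R, hC, h1, h2⟩ := exists_bound_filmField H hm
  have hmeas := measurable_filmField H hm
  refine MemLp.of_eval_piLp fun i => ?_
  have hb : MemLp ((Metric.closedBall (0 : E3) R).indicator fun _ => C) 2 (volume : Measure E3) :=
    memLp_indicator_const 2 measurableSet_closedBall C (Or.inr measure_closedBall_lt_top.ne)
  refine hb.mono (Measurable.aestronglyMeasurable (by fun_prop)) (Eventually.of_forall fun x => ?_)
  by_cases hx : x ∈ Metric.closedBall (0 : E3) R
  · rw [Set.indicator_of_mem hx]; exact (h1 x i).trans (le_abs_self _)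
  · rw [h2 x (by simpa using hx)]; simp

/-- Discontinuities can occur only on the two bounding graphs, which meet each vertical line in one
point and are therefore null. This feeds the approximate identity. -/
theorem ae_continuousAt_filmField : ∀ᵐ x, ContinuousAt (filmField h₁ h₂ m) x := by
  have c1 := H.bot.continuous
  have c2 := H.top.continuous
  have c3 := hm.continuous
  have c4 := hm.continuous_hdiv
  have hae : ∀ᵐ x : E3, x 2 ≠ h₁ (horiz x) ∧ x 2 ≠ h₂ (horiz x) := by
    refine ae_join ?_ fun y => ?_
    · exact MeasurableSet.inter
        (measurableSet_eq_fun (f := fun x : E3 => x 2) (g := fun x => h₁ (horiz x))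
          (by fun_prop) (by fun_prop)).compl
        (measurableSet_eq_fun (f := fun x : E3 => x 2) (g := fun x => h₂ (horiz x))
          (by fun_prop) (by fun_prop)).compl
    · simp only [join_two, horiz_join]
      have : ∀ b : ℝ, ∀ᵐ t : ℝ, t ≠ b := fun b => by rw [ae_iff]; simp
      filter_upwards [this (h₁ y), this (h₂ y)] with t ht1 ht2 using ⟨ht1, ht2⟩
  filter_upwards [hae] with x hx
  by_cases hl : x ∈ layer h₁ h₂
  · have hcont : Continuous fun x : E3 => (!₂[m (horiz x) 0, m (horiz x) 1,
      m (horiz x) 2 - (x 2 - h₁ (horiz x)) * hdiv m (horiz x)] : E3) := by fun_prop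
    refine hcont.continuousAt.congr ?_
    filter_upwards [(isOpen_layer c1 c2).mem_nhds hl] with y hy
    rw [filmField, Set.indicator_of_mem hy]
  · have hz : ∀ᶠ y in 𝓝 x, y ∉ layer h₁ h₂ := by
      by_cases h1 : x 2 < h₁ (horiz x)
      · have : IsOpen {y : E3 | y 2 < h₁ (horiz y)} := isOpen_lt (by fun_prop) (by fun_prop)
        filter_upwards [this.mem_nhds h1] with y hy hy'
        exact lt_asymm hy hy'.1
      · have h2 : h₂ (horiz x) < x 2 := by
          have h3 : h₁ (horiz x) < x 2 := lt_of_le_of_ne (not_lt.1 h1) (Ne.symm hx.1)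
          refine lt_of_le_of_ne ?_ (Ne.symm hx.2)
          by_contra hcon
          exact hl ⟨h3, not_le.1 hcon⟩
        have : IsOpen {y : E3 | h₂ (horiz y) < y 2} := isOpen_lt (by fun_prop) (by fun_prop)
        filter_upwards [this.mem_nhds h2] with y hy hy'
        exact lt_asymm hy hy'.2
    refine (continuousAt_const (y := (0 : E3))).congr ?_
    filter_upwards [hz] with y hy
    rw [filmField, Set.indicator_of_notMem hy]

/-- The divergence theorem with test function y ↦ N(x - y) turns the volume potential into a
difference of single-layer potentials. -/
theorem potential_filmField {N : E3 → ℝ} (hN : IsTest N) (x : E3) :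
    potential (filmField h₁ h₂ m) N x
      = (∫ y, topCharge h₁ h₂ m y * N (x - join y (h₂ y)))
        - ∫ y, graphCharge h₁ m y * N (x - join y (h₁ y)) := by
  have hψ : IsTest fun y => N (x - y) :=
    ⟨hN.1.comp (contDiff_const.sub contDiff_id),
      hN.2.comp_homeomorph (Homeomorph.subLeft x)⟩
  rw [← integral_filmField_gradient H hm hψ]
  have e : ∀ (j : Fin 3) (y : E3), pd j (fun y => N (x - y)) y = -pd j N (x - y) := by
    intro j y
    have h1 : HasFDerivAt (fun y : E3 => x - y) (-ContinuousLinearMap.id ℝ E3) y :=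
      (hasFDerivAt_id y).const_sub x
    have h2 : HasFDerivAt (fun y => N (x - y)) _ y :=
      (hN.differentiable (x - y)).hasFDerivAt.comp y h1
    rw [pd, h2.fderiv]
    simp [pd]
  simp only [inner_gradient, e, mul_neg, Finset.sum_neg_distrib, integral_neg, potential, conv]
  rw [integral_finsetSum]
  intro j _
  exact integrable_filmField_mul H hm ((hN.pd j).integrable.comp_sub_left x) j

/-- The regularised potential is itself a test function, so the divergence theorem applies a second
time and only pairings of surface charges remain. -/
theorem integral_filmField_gradient_potential {N : E3 → ℝ} (hN : IsTest N) :
    ∫ x, inner ℝ (filmField h₁ h₂ m x) (gradient (potential (filmField h₁ h₂ m) N) x)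
      = kernelPair N (topCharge h₁ h₂ m) h₂ (topCharge h₁ h₂ m) h₂
        - kernelPair N (topCharge h₁ h₂ m) h₂ (graphCharge h₁ m) h₁
        - kernelPair N (graphCharge h₁ m) h₁ (topCharge h₁ h₂ m) h₂
        + kernelPair N (graphCharge h₁ m) h₁ (graphCharge h₁ m) h₁ := by
  obtain ⟨C, R, hC, h1, h2⟩ := exists_bound_filmField H hm
  have hmeas := measurable_filmField H hm
  have hF : ∀ j, LocallyIntegrable fun y => filmField h₁ h₂ m y j := fun j =>
    (integrable_of_bounded (f := fun y => filmField h₁ h₂ m y j) (by fun_prop)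
      (fun x => h1 x j) (fun x hx => by rw [h2 x hx]; rfl)).locallyIntegrable
  have hFc : ∀ j, HasCompactSupport fun y => filmField h₁ h₂ m y j := fun j =>
    HasCompactSupport.intro (isCompact_closedBall (0 : E3) R) fun x hx => by
      rw [h2 x (by simpa using hx)]; rfl
  rw [integral_filmField_gradient H hm (IsTest.potential hF hFc hN)]
  simp only [potential_filmField H hm hN, mul_sub]
  have hb := isCharge_graphCharge H.bot hm
  have ht := isCharge_topCharge H hm
  have mb := H.bot.continuous.measurable
  have mt := H.top.continuous.measurable
  have i : ∀ {c h c' h' : E2 → ℝ}, IsCharge c → IsCharge c' → Measurable h → Measurable h' →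
      Integrable fun x => c x * ∫ y, c' y * N (join x (h x) - join y (h' y)) := by
    intro c h c' h' hc hc' hh hh'
    have := (integrable_kernelPair hN hc hc' hh hh').integral_prod_left
    simpa only [integral_const_mul] using this
  rw [integral_sub (i ht ht mt mt) (i ht hb mt mb), integral_sub (i hb ht mb mt) (i hb hb mb mb)]
  simp only [kernelPair]
  ring

/-- The magnetostatic energy of `filmField` is the Coulomb energy of its surface charges. -/
theorem magEnergy_filmField :
    4 * Real.pi * magEnergy (filmField h₁ h₂ m)
      = coulombPair (graphCharge h₁ m) h₁ (graphCharge h₁ m) h₁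
        + coulombPair (topCharge h₁ h₂ m) h₂ (topCharge h₁ h₂ m) h₂
        - 2 * coulombPair (graphCharge h₁ m) h₁ (topCharge h₁ h₂ m) h₂ := by
  obtain ⟨C, R, hC, h1, h2⟩ := exists_bound_filmField H hm
  have hmeas := measurable_filmField H hm
  have hF2 := memLp_filmField H hm
  have hF : ∀ j, LocallyIntegrable fun y => filmField h₁ h₂ m y j := fun j =>
    (integrable_of_bounded (f := fun y => filmField h₁ h₂ m y j) (by fun_prop)
      (fun x => h1 x j) (fun x hx => by rw [h2 x hx]; rfl)).locallyIntegrable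
  have hFc : ∀ j, HasCompactSupport fun y => filmField h₁ h₂ m y j := fun j =>
    HasCompactSupport.intro (isCompact_closedBall (0 : E3) R) fun x hx => by
      rw [h2 x (by simpa using hx)]; rfl
  have hb := isCharge_graphCharge H.bot hm
  have ht := isCharge_topCharge H hm
  have mb := H.bot.continuous.measurable
  have mt := H.top.continuous.measurable
  have hG : ∀ j, MemLp (fun x => strayGradient (filmField h₁ h₂ m) x j) 2 volume := fun j =>
    (Lp.memLp (strayGradient (filmField h₁ h₂ m))).eval_piLp j
  have hFj : ∀ j, MemLp (fun x => filmField h₁ h₂ m x j) 2 volume := fun j => hF2.eval_piLp j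
  -- the regularised energies converge to the energy
  have lim1 : Tendsto (fun a : ℝ => ∑ j, ∫ x, strayGradient (filmField h₁ h₂ m) x j *
      conv (fun y => filmField h₁ h₂ m y j) (negLaplacian (kern a)) x) atTop
      (𝓝 (∑ j, ∫ x, strayGradient (filmField h₁ h₂ m) x j * filmField h₁ h₂ m x j)) := by
    refine tendsto_finsetSum _ fun j _ => ?_
    refine tendsto_integral_mul_conv_negLaplacian (f := fun y => filmField h₁ h₂ m y j)
      (by fun_prop) (fun x => h1 x j) (fun x hx => by rw [h2 x hx]; rfl) (hG j) ?_
    filter_upwards [ae_continuousAt_filmField H hm] with x hx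
    exact (EuclideanSpace.proj j : E3 →L[ℝ] ℝ).continuous.continuousAt.comp hx
  -- Since F - ∇u is orthogonal to ∇u, the pairing of ∇u with F is the integral of |∇u|².
  have e1 : ∑ j, ∫ x, strayGradient (filmField h₁ h₂ m) x j * filmField h₁ h₂ m x j
      = magEnergy (filmField h₁ h₂ m) := by
    have hi : ∀ j, Integrable fun x =>
        strayGradient (filmField h₁ h₂ m) x j * filmField h₁ h₂ m x j :=
      fun j => (hG j).integrable_mul (hFj j)
    rw [← integral_finsetSum _ fun j _ => hi j, magEnergy_eq_norm_sq,
      strayGradient_eq_starProjection hF2]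
    set P := homogeneousH1.starProjection (hF2.toLp (filmField h₁ h₂ m))
    have hsub := homogeneousH1.sub_starProjection_mem_orthogonal (hF2.toLp (filmField h₁ h₂ m))
    have hP : inner ℝ P (hF2.toLp (filmField h₁ h₂ m) - P) = 0 :=
      Submodule.inner_right_of_mem_orthogonal (Submodule.starProjection_apply_mem _ _) hsub
    rw [inner_sub_right, sub_eq_zero, real_inner_self_eq_norm_sq] at hP
    rw [← hP, L2.inner_def]
    refine integral_congr_ae ?_
    filter_upwards [hF2.coeFn_toLp] with x hx
    rw [hx, PiLp.inner_apply]
    refine Finset.sum_congr rfl fun j _ => ?_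
    simp [mul_comm]
  have e2 : ∀ a : ℝ, 1 ≤ a → ∑ j, ∫ x, strayGradient (filmField h₁ h₂ m) x j *
      conv (fun y => filmField h₁ h₂ m y j) (negLaplacian (kern a)) x
      = kernelPair (kern a) (topCharge h₁ h₂ m) h₂ (topCharge h₁ h₂ m) h₂
        - kernelPair (kern a) (topCharge h₁ h₂ m) h₂ (graphCharge h₁ m) h₁
        - kernelPair (kern a) (graphCharge h₁ m) h₁ (topCharge h₁ h₂ m) h₂
        + kernelPair (kern a) (graphCharge h₁ m) h₁ (graphCharge h₁ m) h₁ := by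
    intro a ha
    have hN := isTest_kern ha
    rw [← integral_filmField_gradient_potential H hm hN, integral_inner_potential hF hFc hN hF2,
      ← integral_finsetSum]
    · refine integral_congr_ae (Eventually.of_forall fun x => ?_)
      simp only [PiLp.inner_apply, vconv_apply]
      refine Finset.sum_congr rfl fun j _ => ?_
      simp [mul_comm]
    · intro j _
      exact (hG j).integrable_mul ((IsTest.conv (hF j) (hFc j) hN.negLaplacian).memLp 2)
  have lim2 := (((tendsto_kernelPair ht ht mt mt).sub (tendsto_kernelPair ht hb mt mb)).sub
    (tendsto_kernelPair hb ht mb mt)).add (tendsto_kernelPair hb hb mb mb)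
  have key := tendsto_nhds_unique (lim1.congr' (by
    filter_upwards [eventually_ge_atTop 1] with a ha using e2 a ha)) lim2
  rw [e1, coulombPair_comm ht hb mt mb] at key
  have := Real.pi_pos
  rw [key]
  field_simp
  ring

end

/-! ### Periodic functions and averaging -/

theorem IsQPeriodic.vadd {p : E2 → ℝ} (hp : IsQPeriodic p) {v : E2}
    (hv : v ∈ Submodule.span ℤ (Set.range (EuclideanSpace.basisFun (Fin 2) ℝ).toBasis)) (x : E2) :
    p (v + x) = p x := by
  induction hv using Submodule.span_induction generalizing x with
  | mem v hv =>
    obtain ⟨k, rfl⟩ := hv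
    have := hp x k
    simpa [add_comm] using this
  | zero => simp
  | add v w _ _ h1 h2 => rw [add_assoc, h1, h2]
  | smul n v _ h =>
    induction n using Int.induction_on generalizing x with
    | zero => simp
    | succ n ih => rw [add_smul, one_smul, add_assoc, ih, h]
    | pred n ih =>
      rw [sub_smul, one_smul, sub_add_eq_add_sub, add_sub_assoc, ih]
      have := h (x - v)
      rw [← this]; simp

theorem cellQ_ae_eq : cellQ =ᵐ[volume]
    ZSpan.fundamentalDomain (EuclideanSpace.basisFun (Fin 2) ℝ).toBasis := by
  have h1 : (Set.univ.pi fun _ : Fin 2 => Set.Ioo (0 : ℝ) 1)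
      =ᵐ[volume] (Set.univ.pi fun _ : Fin 2 => Set.Ico (0 : ℝ) 1) :=
    Measure.univ_pi_Ioo_ae_eq_Icc.trans Measure.univ_pi_Ico_ae_eq_Icc.symm
  have h2 := (PiLp.volume_preserving_ofLp (Fin 2)).quasiMeasurePreserving.preimage_ae_eq h1
  have e1 : cellQ = (WithLp.ofLp : E2 → Fin 2 → ℝ) ⁻¹'
      (Set.univ.pi fun _ : Fin 2 => Set.Ioo (0 : ℝ) 1) := by
    ext x; simp [cellQ, Set.mem_ofPred_eq]
  have e2 : ZSpan.fundamentalDomain (EuclideanSpace.basisFun (Fin 2) ℝ).toBasis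
      = (WithLp.ofLp : E2 → Fin 2 → ℝ) ⁻¹' (Set.univ.pi fun _ : Fin 2 => Set.Ico (0 : ℝ) 1) := by
    ext x; simp [ZSpan.mem_fundamentalDomain]
  rw [e1, e2]
  exact h2

theorem measurableSet_cellQ : MeasurableSet cellQ := by
  have : cellQ = (WithLp.ofLp : E2 → Fin 2 → ℝ) ⁻¹' (Set.univ.pi fun _ : Fin 2 => Set.Ioo (0 : ℝ) 1) := by
    ext x; simp [cellQ, Set.mem_ofPred_eq]
  rw [this]
  exact (PiLp.volume_preserving_ofLp (Fin 2)).measurable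
    (MeasurableSet.univ_pi fun _ => measurableSet_Ioo)

theorem volume_cellQ : volume cellQ = 1 := by
  have : cellQ = (WithLp.ofLp : E2 → Fin 2 → ℝ) ⁻¹' (Set.univ.pi fun _ : Fin 2 => Set.Ioo (0 : ℝ) 1) := by
    ext x; simp [cellQ, Set.mem_ofPred_eq]
  rw [this, (PiLp.volume_preserving_ofLp (Fin 2)).measure_preimage
    (MeasurableSet.univ_pi fun _ => measurableSet_Ioo).nullMeasurableSet, Real.volume_pi_Ioo]
  simp

theorem norm_le_two_of_mem_cellQ {y : E2} (hy : y ∈ cellQ) : ‖y‖ ≤ 2 := by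
  have h : ‖y‖ ^ 2 ≤ 2 ^ 2 := by
    rw [EuclideanSpace.norm_sq_eq, Fin.sum_univ_two]
    have h0 := hy 0
    have h1 := hy 1
    simp only [Real.norm_eq_abs, sq_abs]
    nlinarith
  exact le_of_sq_le_sq h (by norm_num)

/-- Up to a null set the cell is a fundamental domain of the lattice ℤ², and so are its translates;
an invariant function has the same integral over all of them. -/
theorem IsQPeriodic.setIntegral_cellQ_add {p : E2 → ℝ} (hp : IsQPeriodic p) (y : E2) :
    ∫ τ in cellQ, p (y + τ) = ∫ τ in cellQ, p τ := by
  set b := (EuclideanSpace.basisFun (Fin 2) ℝ).toBasis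
  have hF := ZSpan.isAddFundamentalDomain b (volume : Measure E2)
  have : VAddInvariantMeasure (Submodule.span ℤ (Set.range b)) E2 (volume : Measure E2) :=
    ⟨fun g s _ => measure_preimage_add volume (g : E2) s⟩
  have hF' := hF.vadd_of_comm y
  rw [setIntegral_congr_set cellQ_ae_eq, setIntegral_congr_set cellQ_ae_eq]
  have e := hF'.setIntegral_eq (f := p) hF fun g x => hp.vadd g.2 x
  rw [← e]
  exact ((measurePreserving_add_left volume y).setIntegral_image_emb
    (measurableEmbedding_addLeft y) p _).symm

/-- Weak convergence of rapidly oscillating periodic functions to their mean. -/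
theorem tendsto_integral_periodic {φ p : E2 → ℝ} (hφ : Continuous φ) (hφc : HasCompactSupport φ)
    (hp : Measurable p) (hpp : IsQPeriodic p) {C : ℝ} (hC : ∀ y, |p y| ≤ C) :
    Tendsto (fun ε : ℝ => ∫ x, φ x * p (ε⁻¹ • x)) (𝓝[>] 0)
      (𝓝 ((∫ x, φ x) * ∫ y in cellQ, p y)) := by
  obtain ⟨Cφ, hCφ0, hCφ⟩ := (isCharge_of_continuous hφ hφc).bdd
  obtain ⟨R, hR0, hR⟩ := (isCharge_of_continuous hφ hφc).far
  have hC0 : 0 ≤ C := (abs_nonneg _).trans (hC 0)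
  have hφi : Integrable φ := hφ.integrable_of_hasCompactSupport hφc
  have mφ := hφ.measurable
  have : IsProbabilityMeasure (volume.restrict cellQ) :=
    ⟨by rw [Measure.restrict_apply_univ, volume_cellQ]⟩
  -- The integral of φ(x) p(x/ε) is unchanged by the substitution x ↦ x + ετ, so it may be averaged
  -- over τ in the unit cell. Replacing φ(x + ετ) by φ(x) then produces the mean of p exactly, and
  -- the replacement error vanishes by continuity of φ.
  set μ := (volume.restrict cellQ).prod (volume : Measure E2)
  have memQ : ∀ᵐ q ∂μ, q.1 ∈ cellQ := by
    have : MeasurableSet {q : E2 × E2 | q.1 ∈ cellQ} := measurable_fst measurableSet_cellQ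
    refine (Measure.ae_prod_iff_ae_ae this).2 ?_
    filter_upwards [ae_restrict_mem measurableSet_cellQ] with τ hτ
    exact Eventually.of_forall fun _ => hτ
  -- For ε ≤ 1 the shift ετ has length at most 2, so both values of φ vanish beyond radius R + 2.
  set bd : E2 × E2 → ℝ := fun q => 1 * (Metric.closedBall (0 : E2) (R + 2)).indicator
    (fun _ => 2 * Cφ * C) q.2
  have hbd : Integrable bd μ := by
    refine Integrable.mul_prod (f := fun _ => (1 : ℝ)) (integrable_const 1) ?_
    rw [integrable_indicator_iff measurableSet_closedBall]
    exact integrableOn_const measure_closedBall_lt_top.ne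
  have hb : ∀ ε : ℝ, 0 < ε → ε ≤ 1 → ∀ q : E2 × E2, q.1 ∈ cellQ →
      ‖(φ (q.2 + ε • q.1) - φ q.2) * p (ε⁻¹ • q.2 + q.1)‖ ≤ bd q := by
    intro ε h0 h1 q hq
    have hn : ‖ε • q.1‖ ≤ 2 := by
      rw [norm_smul, Real.norm_of_nonneg h0.le]
      have := norm_le_two_of_mem_cellQ hq
      have := norm_nonneg q.1
      nlinarith
    by_cases hx : q.2 ∈ Metric.closedBall (0 : E2) (R + 2)
    · simp only [bd, Set.indicator_of_mem hx, one_mul, norm_mul, Real.norm_eq_abs]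
      refine mul_le_mul ?_ (hC _) (abs_nonneg _) (by positivity)
      refine (abs_sub _ _).trans ?_
      have := hCφ (q.2 + ε • q.1); have := hCφ q.2
      linarith
    · have hx' : R + 2 < ‖q.2‖ := by simpa using hx
      have e1 : φ q.2 = 0 := hR _ (by linarith)
      have e2 : φ (q.2 + ε • q.1) = 0 := by
        refine hR _ ?_
        have := norm_sub_norm_le q.2 (-(ε • q.1))
        rw [norm_neg, sub_neg_eq_add] at this
        linarith
      simp [bd, e1, e2, Set.indicator_of_notMem hx]
  have meas : ∀ ε : ℝ, Measurable fun q : E2 × E2 =>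
      (φ (q.2 + ε • q.1) - φ q.2) * p (ε⁻¹ • q.2 + q.1) := by
    intro ε; fun_prop
  have lim : Tendsto (fun ε : ℝ => ∫ q, (φ (q.2 + ε • q.1) - φ q.2) * p (ε⁻¹ • q.2 + q.1) ∂μ)
      (𝓝[>] 0) (𝓝 (∫ _, (0 : ℝ) ∂μ)) := by
    refine tendsto_integral_filter_of_dominated_convergence bd ?_ ?_ hbd ?_
    · exact Eventually.of_forall fun ε => (meas ε).aestronglyMeasurable
    · filter_upwards [Ioc_mem_nhdsGT (zero_lt_one' ℝ)] with ε hε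
      filter_upwards [memQ] with q hq using hb ε hε.1 hε.2 q hq
    · refine Eventually.of_forall fun q => ?_
      have h1 : Tendsto (fun ε : ℝ => φ (q.2 + ε • q.1) - φ q.2) (𝓝[>] 0) (𝓝 0) := by
        have : Continuous fun ε : ℝ => φ (q.2 + ε • q.1) - φ q.2 := by fun_prop
        have h2 := this.tendsto 0
        simp only [zero_smul, add_zero, sub_self] at h2
        exact h2.mono_left nhdsWithin_le_nhds
      exact h1.zero_mul_isBoundedUnder_le
        (isBoundedUnder_of ⟨C, fun ε => hC _⟩)
  rw [integral_zero] at lim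
  have key : ∀ ε : ℝ, 0 < ε → ε ≤ 1 → ∫ x, φ x * p (ε⁻¹ • x)
      = (∫ q, (φ (q.2 + ε • q.1) - φ q.2) * p (ε⁻¹ • q.2 + q.1) ∂μ)
        + (∫ x, φ x) * ∫ y in cellQ, p y := by
    intro ε h0 h1
    have i1 : Integrable (fun q : E2 × E2 =>
        (φ (q.2 + ε • q.1) - φ q.2) * p (ε⁻¹ • q.2 + q.1)) μ := by
      refine hbd.mono' (meas ε).aestronglyMeasurable ?_
      filter_upwards [memQ] with q hq using hb ε h0 h1 q hq
    have i2 : Integrable (fun q : E2 × E2 => φ q.2 * p (ε⁻¹ • q.2 + q.1)) μ := by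
      have := Integrable.mul_prod (μ := volume.restrict cellQ) (f := fun _ => (1 : ℝ))
        (integrable_const 1) hφi
      simp only [one_mul] at this
      exact this.mul_bdd (c := C) (Measurable.aestronglyMeasurable (by fun_prop))
        (Eventually.of_forall fun q => hC _)
    have e2 : ∫ q, φ q.2 * p (ε⁻¹ • q.2 + q.1) ∂μ = (∫ x, φ x) * ∫ y in cellQ, p y := by
      rw [integral_prod_symm _ i2, ← integral_mul_const]
      refine integral_congr_ae (Eventually.of_forall fun x => ?_)
      simp only
      rw [integral_const_mul, hpp.setIntegral_cellQ_add]
    have e1 : ∫ x, φ x * p (ε⁻¹ • x)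
        = ∫ q, φ (q.2 + ε • q.1) * p (ε⁻¹ • q.2 + q.1) ∂μ := by
      have i3 : Integrable (fun q : E2 × E2 => φ (q.2 + ε • q.1) * p (ε⁻¹ • q.2 + q.1)) μ := by
        refine (i1.add i2).congr (Eventually.of_forall fun q => ?_)
        simp only [Pi.add_apply]; ring
      rw [integral_prod _ i3]
      have : ∀ τ : E2, ∫ x, φ (x + ε • τ) * p (ε⁻¹ • x + τ) = ∫ x, φ x * p (ε⁻¹ • x) := by
        intro τ
        rw [← integral_add_right_eq_self (fun x => φ x * p (ε⁻¹ • x)) (ε • τ)]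
        simp only [smul_add, smul_smul, inv_mul_cancel₀ h0.ne', one_smul]
      simp only [this]
      simp
    rw [e1, ← e2, ← integral_add i1 i2]
    refine integral_congr_ae (Eventually.of_forall fun q => ?_)
    simp only; ring
  have := lim.add_const ((∫ x, φ x) * ∫ y in cellQ, p y)
  rw [zero_add] at this
  refine this.congr' ?_
  filter_upwards [Ioc_mem_nhdsGT (zero_lt_one' ℝ)] with ε hε
  rw [key ε hε.1 hε.2]

/-- An interaction kernel that is periodic in the first variable and uniformly integrable in the
second one. -/
structure IsPeriodicKernel (P : E2 → E2 → ℝ) : Prop where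
  meas : Measurable (Function.uncurry P)
  periodic : ∀ z, IsQPeriodic fun y => P y z
  bound : ∃ k : E2 → ℝ, Integrable k ∧ ∀ y z, z ≠ 0 → |P y z| ≤ k z

theorem ae_ne_zero_plane : ∀ᵐ z : E2, z ≠ 0 := by
  rw [ae_iff]; simp

/-- The two-scale interaction of two continuous densities converges to its average. -/
theorem tendsto_integral_periodicKernel {μ ν : E2 → ℝ} (hμ : Continuous μ)
    (hμc : HasCompactSupport μ) (hν : Continuous ν) (hνc : HasCompactSupport ν)
    {P : E2 → E2 → ℝ} (hP : IsPeriodicKernel P) :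
    Tendsto (fun ε : ℝ => ∫ x, ∫ z, μ x * ν (ε • z + x) * P (ε⁻¹ • x) z) (𝓝[>] 0)
      (𝓝 ((∫ x, μ x * ν x) * ∫ y in cellQ, ∫ z, P y z)) := by
  obtain ⟨k, hk, hb⟩ := hP.bound
  obtain ⟨Cν, hCν0, hCν⟩ := (isCharge_of_continuous hν hνc).bdd
  have hPm := hP.meas
  have mμ := hμ.measurable
  have mν := hν.measurable
  have hμi : Integrable μ := hμ.integrable_of_hasCompactSupport hμc
  have bdi : Integrable (fun q : E2 × E2 => 2 * Cν * (|μ q.1| * k q.2)) (volume.prod volume) :=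
    (hμi.abs.mul_prod hk).const_mul _
  have hne : ∀ᵐ q : E2 × E2 ∂(volume.prod volume), q.2 ≠ 0 := by
    have : MeasurableSet {q : E2 × E2 | q.2 ≠ 0} :=
      (measurableSet_eq_fun measurable_snd measurable_const).compl
    exact (Measure.ae_prod_iff_ae_ae this).2 (Eventually.of_forall fun _ => ae_ne_zero_plane)
  have hPc : ∀ ε : ℝ, Measurable fun q : E2 × E2 => P (ε⁻¹ • q.1) q.2 := fun ε =>
    hPm.comp (g := Function.uncurry P) (f := fun q : E2 × E2 => (ε⁻¹ • q.1, q.2)) (by fun_prop)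
  have meas1 : ∀ ε : ℝ, Measurable fun q : E2 × E2 =>
      μ q.1 * ν (ε • q.2 + q.1) * P (ε⁻¹ • q.1) q.2 := fun ε =>
    Measurable.mul (by fun_prop) (hPc ε)
  have meas2 : ∀ ε : ℝ, Measurable fun q : E2 × E2 =>
      μ q.1 * ν q.1 * P (ε⁻¹ • q.1) q.2 := fun ε =>
    Measurable.mul (by fun_prop) (hPc ε)
  have b1 : ∀ (ε : ℝ) (q : E2 × E2), q.2 ≠ 0 →
      ‖μ q.1 * ν (ε • q.2 + q.1) * P (ε⁻¹ • q.1) q.2‖ ≤ 2 * Cν * (|μ q.1| * k q.2) := by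
    intro ε q hq
    have h1 := hb (ε⁻¹ • q.1) q.2 hq
    have h2 := hCν (ε • q.2 + q.1)
    have h3 := abs_nonneg (μ q.1)
    have h4 : 0 ≤ k q.2 := (abs_nonneg _).trans h1
    rw [norm_mul, norm_mul, Real.norm_eq_abs, Real.norm_eq_abs, Real.norm_eq_abs]
    calc |μ q.1| * |ν (ε • q.2 + q.1)| * |P (ε⁻¹ • q.1) q.2| ≤ |μ q.1| * Cν * k q.2 := by gcongr
      _ ≤ 2 * Cν * (|μ q.1| * k q.2) := by
        have : 0 ≤ Cν * (|μ q.1| * k q.2) := by positivity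
        linarith
  have b2 : ∀ (ε : ℝ) (q : E2 × E2), q.2 ≠ 0 →
      ‖μ q.1 * ν q.1 * P (ε⁻¹ • q.1) q.2‖ ≤ 2 * Cν * (|μ q.1| * k q.2) := by
    intro ε q hq
    have h1 := hb (ε⁻¹ • q.1) q.2 hq
    have h2 := hCν q.1
    have h3 := abs_nonneg (μ q.1)
    have h4 : 0 ≤ k q.2 := (abs_nonneg _).trans h1
    rw [norm_mul, norm_mul, Real.norm_eq_abs, Real.norm_eq_abs, Real.norm_eq_abs]
    calc |μ q.1| * |ν q.1| * |P (ε⁻¹ • q.1) q.2| ≤ |μ q.1| * Cν * k q.2 := by gcongr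
      _ ≤ 2 * Cν * (|μ q.1| * k q.2) := by
        have : 0 ≤ Cν * (|μ q.1| * k q.2) := by positivity
        linarith
  have i1 : ∀ ε : ℝ, Integrable (fun q : E2 × E2 =>
      μ q.1 * ν (ε • q.2 + q.1) * P (ε⁻¹ • q.1) q.2) (volume.prod volume) := fun ε =>
    bdi.mono' (meas1 ε).aestronglyMeasurable (hne.mono fun q hq => b1 ε q hq)
  have i2 : ∀ ε : ℝ, Integrable (fun q : E2 × E2 =>
      μ q.1 * ν q.1 * P (ε⁻¹ • q.1) q.2) (volume.prod volume) := fun ε =>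
    bdi.mono' (meas2 ε).aestronglyMeasurable (hne.mono fun q hq => b2 ε q hq)
  -- The slow variable of ν is frozen first, with the integrable majorant of the kernel as
  -- domination. What remains oscillates only through the periodic function y ↦ ∫ P(y, z) dz.
  have lim : Tendsto (fun ε : ℝ => ∫ q : E2 × E2, (μ q.1 * ν (ε • q.2 + q.1) * P (ε⁻¹ • q.1) q.2
      - μ q.1 * ν q.1 * P (ε⁻¹ • q.1) q.2) ∂(volume.prod volume)) (𝓝[>] 0)
      (𝓝 (∫ _ : E2 × E2, (0 : ℝ) ∂(volume.prod volume))) := by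
    refine tendsto_integral_filter_of_dominated_convergence
      (fun q => 2 * Cν * (|μ q.1| * k q.2) + 2 * Cν * (|μ q.1| * k q.2)) ?_ ?_ (bdi.add bdi) ?_
    · exact Eventually.of_forall fun ε => ((meas1 ε).sub (meas2 ε)).aestronglyMeasurable
    · refine Eventually.of_forall fun ε => hne.mono fun q hq => ?_
      exact (norm_sub_le _ _).trans (add_le_add (b1 ε q hq) (b2 ε q hq))
    · refine hne.mono fun q hq => ?_
      have h1 : Tendsto (fun ε : ℝ => μ q.1 * (ν (ε • q.2 + q.1) - ν q.1)) (𝓝[>] 0) (𝓝 0) := by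
        have : Continuous fun ε : ℝ => μ q.1 * (ν (ε • q.2 + q.1) - ν q.1) := by fun_prop
        have h2 := this.tendsto 0
        simp only [zero_smul, zero_add, sub_self, mul_zero] at h2
        exact h2.mono_left nhdsWithin_le_nhds
      have h2 : Tendsto (fun ε : ℝ => μ q.1 * (ν (ε • q.2 + q.1) - ν q.1) * P (ε⁻¹ • q.1) q.2)
          (𝓝[>] 0) (𝓝 0) :=
        h1.zero_mul_isBoundedUnder_le (isBoundedUnder_of ⟨k q.2, fun ε => hb _ _ hq⟩)
      refine h2.congr fun ε => ?_
      ring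
  rw [integral_zero] at lim
  have hp : Measurable fun y => ∫ z, P y z :=
    (StronglyMeasurable.integral_prod_right hPm.stronglyMeasurable).measurable
  have hpp : IsQPeriodic fun y => ∫ z, P y z := by
    intro y j
    have := fun z => hP.periodic z y j
    simp only at this
    simp only [this]
  have hpC : ∀ y, |∫ z, P y z| ≤ ∫ z, k z := fun y => by
    rw [← Real.norm_eq_abs]
    exact norm_integral_le_of_norm_le hk (ae_ne_zero_plane.mono fun z hz => hb y z hz)
  have lim2 := tendsto_integral_periodic (hμ.mul hν) hμc.mul_right hp hpp hpC
  have := lim.add lim2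
  rw [zero_add] at this
  refine this.congr fun ε => ?_
  rw [integral_sub (i1 ε) (i2 ε), integral_prod _ (i1 ε), integral_prod _ (i2 ε)]
  simp only [integral_const_mul, Pi.mul_apply]
  ring

/-! ### Oscillating profiles -/

/-- Subtracting the lattice part brings every point into one bounded cell. Uniform bounds for
continuous periodic functions then follow by compactness. -/
theorem IsQPeriodic.exists_norm_le {p : E2 → ℝ} (hp : IsQPeriodic p) :
    ∃ R : ℝ, ∀ x, ∃ y : E2, ‖y‖ ≤ R ∧ p x = p y := by
  set b := (EuclideanSpace.basisFun (Fin 2) ℝ).toBasis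
  refine ⟨∑ i, ‖b i‖, fun x => ⟨ZSpan.fract b x, ZSpan.norm_fract_le b x, ?_⟩⟩
  have := hp.vadd (ZSpan.floor b x).2 (ZSpan.fract b x)
  rw [← this, ZSpan.fract_apply]
  simp

theorem IsQPeriodic.isProfile {f : E2 → ℝ} (hf : ∃ K : NNReal, LipschitzWith K f)
    (hp : IsQPeriodic f) : IsProfile f := by
  refine ⟨hf, ?_⟩
  obtain ⟨K, hK⟩ := hf
  obtain ⟨R, hR⟩ := hp.exists_norm_le
  obtain ⟨B, hB⟩ := (isCompact_closedBall (0 : E2) R).exists_bound_of_continuousOn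
    hK.continuous.continuousOn
  refine ⟨B, fun x => ?_⟩
  obtain ⟨y, hy, e⟩ := hR x
  rw [e]
  exact hB y (by simpa using hy)

/-- Compactness of a period cell. Applied to f₂ - f₁ it gives a uniform lower bound for the
thickness. -/
theorem IsQPeriodic.exists_pos_le {f : E2 → ℝ} (hf : Continuous f) (hp : IsQPeriodic f)
    (h0 : ∀ x, 0 < f x) : ∃ c : ℝ, 0 < c ∧ ∀ x, c ≤ f x := by
  obtain ⟨R, hR⟩ := hp.exists_norm_le
  have hR0 : 0 ≤ R := by
    obtain ⟨y, hy, -⟩ := hR 0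
    exact (norm_nonneg y).trans hy
  obtain ⟨z, -, hz⟩ := (isCompact_closedBall (0 : E2) R).exists_isMinOn
    ⟨0, by simpa using hR0⟩ hf.continuousOn
  refine ⟨f z, h0 z, fun x => ?_⟩
  obtain ⟨y, hy, e⟩ := hR x
  rw [e]
  exact hz (by simpa using hy)

theorem IsQPeriodic.hpd {f : E2 → ℝ} (hp : IsQPeriodic f) (a : Fin 2) :
    IsQPeriodic (hpd a f) := by
  intro x k
  have : (fun x => f (x + EuclideanSpace.single k 1)) = f := funext fun x => hp x k
  rw [ThinFilm.hpd, ← fderiv_comp_add_right, this]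
  rfl

theorem IsQPeriodic.shift {f : E2 → ℝ} (hp : IsQPeriodic f) (z : E2) :
    IsQPeriodic fun y => f (z + y) := by
  intro x k
  simp only [← add_assoc]
  exact hp _ k

/-- The profile `ε f(x'/ε)`. -/
noncomputable def scaleProfile (ε : ℝ) (f : E2 → ℝ) (y : E2) : ℝ := ε * f (ε⁻¹ • y)

/-- Slopes are invariant under the scaling εf(·/ε). Hence the surface charges stay of order one
although the film becomes thin. -/
theorem hpd_scaleProfile {ε : ℝ} (hε : 0 < ε) (f : E2 → ℝ) (a : Fin 2) (y : E2) :
    hpd a (scaleProfile ε f) y = hpd a f (ε⁻¹ • y) := by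
  have : scaleProfile ε f = ε • fun y => f (ε⁻¹ • y) := rfl
  rw [hpd, this, fderiv_const_smul_field, Pi.smul_apply, fderiv_comp_smul]
  simp [smul_smul, mul_inv_cancel₀ hε.ne', hpd]

theorem IsProfile.scale {f : E2 → ℝ} (hf : IsProfile f) (ε : ℝ) :
    IsProfile (scaleProfile ε f) := by
  obtain ⟨K, hK⟩ := hf.lip
  obtain ⟨B, hB⟩ := hf.bdd
  refine ⟨⟨_, (lipschitzWith_smul ε).comp (hK.comp (lipschitzWith_smul ε⁻¹))⟩,
    ⟨|ε| * B, fun y => ?_⟩⟩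
  rw [scaleProfile, abs_mul]
  exact mul_le_mul_of_nonneg_left (hB _) (abs_nonneg _)

theorem IsFilm.scale {f₁ f₂ : E2 → ℝ} (H : IsFilm f₁ f₂) {ε : ℝ} (hε : 0 < ε) :
    IsFilm (scaleProfile ε f₁) (scaleProfile ε f₂) :=
  ⟨H.bot.scale ε, H.top.scale ε, fun _ => mul_lt_mul_of_pos_left (H.lt _) hε⟩

/-! ### The interaction at scale `ε` -/

/-- The Coulomb interaction in rescaled variables. -/
noncomputable def scaledPair (ε : ℝ) (c f c' f' : E2 → ℝ) : ℝ :=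
  ∫ x, ∫ z, c x * c' (ε • z + x) * (√(‖z‖ ^ 2 + |f' (z + ε⁻¹ • x) - f (ε⁻¹ • x)| ^ 2))⁻¹

theorem integral_scale {ε : ℝ} (hε : 0 < ε) (F : E2 → ℝ) :
    ∫ z, F z = ε ^ 2 * ∫ z, F (ε • z) := by
  rw [Measure.integral_comp_smul]
  simp only [finrank_euclideanSpace, Fintype.card_fin, smul_eq_mul]
  rw [abs_of_pos (by positivity)]
  field_simp

/-- In z = (y - x)/ε the planar Jacobian gives ε² and the kernel gives ε⁻¹, which cancel the
prefactor 1/ε. -/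
theorem coulombPair_scaleProfile {ε : ℝ} (hε : 0 < ε) (c f c' f' : E2 → ℝ) :
    1 / ε * coulombPair c (scaleProfile ε f) c' (scaleProfile ε f') = scaledPair ε c f c' f' := by
  rw [coulombPair, scaledPair, ← integral_const_mul]
  refine integral_congr_ae (Eventually.of_forall fun x => ?_)
  simp only
  rw [integral_scale hε, ← integral_const_mul, ← integral_const_mul]
  refine integral_congr_ae (Eventually.of_forall fun z => ?_)
  simp only [scaleProfile, smul_add, smul_smul, inv_mul_cancel₀ hε.ne', one_smul, norm_smul,
    Real.norm_of_nonneg hε.le, ← mul_sub, abs_mul, abs_of_pos hε, mul_pow, ← mul_add]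
  rw [Real.sqrt_mul (by positivity), Real.sqrt_sq hε.le]
  field_simp

/-- Both charges have bounded support, so only |z| ≤ (R + S)/ε matters. This gives integrability at
each fixed ε, with no uniformity as ε → 0. -/
theorem integrable_pair {c c' : E2 → ℝ} (hc : IsCharge c) (hc' : IsCharge c') {ε : ℝ} (hε : 0 < ε)
    {s : E2 × E2 → ℝ} (hs : Measurable s) (hb : ∀ p : E2 × E2, p.2 ≠ 0 → |s p| ≤ ‖p.2‖⁻¹) :
    Integrable (fun p : E2 × E2 => c p.1 * c' (ε • p.2 + p.1) * s p) (volume.prod volume) := by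
  obtain ⟨C, hC0, hC⟩ := hc'.bdd
  obtain ⟨R, hR0, hR⟩ := hc.far
  obtain ⟨S, hS0, hS⟩ := hc'.far
  have m1 := hc.meas
  have m2 := hc'.meas
  have hk : Integrable (fun z : E2 => (Metric.closedBall (0 : E2) (ε⁻¹ * (R + S))).indicator
      (fun z => C * ‖z‖⁻¹) z) := by
    rw [integrable_indicator_iff measurableSet_closedBall]
    exact (integrableOn_inv_norm _).const_mul C
  refine (hc.integrable.abs.mul_prod hk).mono' (Measurable.aestronglyMeasurable (by fun_prop)) ?_
  have hne : ∀ᵐ q : E2 × E2 ∂(volume.prod volume), q.2 ≠ 0 := by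
    have : MeasurableSet {q : E2 × E2 | q.2 ≠ 0} :=
      (measurableSet_eq_fun measurable_snd measurable_const).compl
    exact (Measure.ae_prod_iff_ae_ae this).2 (Eventually.of_forall fun _ => ae_ne_zero_plane)
  filter_upwards [hne] with q hq
  by_cases hx : R < ‖q.1‖
  · simp [hR _ hx]
  by_cases hz : q.2 ∈ Metric.closedBall (0 : E2) (ε⁻¹ * (R + S))
  · rw [Set.indicator_of_mem hz, norm_mul, norm_mul, mul_assoc]
    refine mul_le_mul_of_nonneg_left ?_ (abs_nonneg _)
    exact mul_le_mul (hC _) (hb q hq) (abs_nonneg _) hC0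
  · have hz' : ε⁻¹ * (R + S) < ‖q.2‖ := by simpa using hz
    rw [inv_mul_lt_iff₀ hε] at hz'
    have h1 : S < ‖ε • q.2 + q.1‖ := by
      have := norm_sub_norm_le (ε • q.2) (-q.1)
      rw [norm_neg, sub_neg_eq_add, norm_smul, Real.norm_of_nonneg hε.le] at this
      push Not at hx
      linarith
    rw [hS _ h1]
    simp only [mul_zero, zero_mul, norm_zero]
    refine mul_nonneg (abs_nonneg _) (Set.indicator_nonneg (fun z _ => by positivity) _)

theorem measurable_coulombKernel {f f' : E2 → ℝ} (hf : Measurable f) (hf' : Measurable f')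
    (ε : ℝ) : Measurable fun p : E2 × E2 =>
      (√(‖p.2‖ ^ 2 + |f' (p.2 + ε⁻¹ • p.1) - f (ε⁻¹ • p.1)| ^ 2))⁻¹ := by
  have : Measurable fun p : E2 × E2 => |f' (p.2 + ε⁻¹ • p.1) - f (ε⁻¹ • p.1)| :=
    (continuous_abs.measurable).comp (by fun_prop)
  fun_prop

theorem abs_inv_sqrt_le {z : E2} (hz : z ≠ 0) {s : ℝ} (hs : 0 ≤ s) :
    |(√(‖z‖ ^ 2 + s))⁻¹| ≤ ‖z‖⁻¹ := by
  have hz' := norm_pos_iff.2 hz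
  rw [abs_of_nonneg (by positivity)]
  refine inv_anti₀ hz' ?_
  exact Real.le_sqrt_of_sq_le (by linarith)

section
variable {c c' d f f' : E2 → ℝ} (hc : IsCharge c) (hc' : IsCharge c') (hd : IsCharge d)
  (hf : Measurable f) (hf' : Measurable f') {ε : ℝ} (hε : 0 < ε)
include hf hf' hε

include hc hc' in
theorem integrable_scaledPair : Integrable (fun p : E2 × E2 => c p.1 * c' (ε • p.2 + p.1) *
    (√(‖p.2‖ ^ 2 + |f' (p.2 + ε⁻¹ • p.1) - f (ε⁻¹ • p.1)| ^ 2))⁻¹) (volume.prod volume) :=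
  integrable_pair hc hc' hε (measurable_coulombKernel hf hf' ε)
    fun _ hp => abs_inv_sqrt_le hp (by positivity)

include hc hc' in
theorem scaledPair_eq : scaledPair ε c f c' f' = ∫ p : E2 × E2, c p.1 * c' (ε • p.2 + p.1) *
    (√(‖p.2‖ ^ 2 + |f' (p.2 + ε⁻¹ • p.1) - f (ε⁻¹ • p.1)| ^ 2))⁻¹ ∂(volume.prod volume) := by
  rw [integral_prod _ (integrable_scaledPair hc hc' hf hf' hε)]
  rfl

include hc hc' hd in
theorem scaledPair_sub_left : scaledPair ε (fun x => c x - d x) f c' f'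
    = scaledPair ε c f c' f' - scaledPair ε d f c' f' := by
  rw [scaledPair_eq (hc.sub hd) hc' hf hf' hε, scaledPair_eq hc hc' hf hf' hε,
    scaledPair_eq hd hc' hf hf' hε, ← integral_sub (integrable_scaledPair hc hc' hf hf' hε)
      (integrable_scaledPair hd hc' hf hf' hε)]
  refine integral_congr_ae (Eventually.of_forall fun p => ?_)
  simp only; ring

include hc hc' hd in
theorem scaledPair_sub_right : scaledPair ε c f (fun x => c' x - d x) f'
    = scaledPair ε c f c' f' - scaledPair ε c f d f' := by
  rw [scaledPair_eq hc (hc'.sub hd) hf hf' hε, scaledPair_eq hc hc' hf hf' hε,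
    scaledPair_eq hc hd hf hf' hε, ← integral_sub (integrable_scaledPair hc hc' hf hf' hε)
      (integrable_scaledPair hc hd hf hf' hε)]
  refine integral_congr_ae (Eventually.of_forall fun p => ?_)
  simp only; ring

end

/-! ### Subtracting the interaction of two planes -/

/-- The interaction of two charged planes at distance one (in rescaled variables). -/
noncomputable def planePair (ε : ℝ) (c c' : E2 → ℝ) : ℝ :=
  scaledPair ε c (fun _ => 0) c' (fun _ => 1)

/-- The kernel depends on the heights only through their distance, which is one whichever plane is
named first. -/
theorem planePair_comm {c c' : E2 → ℝ} (hc : IsCharge c) (hc' : IsCharge c') {ε : ℝ} (hε : 0 < ε) :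
    planePair ε c c' = planePair ε c' c := by
  have h1 := coulombPair_scaleProfile hε c (fun _ => 0) c' (fun _ => 1)
  have h2 := coulombPair_scaleProfile hε c' (fun _ => 1) c (fun _ => 0)
  rw [coulombPair_comm hc hc' ((isProfile_const 0).scale ε).continuous.measurable
    ((isProfile_const 1).scale ε).continuous.measurable, h2] at h1
  rw [planePair, ← h1, planePair]
  simp [scaledPair]

/-- The difference of the Coulomb kernel of two graphs and that of two planes at distance one. -/
noncomputable def gapKernel (f f' : E2 → ℝ) (y z : E2) : ℝ :=
  (√(‖z‖ ^ 2 + |f' (z + y) - f y| ^ 2))⁻¹ - (√(‖z‖ ^ 2 + 1))⁻¹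

/-- At fixed ε each interaction converges absolutely, which permits subtracting under the integral.
Only the difference kernel has an integrable majorant independent of ε. -/
theorem scaledPair_sub_planePair {c c' f f' : E2 → ℝ} (hc : IsCharge c) (hc' : IsCharge c')
    (hf : Measurable f) (hf' : Measurable f') {ε : ℝ} (hε : 0 < ε) :
    scaledPair ε c f c' f' - planePair ε c c'
      = ∫ x, ∫ z, c x * c' (ε • z + x) * gapKernel f f' (ε⁻¹ • x) z := by
  have i1 := integrable_scaledPair hc hc' hf hf' hε
  have i2 := integrable_scaledPair (f := fun _ => 0) (f' := fun _ => 1) hc hc'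
    measurable_const measurable_const hε
  have e : ∀ p : E2 × E2, c p.1 * c' (ε • p.2 + p.1) * gapKernel f f' (ε⁻¹ • p.1) p.2
      = c p.1 * c' (ε • p.2 + p.1) *
        (√(‖p.2‖ ^ 2 + |f' (p.2 + ε⁻¹ • p.1) - f (ε⁻¹ • p.1)| ^ 2))⁻¹
        - c p.1 * c' (ε • p.2 + p.1) * (√(‖p.2‖ ^ 2 + |(1 : ℝ) - 0| ^ 2))⁻¹ := by
    intro p; rw [gapKernel]; norm_num; ring
  rw [planePair, scaledPair_eq hc hc' hf hf' hε,
    scaledPair_eq hc hc' measurable_const measurable_const hε, ← integral_sub i1 i2]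
  simp only [← e]
  rw [integral_prod]
  exact (i1.sub i2).congr (Eventually.of_forall fun p => (e p).symm)

theorem integrable_gap_bound : Integrable fun z : E2 => ‖z‖⁻¹ * (1 + ‖z‖ ^ 2)⁻¹ := by
  rw [integrable_fun_norm_addHaar (volume : Measure E2) (f := fun r => r⁻¹ * (1 + r ^ 2)⁻¹)]
  simp only [finrank_euclideanSpace, Fintype.card_fin]
  refine (integrable_inv_one_add_sq.integrableOn (s := Set.Ioi 0)).congr_fun (fun r hr => ?_)
    measurableSet_Ioi
  have hr0 : r ≠ 0 := (Set.mem_Ioi.1 hr).ne'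
  simp [hr0]

/-- With A and B the two square roots, 1/A - 1/B = (B² - A²)/(AB(A + B)), and the numerator 1 - s²
is bounded. This gives decay like |z|⁻³ at infinity and a singularity no worse than |z|⁻¹ at the
origin, hence integrability in the plane. -/
theorem abs_gapKernel_le {f f' : E2 → ℝ} {S : ℝ} (hS : ∀ y z, |f' (z + y) - f y| ≤ S) (y : E2)
    {z : E2} (hz : z ≠ 0) : |gapKernel f f' y z| ≤ (S ^ 2 + 1) * (‖z‖⁻¹ * (1 + ‖z‖ ^ 2)⁻¹) := by
  have hz' := norm_pos_iff.2 hz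
  set s := |f' (z + y) - f y|
  have hs0 : 0 ≤ s := abs_nonneg _
  have hs : s ≤ S := hS y z
  set A := √(‖z‖ ^ 2 + s ^ 2)
  set B := √(‖z‖ ^ 2 + 1)
  have hA : ‖z‖ ≤ A := Real.le_sqrt_of_sq_le (by nlinarith)
  have hA2 : A ^ 2 = ‖z‖ ^ 2 + s ^ 2 := Real.sq_sqrt (by positivity)
  have hB2 : B ^ 2 = ‖z‖ ^ 2 + 1 := Real.sq_sqrt (by positivity)
  have hB : 0 < B := Real.sqrt_pos.2 (by positivity)
  have hA0 : 0 < A := hz'.trans_le hA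
  have e : A⁻¹ - B⁻¹ = (1 - s ^ 2) / (A * B * (A + B)) := by
    have : 1 - s ^ 2 = (B - A) * (A + B) := by linear_combination hA2 - hB2
    rw [this]; field_simp
  change |A⁻¹ - B⁻¹| ≤ _
  rw [e, abs_div, abs_of_pos (a := A * B * (A + B)) (by positivity), ← mul_inv, ← div_eq_mul_inv]
  refine div_le_div₀ (by positivity) ?_ (by positivity) ?_
  · rw [abs_le]; constructor <;> nlinarith
  · rw [add_comm, ← hB2]
    calc ‖z‖ * B ^ 2 ≤ A * B * B := by rw [sq, ← mul_assoc]; gcongr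
      _ ≤ A * B * (A + B) := by gcongr; linarith

theorem measurable_gapKernel {f f' : E2 → ℝ} (hf : Measurable f) (hf' : Measurable f') :
    Measurable fun p : E2 × E2 => gapKernel f f' p.1 p.2 := by
  have : Measurable fun p : E2 × E2 => |f' (p.2 + p.1) - f p.1| :=
    (continuous_abs.measurable).comp (by fun_prop)
  unfold gapKernel
  fun_prop

/-- Bounded, measurable and periodic coefficients. -/
structure IsCoeff (p : E2 → ℝ) : Prop where
  meas : Measurable p
  bdd : ∃ C : ℝ, ∀ y, |p y| ≤ C
  periodic : IsQPeriodic p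

theorem IsCoeff.isPeriodicKernel {p q : E2 → ℝ} (hp : IsCoeff p) (hq : IsCoeff q)
    {κ : E2 → E2 → ℝ} (hκ : IsPeriodicKernel κ) :
    IsPeriodicKernel fun y z => p y * q (z + y) * κ y z := by
  obtain ⟨C, hC⟩ := hp.bdd
  obtain ⟨D, hD⟩ := hq.bdd
  obtain ⟨k, hk, hb⟩ := hκ.bound
  have m1 := hp.meas
  have m2 := hq.meas
  have hC0 : 0 ≤ C := (abs_nonneg _).trans (hC 0)
  refine ⟨?_, fun z y j => ?_, ⟨fun z => C * D * k z, hk.const_mul _, fun y z hz => ?_⟩⟩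
  · exact Measurable.mul (f := fun a : E2 × E2 => p a.1 * q (a.2 + a.1)) (by fun_prop) hκ.meas
  · have h1 := hp.periodic y j
    have h2 := hq.periodic.shift z y j
    have h3 := hκ.periodic z y j
    simp only at h2 h3
    simp only [h1, h2, h3]
  · rw [abs_mul, abs_mul]
    exact mul_le_mul (mul_le_mul (hC y) (hD _) (abs_nonneg _) hC0) (hb y z hz) (abs_nonneg _)
      (mul_nonneg hC0 ((abs_nonneg _).trans (hD 0)))

theorem isPeriodicKernel_gapKernel {f f' : E2 → ℝ} (hf : IsCoeff f) (hf' : IsCoeff f') :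
    IsPeriodicKernel (gapKernel f f') := by
  obtain ⟨C, hC⟩ := hf.bdd
  obtain ⟨D, hD⟩ := hf'.bdd
  refine ⟨measurable_gapKernel hf.meas hf'.meas, fun z y j => ?_,
    ⟨_, integrable_gap_bound.const_mul ((D + C) ^ 2 + 1), fun y z hz => abs_gapKernel_le
      (fun y z => (abs_sub _ _).trans (add_le_add (hD _) (hC _))) y hz⟩⟩
  have h1 := hf.periodic y j
  have h2 := hf'.periodic.shift z y j
  simp only at h2
  simp only [gapKernel, h1, h2]

/-! ### Integration by parts in the interaction of two planes -/

/-- The convolution pairing of two densities with a kernel in the plane. -/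
noncomputable def planarPair (k c c' : E2 → ℝ) : ℝ := ∫ x, ∫ z, c x * c' (z + x) * k z

section
variable {k c c' : E2 → ℝ} (hk : Measurable k) (hb : ∃ B : ℝ, ∀ y, |k y| ≤ B)
  (hc : IsCharge c) (hc' : IsCharge c')
include hk hb hc hc'

theorem integrable_planarPair :
    Integrable (fun p : E2 × E2 => c p.1 * c' p.2 * k (p.2 - p.1)) (volume.prod volume) := by
  obtain ⟨B, hB⟩ := hb
  exact (hc.integrable.mul_prod hc'.integrable).mul_bdd (c := B)
    (Measurable.aestronglyMeasurable (by fun_prop)) (Eventually.of_forall fun _ => hB _)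

omit hk hb hc hc' in
theorem planarPair_eq_left : planarPair k c c' = ∫ x, c x * ∫ y, k (y - x) * c' y := by
  refine integral_congr_ae (Eventually.of_forall fun x => ?_)
  simp only
  rw [← integral_const_mul,
    ← integral_add_right_eq_self (fun y => c x * (k (y - x) * c' y)) x]
  refine integral_congr_ae (Eventually.of_forall fun z => ?_)
  simp only [add_sub_cancel_right]
  ring

theorem planarPair_eq_right : planarPair k c c' = ∫ y, c' y * ∫ x, k (y - x) * c x := by
  rw [planarPair_eq_left]
  simp only [← integral_const_mul]
  have hi := integrable_planarPair hk hb hc hc'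
  rw [integral_integral_swap (f := fun x y => c x * (k (y - x) * c' y))
    (hi.congr (Eventually.of_forall fun p => by simp only [Function.uncurry]; ring))]
  refine integral_congr_ae (Eventually.of_forall fun y => integral_congr_ae
    (Eventually.of_forall fun x => ?_))
  simp only
  ring

theorem integrable_mul_planar : Integrable fun x => c x * ∫ y, k (y - x) * c' y := by
  have hi := (integrable_planarPair hk hb hc hc').integral_prod_left
  refine hi.congr (Eventually.of_forall fun x => ?_)
  simp only [← integral_const_mul]
  exact integral_congr_ae (Eventually.of_forall fun y => by simp only; ring)

theorem integrable_mul_planar' : Integrable fun y => c' y * ∫ x, k (y - x) * c x := by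
  have hi := (integrable_planarPair hk hb hc hc').integral_prod_right
  refine hi.congr (Eventually.of_forall fun x => ?_)
  simp only [← integral_const_mul]
  exact integral_congr_ae (Eventually.of_forall fun y => by simp only; ring)

end

theorem isCharge_of_isProfile {G : E2 → ℝ} (hG : IsProfile G) (hc : HasCompactSupport G) :
    IsCharge G := isCharge_of_continuous hG.continuous hc

theorem isCharge_hpd {G : E2 → ℝ} (hG : IsProfile G) (hc : HasCompactSupport G) (a : Fin 2) :
    IsCharge (hpd a G) := by
  obtain ⟨B, hB⟩ := hG.hpd_bdd a
  have hs : HasCompactSupport (hpd a G) := hc.fderiv_apply ℝ _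
  obtain ⟨R, hR⟩ := hs.isCompact.isBounded.subset_closedBall 0
  refine ⟨measurable_hpd a G, ⟨|B|, abs_nonneg _, fun y => (hB y).trans (le_abs_self _)⟩,
    ⟨|R|, abs_nonneg _, fun y hy => image_eq_zero_of_notMem_tsupport fun h => ?_⟩⟩
  have h5 : ‖y‖ ≤ R := by simpa using hR h
  linarith [le_abs_self R]

/-- Integration by parts against the compactly supported Lipschitz fields `G a`; it is meaningful
because α equals minus their divergence almost everywhere. -/
theorem integral_mul_of_eq_neg_div {G : Fin 2 → E2 → ℝ} (hG : ∀ a, IsProfile (G a))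
    (hGc : ∀ a, HasCompactSupport (G a)) {α : E2 → ℝ}
    (hα : ∀ᵐ x, α x = -∑ a, hpd a (G a) x) {f : E2 → ℝ} (hf : IsProfile f) :
    ∫ x, f x * α x = ∑ a, ∫ x, hpd a f x * G a x := by
  have h1 : ∫ x, f x * α x = ∫ x, -∑ a, hpd a (G a) x * f x := by
    refine integral_congr_ae ?_
    filter_upwards [hα] with x hx
    rw [hx, mul_neg, Finset.mul_sum]
    simp only [mul_comm]
  rw [h1, integral_neg, integral_finsetSum, ← Finset.sum_neg_distrib]
  · refine Finset.sum_congr rfl fun a _ => ?_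
    rw [integral_hpd_mul hf.lip (hG a).lip (hGc a)]
  · intro a _
    exact ((isCharge_hpd (hG a) (hGc a) a).mul_bdd hf.continuous.measurable hf.bdd).integrable

theorem IsProfile.comp_sub {f : E2 → ℝ} (hf : IsProfile f) (x : E2) :
    IsProfile fun y => f (y - x) := by
  obtain ⟨K, hK⟩ := hf.lip
  obtain ⟨B, hB⟩ := hf.bdd
  refine ⟨⟨K, LipschitzWith.of_dist_le_mul fun y z => ?_⟩, ⟨B, fun y => hB _⟩⟩
  have := hK.dist_le_mul (y - x) (z - x)
  rwa [dist_sub_right] at this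

theorem IsProfile.comp_sub_left {f : E2 → ℝ} (hf : IsProfile f) (x : E2) :
    IsProfile fun y => f (x - y) := by
  obtain ⟨K, hK⟩ := hf.lip
  obtain ⟨B, hB⟩ := hf.bdd
  refine ⟨⟨K, LipschitzWith.of_dist_le_mul fun y z => ?_⟩, ⟨B, fun y => hB _⟩⟩
  have := hK.dist_le_mul (x - y) (x - z)
  rwa [dist_sub_left] at this

theorem hpd_comp_sub (a : Fin 2) (f : E2 → ℝ) (x y : E2) :
    hpd a (fun y => f (y - x)) y = hpd a f (y - x) := by
  rw [hpd, fderiv_comp_sub]; rfl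

theorem hpd_comp_smul (a : Fin 2) (f : E2 → ℝ) (r : ℝ) (y : E2) :
    hpd a (fun y => f (r • y)) y = r * hpd a f (r • y) := by
  rw [hpd, fderiv_comp_smul]; rfl

theorem hpd_const_mul (a : Fin 2) (f : E2 → ℝ) (r : ℝ) (y : E2) :
    hpd a (fun y => r * f y) y = r * hpd a f y := by
  have : (fun y => r * f y) = r • f := rfl
  rw [hpd, this, fderiv_const_smul_field]; rfl

theorem hpd_comp_sub_left (a : Fin 2) (f : E2 → ℝ) (x y : E2) :
    hpd a (fun y => f (x - y)) y = -hpd a f (x - y) := by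
  have h1 := hpd_comp_smul a (fun y => f (x + y)) (-1) y
  have h2 : hpd a (fun y => f (x + y)) ((-1 : ℝ) • y) = hpd a f (x + (-1 : ℝ) • y) := by
    rw [hpd, fderiv_comp_add_left]; rfl
  simp only [neg_smul, one_smul, ← sub_eq_add_neg] at h1 h2
  rw [h1, h2]; ring

/-- Both charges are minus the divergence of G, so one derivative is moved to the kernel for each of
them. The kernel depends on y - x, so the derivative in x reverses the sign, which explains the
minus before the Hessian. -/
theorem planarPair_by_parts {k : E2 → ℝ} (hk : IsProfile k) (hk' : ∀ a, IsProfile (hpd a k))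
    {G : Fin 2 → E2 → ℝ} (hG : ∀ a, IsProfile (G a)) (hGc : ∀ a, HasCompactSupport (G a))
    {α : E2 → ℝ} (hα : ∀ᵐ x, α x = -∑ a, hpd a (G a) x) (hαc : IsCharge α) :
    planarPair k α α = -∑ a, ∑ b, planarPair (hpd b (hpd a k)) (G b) (G a) := by
  have cG : ∀ a, IsCharge (G a) := fun a => isCharge_of_isProfile (hG a) (hGc a)
  have e1 : planarPair k α α = ∑ a, planarPair (hpd a k) α (G a) := by
    rw [planarPair_eq_left]
    have : ∀ x, α x * ∫ y, k (y - x) * α y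
        = ∑ a, α x * ∫ y, hpd a k (y - x) * G a y := by
      intro x
      rw [integral_mul_of_eq_neg_div hG hGc hα (hk.comp_sub x), Finset.mul_sum]
      simp only [hpd_comp_sub]
    simp only [this]
    rw [integral_finsetSum]
    · simp only [planarPair_eq_left]
    · intro a _
      exact integrable_mul_planar (measurable_hpd a k) (hk.hpd_bdd a) hαc (cG a)
  rw [e1, ← Finset.sum_neg_distrib]
  refine Finset.sum_congr rfl fun a _ => ?_
  rw [planarPair_eq_right (measurable_hpd a k) (hk.hpd_bdd a) hαc (cG a)]
  have : ∀ y, G a y * ∫ x, hpd a k (y - x) * α x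
      = -∑ b, G a y * ∫ x, hpd b (hpd a k) (y - x) * G b x := by
    intro y
    rw [integral_mul_of_eq_neg_div hG hGc hα ((hk' a).comp_sub_left y), Finset.mul_sum,
      ← Finset.sum_neg_distrib]
    simp only [hpd_comp_sub_left, neg_mul, integral_neg, mul_neg]
  simp only [this, integral_neg]
  rw [integral_finsetSum]
  · congr 1
    refine Finset.sum_congr rfl fun b _ => ?_
    rw [planarPair_eq_right (measurable_hpd b _) ((hk' a).hpd_bdd b) (cG b) (cG a)]
  · intro b _
    exact integrable_mul_planar' (measurable_hpd b _) ((hk' a).hpd_bdd b) (cG b) (cG a)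

/-! ### The kernel of two planes at distance one -/

theorem hpd_rpow (r : ℝ) (a : Fin 2) (z : E2) :
    hpd a (fun z => (‖z‖ ^ 2 + 1) ^ r) z = 2 * r * (z a * (‖z‖ ^ 2 + 1) ^ (r - 1)) := by
  have h1 : HasFDerivAt (fun z : E2 => ‖z‖ ^ 2 + 1) (2 • innerSL ℝ z) z :=
    (hasStrictFDerivAt_norm_sq z).hasFDerivAt.add_const 1
  have h2 := h1.rpow_const (p := r) (Or.inl (by positivity))
  rw [hpd, h2.fderiv]
  simp [EuclideanSpace.inner_single_right]
  ring

theorem differentiable_rpow (r : ℝ) : Differentiable ℝ fun z : E2 => (‖z‖ ^ 2 + 1) ^ r := by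
  intro z
  have h1 : HasFDerivAt (fun z : E2 => ‖z‖ ^ 2 + 1) (2 • innerSL ℝ z) z :=
    (hasStrictFDerivAt_norm_sq z).hasFDerivAt.add_const 1
  exact (h1.rpow_const (p := r) (Or.inl (by positivity))).differentiableAt

theorem hpd_coord_mul_rpow (c r : ℝ) (a b : Fin 2) (z : E2) :
    hpd b (fun z => c * (z a * (‖z‖ ^ 2 + 1) ^ r)) z
      = c * ((if a = b then 1 else 0) * (‖z‖ ^ 2 + 1) ^ r
        + 2 * r * (z a * z b * (‖z‖ ^ 2 + 1) ^ (r - 1))) := by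
  have h1 : HasFDerivAt (fun z : E2 => z a) (EuclideanSpace.proj a : E2 →L[ℝ] ℝ) z :=
    (EuclideanSpace.proj a : E2 →L[ℝ] ℝ).hasFDerivAt
  have h2 := (h1.mul (differentiable_rpow r z).hasFDerivAt)
  have h2' : HasFDerivAt (fun z : E2 => z a * (‖z‖ ^ 2 + 1) ^ r) _ z := h2
  have h3 := hpd_rpow r b z
  rw [hpd_const_mul, hpd, h2'.fderiv]
  rw [hpd] at h3
  simp only [_root_.add_apply, _root_.smul_apply, smul_eq_mul, h3]
  have e : (EuclideanSpace.proj a : E2 →L[ℝ] ℝ) (EuclideanSpace.single b (1 : ℝ))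
      = if a = b then 1 else 0 := by simp
  rw [e]
  ring

theorem isProfile_of_hpd_bdd {f : E2 → ℝ} (hf : Differentiable ℝ f) {C : ℝ}
    (h0 : ∀ y, |f y| ≤ C) (h1 : ∀ a y, |hpd a f y| ≤ C) : IsProfile f := by
  have hC : 0 ≤ C := (abs_nonneg _).trans (h0 0)
  refine ⟨⟨Real.toNNReal (2 * C), lipschitzWith_of_nnnorm_fderiv_le hf fun y => ?_⟩, ⟨C, h0⟩⟩
  rw [← NNReal.coe_le_coe, Real.coe_toNNReal _ (by positivity), coe_nnnorm]
  refine ContinuousLinearMap.opNorm_le_bound _ (by positivity) fun v => ?_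
  have e : fderiv ℝ f y v = v 0 * hpd 0 f y + v 1 * hpd 1 f y := by
    have : v = v 0 • EuclideanSpace.single 0 (1 : ℝ) + v 1 • EuclideanSpace.single 1 (1 : ℝ) := by
      ext i; fin_cases i <;> simp
    conv_lhs => rw [this]
    rw [map_add, map_smul, map_smul]; rfl
  rw [e]
  have n0 := PiLp.norm_apply_le v 0
  have n1 := PiLp.norm_apply_le v 1
  calc ‖v 0 * hpd 0 f y + v 1 * hpd 1 f y‖ ≤ ‖v 0‖ * |hpd 0 f y| + ‖v 1‖ * |hpd 1 f y| := by
        refine (norm_add_le _ _).trans ?_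
        rw [norm_mul, norm_mul]; rfl
    _ ≤ ‖v‖ * C + ‖v‖ * C := by
        gcongr
        · exact h1 0 y
        · exact h1 1 y
    _ = 2 * C * ‖v‖ := by ring

theorem abs_coord_le (z : E2) (a : Fin 2) : |z a| ≤ (‖z‖ ^ 2 + 1) ^ (1 / 2 : ℝ) := by
  rw [← Real.sqrt_eq_rpow]
  refine Real.le_sqrt_of_sq_le ?_
  have := PiLp.norm_apply_le z a
  rw [Real.norm_eq_abs] at this
  have := abs_nonneg (z a)
  nlinarith

/-- The Coulomb kernel of two planes at distance one. -/
noncomputable def planeKernel (z : E2) : ℝ := (√(‖z‖ ^ 2 + 1))⁻¹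

/-- Minus the Hessian of the Coulomb kernel of two planes at distance one. -/
noncomputable def dipoleKernel (a b : Fin 2) (z : E2) : ℝ :=
  (if a = b then 1 else 0) / (‖z‖ ^ 2 + 1) ^ (3 / 2 : ℝ)
    - 3 * (z a * z b) / (‖z‖ ^ 2 + 1) ^ (5 / 2 : ℝ)

theorem planeKernel_eq (z : E2) : planeKernel z = (‖z‖ ^ 2 + 1) ^ (-(1 / 2) : ℝ) := by
  rw [planeKernel, Real.sqrt_eq_rpow, Real.rpow_neg (by positivity)]

theorem hpd_planeKernel (a : Fin 2) :
    hpd a planeKernel = fun z => -1 * (z a * (‖z‖ ^ 2 + 1) ^ (-(3 / 2) : ℝ)) := by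
  have : planeKernel = fun z => (‖z‖ ^ 2 + 1) ^ (-(1 / 2) : ℝ) := funext planeKernel_eq
  funext z
  rw [this, hpd_rpow]
  norm_num

theorem hpd_hpd_planeKernel (a b : Fin 2) (z : E2) :
    hpd b (hpd a planeKernel) z = -dipoleKernel a b z := by
  rw [hpd_planeKernel, hpd_coord_mul_rpow, dipoleKernel]
  have e1 : (-(3 / 2) - 1 : ℝ) = -(5 / 2) := by norm_num
  rw [e1, Real.rpow_neg (by positivity), Real.rpow_neg (by positivity)]
  ring

/-- Each coordinate is at most (|z|² + 1)^{1/2}, so both terms decay with exponent 3/2 of |z|² + 1;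
the constant is 4 = 1 + 3. Decay of order three is integrable in dimension two, unlike that of the
plane kernel itself. -/
theorem abs_dipoleKernel_le (a b : Fin 2) (z : E2) :
    |dipoleKernel a b z| ≤ 4 * (1 + ‖z‖ ^ 2) ^ (-3 / 2 : ℝ) := by
  have hs : 0 < ‖z‖ ^ 2 + 1 := by positivity
  have e : (1 + ‖z‖ ^ 2) ^ (-3 / 2 : ℝ) = ((‖z‖ ^ 2 + 1) ^ (3 / 2 : ℝ))⁻¹ := by
    rw [add_comm, ← Real.rpow_neg hs.le]; norm_num
  have p : 0 < (‖z‖ ^ 2 + 1) ^ (3 / 2 : ℝ) := by positivity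
  have p5 : 0 < (‖z‖ ^ 2 + 1) ^ (5 / 2 : ℝ) := by positivity
  have e5 : (‖z‖ ^ 2 + 1) ^ (5 / 2 : ℝ) = (‖z‖ ^ 2 + 1) ^ (1 / 2 : ℝ) * (‖z‖ ^ 2 + 1) ^ (1 / 2 : ℝ)
      * (‖z‖ ^ 2 + 1) ^ (3 / 2 : ℝ) := by
    rw [← Real.rpow_add hs, ← Real.rpow_add hs]; norm_num
  have h1 : |(if a = b then (1 : ℝ) else 0) / (‖z‖ ^ 2 + 1) ^ (3 / 2 : ℝ)|
      ≤ ((‖z‖ ^ 2 + 1) ^ (3 / 2 : ℝ))⁻¹ := by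
    split_ifs
    · rw [one_div, abs_of_pos (by positivity)]
    · simp; positivity
  have h2 : |3 * (z a * z b) / (‖z‖ ^ 2 + 1) ^ (5 / 2 : ℝ)|
      ≤ 3 * ((‖z‖ ^ 2 + 1) ^ (3 / 2 : ℝ))⁻¹ := by
    rw [abs_div, abs_of_pos p5, abs_mul, abs_mul, div_le_iff₀ p5, e5]
    have := mul_le_mul (abs_coord_le z a) (abs_coord_le z b) (abs_nonneg _) (by positivity)
    norm_num only [abs_of_pos]
    calc (3 : ℝ) * (|z a| * |z b|)
        ≤ 3 * ((‖z‖ ^ 2 + 1) ^ (1 / 2 : ℝ) * (‖z‖ ^ 2 + 1) ^ (1 / 2 : ℝ)) := by gcongr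
      _ = _ := by field_simp
  rw [dipoleKernel, e]
  exact (abs_sub _ _).trans (by linarith)

theorem abs_dipoleKernel_le_four (a b : Fin 2) (z : E2) : |dipoleKernel a b z| ≤ 4 := by
  have h : (1 + ‖z‖ ^ 2) ^ (-3 / 2 : ℝ) ≤ 1 :=
    Real.rpow_le_one_of_one_le_of_nonpos (by nlinarith [sq_nonneg ‖z‖]) (by norm_num)
  linarith [abs_dipoleKernel_le a b z]

theorem abs_hpd_planeKernel_le (a : Fin 2) (z : E2) : |hpd a planeKernel z| ≤ 1 := by
  have hs : 0 < ‖z‖ ^ 2 + 1 := by positivity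
  have e : (‖z‖ ^ 2 + 1) ^ (1 / 2 : ℝ) * (‖z‖ ^ 2 + 1) ^ (-(3 / 2) : ℝ)
      = (‖z‖ ^ 2 + 1) ^ (-1 : ℝ) := by
    rw [← Real.rpow_add hs]; norm_num
  rw [hpd_planeKernel, abs_mul, abs_mul, abs_neg, abs_one, one_mul,
    abs_of_pos (a := (‖z‖ ^ 2 + 1) ^ (-(3 / 2) : ℝ)) (by positivity)]
  refine (mul_le_mul_of_nonneg_right (abs_coord_le z a) (by positivity)).trans ?_
  rw [e]
  exact Real.rpow_le_one_of_one_le_of_nonpos (by nlinarith [sq_nonneg ‖z‖]) (by norm_num)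

theorem isProfile_planeKernel : IsProfile planeKernel := by
  have : planeKernel = fun z => (‖z‖ ^ 2 + 1) ^ (-(1 / 2) : ℝ) := funext planeKernel_eq
  refine isProfile_of_hpd_bdd (C := 1) (this ▸ differentiable_rpow _) (fun z => ?_)
    abs_hpd_planeKernel_le
  rw [planeKernel_eq, abs_of_pos (by positivity)]
  exact Real.rpow_le_one_of_one_le_of_nonpos (by nlinarith [sq_nonneg ‖z‖]) (by norm_num)

theorem isProfile_hpd_planeKernel (a : Fin 2) : IsProfile (hpd a planeKernel) := by
  refine isProfile_of_hpd_bdd (C := 4) ?_ (fun z => (abs_hpd_planeKernel_le a z).trans (by norm_num))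
    fun b z => ?_
  · rw [hpd_planeKernel]
    have h1 : Differentiable ℝ fun z : E2 => z a := by fun_prop
    exact (h1.mul (differentiable_rpow _)).const_mul _
  · rw [hpd_hpd_planeKernel, abs_neg]; exact abs_dipoleKernel_le_four a b z

theorem isPeriodicKernel_dipoleKernel (a b : Fin 2) :
    IsPeriodicKernel fun _ z => dipoleKernel a b z := by
  refine ⟨?_, fun z x k => rfl, ⟨_, ?_, fun y z _ => abs_dipoleKernel_le a b z⟩⟩
  · unfold dipoleKernel Function.uncurry
    fun_prop
  · have := integrable_rpow_neg_one_add_norm_sq (E := E2) (μ := volume) (r := 3)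
      (by simp; norm_num)
    exact this.const_mul 4

theorem IsProfile.comp_smul {f : E2 → ℝ} (hf : IsProfile f) (r : ℝ) :
    IsProfile fun y => f (r • y) := by
  obtain ⟨K, hK⟩ := hf.lip
  obtain ⟨B, hB⟩ := hf.bdd
  exact ⟨⟨_, hK.comp (lipschitzWith_smul r)⟩, ⟨B, fun y => hB _⟩⟩

theorem planarPair_scale {ε : ℝ} (hε : 0 < ε) (k c c' : E2 → ℝ) :
    planarPair (fun z => k (ε⁻¹ • z)) c c' = ε ^ 2 * ∫ x, ∫ z, c x * c' (ε • z + x) * k z := by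
  rw [planarPair, ← integral_const_mul]
  refine integral_congr_ae (Eventually.of_forall fun x => ?_)
  simp only
  rw [integral_scale hε]
  simp only [smul_smul, inv_mul_cancel₀ hε.ne', one_smul]

/-- Two derivatives of the kernel at scale ε cost ε⁻². In the application G carries the film
thickness, which is O(ε), so the two factors `G a` and `G b` absorb this loss. -/
theorem planePair_eq_dipole {ε : ℝ} (hε : 0 < ε) {G : Fin 2 → E2 → ℝ} (hG : ∀ a, IsProfile (G a))
    (hGc : ∀ a, HasCompactSupport (G a)) {α : E2 → ℝ} (hα : ∀ᵐ x, α x = -∑ a, hpd a (G a) x)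
    (hαc : IsCharge α) :
    planePair ε α α = (ε ^ 2)⁻¹ * ∑ a, ∑ b,
      ∫ x, ∫ z, G b x * G a (ε • z + x) * dipoleKernel a b z := by
  have e1 : planePair ε α α = (ε ^ 2)⁻¹ * planarPair (fun z => planeKernel (ε⁻¹ • z)) α α := by
    rw [planarPair_scale hε, planePair, scaledPair]
    simp only [planeKernel]
    norm_num
    field_simp
  have hd1 : ∀ a, hpd a (fun z => planeKernel (ε⁻¹ • z))
      = fun z => ε⁻¹ * hpd a planeKernel (ε⁻¹ • z) := fun a =>
    funext fun z => hpd_comp_smul a planeKernel ε⁻¹ z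
  have hd2 : ∀ a b, hpd b (hpd a (fun z => planeKernel (ε⁻¹ • z)))
      = fun z => -((ε ^ 2)⁻¹ * dipoleKernel a b (ε⁻¹ • z)) := by
    intro a b
    funext z
    rw [hd1, hpd_const_mul, hpd_comp_smul, hpd_hpd_planeKernel]
    field_simp
  have hk' : ∀ a, IsProfile (hpd a fun z => planeKernel (ε⁻¹ • z)) := by
    intro a
    rw [hd1]
    exact (isProfile_const ε⁻¹).mul ((isProfile_hpd_planeKernel a).comp_smul ε⁻¹)
  have e2 := planarPair_by_parts (isProfile_planeKernel.comp_smul ε⁻¹) hk' hG hGc hα hαc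
  rw [e1, e2, ← Finset.sum_neg_distrib]
  congr 1
  refine Finset.sum_congr rfl fun a _ => ?_
  rw [← Finset.sum_neg_distrib]
  refine Finset.sum_congr rfl fun b _ => ?_
  rw [hd2, planarPair_scale hε (fun z => -((ε ^ 2)⁻¹ * dipoleKernel a b z)),
    ← integral_const_mul, ← integral_neg]
  refine integral_congr_ae (Eventually.of_forall fun x => ?_)
  simp only
  rw [← integral_const_mul, ← integral_neg]
  refine integral_congr_ae (Eventually.of_forall fun z => ?_)
  simp only
  field_simp

/-! ### The limit of the energy of a thin film with an oscillating profile -/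

theorem integrable_periodicKernel {μ ν : E2 → ℝ} (hμ : IsCharge μ) (hν : IsCharge ν)
    {P : E2 → E2 → ℝ} (hP : IsPeriodicKernel P) (ε : ℝ) :
    Integrable (fun q : E2 × E2 => μ q.1 * ν (ε • q.2 + q.1) * P (ε⁻¹ • q.1) q.2)
      (volume.prod volume) := by
  obtain ⟨k, hk, hb⟩ := hP.bound
  obtain ⟨C, hC0, hC⟩ := hν.bdd
  have m1 := hμ.meas
  have m2 := hν.meas
  have hne : ∀ᵐ q : E2 × E2 ∂(volume.prod volume), q.2 ≠ 0 := by
    have : MeasurableSet {q : E2 × E2 | q.2 ≠ 0} :=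
      (measurableSet_eq_fun measurable_snd measurable_const).compl
    exact (Measure.ae_prod_iff_ae_ae this).2 (Eventually.of_forall fun _ => ae_ne_zero_plane)
  have hPc : Measurable fun q : E2 × E2 => P (ε⁻¹ • q.1) q.2 :=
    hP.meas.comp (g := Function.uncurry P) (f := fun q : E2 × E2 => (ε⁻¹ • q.1, q.2))
      (by fun_prop)
  refine ((hμ.integrable.abs.mul_prod hk).const_mul C).mono'
    (Measurable.mul (by fun_prop) hPc).aestronglyMeasurable (hne.mono fun q hq => ?_)
  have h1 := hb (ε⁻¹ • q.1) q.2 hq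
  have h2 := hC (ε • q.2 + q.1)
  rw [norm_mul, norm_mul, Real.norm_eq_abs, Real.norm_eq_abs, Real.norm_eq_abs]
  calc |μ q.1| * |ν (ε • q.2 + q.1)| * |P (ε⁻¹ • q.1) q.2| ≤ |μ q.1| * C * k q.2 := by gcongr
    _ = C * (|μ q.1| * k q.2) := by ring

/-- A charge composed of slowly varying densities `μ s` with oscillating coefficients `p s`. -/
noncomputable def oscCharge (w : Fin 4 → ℝ) (μ p : Fin 4 → E2 → ℝ) (ε : ℝ) (x : E2) : ℝ :=
  ∑ s, w s * (μ s x * p s (ε⁻¹ • x))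

theorem IsCharge.add {c g : E2 → ℝ} (hc : IsCharge c) (hg : IsCharge g) :
    IsCharge fun y => c y + g y := by
  have h := hc.sub (hg.mul_bdd (g := fun _ => -1) measurable_const ⟨1, fun _ => by simp⟩)
  simpa using h

theorem isCharge_oscCharge {μ p : Fin 4 → E2 → ℝ} (hμ : ∀ s, IsCharge (μ s))
    (hp : ∀ s, IsCoeff (p s)) (w : Fin 4 → ℝ) (ε : ℝ) : IsCharge (oscCharge w μ p ε) := by
  have h : ∀ s, IsCharge fun x => w s * (μ s x * p s (ε⁻¹ • x)) := by
    intro s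
    have m := (hp s).meas
    obtain ⟨C, hC⟩ := (hp s).bdd
    have h1 := ((hμ s).mul_bdd (g := fun x => p s (ε⁻¹ • x)) (by fun_prop)
      ⟨C, fun y => hC _⟩).mul_bdd (g := fun _ => w s) measurable_const ⟨|w s|, fun _ => le_rfl⟩
    simpa only [mul_comm (w s)] using h1
  have := (((h 0).add (h 1)).add (h 2)).add (h 3)
  unfold oscCharge
  simpa only [Fin.sum_univ_four] using this

/-- Bilinear expansion: every pair of components is a two-scale interaction with an integrable
periodic kernel, and the weights converge. -/
theorem tendsto_scaledPair_sub {μ : Fin 4 → E2 → ℝ} (hμ : ∀ s, Continuous (μ s))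
    (hμc : ∀ s, HasCompactSupport (μ s)) {p q : Fin 4 → E2 → ℝ} (hp : ∀ s, IsCoeff (p s))
    (hq : ∀ s, IsCoeff (q s)) {f f' : E2 → ℝ} (hf : IsCoeff f) (hf' : IsCoeff f')
    {w w' : ℝ → Fin 4 → ℝ} {W W' : Fin 4 → ℝ}
    (hw : ∀ s, Tendsto (fun ε => w ε s) (𝓝[>] 0) (𝓝 (W s)))
    (hw' : ∀ s, Tendsto (fun ε => w' ε s) (𝓝[>] 0) (𝓝 (W' s))) :
    Tendsto (fun ε => scaledPair ε (oscCharge (w ε) μ p ε) f (oscCharge (w' ε) μ q ε) f'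
      - planePair ε (oscCharge (w ε) μ p ε) (oscCharge (w' ε) μ q ε)) (𝓝[>] 0)
      (𝓝 (∑ s, ∑ t, W s * W' t * ((∫ x, μ s x * μ t x) *
        ∫ y in cellQ, ∫ z, p s y * q t (z + y) * gapKernel f f' y z))) := by
  have cμ : ∀ s, IsCharge (μ s) := fun s => isCharge_of_continuous (hμ s) (hμc s)
  have hκ := isPeriodicKernel_gapKernel hf hf'
  have hP : ∀ s t, IsPeriodicKernel fun y z => p s y * q t (z + y) * gapKernel f f' y z :=
    fun s t => (hp s).isPeriodicKernel (hq t) hκ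
  have lim : Tendsto (fun ε => ∑ s, ∑ t, w ε s * w' ε t * ∫ x, ∫ z, μ s x * μ t (ε • z + x) *
      (p s (ε⁻¹ • x) * q t (z + ε⁻¹ • x) * gapKernel f f' (ε⁻¹ • x) z)) (𝓝[>] 0)
      (𝓝 (∑ s, ∑ t, W s * W' t * ((∫ x, μ s x * μ t x) *
        ∫ y in cellQ, ∫ z, p s y * q t (z + y) * gapKernel f f' y z))) := by
    refine tendsto_finsetSum _ fun s _ => tendsto_finsetSum _ fun t _ => ?_
    exact ((hw s).mul (hw' t)).mul
      (tendsto_integral_periodicKernel (hμ s) (hμc s) (hμ t) (hμc t) (hP s t))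
  refine lim.congr' ?_
  filter_upwards [self_mem_nhdsWithin] with ε hε
  have hε : 0 < ε := hε
  have i := fun s t => integrable_periodicKernel (cμ s) (cμ t) (hP s t) ε
  rw [scaledPair_sub_planePair (isCharge_oscCharge cμ hp _ _) (isCharge_oscCharge cμ hq _ _)
    hf.meas hf'.meas hε]
  have e : ∀ x z, oscCharge (w ε) μ p ε x * oscCharge (w' ε) μ q ε (ε • z + x)
        * gapKernel f f' (ε⁻¹ • x) z
      = ∑ s, ∑ t, w ε s * w' ε t * (μ s x * μ t (ε • z + x) *
        (p s (ε⁻¹ • x) * q t (z + ε⁻¹ • x) * gapKernel f f' (ε⁻¹ • x) z)) := by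
    intro x z
    simp only [oscCharge, Finset.mul_sum, Finset.sum_mul, smul_add, smul_smul,
      inv_mul_cancel₀ hε.ne', one_smul]
    rw [Finset.sum_comm]
    refine Finset.sum_congr rfl fun s _ => Finset.sum_congr rfl fun t _ => ?_
    ring
  simp only [e]
  have i2 : ∀ s t, Integrable (fun r : E2 × E2 => w ε s * w' ε t * (μ s r.1 *
      μ t (ε • r.2 + r.1) * (p s (ε⁻¹ • r.1) * q t (r.2 + ε⁻¹ • r.1)
        * gapKernel f f' (ε⁻¹ • r.1) r.2))) (volume.prod volume) := fun s t =>
    (i s t).const_mul _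
  have i1 : ∀ s, Integrable (fun r : E2 × E2 => ∑ t, w ε s * w' ε t * (μ s r.1 *
      μ t (ε • r.2 + r.1) * (p s (ε⁻¹ • r.1) * q t (r.2 + ε⁻¹ • r.1)
        * gapKernel f f' (ε⁻¹ • r.1) r.2))) (volume.prod volume) := fun s =>
    integrable_finsetSum _ fun t _ => i2 s t
  rw [← integral_prod (fun r : E2 × E2 => ∑ s, ∑ t, w ε s * w' ε t * (μ s r.1 *
      μ t (ε • r.2 + r.1) * (p s (ε⁻¹ • r.1) * q t (r.2 + ε⁻¹ • r.1)
        * gapKernel f f' (ε⁻¹ • r.1) r.2))) (integrable_finsetSum _ fun s _ => i1 s),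
    integral_finsetSum _ fun s _ => i1 s]
  refine Finset.sum_congr rfl fun s _ => ?_
  rw [integral_finsetSum _ fun t _ => i2 s t]
  refine Finset.sum_congr rfl fun t _ => ?_
  rw [integral_const_mul, integral_prod _ (i s t)]

/-! ### Separating slow densities from oscillating coefficients -/

/-- The slowly varying densities in the charges of `filmField`. -/
noncomputable def fieldDensity (m : E2 → E3) : Fin 4 → E2 → ℝ :=
  ![fun y => m y 0, fun y => m y 1, fun y => m y 2, hdiv m]

/-- The oscillating coefficients in the charges of `filmField`. -/
noncomputable def chargeCoeff (f g : E2 → ℝ) : Fin 4 → E2 → ℝ :=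
  ![fun y => -hpd 0 f y, fun y => -hpd 1 f y, fun _ => 1, fun y => -g y]

theorem continuous_fieldDensity {m : E2 → E3} (hm : IsTestField m) (s : Fin 4) :
    Continuous (fieldDensity m s) := by
  fin_cases s
  · exact (hm.contDiff_apply 0).continuous
  · exact (hm.contDiff_apply 1).continuous
  · exact (hm.contDiff_apply 2).continuous
  · exact hm.continuous_hdiv

theorem hasCompactSupport_fieldDensity {m : E2 → E3} (hm : IsTestField m) (s : Fin 4) :
    HasCompactSupport (fieldDensity m s) := by
  fin_cases s
  · exact hm.hasCompactSupport_apply 0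
  · exact hm.hasCompactSupport_apply 1
  · exact hm.hasCompactSupport_apply 2
  · exact hm.hasCompactSupport_hdiv

theorem isCoeff_of_isProfile {f : E2 → ℝ} (hf : IsProfile f) (hp : IsQPeriodic f) : IsCoeff f :=
  ⟨hf.continuous.measurable, hf.bdd, hp⟩

theorem IsCoeff.neg {p : E2 → ℝ} (hp : IsCoeff p) : IsCoeff fun y => -p y := by
  obtain ⟨C, hC⟩ := hp.bdd
  refine ⟨hp.meas.neg, ⟨C, fun y => by rw [abs_neg]; exact hC y⟩, fun x k => ?_⟩
  simp only [hp.periodic x k]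

theorem isCoeff_chargeCoeff {f g : E2 → ℝ} (hf : IsProfile f) (hp : IsQPeriodic f)
    (hg : IsCoeff g) (s : Fin 4) : IsCoeff (chargeCoeff f g s) := by
  have h := fun a => IsCoeff.neg ⟨measurable_hpd a f, hf.hpd_bdd a, hp.hpd a⟩
  fin_cases s
  · exact h 0
  · exact h 1
  · exact ⟨measurable_const, ⟨1, fun _ => by simp [chargeCoeff]⟩, fun _ _ => rfl⟩
  · exact hg.neg

/-- The fourth weight is zero, so `g` is arbitrary; the slot exists so that bottom and top charges
have the same format. -/
theorem graphCharge_scaleProfile {ε : ℝ} (hε : 0 < ε) (f g : E2 → ℝ) (m : E2 → E3) :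
    graphCharge (scaleProfile ε f) m
      = oscCharge ![1, 1, 1, 0] (fieldDensity m) (chargeCoeff f g) ε := by
  funext x
  simp [graphCharge, hpd_scaleProfile hε, oscCharge, Fin.sum_univ_four, fieldDensity, chargeCoeff]
  ring

/-- The divergence term carries the film thickness ε(f₂ - f₁), hence the weight ε in the fourth
slot. -/
theorem topCharge_scaleProfile {ε : ℝ} (hε : 0 < ε) (f₁ f₂ : E2 → ℝ) (m : E2 → E3) :
    topCharge (scaleProfile ε f₁) (scaleProfile ε f₂) m
      = oscCharge ![1, 1, 1, ε] (fieldDensity m) (chargeCoeff f₂ fun y => f₂ y - f₁ y) ε := by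
  funext x
  simp [topCharge, graphCharge, hpd_scaleProfile hε, oscCharge, Fin.sum_univ_four, fieldDensity,
    chargeCoeff, scaleProfile]
  ring

theorem surfaceMatrix_eq (f h g g' : E2 → ℝ) (i j : Fin 3) :
    surfaceMatrix f h i j = ∫ y in cellQ, ∫ z, chargeCoeff f g i.castSucc y *
      chargeCoeff h g' j.castSucc (z + y) * gapKernel f h y z := by
  have e : ∀ (f g : E2 → ℝ) (i : Fin 3) (y : E2), chargeCoeff f g i.castSucc y
      = normalVec f y i := by
    intro f g i y
    fin_cases i <;> simp [chargeCoeff, normalVec, gradient_apply_plane]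
  simp only [surfaceMatrix, e, tensor, vecMulVec_apply, gapKernel, div_eq_mul_inv, ← mul_sub]

theorem thicknessMatrix_castSucc (f₁ f₂ : E2 → ℝ) (a b : Fin 2) :
    thicknessMatrix f₁ f₂ a.castSucc b.castSucc = ∫ y in cellQ, ∫ z : E2,
      (f₂ y - f₁ y) * (f₂ (z + y) - f₁ (z + y)) * dipoleKernel a b z := by
  have e0 : ∀ (a : Fin 2), vecE3 a.castSucc = 0 := by
    intro a; fin_cases a <;> simp [vecE3]
  have e1 : ∀ (z : E2) (a : Fin 2), liftHoriz z a.castSucc = z a := by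
    intro z a; fin_cases a <;> simp [liftHoriz]
  simp only [thicknessMatrix, tensor, vecMulVec_apply, Matrix.sub_apply, Matrix.one_apply, e0, e1,
    mul_zero, sub_zero, Fin.castSucc_inj, dipoleKernel]
  refine integral_congr_ae (Eventually.of_forall fun y => integral_congr_ae
    (Eventually.of_forall fun z => ?_))
  simp only
  ring

/-- Both I - e₃ ⊗ e₃ and (z', 0) ⊗ (z', 0) annihilate the vertical direction. -/
theorem thicknessMatrix_last_left (f₁ f₂ : E2 → ℝ) (j : Fin 3) :
    thicknessMatrix f₁ f₂ (Fin.last 2) j = 0 := by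
  have h : (Fin.last 2 : Fin 3) = 2 := rfl
  rw [h]
  fin_cases j <;> simp [thicknessMatrix, tensor, vecMulVec_apply, vecE3, liftHoriz]

theorem thicknessMatrix_last_right (f₁ f₂ : E2 → ℝ) (i : Fin 3) :
    thicknessMatrix f₁ f₂ i (Fin.last 2) = 0 := by
  have h : (Fin.last 2 : Fin 3) = 2 := rfl
  rw [h]
  fin_cases i <;> simp [thicknessMatrix, tensor, vecMulVec_apply, vecE3, liftHoriz]

theorem quadForm_eq (A : Matrix (Fin 3) (Fin 3) ℝ) (e : E3) :
    quadForm A e = ∑ i, ∑ j, A i j * (e i * e j) := by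
  simp only [quadForm, dotProduct, mulVec, Finset.sum_mul]
  refine Finset.sum_congr rfl fun i _ => Finset.sum_congr rfl fun j _ => ?_
  ring

theorem integral_quadForm (A : Matrix (Fin 3) (Fin 3) ℝ) {m : E2 → E3} (hm : IsTestField m) :
    ∫ x, quadForm A (m x) = ∑ i, ∑ j, A i j * ∫ x, m x i * m x j := by
  have hi : ∀ i j, Integrable fun x => m x i * m x j := fun i j =>
    ((hm.contDiff_apply i).continuous.mul (hm.contDiff_apply j).continuous).integrable_of_hasCompactSupport
      ((hm.hasCompactSupport_apply i).mul_right)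
  obtain ⟨a, ha⟩ : ∃ a : Fin 3 → Fin 3 → ℝ, ∀ i j, A i j = a i j := ⟨A, fun _ _ => rfl⟩
  simp only [quadForm_eq, ha]
  rw [integral_finsetSum _ fun i _ => integrable_finsetSum _ fun j _ => (hi i j).const_mul _]
  refine Finset.sum_congr rfl fun i _ => ?_
  rw [integral_finsetSum _ fun j _ => (hi i j).const_mul _]
  refine Finset.sum_congr rfl fun j _ => ?_
  rw [integral_const_mul]

section
variable {f₁ f₂ : E2 → ℝ} (H : IsFilm f₁ f₂) (p₁ : IsQPeriodic f₁) (p₂ : IsQPeriodic f₂)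
  {m : E2 → E3} (hm : IsTestField m)
include H p₁ p₂ hm

omit H p₁ p₂ in
-- The weight of the divergence slot tends to zero, so only the three components of the
-- magnetization survive, paired with the components of the normals.
theorem tendsto_surface {f f' g g' : E2 → ℝ} (hf : IsProfile f) (hp : IsQPeriodic f)
    (hf' : IsProfile f') (hp' : IsQPeriodic f') (hg : IsCoeff g) (hg' : IsCoeff g')
    {w w' : ℝ → ℝ} (hw : Tendsto w (𝓝[>] 0) (𝓝 0)) (hw' : Tendsto w' (𝓝[>] 0) (𝓝 0)) :
    Tendsto (fun ε =>
      scaledPair ε (oscCharge ![1, 1, 1, w ε] (fieldDensity m) (chargeCoeff f g) ε) f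
        (oscCharge ![1, 1, 1, w' ε] (fieldDensity m) (chargeCoeff f' g') ε) f'
      - planePair ε (oscCharge ![1, 1, 1, w ε] (fieldDensity m) (chargeCoeff f g) ε)
        (oscCharge ![1, 1, 1, w' ε] (fieldDensity m) (chargeCoeff f' g') ε)) (𝓝[>] 0)
      (𝓝 (∑ i, ∑ j, surfaceMatrix f f' i j * ∫ x, m x i * m x j)) := by
  have hW : ∀ w : ℝ → ℝ, Tendsto w (𝓝[>] 0) (𝓝 0) → ∀ s : Fin 4,
      Tendsto (fun ε => (![1, 1, 1, w ε] : Fin 4 → ℝ) s) (𝓝[>] 0)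
        (𝓝 ((![1, 1, 1, 0] : Fin 4 → ℝ) s)) := by
    intro w hw s
    fin_cases s
    · exact tendsto_const_nhds
    · exact tendsto_const_nhds
    · exact tendsto_const_nhds
    · exact hw
  have h := tendsto_scaledPair_sub (continuous_fieldDensity hm)
    (hasCompactSupport_fieldDensity hm) (isCoeff_chargeCoeff hf hp hg)
    (isCoeff_chargeCoeff hf' hp' hg') (isCoeff_of_isProfile hf hp) (isCoeff_of_isProfile hf' hp')
    (hW w hw) (hW w' hw')
  convert h using 2
  have e1 : ∀ i : Fin 3, (![1, 1, 1, 0] : Fin 4 → ℝ) i.castSucc = 1 := by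
    intro i; fin_cases i <;> rfl
  have e2 : (![1, 1, 1, 0] : Fin 4 → ℝ) (Fin.last 3) = 0 := rfl
  have e3 : ∀ (i : Fin 3) (x : E2), fieldDensity m i.castSucc x = m x i := by
    intro i x; fin_cases i <;> rfl
  simp only [Fin.sum_univ_castSucc (n := 3), e1, e2, e3, zero_mul, mul_zero, add_zero, one_mul,
    Finset.sum_const_zero, ← surfaceMatrix_eq]
  simp only [mul_comm]

/-- The net charge of a column, top minus bottom, is minus the horizontal divergence of (thickness)
m'. The dipole form of the plane interaction then has a nonzero finite scale: ε⁻² times two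
thicknesses of order ε. -/
theorem tendsto_thickness : Tendsto (fun ε => planePair ε
      (fun x => topCharge (scaleProfile ε f₁) (scaleProfile ε f₂) m x
        - graphCharge (scaleProfile ε f₁) m x)
      (fun x => topCharge (scaleProfile ε f₁) (scaleProfile ε f₂) m x
        - graphCharge (scaleProfile ε f₁) m x)) (𝓝[>] 0)
      (𝓝 (∑ i, ∑ j, thicknessMatrix f₁ f₂ i j * ∫ x, m x i * m x j)) := by
  have hg := isCoeff_of_isProfile (H.top.sub H.bot) fun x k => by
    rw [p₁ x k, p₂ x k]
  have lim : Tendsto (fun ε : ℝ => ∑ a : Fin 2, ∑ b : Fin 2, ∫ x, ∫ z : E2,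
      m x b.castSucc * m (ε • z + x) a.castSucc * ((f₂ (ε⁻¹ • x) - f₁ (ε⁻¹ • x)) *
        (f₂ (z + ε⁻¹ • x) - f₁ (z + ε⁻¹ • x)) * dipoleKernel a b z)) (𝓝[>] 0)
      (𝓝 (∑ a : Fin 2, ∑ b : Fin 2, (∫ x, m x b.castSucc * m x a.castSucc) *
        thicknessMatrix f₁ f₂ a.castSucc b.castSucc)) := by
    refine tendsto_finsetSum _ fun a _ => tendsto_finsetSum _ fun b _ => ?_
    rw [thicknessMatrix_castSucc]
    exact tendsto_integral_periodicKernel (hm.contDiff_apply _).continuous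
      (hm.hasCompactSupport_apply _) (hm.contDiff_apply _).continuous
      (hm.hasCompactSupport_apply _) (hg.isPeriodicKernel hg (isPeriodicKernel_dipoleKernel a b))
  have e : ∑ i, ∑ j, thicknessMatrix f₁ f₂ i j * ∫ x, m x i * m x j
      = ∑ a : Fin 2, ∑ b : Fin 2, (∫ x, m x b.castSucc * m x a.castSucc) *
        thicknessMatrix f₁ f₂ a.castSucc b.castSucc := by
    simp only [Fin.sum_univ_castSucc (n := 2), thicknessMatrix_last_left,
      thicknessMatrix_last_right, zero_mul, add_zero, Finset.sum_const_zero]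
    refine Finset.sum_congr rfl fun a _ => Finset.sum_congr rfl fun b _ => ?_
    simp only [mul_comm]
  rw [e]
  refine lim.congr' ?_
  filter_upwards [self_mem_nhdsWithin] with ε hε
  have hε : 0 < ε := hε
  have Hε := H.scale hε
  set G : Fin 2 → E2 → ℝ := fun a x =>
    (scaleProfile ε f₂ x - scaleProfile ε f₁ x) * m x a.castSucc with hG
  have hα : ∀ᵐ x, topCharge (scaleProfile ε f₁) (scaleProfile ε f₂) m x
      - graphCharge (scaleProfile ε f₁) m x = -∑ a, hpd a (G a) x := by
    filter_upwards [Hε.bot.ae_differentiableAt, Hε.top.ae_differentiableAt] with x d1 d2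
    simp only [hG, Fin.sum_univ_two, hpd_thickness_mul hm _ d1 d2, topCharge, graphCharge, hdiv]
    simp
    ring
  rw [planePair_eq_dipole hε (G := G)
    (fun a => (Hε.top.sub Hε.bot).mul (hm.isProfile _))
    (fun a => (hm.hasCompactSupport_apply _).mul_left) hα
    ((isCharge_topCharge Hε hm).sub (isCharge_graphCharge Hε.bot hm)), Finset.mul_sum]
  refine Finset.sum_congr rfl fun a _ => ?_
  rw [Finset.mul_sum]
  refine Finset.sum_congr rfl fun b _ => ?_
  rw [← integral_const_mul]
  refine integral_congr_ae (Eventually.of_forall fun x => ?_)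
  simp only
  rw [← integral_const_mul]
  refine integral_congr_ae (Eventually.of_forall fun z => ?_)
  simp only [hG, scaleProfile, smul_add, smul_smul, inv_mul_cancel₀ hε.ne', one_smul]
  field_simp

/-- The magnetostatic energy of a thin film with a smooth magnetization. -/
theorem tendsto_magEnergy_filmField :
    Tendsto (fun ε => 1 / ε * magEnergy (filmField (scaleProfile ε f₁) (scaleProfile ε f₂) m))
      (𝓝[>] 0) (𝓝 (∫ x, quadForm (Ahom f₁ f₂) (m x))) := by
  have hg := isCoeff_of_isProfile (H.top.sub H.bot) fun x k => by
    rw [p₁ x k, p₂ x k]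
  have t0 : Tendsto (fun _ : ℝ => (0 : ℝ)) (𝓝[>] 0) (𝓝 0) := tendsto_const_nhds
  have t1 : Tendsto (fun ε : ℝ => ε) (𝓝[>] 0) (𝓝 0) := tendsto_id.mono_left nhdsWithin_le_nhds
  have l11 := tendsto_surface hm H.bot p₁ H.bot p₁ hg hg t0 t0
  have l22 := tendsto_surface hm H.top p₂ H.top p₂ hg hg t1 t1
  have l12 := tendsto_surface hm H.bot p₁ H.top p₂ hg hg t0 t1
  have lt := tendsto_thickness H p₁ p₂ hm
  have L := (((l11.add l22).sub (l12.const_mul 2)).add lt).const_mul (4 * Real.pi)⁻¹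
  have hpi := Real.pi_pos
  have elim : ∫ x, quadForm (Ahom f₁ f₂) (m x) = (4 * Real.pi)⁻¹ *
      (∑ i, ∑ j, surfaceMatrix f₁ f₁ i j * (∫ x, m x i * m x j)
      + ∑ i, ∑ j, surfaceMatrix f₂ f₂ i j * (∫ x, m x i * m x j)
      - 2 * ∑ i, ∑ j, surfaceMatrix f₁ f₂ i j * (∫ x, m x i * m x j)
      + ∑ i, ∑ j, thicknessMatrix f₁ f₂ i j * ∫ x, m x i * m x j) := by
    rw [integral_quadForm _ hm]
    simp only [Finset.mul_sum, ← Finset.sum_add_distrib, ← Finset.sum_sub_distrib]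
    refine Finset.sum_congr rfl fun i _ => Finset.sum_congr rfl fun j _ => ?_
    simp only [Ahom, Matrix.add_apply, Matrix.sub_apply, Matrix.smul_apply, smul_eq_mul]
    field_simp
    ring
  rw [elim]
  refine L.congr' ?_
  filter_upwards [self_mem_nhdsWithin] with ε hε
  have hε : 0 < ε := hε
  have Hε := H.scale hε
  have id := magEnergy_filmField Hε hm
  have c1 := isCharge_graphCharge Hε.bot hm
  have c2 := isCharge_topCharge Hε hm
  have m0 : Measurable fun _ : E2 => (0 : ℝ) := measurable_const
  have m1 : Measurable fun _ : E2 => (1 : ℝ) := measurable_const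
  rw [← graphCharge_scaleProfile hε, ← topCharge_scaleProfile hε]
  -- The three subtracted plane interactions have the same kernel, so with signs +, +, -2 they form
  -- the quadratic form evaluated at top charge minus bottom charge.
  have dd := scaledPair_sub_left c2 (c2.sub c1) c1 m0 m1 hε
  rw [scaledPair_sub_right c2 c2 c1 m0 m1 hε, scaledPair_sub_right c1 c2 c1 m0 m1 hε] at dd
  have sy := planePair_comm c2 c1 hε
  rw [← coulombPair_scaleProfile hε, ← coulombPair_scaleProfile hε,
    ← coulombPair_scaleProfile hε]
  unfold planePair at sy ⊢
  rw [dd]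
  have : magEnergy (filmField (scaleProfile ε f₁) (scaleProfile ε f₂) m)
      = (4 * Real.pi)⁻¹ * (4 * Real.pi *
        magEnergy (filmField (scaleProfile ε f₁) (scaleProfile ε f₂) m)) := by
    field_simp
  rw [this, id]
  linear_combination -(4 * Real.pi)⁻¹ * sy

end

/-! ### The limit energy for square integrable magnetizations -/

/-- The field `m(x')` in a layer. -/
noncomputable def layerField (h₁ h₂ : E2 → ℝ) (m : E2 → E3) : E3 → E3 :=
  (layer h₁ h₂).indicator fun x => m (horiz x)

theorem lintegral_enorm_sq {X V : Type*} [MeasurableSpace X] [NormedAddCommGroup V]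
    (μ : Measure X) (F : X → V) :
    ∫⁻ x, ENNReal.ofReal (‖F x‖ ^ 2) ∂μ = ∫⁻ x, ‖F x‖ₑ ^ 2 ∂μ := by
  refine lintegral_congr fun x => ?_
  rw [ENNReal.ofReal_pow (norm_nonneg _), ofReal_norm]

theorem integral_norm_sq_eq {X V : Type*} [MeasurableSpace X] [NormedAddCommGroup V]
    {μ : Measure X} {F : X → V} (hF : AEStronglyMeasurable F μ) :
    ∫ x, ‖F x‖ ^ 2 ∂μ = (∫⁻ x, ‖F x‖ₑ ^ 2 ∂μ).toReal := by
  rw [integral_eq_lintegral_of_nonneg_ae (Eventually.of_forall fun x => by positivity)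
    (by exact hF.norm.pow 2), lintegral_enorm_sq]

theorem memLp_two_iff_lintegral {X V : Type*} [MeasurableSpace X] [NormedAddCommGroup V]
    {μ : Measure X} {F : X → V} (hF : AEStronglyMeasurable F μ) :
    MemLp F 2 μ ↔ ∫⁻ x, ‖F x‖ₑ ^ 2 ∂μ < ⊤ := by
  rw [memLp_two_iff_integrable_sq_norm hF, Integrable, and_iff_right (by exact hF.norm.pow 2),
    hasFiniteIntegral_iff_ofReal (Eventually.of_forall fun x => by positivity),
    lintegral_enorm_sq]

theorem Lp_norm_sq_eq {X : Type*} [MeasurableSpace X] {μ : Measure X} (G : Lp E3 2 μ) :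
    ‖G‖ ^ 2 = ∫ x, ‖G x‖ ^ 2 ∂μ := by
  rw [← real_inner_self_eq_norm_sq, L2.inner_def]
  simp

theorem norm_toLp_sub_sq {X : Type*} [MeasurableSpace X] {μ : Measure X} {F G : X → E3}
    (hF : MemLp F 2 μ) (hG : MemLp G 2 μ) :
    ‖hF.toLp - hG.toLp‖ ^ 2 = ∫ x, ‖F x - G x‖ ^ 2 ∂μ := by
  rw [Lp_norm_sq_eq]
  refine integral_congr_ae ?_
  filter_upwards [Lp.coeFn_sub hF.toLp hG.toLp, hF.coeFn_toLp, hG.coeFn_toLp] with x h1 h2 h3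
  rw [h1, Pi.sub_apply, h2, h3]

section
variable {h₁ h₂ : E2 → ℝ} (H : IsFilm h₁ h₂)
include H

theorem measurable_layerField {m : E2 → E3} (hm : Measurable m) :
    Measurable (layerField h₁ h₂ m) :=
  (hm.comp continuous_horiz.measurable).indicator
    (isOpen_layer H.bot.continuous H.top.continuous).measurableSet

theorem lintegral_layerField {m : E2 → E3} (hm : Measurable m) :
    ∫⁻ x, ‖layerField h₁ h₂ m x‖ₑ ^ 2 = ∫⁻ y, ENNReal.ofReal (h₂ y - h₁ y) * ‖m y‖ₑ ^ 2 := by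
  have hS := (isOpen_layer H.bot.continuous H.top.continuous).measurableSet
  have e : ∀ x, ‖layerField h₁ h₂ m x‖ₑ ^ 2
      = (layer h₁ h₂).indicator (fun x => ‖m (horiz x)‖ₑ ^ 2) x := by
    intro x
    by_cases hx : x ∈ layer h₁ h₂
    · simp [layerField, hx]
    · simp [layerField, hx]
  have mh := continuous_horiz.measurable
  simp only [e]
  rw [lintegral_indicator hS]
  have := lintegral_layer H.bot.continuous H.top.continuous H.lt MeasurableSet.univ
    (ψ := fun x => ‖m (horiz x)‖ₑ ^ 2) (by fun_prop)
  simpa using this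

theorem memLp_layerField {m : E2 → E3} (hm : Measurable m) (hm2 : MemLp m 2) {T : ℝ}
    (hT : ∀ y, h₂ y - h₁ y ≤ T) : MemLp (layerField h₁ h₂ m) 2 volume ∧
      ∫ x, ‖layerField h₁ h₂ m x‖ ^ 2 ≤ T * ∫ y, ‖m y‖ ^ 2 := by
  have hT0 : 0 ≤ T := (sub_pos.2 (H.lt 0)).le.trans (hT 0)
  have hle : ∫⁻ x, ‖layerField h₁ h₂ m x‖ₑ ^ 2 ≤ ENNReal.ofReal T * ∫⁻ y, ‖m y‖ₑ ^ 2 := by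
    rw [lintegral_layerField H hm, ← lintegral_const_mul _ (by fun_prop)]
    exact lintegral_mono fun y => by gcongr; exact hT y
  have hfin := (memLp_two_iff_lintegral hm.aestronglyMeasurable).1 hm2
  have hM := (measurable_layerField H hm).aestronglyMeasurable (μ := volume)
  refine ⟨(memLp_two_iff_lintegral hM).2
    (hle.trans_lt (ENNReal.mul_lt_top ENNReal.ofReal_lt_top hfin)), ?_⟩
  rw [integral_norm_sq_eq hM, integral_norm_sq_eq hm.aestronglyMeasurable]
  refine (ENNReal.toReal_mono (ENNReal.mul_lt_top ENNReal.ofReal_lt_top hfin).ne hle).trans ?_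
  rw [ENNReal.toReal_mul, ENNReal.toReal_ofReal hT0]

omit H in
-- The two fields differ only in the vertical component, by (x₃ - h₁) div m, and x₃ - h₁ is at most
-- the thickness.
theorem norm_filmField_sub_layerField_le {m : E2 → E3} {T : ℝ}
    (hT : ∀ y, h₂ y - h₁ y ≤ T) (x : E3) :
    ‖filmField h₁ h₂ m x - layerField h₁ h₂ m x‖
      ≤ ‖layerField h₁ h₂ (fun y => EuclideanSpace.single 2 (T * hdiv m y)) x‖ := by
  by_cases hx : x ∈ layer h₁ h₂
  · simp only [filmField, layerField, Set.indicator_of_mem hx]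
    have e : (!₂[m (horiz x) 0, m (horiz x) 1,
        m (horiz x) 2 - (x 2 - h₁ (horiz x)) * hdiv m (horiz x)] : E3) - m (horiz x)
        = EuclideanSpace.single 2 (-((x 2 - h₁ (horiz x)) * hdiv m (horiz x))) := by
      ext i; fin_cases i <;> simp
    rw [e, PiLp.norm_single, PiLp.norm_single, norm_neg, norm_mul, norm_mul]
    refine mul_le_mul_of_nonneg_right ?_ (norm_nonneg _)
    have h1 := hx.1
    have h2 := hx.2
    have h3 := hT (horiz x)
    rw [Real.norm_of_nonneg (by linarith), Real.norm_of_nonneg (by linarith)]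
    linarith
  · simp [filmField, layerField, Set.indicator_of_notMem hx]

end

/-- A quadratic form, integrated over the plane, as a function on `L²`. -/
theorem exists_continuous_integral_quadForm (A : Matrix (Fin 3) (Fin 3) ℝ) :
    ∃ Q : Lp E3 2 (volume : Measure E2) → ℝ, Continuous Q ∧
      ∀ (m : E2 → E3) (hm : MemLp m 2), Q hm.toLp = ∫ x, quadForm A (m x) := by
  set L : E3 →L[ℝ] E3 := LinearMap.toContinuousLinearMap (Matrix.toEuclideanLin A)
  refine ⟨fun f => inner ℝ f (L.compLpL 2 volume f), by fun_prop, fun m hm => ?_⟩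
  simp only
  rw [L2.inner_def]
  refine integral_congr_ae ?_
  filter_upwards [ContinuousLinearMap.coeFn_compLpL L hm.toLp, hm.coeFn_toLp] with x h1 h2
  rw [h1, h2]
  simp [L, quadForm, EuclideanSpace.inner_eq_star_dotProduct]

section
variable {f₁ f₂ : E2 → ℝ} (H : IsFilm f₁ f₂) (p₁ : IsQPeriodic f₁) (p₂ : IsQPeriodic f₂)
include H

/-- The square root of the rescaled magnetostatic energy of a layer. -/
noncomputable def layerNorm (f₁ f₂ : E2 → ℝ) (ε : ℝ) (m : E2 → E3) : ℝ :=
  √(1 / ε) * ‖strayGradient (layerField (scaleProfile ε f₁) (scaleProfile ε f₂) m)‖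

omit H in
theorem layerNorm_sq {ε : ℝ} (hε : 0 < ε) (m : E2 → E3) : layerNorm f₁ f₂ ε m ^ 2
    = 1 / ε * magEnergy (layerField (scaleProfile ε f₁) (scaleProfile ε f₂) m) := by
  rw [layerNorm, mul_pow, Real.sq_sqrt (by positivity), magEnergy_eq_norm_sq]

theorem IsFilm.exists_thickness_le : ∃ T : ℝ, 0 < T ∧ (∀ y, f₂ y - f₁ y ≤ T) ∧
    ∀ ε : ℝ, 0 < ε → ∀ y, scaleProfile ε f₂ y - scaleProfile ε f₁ y ≤ ε * T := by
  obtain ⟨T, hT⟩ := (H.top.sub H.bot).bdd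
  have hT' : ∀ y, f₂ y - f₁ y ≤ T := fun y => (le_abs_self _).trans (hT y)
  refine ⟨T, (sub_pos.2 (H.lt 0)).trans_le (hT' 0), hT', fun ε hε y => ?_⟩
  rw [scaleProfile, scaleProfile, ← mul_sub]
  exact mul_le_mul_of_nonneg_left (hT' _) hε.le

/-- The squared L² norm over the layer is at most εT times that over the plane, and this ε cancels
the prefactor 1/ε. The Lipschitz constant √T is therefore independent of ε. -/
theorem abs_layerNorm_sub_le {T : ℝ} {ε : ℝ} (hε : 0 < ε)
    (hT : ∀ y, scaleProfile ε f₂ y - scaleProfile ε f₁ y ≤ ε * T) {m n : E2 → E3}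
    (hm : Measurable m) (hm2 : MemLp m 2 volume) (hn : Measurable n) (hn2 : MemLp n 2 volume) :
    |layerNorm f₁ f₂ ε m - layerNorm f₁ f₂ ε n| ≤ √T * ‖hm2.toLp - hn2.toLp‖ := by
  have Hε := H.scale hε
  obtain ⟨l1, -⟩ := memLp_layerField Hε hm hm2 hT
  obtain ⟨l2, -⟩ := memLp_layerField Hε hn hn2 hT
  have h := norm_strayGradient_sub_le l1 l2
  obtain ⟨-, l3⟩ := memLp_layerField Hε (hm.sub hn) (hm2.sub hn2) hT
  have e : ∀ x, layerField (scaleProfile ε f₁) (scaleProfile ε f₂) m x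
      - layerField (scaleProfile ε f₁) (scaleProfile ε f₂) n x
      = layerField (scaleProfile ε f₁) (scaleProfile ε f₂) (m - n) x := by
    intro x
    by_cases hx : x ∈ layer (scaleProfile ε f₁) (scaleProfile ε f₂) <;> simp [layerField, hx]
  simp only [e] at h
  rw [layerNorm, layerNorm, ← mul_sub, abs_mul, abs_of_nonneg (Real.sqrt_nonneg _)]
  refine (mul_le_mul_of_nonneg_left (h.trans (Real.sqrt_le_sqrt l3)) (Real.sqrt_nonneg _)).trans ?_
  have hnn : ∫ y, ‖(m - n) y‖ ^ 2 = ‖hm2.toLp - hn2.toLp‖ ^ 2 := (norm_toLp_sub_sq hm2 hn2).symm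
  rw [← Real.sqrt_mul (by positivity), hnn]
  have : 1 / ε * (ε * T * ‖hm2.toLp - hn2.toLp‖ ^ 2) = T * ‖hm2.toLp - hn2.toLp‖ ^ 2 := by
    field_simp
  rw [this, Real.sqrt_mul' _ (by positivity), Real.sqrt_sq (norm_nonneg _)]

/-- The correction has size O(ε) on a set of thickness O(ε), so its squared L² norm is O(ε³);
dividing by ε leaves O(ε²). -/
theorem tendsto_layerNorm_sub {m : E2 → E3} (hm : IsTestField m) :
    Tendsto (fun ε => layerNorm f₁ f₂ ε m
      - √(1 / ε * magEnergy (filmField (scaleProfile ε f₁) (scaleProfile ε f₂) m))) (𝓝[>] 0)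
      (𝓝 0) := by
  obtain ⟨T, hT0, -, hT⟩ := H.exists_thickness_le
  have hmm := hm.continuous.measurable
  have hm2 : MemLp m 2 := hm.continuous.memLp_of_hasCompactSupport hm.2
  set C := √(T * ∫ y, ‖(EuclideanSpace.single 2 (T * hdiv m y) : E3)‖ ^ 2)
  have hlim : Tendsto (fun ε : ℝ => ε * C) (𝓝[>] 0) (𝓝 0) := by
    have : Continuous fun ε : ℝ => ε * C := by fun_prop
    have := this.tendsto 0
    rw [zero_mul] at this
    exact this.mono_left nhdsWithin_le_nhds
  refine squeeze_zero_norm' ?_ hlim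
  filter_upwards [self_mem_nhdsWithin] with ε hε
  have hε : 0 < ε := hε
  have Hε := H.scale hε
  obtain ⟨l1, -⟩ := memLp_layerField Hε hmm hm2 (hT ε hε)
  have l2 := memLp_filmField Hε hm
  have h := norm_strayGradient_sub_le l2 l1
  have hd := hm.continuous_hdiv
  have hnc : Continuous fun y => (EuclideanSpace.single 2 (ε * T * hdiv m y) : E3) := by
    have : Continuous fun t : ℝ => (EuclideanSpace.single 2 t : E3) := by
      have := ((ContinuousLinearMap.id ℝ ℝ).smulRight
        (EuclideanSpace.single (2 : Fin 3) (1 : ℝ))).continuous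
      refine this.congr fun t => ?_
      ext i; fin_cases i <;> simp
    fun_prop
  have hnm : MemLp (fun y => (EuclideanSpace.single 2 (ε * T * hdiv m y) : E3)) 2 := by
    refine hnc.memLp_of_hasCompactSupport ?_
    exact hm.hasCompactSupport_hdiv.comp_left
      (g := fun t => (EuclideanSpace.single 2 (ε * T * t) : E3)) (by simp)
  obtain ⟨l3, l4⟩ := memLp_layerField Hε hnc.measurable hnm (hT ε hε)
  have hle : ∫ x, ‖filmField (scaleProfile ε f₁) (scaleProfile ε f₂) m x
      - layerField (scaleProfile ε f₁) (scaleProfile ε f₂) m x‖ ^ 2 ≤ ε ^ 3 * C ^ 2 := by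
    calc _ ≤ ∫ x, ‖layerField (scaleProfile ε f₁) (scaleProfile ε f₂)
            (fun y => EuclideanSpace.single 2 (ε * T * hdiv m y)) x‖ ^ 2 := by
          refine integral_mono_of_nonneg (Eventually.of_forall fun x => by positivity)
            ((memLp_two_iff_integrable_sq_norm l3.1).1 l3) (Eventually.of_forall fun x => ?_)
          exact pow_le_pow_left₀ (norm_nonneg _)
            (norm_filmField_sub_layerField_le (hT ε hε) x) 2
      _ ≤ _ := l4
      _ = ε ^ 3 * C ^ 2 := by
          rw [Real.sq_sqrt (mul_nonneg hT0.le (integral_nonneg fun y => by positivity)),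
            ← integral_const_mul, ← integral_const_mul, ← integral_const_mul]
          refine integral_congr_ae (Eventually.of_forall fun y => ?_)
          simp only [PiLp.norm_single, norm_mul, Real.norm_eq_abs, mul_pow, sq_abs]
          ring
  rw [Real.sqrt_mul (by positivity), magEnergy_eq_norm_sq, Real.sqrt_sq (norm_nonneg _),
    layerNorm, ← mul_sub, norm_mul, norm_sub_rev, Real.norm_eq_abs, Real.norm_eq_abs,
    abs_of_nonneg (Real.sqrt_nonneg _)]
  refine (mul_le_mul_of_nonneg_left (h.trans (Real.sqrt_le_sqrt hle)) (Real.sqrt_nonneg _)).trans ?_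
  rw [← Real.sqrt_mul (by positivity)]
  have : 1 / ε * (ε ^ 3 * C ^ 2) = (ε * C) ^ 2 := by field_simp
  rw [this, Real.sqrt_sq (mul_nonneg hε.le (Real.sqrt_nonneg _))]

include p₁ p₂

/-- The magnetostatic energy of a thin film with a magnetization that does not depend on `ε`. -/
theorem tendsto_magEnergy_layerField {m : E2 → E3} (hm : Measurable m) (hm2 : MemLp m 2) :
    Tendsto (fun ε => 1 / ε * magEnergy (layerField (scaleProfile ε f₁) (scaleProfile ε f₂) m))
      (𝓝[>] 0) (𝓝 (∫ x, quadForm (Ahom f₁ f₂) (m x))) := by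
  obtain ⟨T, hT0, -, hT⟩ := H.exists_thickness_le
  obtain ⟨Q, hQ, hQe⟩ := exists_continuous_integral_quadForm (Ahom f₁ f₂)
  have htest : ∀ n : E2 → E3, IsTestField n → ∀ hn2 : MemLp n 2,
      0 ≤ Q hn2.toLp ∧ Tendsto (fun ε => layerNorm f₁ f₂ ε n) (𝓝[>] 0) (𝓝 (√(Q hn2.toLp))) := by
    intro n hn hn2
    have h := tendsto_magEnergy_filmField H p₁ p₂ hn
    rw [hQe n hn2]
    refine ⟨ge_of_tendsto h ?_, ?_⟩
    · filter_upwards [self_mem_nhdsWithin] with ε hε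
      have hε : 0 < ε := hε
      rw [magEnergy_eq_norm_sq]; positivity
    · have h1 := (Real.continuous_sqrt.tendsto _).comp h
      have h2 := (tendsto_layerNorm_sub H hn).add h1
      rw [zero_add] at h2
      refine h2.congr fun ε => ?_
      simp
  have happ : ∀ δ : ℝ, 0 < δ → ∃ n : E2 → E3, ∃ hn2 : MemLp n 2 volume, IsTestField n ∧
      ‖hm2.toLp - hn2.toLp‖ ≤ δ := by
    intro δ hδ
    obtain ⟨n, n1, n2, n3⟩ := hm2.exist_eLpNorm_sub_le (by simp) (by simp) hδ
    have hn2 : MemLp n 2 := n2.continuous.memLp_of_hasCompactSupport n1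
    refine ⟨n, hn2, ⟨n2, n1⟩, ?_⟩
    rw [← MemLp.toLp_sub, Lp.norm_toLp]
    exact ENNReal.toReal_le_of_le_ofReal hδ.le n3
  -- Nonnegativity of the limit form is known for test fields, as a limit of energies, and extends
  -- by density. It allows the square root to be undone at the end.
  have hQ0 : 0 ≤ Q hm2.toLp := by
    refine le_of_forall_pos_le_add fun δ hδ => ?_
    obtain ⟨η, hη, hη'⟩ := Metric.continuousAt_iff.1 (hQ.continuousAt (x := hm2.toLp)) δ hδ
    obtain ⟨n, hn2, hn, hle⟩ := happ (η / 2) (by positivity)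
    have h1 := hη' (x := hn2.toLp) (by rw [dist_comm, dist_eq_norm]; linarith)
    rw [Real.dist_eq] at h1
    have h2 := (htest n hn hn2).1
    have := (abs_lt.1 h1).2
    linarith
  have key : Tendsto (fun ε => layerNorm f₁ f₂ ε m) (𝓝[>] 0) (𝓝 (√(Q hm2.toLp))) := by
    rw [Metric.tendsto_nhds]
    intro δ hδ
    have hcont : Continuous fun f => √(Q f) := by fun_prop
    obtain ⟨η, hη, hη'⟩ := Metric.continuousAt_iff.1 (hcont.continuousAt (x := hm2.toLp)) (δ / 4)
      (by positivity)
    -- The first bound brings the limits for n and m within δ/4; the second brings their layer norms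
    -- within δ/4, for every ε > 0 at once.
    set θ := min (η / 2) (δ / (4 * (√T + 1)))
    have hθ : 0 < θ := by positivity
    obtain ⟨n, hn2, hn, hle⟩ := happ θ hθ
    have h1 := hη' (x := hn2.toLp) (by
      rw [dist_comm, dist_eq_norm]; linarith [min_le_left (η / 2) (δ / (4 * (√T + 1)))])
    have h2 := Metric.tendsto_nhds.1 (htest n hn hn2).2 (δ / 4) (by positivity)
    filter_upwards [h2, self_mem_nhdsWithin] with ε h2 hε
    have h3 := abs_layerNorm_sub_le H hε (hT ε hε) hm hm2 hn.continuous.measurable hn2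
    have h4 : √T * ‖hm2.toLp - hn2.toLp‖ ≤ δ / 4 := by
      calc √T * ‖hm2.toLp - hn2.toLp‖ ≤ (√T + 1) * (δ / (4 * (√T + 1))) := by
            gcongr
            · linarith
            · exact hle.trans (min_le_right _ _)
        _ = δ / 4 := by have := Real.sqrt_nonneg T; field_simp
    have t1 := dist_triangle (layerNorm f₁ f₂ ε m) (layerNorm f₁ f₂ ε n) (√(Q hm2.toLp))
    have t2 := dist_triangle (layerNorm f₁ f₂ ε n) (√(Q hn2.toLp)) (√(Q hm2.toLp))
    rw [← Real.dist_eq] at h3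
    linarith
  have h := key.pow 2
  rw [Real.sq_sqrt hQ0, hQe] at h
  refine h.congr' ?_
  filter_upwards [self_mem_nhdsWithin] with ε hε
  exact layerNorm_sq hε m

end

/-! ### Mollification -/

/-- Cauchy–Schwarz against the constant one. -/
theorem lintegral_sq_le {X : Type*} [MeasurableSpace X] {ν : Measure X} {h : X → ENNReal}
    (hh : AEMeasurable h ν) : (∫⁻ x, h x ∂ν) ^ 2 ≤ ν Set.univ * ∫⁻ x, h x ^ 2 ∂ν := by
  have := ENNReal.lintegral_mul_le_Lp_mul_Lq ν (p := 2) (q := 2)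
    (Real.HolderConjugate.two_two) hh (aemeasurable_const (b := (1 : ENNReal)))
  simp only [Pi.mul_apply, mul_one, one_pow, lintegral_const, one_mul,
    ENNReal.rpow_ofNat] at this
  calc (∫⁻ x, h x ∂ν) ^ 2
      ≤ ((∫⁻ x, h x ^ 2 ∂ν) ^ (1 / 2 : ℝ) * ν Set.univ ^ (1 / 2 : ℝ)) ^ 2 := by gcongr
    _ = ν Set.univ * ∫⁻ x, h x ^ 2 ∂ν := by
      rw [mul_pow, ← ENNReal.rpow_natCast, ← ENNReal.rpow_natCast, ← ENNReal.rpow_mul,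
        ← ENNReal.rpow_mul, mul_comm]
      norm_num

/-- Mollification of a vector field. -/
noncomputable def moll (η : ContDiffBump (0 : E3)) (F : E3 → E3) : E3 → E3 :=
  convolution (η.normed volume) F (ContinuousLinearMap.lsmul ℝ ℝ) volume

section
variable (η : ContDiffBump (0 : E3))

theorem isTest_normed : IsTest (η.normed volume) :=
  ⟨η.contDiff_normed, η.hasCompactSupport_normed⟩

theorem moll_apply (F : E3 → E3) (x : E3) :
    moll η F x = ∫ y, η.normed volume (x - y) • F y := by
  rw [moll, convolution_eq_swap]; rfl

theorem contDiff_moll {F : E3 → E3} (hF : LocallyIntegrable F) : ContDiff ℝ 1 (moll η F) :=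
  η.hasCompactSupport_normed.contDiff_convolution_left _ (isTest_normed η).contDiff_one hF

theorem fderiv_moll {F : E3 → E3} (hF : LocallyIntegrable F) (x : E3) (i : Fin 3) :
    fderiv ℝ (moll η F) x (EuclideanSpace.single i 1)
      = ∫ y, pd i (η.normed volume) (x - y) • F y := by
  have hN := isTest_normed η
  have h := hN.2.hasFDerivAt_convolution_left (ContinuousLinearMap.lsmul ℝ ℝ) hN.contDiff_one hF x
  have hc : ConvolutionExistsAt (fderiv ℝ (η.normed volume)) F x
      ((ContinuousLinearMap.lsmul ℝ ℝ : ℝ →L[ℝ] E3 →L[ℝ] E3).precompL E3) volume :=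
    (hN.2.fderiv ℝ).convolutionExists_left _
      (hN.contDiff_one.continuous_fderiv one_ne_zero) hF x
  rw [moll, h.fderiv, convolution, ContinuousLinearMap.integral_apply hc]
  rw [← integral_sub_left_eq_self _ volume x]
  refine integral_congr_ae (Eventually.of_forall fun y => ?_)
  simp [pd]

/-- When the closed ball of the mollifier radius around x lies in U, the function y ↦ η(x - y) is an
admissible test function in the definition of the weak derivative. -/
theorem moll_of_isWeakPartial {U : Set E3} {F g : E3 → E3} {i : Fin 3}
    (hw : IsWeakPartial U i F g) (hF0 : ∀ y ∉ U, F y = 0) (hg0 : ∀ y ∉ U, g y = 0)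
    (hF : LocallyIntegrable F) {x : E3} (hx : Metric.closedBall x η.rOut ⊆ U) :
    fderiv ℝ (moll η F) x (EuclideanSpace.single i 1) = moll η g x := by
  have hN := isTest_normed η
  have hφ : IsTest fun y => η.normed volume (x - y) :=
    ⟨hN.1.comp (contDiff_const.sub contDiff_id), hN.2.comp_homeomorph (Homeomorph.subLeft x)⟩
  have hsupp : tsupport (fun y => η.normed volume (x - y)) ⊆ U := by
    refine subset_trans ?_ hx
    refine closure_minimal (fun y hy => ?_) Metric.isClosed_closedBall
    have : x - y ∈ Function.support (η.normed volume) := hy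
    rw [η.support_normed_eq] at this
    have h1 : ‖x - y‖ < η.rOut := by simpa using this
    rw [Metric.mem_closedBall, dist_comm, dist_eq_norm]
    exact h1.le
  have e : ∀ y, fderiv ℝ (fun y => η.normed volume (x - y)) y (EuclideanSpace.single i 1)
      = -pd i (η.normed volume) (x - y) := by
    intro y
    have h1 : HasFDerivAt (fun y : E3 => x - y) (-ContinuousLinearMap.id ℝ E3) y :=
      (hasFDerivAt_id y).const_sub x
    have h2 : HasFDerivAt (fun y => η.normed volume (x - y)) _ y :=
      (hN.differentiable (x - y)).hasFDerivAt.comp y h1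
    rw [h2.fderiv]
    simp [pd]
  have h := hw _ hφ hsupp
  rw [setIntegral_eq_integral_of_forall_compl_eq_zero fun y hy => by rw [hF0 y hy, smul_zero],
    setIntegral_eq_integral_of_forall_compl_eq_zero fun y hy => by rw [hg0 y hy, smul_zero]] at h
  simp only [e, neg_smul, integral_neg, neg_inj] at h
  rw [fderiv_moll η hF, moll_apply, h]

theorem lintegral_normed (x : E3) : ∫⁻ y, ENNReal.ofReal (η.normed volume (x - y)) = 1 := by
  rw [lintegral_sub_left_eq_self (fun y => ENNReal.ofReal (η.normed volume y)) x,
    ← ofReal_integral_eq_lintegral_ofReal (isTest_normed η).integrable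
      (Eventually.of_forall η.nonneg_normed), η.integral_normed, ENNReal.ofReal_one]

theorem measurable_normed (x : E3) :
    Measurable fun y => ENNReal.ofReal (η.normed volume (x - y)) := by
  have := (isTest_normed η).continuous
  exact ENNReal.measurable_ofReal.comp (Continuous.measurable (by fun_prop))

/-- Jensen's inequality for the square: the mollifier is a probability density. -/
theorem enorm_moll_sq_le {g : E3 → E3} (hg : Measurable g) (x : E3) :
    ‖moll η g x‖ₑ ^ 2 ≤ ∫⁻ y, ENNReal.ofReal (η.normed volume (x - y)) * ‖g y‖ₑ ^ 2 := by
  set ν := (volume : Measure E3).withDensity fun y => ENNReal.ofReal (η.normed volume (x - y))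
  have hm := measurable_normed η x
  have h1 : ‖moll η g x‖ₑ ≤ ∫⁻ y, ‖g y‖ₑ ∂ν := by
    rw [moll_apply, lintegral_withDensity_eq_lintegral_mul _ hm (by fun_prop)]
    refine (enorm_integral_le_lintegral_enorm _).trans (lintegral_mono fun y => ?_)
    rw [enorm_smul, Pi.mul_apply, Real.enorm_of_nonneg (η.nonneg_normed _)]
  have h2 := lintegral_sq_le (ν := ν) (h := fun y => ‖g y‖ₑ) (by fun_prop)
  have h3 : ν Set.univ = 1 := by
    rw [withDensity_apply _ MeasurableSet.univ, setLIntegral_univ, lintegral_normed]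
  have h4 : ∫⁻ y, ‖g y‖ₑ ^ 2 ∂ν
      = ∫⁻ y, ENNReal.ofReal (η.normed volume (x - y)) * ‖g y‖ₑ ^ 2 :=
    lintegral_withDensity_eq_lintegral_mul _ hm (by fun_prop)
  rw [h3, one_mul, h4] at h2
  exact (pow_le_pow_left' h1 2).trans h2

/-- Tonelli's theorem and unit mass of the mollifier. Mass is moved by less than the outer radius,
so the target set only has to contain that neighbourhood. -/
theorem lintegral_moll_le {Γ : E3 → ENNReal} (hΓ : Measurable Γ) {K K' : Set E3}
    (hK : MeasurableSet K) (hK' : MeasurableSet K')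
    (h : ∀ x ∈ K, ∀ y, ‖x - y‖ < η.rOut → y ∈ K') :
    ∫⁻ x in K, ∫⁻ y, ENNReal.ofReal (η.normed volume (x - y)) * Γ y ≤ ∫⁻ y in K', Γ y := by
  have hc := (isTest_normed η).continuous
  have hm : Measurable fun p : E3 × E3 => ENNReal.ofReal (η.normed volume (p.1 - p.2)) :=
    ENNReal.measurable_ofReal.comp (Continuous.measurable (by fun_prop))
  have e : ∀ x ∈ K, ∫⁻ y, ENNReal.ofReal (η.normed volume (x - y)) * Γ y
      ≤ ∫⁻ y in K', ENNReal.ofReal (η.normed volume (x - y)) * Γ y := by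
    intro x hx
    rw [← lintegral_indicator hK']
    refine lintegral_mono fun y => ?_
    by_cases hy : y ∈ K'
    · rw [Set.indicator_of_mem hy]
    · have : η.normed volume (x - y) = 0 := by
        by_contra h0
        have h1 : x - y ∈ Function.support (η.normed volume) := h0
        rw [η.support_normed_eq] at h1
        exact hy (h x hx y (by simpa using h1))
      simp [this]
  refine (setLIntegral_mono' hK e).trans ?_
  rw [lintegral_lintegral_swap (by fun_prop)]
  refine lintegral_mono fun y => ?_
  simp only
  rw [lintegral_mul_const _ (by fun_prop)]
  refine (mul_le_mul_left (setLIntegral_le_lintegral _ _) _).trans ?_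
  have : ∫⁻ x, ENNReal.ofReal (η.normed volume (x - y)) = 1 := by
    rw [lintegral_sub_right_eq_self (fun x => ENNReal.ofReal (η.normed volume x)) y]
    have := lintegral_normed η 0
    rw [lintegral_sub_left_eq_self (fun y => ENNReal.ofReal (η.normed volume y)) 0] at this
    exact this
  rw [this, one_mul]

end

/-! ### Flattening a layer -/

/-- The map from the flat layer `0 < x₃ < 1` onto the layer between two graphs. -/
noncomputable def flat (h₁ h₂ : E2 → ℝ) (x : E3) : E3 :=
  join (horiz x) (h₁ (horiz x) + x 2 * (h₂ (horiz x) - h₁ (horiz x)))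

/-- The flat cylinder over `D`. -/
def cylinder (D : Set E2) : Set E3 := horiz ⁻¹' D ∩ layer (fun _ => 0) (fun _ => 1)

theorem measurableSet_cylinder {D : Set E2} (hD : MeasurableSet D) :
    MeasurableSet (cylinder D) :=
  (continuous_horiz.measurable hD).inter
    (isOpen_layer continuous_const continuous_const).measurableSet

theorem lintegral_cylinder {D : Set E2} (hD : MeasurableSet D) {ψ : E3 → ENNReal}
    (hψ : Measurable ψ) :
    ∫⁻ x in cylinder D, ψ x = ∫⁻ y in D, ∫⁻ t in Set.Ioo (0 : ℝ) 1, ψ (join y t) := by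
  rw [cylinder, lintegral_layer continuous_const continuous_const (fun _ => zero_lt_one) hD hψ]
  simp

theorem volume_cylinder {D : Set E2} (hD : MeasurableSet D) :
    volume (cylinder D) = volume D := by
  have := lintegral_cylinder hD (ψ := fun _ => 1) measurable_const
  simpa using this

section
variable {h₁ h₂ : E2 → ℝ} (c₁ : Continuous h₁) (c₂ : Continuous h₂) (h : ∀ y, h₁ y < h₂ y)
  {D : Set E2} (hD : MeasurableSet D) {ψ : E3 → ENNReal} (hψ : Measurable ψ)
include c₁ c₂

theorem continuous_flat : Continuous (flat h₁ h₂) := by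
  unfold flat; fun_prop

include h hD hψ

/-- The Jacobian of the flattening is the thickness h₂ - h₁, here bounded below by `c`. -/
theorem lintegral_flat_le {c : ℝ} (hc : 0 < c) (hle : ∀ y, c ≤ h₂ y - h₁ y) :
    ∫⁻ x in cylinder D, ψ (flat h₁ h₂ x)
      ≤ ENNReal.ofReal c⁻¹ * ∫⁻ x in horiz ⁻¹' D ∩ layer h₁ h₂, ψ x := by
  have hf := continuous_flat c₁ c₂
  have mψ : Measurable fun p : E2 × ℝ => ψ (join p.1 (h₁ p.1 + p.2 * (h₂ p.1 - h₁ p.1))) :=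
    hψ.comp (Continuous.measurable (by fun_prop))
  have m1 : Measurable fun y => ∫⁻ t in Set.Ioo (0 : ℝ) 1,
      ψ (join y (h₁ y + t * (h₂ y - h₁ y))) := mψ.lintegral_prod_right'
  rw [lintegral_cylinder hD (ψ := fun x => ψ (flat h₁ h₂ x)) (hψ.comp hf.measurable),
    lintegral_layer c₁ c₂ h hD hψ, ← lintegral_const_mul _ (by fun_prop)]
  refine lintegral_mono fun y => ?_
  simp only [flat, horiz_join, join_two]
  rw [← mul_assoc, ← ENNReal.ofReal_mul (by positivity)]
  refine le_mul_of_one_le_left' ?_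
  rw [← ENNReal.ofReal_one]
  refine ENNReal.ofReal_le_ofReal ?_
  rw [inv_mul_eq_div, le_div_iff₀ hc]
  linarith [hle y]

theorem lintegral_layer_le_flat {T : ℝ} (hle : ∀ y, h₂ y - h₁ y ≤ T) :
    ∫⁻ x in horiz ⁻¹' D ∩ layer h₁ h₂, ψ x
      ≤ ENNReal.ofReal T * ∫⁻ x in cylinder D, ψ (flat h₁ h₂ x) := by
  have hf := continuous_flat c₁ c₂
  have mψ : Measurable fun p : E2 × ℝ => ψ (join p.1 (h₁ p.1 + p.2 * (h₂ p.1 - h₁ p.1))) :=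
    hψ.comp (Continuous.measurable (by fun_prop))
  have m1 : Measurable fun y => ∫⁻ t in Set.Ioo (0 : ℝ) 1,
      ψ (join y (h₁ y + t * (h₂ y - h₁ y))) := mψ.lintegral_prod_right'
  rw [lintegral_cylinder hD (ψ := fun x => ψ (flat h₁ h₂ x)) (hψ.comp hf.measurable),
    lintegral_layer c₁ c₂ h hD hψ]
  simp only [flat, horiz_join, join_two]
  rw [← lintegral_const_mul _ m1]
  exact lintegral_mono fun y => mul_le_mul_left (ENNReal.ofReal_le_ofReal (hle y)) _

omit hψ in
-- The lower bound on the Jacobian makes preimages of null sets null. The property need not be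
-- measurable, so a measurable hull of the exceptional set is used.
theorem ae_flat {c : ℝ} (hc : 0 < c) (hle : ∀ y, c ≤ h₂ y - h₁ y) {p : E3 → Prop}
    (hp : ∀ᵐ x ∂(volume.restrict (horiz ⁻¹' D ∩ layer h₁ h₂)), p x) :
    ∀ᵐ x ∂(volume.restrict (cylinder D)), p (flat h₁ h₂ x) := by
  set μ := volume.restrict (horiz ⁻¹' D ∩ layer h₁ h₂)
  set N := toMeasurable μ {x | ¬ p x}
  have hN : MeasurableSet N := measurableSet_toMeasurable _ _
  have hN0 : μ N = 0 := by rw [measure_toMeasurable]; exact hp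
  have h1 := lintegral_flat_le c₁ c₂ h hD (ψ := N.indicator 1)
    (measurable_one.indicator hN) hc hle
  change _ ≤ ENNReal.ofReal c⁻¹ * ∫⁻ x, _ ∂μ at h1
  rw [lintegral_indicator_one hN, hN0, mul_zero, nonpos_iff_eq_zero,
    lintegral_eq_zero_iff (f := fun x => N.indicator 1 (flat h₁ h₂ x)) ((measurable_one.indicator hN).comp
      (continuous_flat c₁ c₂).measurable)] at h1
  filter_upwards [h1] with x hx
  by_contra hcon
  have : flat h₁ h₂ x ∈ N := subset_toMeasurable _ _ hcon
  simp [Set.indicator_of_mem this] at hx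

end

/-! ### Increments along flattened segments -/

/-- The weighted density `β²(|g₀|² + |g₁|²) + γ²|g₂|²`. -/
noncomputable def gradDensity (β γ : ℝ) (g : Fin 3 → E3 → E3) (x : E3) : ENNReal :=
  ENNReal.ofReal (β ^ 2) * ‖g 0 x‖ₑ ^ 2 + ENNReal.ofReal (β ^ 2) * ‖g 1 x‖ₑ ^ 2
    + ENNReal.ofReal (γ ^ 2) * ‖g 2 x‖ₑ ^ 2

/-- The partial derivatives of a vector field. -/
noncomputable def vpd (v : E3 → E3) (i : Fin 3) (x : E3) : E3 :=
  fderiv ℝ v x (EuclideanSpace.single i 1)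

theorem continuous_vpd {v : E3 → E3} (hv : ContDiff ℝ 1 v) (i : Fin 3) : Continuous (vpd v i) :=
  (hv.continuous_fderiv one_ne_zero).clm_apply continuous_const

/-- A bound for the increments of `v` along a flattened segment. -/
noncomputable def slopeBound (β γ : ℝ) (v : E3 → E3) (x : E3) : ℝ :=
  β * ‖vpd v 0 x‖ + β * ‖vpd v 1 x‖ + γ * ‖vpd v 2 x‖

/-- The square of a sum of three terms is at most three times the sum of their squares. -/
theorem ofReal_slopeBound_sq_le {β γ : ℝ} (v : E3 → E3) (x : E3) :
    ENNReal.ofReal (slopeBound β γ v x) ^ 2 ≤ 3 * gradDensity β γ (vpd v) x := by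
  have e : 3 * gradDensity β γ (vpd v) x = ENNReal.ofReal (3 * (β ^ 2 * ‖vpd v 0 x‖ ^ 2
      + β ^ 2 * ‖vpd v 1 x‖ ^ 2 + γ ^ 2 * ‖vpd v 2 x‖ ^ 2)) := by
    rw [ENNReal.ofReal_mul (by norm_num), ENNReal.ofReal_add (by positivity) (by positivity),
      ENNReal.ofReal_add (by positivity) (by positivity), ENNReal.ofReal_mul (by positivity),
      ENNReal.ofReal_mul (by positivity), ENNReal.ofReal_mul (by positivity),
      ENNReal.ofReal_pow (norm_nonneg _), ENNReal.ofReal_pow (norm_nonneg _),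
      ENNReal.ofReal_pow (norm_nonneg _), ofReal_norm, ofReal_norm, ofReal_norm]
    simp [gradDensity]
  rw [e]
  rcases le_total 0 (slopeBound β γ v x) with h0 | h0
  · rw [← ENNReal.ofReal_pow h0]
    refine ENNReal.ofReal_le_ofReal ?_
    rw [slopeBound]
    nlinarith [sq_nonneg (β * ‖vpd v 0 x‖ - β * ‖vpd v 1 x‖),
      sq_nonneg (β * ‖vpd v 0 x‖ - γ * ‖vpd v 2 x‖), sq_nonneg (β * ‖vpd v 1 x‖ - γ * ‖vpd v 2 x‖)]
  · rw [ENNReal.ofReal_of_nonpos h0]; simp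

theorem norm_le_sum_abs (x : E3) : ‖x‖ ≤ |x 0| + |x 1| + |x 2| := by
  have e : x = x 0 • EuclideanSpace.single 0 (1 : ℝ) + x 1 • EuclideanSpace.single 1 (1 : ℝ)
      + x 2 • EuclideanSpace.single 2 (1 : ℝ) := by
    ext i; fin_cases i <;> simp
  conv_lhs => rw [e]
  refine (norm_add₃_le).trans ?_
  simp [norm_smul]

theorem norm_clm_apply_le (L : E3 →L[ℝ] E3) (x : E3) :
    ‖L x‖ ≤ |x 0| * ‖L (EuclideanSpace.single 0 1)‖ + |x 1| * ‖L (EuclideanSpace.single 1 1)‖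
      + |x 2| * ‖L (EuclideanSpace.single 2 1)‖ := by
  have e : x = x 0 • EuclideanSpace.single 0 (1 : ℝ) + x 1 • EuclideanSpace.single 1 (1 : ℝ)
      + x 2 • EuclideanSpace.single 2 (1 : ℝ) := by
    ext i; fin_cases i <;> simp
  conv_lhs => rw [e]
  rw [map_add, map_add, map_smul, map_smul, map_smul]
  refine (norm_add₃_le).trans ?_
  simp [norm_smul]

theorem horiz_segment (p q : E3) (s : ℝ) :
    horiz (p + s • (q - p)) = horiz p + s • (horiz q - horiz p) := by
  ext i; fin_cases i <;> simp

section
variable {h₁ h₂ : E2 → ℝ} {Λ : NNReal} (L₁ : LipschitzWith Λ h₁) (L₂ : LipschitzWith Λ h₂)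
  {T : ℝ} (h0 : ∀ y, 0 ≤ h₂ y - h₁ y) (hT : ∀ y, h₂ y - h₁ y ≤ T)
  {p q : E3} (hp : p 2 ∈ Set.Icc (0 : ℝ) 1) (hq : q 2 ∈ Set.Icc (0 : ℝ) 1) {ℓ : ℝ}
  (hl : ‖horiz q - horiz p‖ ≤ ℓ)
include L₁ L₂ h0 hT hp hq hl

/-- The height over y at relative height t is (1 - t)h₁ + t h₂. It changes through the graphs, at
rate at most Λℓ, and through t, at rate at most the thickness T. -/
theorem abs_flat_segment_sub_le {s z : ℝ} (hz : z ∈ Set.Icc (0 : ℝ) 1) (hsz : s ≤ z) :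
    |flat h₁ h₂ (p + z • (q - p)) 2 - flat h₁ h₂ (p + s • (q - p)) 2| ≤ (z - s) * (Λ * ℓ + T) := by
  set y := horiz (p + s • (q - p)) with hy
  set y' := horiz (p + z • (q - p)) with hy'
  set t := (p + s • (q - p)) 2 with ht
  set t' := (p + z • (q - p)) 2 with ht'
  have et : t = p 2 + s * (q 2 - p 2) := by simp [ht]
  have et' : t' = p 2 + z * (q 2 - p 2) := by simp [ht']
  have t0 : 0 ≤ t' := by rw [et']; nlinarith [hp.1, hp.2, hq.1, hq.2, hz.1, hz.2]
  have t1 : t' ≤ 1 := by rw [et']; nlinarith [hp.1, hp.2, hq.1, hq.2, hz.1, hz.2]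
  have dy : dist y' y ≤ (z - s) * ℓ := by
    rw [dist_eq_norm, hy, hy', horiz_segment, horiz_segment, add_sub_add_left_eq_sub, ← sub_smul,
      norm_smul, Real.norm_of_nonneg (sub_nonneg.2 hsz)]
    exact mul_le_mul_of_nonneg_left hl (sub_nonneg.2 hsz)
  have d1 : |h₁ y' - h₁ y| ≤ Λ * ((z - s) * ℓ) :=
    (L₁.dist_le_mul y' y).trans (mul_le_mul_of_nonneg_left dy Λ.2)
  have d2 : |h₂ y' - h₂ y| ≤ Λ * ((z - s) * ℓ) :=
    (L₂.dist_le_mul y' y).trans (mul_le_mul_of_nonneg_left dy Λ.2)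
  have dt : |t' - t| ≤ z - s := by
    rw [et, et', add_sub_add_left_eq_sub, ← sub_mul, abs_mul, abs_of_nonneg (sub_nonneg.2 hsz)]
    refine mul_le_of_le_one_right (sub_nonneg.2 hsz) ?_
    rw [abs_le]; constructor <;> linarith [hp.1, hp.2, hq.1, hq.2]
  have e : flat h₁ h₂ (p + z • (q - p)) 2 - flat h₁ h₂ (p + s • (q - p)) 2
      = (1 - t') * (h₁ y' - h₁ y) + t' * (h₂ y' - h₂ y) + (t' - t) * (h₂ y - h₁ y) := by
    simp only [flat, join_two]
    ring
  rw [e]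
  calc |(1 - t') * (h₁ y' - h₁ y) + t' * (h₂ y' - h₂ y) + (t' - t) * (h₂ y - h₁ y)|
      ≤ (1 - t') * |h₁ y' - h₁ y| + t' * |h₂ y' - h₂ y| + |t' - t| * (h₂ y - h₁ y) := by
        refine (abs_add_le _ _).trans (add_le_add ((abs_add_le _ _).trans ?_) ?_)
        · rw [abs_mul, abs_mul, abs_of_nonneg t0, abs_of_nonneg (sub_nonneg.2 t1)]
        · rw [abs_mul, abs_of_nonneg (h0 y)]
    _ ≤ (1 - t') * (Λ * ((z - s) * ℓ)) + t' * (Λ * ((z - s) * ℓ)) + (z - s) * T := by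
        gcongr
        · exact h0 y
        · exact hT y
    _ = (z - s) * (Λ * ℓ + T) := by ring

/-- A flattened segment is only Lipschitz, since the graphs need not be differentiable along it, so
the chain rule is not available. Instead one-sided difference quotients of |v(X s) - v(X 0)| are
compared with the density `slopeBound`. -/
theorem norm_sub_flat_le {v : E3 → E3} (hv : ContDiff ℝ 1 v) :
    ‖v (flat h₁ h₂ q) - v (flat h₁ h₂ p)‖
      ≤ ∫ s in (0 : ℝ)..1, slopeBound ℓ (Λ * ℓ + T) v (flat h₁ h₂ (p + s • (q - p))) := by
  have hℓ : 0 ≤ ℓ := (norm_nonneg _).trans hl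
  have hT0 : 0 ≤ T := (h0 0).trans (hT 0)
  set γ : ℝ := Λ * ℓ + T
  have hγ : 0 ≤ γ := by positivity
  have hfc := continuous_flat L₁.continuous L₂.continuous
  set X : ℝ → E3 := fun s => flat h₁ h₂ (p + s • (q - p))
  have hX : Continuous X := by fun_prop
  have hvc := hv.continuous
  set G : ℝ → ℝ := fun s => slopeBound ℓ γ v (X s) with hG
  have hGc : Continuous G := by
    have h0 := (continuous_vpd hv 0).comp hX
    have h1 := (continuous_vpd hv 1).comp hX
    have h2 := (continuous_vpd hv 2).comp hX
    exact ((continuous_const.mul h0.norm).add (continuous_const.mul h1.norm)).add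
      (continuous_const.mul h2.norm)
  have key := image_le_of_liminf_slope_right_le_deriv_boundary (a := 0) (b := 1)
    (f := fun s => ‖v (X s) - v (X 0)‖) (B := fun s => ∫ r in (0 : ℝ)..s, G r) (B' := G)
    (by fun_prop) (by simp) ?_ ?_ ?_ (Set.right_mem_Icc.2 zero_le_one)
  · have e1 : X 1 = flat h₁ h₂ q := by simp [X]
    have e0 : X 0 = flat h₁ h₂ p := by simp [X]
    rw [e1, e0] at key
    exact key
  · exact (intervalIntegral.continuous_primitive
      (fun a b => hGc.intervalIntegrable a b) 0).continuousOn
  · intro s _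
    exact (intervalIntegral.integral_hasDerivAt_right (hGc.intervalIntegrable _ _)
      (hGc.stronglyMeasurableAtFilter _ _) hGc.continuousAt).hasDerivWithinAt
  · intro s hs r hr
    refine Eventually.frequently ?_
    -- The tolerance in the differentiability of v is chosen so that c(2ℓ + γ), the error per unit
    -- of parameter, stays below the gap r - G s.
    set c := (r - G s) / (2 * (2 * ℓ + γ + 1))
    have hc : 0 < c := div_pos (sub_pos.2 hr) (by positivity)
    have hd : HasFDerivAt v (fderiv ℝ v (X s)) (X s) :=
      (hv.differentiable one_ne_zero (X s)).hasFDerivAt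
    have h1 := (hd.isLittleO.def hc)
    have h2 := (hX.tendsto s).eventually h1
    filter_upwards [h2.filter_mono nhdsWithin_le_nhds, Ioo_mem_nhdsGT hs.2] with z hz hz'
    have hzs : 0 < z - s := sub_pos.2 hz'.1
    have hz1 : z ∈ Set.Icc (0 : ℝ) 1 := ⟨hs.1.trans hz'.1.le, hz'.2.le⟩
    have a2 : |(X z - X s) 2| ≤ (z - s) * γ := by
      exact abs_flat_segment_sub_le L₁ L₂ h0 hT hp hq hl hz1 hz'.1.le
    have aux : ∀ i : Fin 2, |(z - s) * (horiz q - horiz p) i| ≤ (z - s) * ℓ := by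
      intro i
      rw [abs_mul, abs_of_pos hzs]
      exact mul_le_mul_of_nonneg_left ((PiLp.norm_apply_le _ i).trans hl) hzs.le
    have a0 : |(X z - X s) 0| ≤ (z - s) * ℓ := by
      have : (X z - X s) 0 = (z - s) * (horiz q - horiz p) 0 := by
        simp [X, flat]; ring
      rw [this]; exact aux 0
    have a1 : |(X z - X s) 1| ≤ (z - s) * ℓ := by
      have : (X z - X s) 1 = (z - s) * (horiz q - horiz p) 1 := by
        simp [X, flat]; ring
      rw [this]; exact aux 1
    have n1 : ‖X z - X s‖ ≤ (z - s) * (2 * ℓ + γ) := by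
      have := norm_le_sum_abs (X z - X s)
      linarith
    have n2 : ‖fderiv ℝ v (X s) (X z - X s)‖ ≤ (z - s) * G s := by
      refine (norm_clm_apply_le _ _).trans ?_
      have : (z - s) * G s = (z - s) * ℓ * ‖vpd v 0 (X s)‖ + (z - s) * ℓ * ‖vpd v 1 (X s)‖
          + (z - s) * γ * ‖vpd v 2 (X s)‖ := by simp only [hG, slopeBound]; ring
      rw [this]
      simp only [vpd]
      gcongr
    have n3 : ‖v (X z) - v (X s)‖ ≤ (z - s) * (G s + c * (2 * ℓ + γ)) := by
      have := norm_add_le (v (X z) - v (X s) - fderiv ℝ v (X s) (X z - X s))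
        (fderiv ℝ v (X s) (X z - X s))
      rw [sub_add_cancel] at this
      have h3 := mul_le_mul_of_nonneg_left n1 hc.le
      linarith
    have n4 : ‖v (X z) - v (X 0)‖ - ‖v (X s) - v (X 0)‖ ≤ ‖v (X z) - v (X s)‖ := by
      have := norm_sub_norm_le (v (X z) - v (X 0)) (v (X s) - v (X 0))
      rwa [sub_sub_sub_cancel_right] at this
    have n5 : c * (2 * ℓ + γ) < r - G s := by
      have : c * (2 * ℓ + γ) = (r - G s) * ((2 * ℓ + γ) / (2 * (2 * ℓ + γ + 1))) := by
        simp only [c]; field_simp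
      rw [this]
      refine mul_lt_of_lt_one_right (sub_pos.2 hr) ?_
      rw [div_lt_one (by positivity)]
      linarith
    rw [slope_def_field, div_lt_iff₀ hzs]
    have n6 : (z - s) * (G s + c * (2 * ℓ + γ)) < (z - s) * r :=
      mul_lt_mul_of_pos_left (by linarith) hzs
    linarith

theorem enorm_sub_flat_sq_le {v : E3 → E3} (hv : ContDiff ℝ 1 v) :
    ‖v (flat h₁ h₂ q) - v (flat h₁ h₂ p)‖ₑ ^ 2
      ≤ ∫⁻ s in Set.Ioc (0 : ℝ) 1,
        3 * gradDensity ℓ (Λ * ℓ + T) (vpd v) (flat h₁ h₂ (p + s • (q - p))) := by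
  have hℓ : 0 ≤ ℓ := (norm_nonneg _).trans hl
  have hT0 : 0 ≤ T := (h0 0).trans (hT 0)
  have hfc := continuous_flat L₁.continuous L₂.continuous
  have hX : Continuous fun s : ℝ => flat h₁ h₂ (p + s • (q - p)) := by fun_prop
  have hGc : Continuous fun s : ℝ =>
      slopeBound ℓ (Λ * ℓ + T) v (flat h₁ h₂ (p + s • (q - p))) := by
    have h0 := (continuous_vpd hv 0).comp hX
    have h1 := (continuous_vpd hv 1).comp hX
    have h2 := (continuous_vpd hv 2).comp hX
    exact ((continuous_const.mul h0.norm).add (continuous_const.mul h1.norm)).add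
      (continuous_const.mul h2.norm)
  have hG0 : ∀ x, 0 ≤ slopeBound ℓ (Λ * ℓ + T) v x := fun x => by
    rw [slopeBound]; positivity
  have h1 := norm_sub_flat_le L₁ L₂ h0 hT hp hq hl hv
  rw [intervalIntegral.integral_of_le zero_le_one,
    integral_eq_lintegral_of_nonneg_ae (Eventually.of_forall fun s => hG0 _)
      hGc.aestronglyMeasurable] at h1
  have h2 : ‖v (flat h₁ h₂ q) - v (flat h₁ h₂ p)‖ₑ ≤ ∫⁻ s in Set.Ioc (0 : ℝ) 1,
      ENNReal.ofReal (slopeBound ℓ (Λ * ℓ + T) v (flat h₁ h₂ (p + s • (q - p)))) := by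
    rw [← ofReal_norm]
    exact (ENNReal.ofReal_le_ofReal h1).trans ENNReal.ofReal_toReal_le
  refine (pow_le_pow_left' h2 2).trans ((lintegral_sq_le ?_).trans ?_)
  · exact hGc.measurable.ennreal_ofReal.aemeasurable
  · simp only [Measure.restrict_apply_univ, Real.volume_Ioc, sub_zero, ENNReal.ofReal_one, one_mul]
    exact lintegral_mono fun s => ofReal_slopeBound_sq_le v _

end

/-! ### Averaging over segments of a convex set -/

/-- The map q ↦ p + s(q - p) keeps the convex set X inside itself and has Jacobian s³ ≥ 1/8. -/
theorem lintegral_segment_le {X : Set E3} (hX : MeasurableSet X) (hc : Convex ℝ X)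
    {h : E3 → ENNReal} (hh : Measurable h) {s : ℝ} (hs : 1 / 2 ≤ s) (hs1 : s ≤ 1) {p : E3}
    (hp : p ∈ X) : ∫⁻ q in X, h (p + s • (q - p)) ≤ 8 * ∫⁻ q in X, h q := by
  have hs0 : 0 < s := by linarith
  have h1 : ∫⁻ q in X, h (p + s • (q - p)) ≤ ∫⁻ q, X.indicator h (s • q + (p - s • p)) := by
    rw [← lintegral_indicator hX]
    refine lintegral_mono fun q => ?_
    by_cases hq : q ∈ X
    · rw [Set.indicator_of_mem hq]
      have e : s • q + (p - s • p) = p + s • (q - p) := by rw [smul_sub]; abel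
      have hmem : p + s • (q - p) ∈ X := hc.add_smul_sub_mem hp hq ⟨hs0.le, hs1⟩
      rw [e, Set.indicator_of_mem hmem]
    · rw [Set.indicator_of_notMem hq]; exact zero_le
  have mi : Measurable (X.indicator h) := hh.indicator hX
  have h2 : ∫⁻ q, X.indicator h (s • q + (p - s • p))
      = ENNReal.ofReal |(s ^ 3)⁻¹| * ∫⁻ q, X.indicator h q := by
    have := lintegral_map (μ := (volume : Measure E3)) (f := fun q => X.indicator h (q + (p - s • p)))
      (g := fun q : E3 => s • q) (by fun_prop) (by fun_prop)
    rw [← this, Measure.map_addHaar_smul _ hs0.ne', lintegral_smul_measure,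
      lintegral_add_right_eq_self (fun q => X.indicator h q)]
    simp
  rw [h2, lintegral_indicator hX] at h1
  refine h1.trans ?_
  gcongr
  have : (8 : ENNReal) = ENNReal.ofReal 8 := by simp
  rw [this]
  refine ENNReal.ofReal_le_ofReal ?_
  rw [abs_of_pos (by positivity), inv_le_comm₀ (by positivity) (by norm_num)]
  calc (8 : ℝ)⁻¹ = (1 / 2) ^ 3 := by norm_num
    _ ≤ s ^ 3 := by gcongr

/-- For s < 1/2 the contraction in q degenerates, but p + s(q - p) = q + (1 - s)(p - q), so the
roles of the two endpoints are exchanged. -/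
theorem lintegral_pair_segment_le {X : Set E3} (hX : MeasurableSet X) (hc : Convex ℝ X)
    {h : E3 → ENNReal} (hh : Measurable h) {s : ℝ} (hs : s ∈ Set.Ioc (0 : ℝ) 1) :
    ∫⁻ p in X, ∫⁻ q in X, h (p + s • (q - p)) ≤ volume X * (8 * ∫⁻ q in X, h q) := by
  have half : ∀ s : ℝ, 1 / 2 ≤ s → s ≤ 1 →
      ∫⁻ p in X, ∫⁻ q in X, h (p + s • (q - p)) ≤ volume X * (8 * ∫⁻ q in X, h q) := by
    intro s h1 h2
    refine (setLIntegral_mono' hX fun p hp => lintegral_segment_le hX hc hh h1 h2 hp).trans ?_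
    rw [lintegral_const, Measure.restrict_apply_univ, mul_comm]
  rcases le_total (1 / 2) s with h1 | h1
  · exact half s h1 hs.2
  · have := half (1 - s) (by linarith) (by linarith [hs.1])
    rw [lintegral_lintegral_swap (by fun_prop)] at this
    refine le_trans (le_of_eq ?_) this
    refine lintegral_congr fun p => lintegral_congr fun q => ?_
    congr 1
    rw [sub_smul, one_smul, smul_sub, smul_sub]
    abel

theorem lintegral_pair_segment_Ioc_le {X : Set E3} (hX : MeasurableSet X) (hc : Convex ℝ X)
    {h : E3 → ENNReal} (hh : Measurable h) :
    ∫⁻ p in X, ∫⁻ q in X, ∫⁻ s in Set.Ioc (0 : ℝ) 1, h (p + s • (q - p))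
      ≤ volume X * (8 * ∫⁻ q in X, h q) := by
  have m1 : Measurable fun r : (E3 × ℝ) × E3 => h (r.1.1 + r.1.2 • (r.2 - r.1.1)) := by fun_prop
  have m2 : Measurable fun r : E3 × ℝ => ∫⁻ q in X, h (r.1 + r.2 • (q - r.1)) :=
    m1.lintegral_prod_right'
  have e1 : ∀ p, ∫⁻ q in X, ∫⁻ s in Set.Ioc (0 : ℝ) 1, h (p + s • (q - p))
      = ∫⁻ s in Set.Ioc (0 : ℝ) 1, ∫⁻ q in X, h (p + s • (q - p)) := fun p =>
    lintegral_lintegral_swap (by fun_prop)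
  simp only [e1]
  rw [lintegral_lintegral_swap m2.aemeasurable]
  refine (setLIntegral_mono' measurableSet_Ioc fun s hs =>
    lintegral_pair_segment_le hX hc hh hs).trans ?_
  simp

/-! ### A Poincaré inequality in a layer -/

/-- The part of the flat cylinder over `D` at relative heights between `t` and `1 - t`. -/
def box (D : Set E2) (t : ℝ) : Set E3 := {x | horiz x ∈ D ∧ x 2 ∈ Set.Icc t (1 - t)}

theorem box_subset_cylinder (D : Set E2) {t : ℝ} (ht : 0 < t) : box D t ⊆ cylinder D :=
  fun _ hx => ⟨hx.1, ht.trans_le hx.2.1, lt_of_le_of_lt hx.2.2 (by linarith)⟩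

theorem isCompact_box {D : Set E2} (hD : IsCompact D) (t : ℝ) : IsCompact (box D t) := by
  have e : box D t = (fun p : E2 × ℝ => join p.1 p.2) '' (D ×ˢ Set.Icc t (1 - t)) := by
    ext x
    constructor
    · rintro ⟨h1, h2⟩
      exact ⟨(horiz x, x 2), ⟨h1, h2⟩, by simp⟩
    · rintro ⟨⟨y, s⟩, ⟨h1, h2⟩, rfl⟩
      exact ⟨by simpa using h1, by simpa using h2⟩
  rw [e]
  exact (hD.prod isCompact_Icc).image continuous_join

theorem convex_box {D : Set E2} (hD : Convex ℝ D) (t : ℝ) : Convex ℝ (box D t) := by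
  intro x hx y hy a b ha hb hab
  refine ⟨?_, ?_⟩
  · have : horiz (a • x + b • y) = a • horiz x + b • horiz y := by
      ext i; fin_cases i <;> simp
    rw [this]
    exact hD hx.1 hy.1 ha hb hab
  · have := convex_Icc t (1 - t) hx.2 hy.2 ha hb hab
    simpa using this

theorem norm_horiz_le (x : E3) : ‖horiz x‖ ≤ ‖x‖ := by
  have h := norm_sq_join (horiz x) (x 2)
  rw [join_horiz] at h
  exact le_of_sq_le_sq (by nlinarith [sq_nonneg (x 2)]) (norm_nonneg _)

theorem horiz_sub (x y : E3) : horiz (x - y) = horiz x - horiz y := by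
  ext i; fin_cases i <;> simp

theorem measurable_gradDensity (β γ : ℝ) {g : Fin 3 → E3 → E3} (hg : ∀ i, Measurable (g i)) :
    Measurable (gradDensity β γ g) := by
  have h0 := hg 0
  have h1 := hg 1
  have h2 := hg 2
  unfold gradDensity
  fun_prop

theorem gradDensity_moll_le (η : ContDiffBump (0 : E3)) (β γ : ℝ) {g : Fin 3 → E3 → E3}
    (hg : ∀ i, Measurable (g i)) (x : E3) : gradDensity β γ (fun i => moll η (g i)) x
      ≤ ∫⁻ y, ENNReal.ofReal (η.normed volume (x - y)) * gradDensity β γ g y := by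
  have hm := measurable_normed η x
  have h0 := hg 0
  have h1 := hg 1
  have h2 := hg 2
  have e : ∫⁻ y, ENNReal.ofReal (η.normed volume (x - y)) * gradDensity β γ g y
      = ENNReal.ofReal (β ^ 2) * (∫⁻ y, ENNReal.ofReal (η.normed volume (x - y)) * ‖g 0 y‖ₑ ^ 2)
      + ENNReal.ofReal (β ^ 2) * (∫⁻ y, ENNReal.ofReal (η.normed volume (x - y)) * ‖g 1 y‖ₑ ^ 2)
      + ENNReal.ofReal (γ ^ 2) *
        ∫⁻ y, ENNReal.ofReal (η.normed volume (x - y)) * ‖g 2 y‖ₑ ^ 2 := by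
    rw [← lintegral_const_mul _ (by fun_prop), ← lintegral_const_mul _ (by fun_prop),
      ← lintegral_const_mul _ (by fun_prop), ← lintegral_add_left (by fun_prop),
      ← lintegral_add_left (by fun_prop)]
    refine lintegral_congr fun y => ?_
    rw [gradDensity]
    ring
  rw [e, gradDensity]
  gcongr
  · exact enorm_moll_sq_le η h0 x
  · exact enorm_moll_sq_le η h1 x
  · exact enorm_moll_sq_le η h2 x

section
variable {h₁ h₂ : E2 → ℝ} {Λ : NNReal} (L₁ : LipschitzWith Λ h₁) (L₂ : LipschitzWith Λ h₂)
  {c T : ℝ} (hc : 0 < c) (hcl : ∀ y, c ≤ h₂ y - h₁ y) (hT : ∀ y, h₂ y - h₁ y ≤ T)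
  {ω : Set E2} (hω : IsOpen ω) {F : E3 → E3} {g : Fin 3 → E3 → E3}
  (hF : MemLp F 2 volume) (hg : ∀ i, Measurable (g i))
  (hF0 : ∀ x ∉ horiz ⁻¹' ω ∩ layer h₁ h₂, F x = 0)
  (hg0 : ∀ i, ∀ x ∉ horiz ⁻¹' ω ∩ layer h₁ h₂, g i x = 0)
  (hw : ∀ i, IsWeakPartial (horiz ⁻¹' ω ∩ layer h₁ h₂) i F (g i))
  {D : Set E2} (hD : IsCompact D) (hDc : Convex ℝ D) (hDω : D ⊆ ω)
  {ℓ : ℝ} (hℓ : ∀ y ∈ D, ∀ z ∈ D, ‖y - z‖ ≤ ℓ)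
include L₁ L₂ hc hcl hT hω hF hg hF0 hg0 hw hD hDc hDω hℓ

/-- The flattened box is compact in the open film, so for small mollifier radius the mollified map
has classical derivatives equal to the mollified weak ones there. Increments along flattened
segments are then averaged over pairs of endpoints. The constant is 24 = 3 · 8, and the thickening
of D records the spread of the mollifier. -/
theorem lintegral_box_moll_le {t : ℝ} (ht : 0 < t) : ∃ r₀ : ℝ, 0 < r₀ ∧
    ∀ η : ContDiffBump (0 : E3), η.rOut < r₀ →
      ∫⁻ p in box D t, ∫⁻ q in box D t,
        ‖moll η F (flat h₁ h₂ q) - moll η F (flat h₁ h₂ p)‖ₑ ^ 2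
      ≤ volume (cylinder D) * (24 * ENNReal.ofReal c⁻¹ *
        ∫⁻ x in horiz ⁻¹' Metric.cthickening η.rOut D ∩ (horiz ⁻¹' ω ∩ layer h₁ h₂),
          gradDensity ℓ (Λ * ℓ + T) g x) := by
  have hlt : ∀ y, h₁ y < h₂ y := fun y => by linarith [hcl y]
  have cf := continuous_flat L₁.continuous L₂.continuous
  have hΩ : IsOpen (horiz ⁻¹' ω ∩ layer h₁ h₂) :=
    (hω.preimage continuous_horiz).inter (isOpen_layer L₁.continuous L₂.continuous)
  have hB := isCompact_box hD t
  have hBm := hB.measurableSet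
  have hK : IsCompact (flat h₁ h₂ '' box D t) := hB.image cf
  have hKm := hK.measurableSet
  have hKΩ : flat h₁ h₂ '' box D t ⊆ horiz ⁻¹' D ∩ layer h₁ h₂ := by
    rintro _ ⟨x, hx, rfl⟩
    have hd := sub_pos.2 (hlt (horiz x))
    have h1 := ht.trans_le hx.2.1
    have h2 : x 2 < 1 := lt_of_le_of_lt hx.2.2 (by linarith)
    refine ⟨by simpa [flat] using hx.1, ?_, ?_⟩
    · simp only [flat, horiz_join, join_two]; nlinarith
    · simp only [flat, horiz_join, join_two]; nlinarith
  obtain ⟨r₀, hr0, hr⟩ := hK.exists_cthickening_subset_open hΩ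
    (hKΩ.trans (Set.inter_subset_inter_left _ (Set.preimage_mono hDω)))
  refine ⟨r₀, hr0, fun η hη => ?_⟩
  have hball : ∀ x ∈ flat h₁ h₂ '' box D t,
      Metric.closedBall x η.rOut ⊆ horiz ⁻¹' ω ∩ layer h₁ h₂ := fun x hx =>
    ((Metric.closedBall_subset_cthickening hx _).trans (Metric.cthickening_mono hη.le _)).trans hr
  have hFl : LocallyIntegrable F := hF.locallyIntegrable (by norm_num)
  set W := gradDensity ℓ (Λ * ℓ + T) g
  have mW : Measurable W := measurable_gradDensity _ _ hg
  have hv := contDiff_moll η hFl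
  have mG : Measurable (gradDensity ℓ (Λ * ℓ + T) (vpd (moll η F))) :=
    measurable_gradDensity _ _ fun i => (continuous_vpd hv i).measurable
  set J : E3 → ENNReal := fun x => ∫⁻ y, ENNReal.ofReal (η.normed volume (x - y)) * W y
  have mJ : Measurable J := by
    have hcn := (isTest_normed η).continuous
    have : Measurable fun p : E3 × E3 => ENNReal.ofReal (η.normed volume (p.1 - p.2)) * W p.2 :=
      (ENNReal.measurable_ofReal.comp (Continuous.measurable (by fun_prop))).mul (by fun_prop)
    exact this.lintegral_prod_right'
  have hGJ : ∀ x ∈ flat h₁ h₂ '' box D t,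
      gradDensity ℓ (Λ * ℓ + T) (vpd (moll η F)) x ≤ J x := by
    intro x hx
    have e : ∀ i, vpd (moll η F) i x = moll η (g i) x := fun i =>
      moll_of_isWeakPartial η (hw i) hF0 (hg0 i) hFl (hball x hx)
    have := gradDensity_moll_le η ℓ (Λ * ℓ + T) hg x
    refine le_trans (le_of_eq ?_) this
    simp only [gradDensity, e]
  have hI : ∀ p ∈ box D t, p 2 ∈ Set.Icc (0 : ℝ) 1 := fun p hp =>
    ⟨ht.le.trans hp.2.1, hp.2.2.trans (by linarith)⟩
  have s1 : ∫⁻ p in box D t, ∫⁻ q in box D t,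
        ‖moll η F (flat h₁ h₂ q) - moll η F (flat h₁ h₂ p)‖ₑ ^ 2
      ≤ ∫⁻ p in box D t, ∫⁻ q in box D t, ∫⁻ s in Set.Ioc (0 : ℝ) 1,
        3 * gradDensity ℓ (Λ * ℓ + T) (vpd (moll η F)) (flat h₁ h₂ (p + s • (q - p))) :=
    setLIntegral_mono' hBm fun p hp => setLIntegral_mono' hBm fun q hq =>
      enorm_sub_flat_sq_le L₁ L₂ (fun y => (sub_pos.2 (hlt y)).le) hT (hI p hp) (hI q hq)
        (hℓ _ hq.1 _ hp.1) hv
  have s2 := lintegral_pair_segment_Ioc_le hBm (convex_box hDc t)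
    (h := fun x => 3 * gradDensity ℓ (Λ * ℓ + T) (vpd (moll η F)) (flat h₁ h₂ x))
    (measurable_const.mul (mG.comp cf.measurable))
  have s3 : ∫⁻ x in box D t, 3 * gradDensity ℓ (Λ * ℓ + T) (vpd (moll η F)) (flat h₁ h₂ x)
      ≤ 3 * (ENNReal.ofReal c⁻¹ * ∫⁻ x in horiz ⁻¹' Metric.cthickening η.rOut D ∩
        (horiz ⁻¹' ω ∩ layer h₁ h₂), W x) := by
    have mGf : Measurable fun x => gradDensity ℓ (Λ * ℓ + T) (vpd (moll η F)) (flat h₁ h₂ x) :=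
      mG.comp cf.measurable
    rw [lintegral_const_mul _ mGf]
    gcongr
    calc ∫⁻ x in box D t, gradDensity ℓ (Λ * ℓ + T) (vpd (moll η F)) (flat h₁ h₂ x)
        ≤ ∫⁻ x in box D t, (flat h₁ h₂ '' box D t).indicator J (flat h₁ h₂ x) := by
          refine setLIntegral_mono' hBm fun x hx => ?_
          have hx' := Set.mem_image_of_mem (flat h₁ h₂) hx
          rw [Set.indicator_of_mem hx']
          exact hGJ _ hx'
      _ ≤ ∫⁻ x in cylinder D, (flat h₁ h₂ '' box D t).indicator J (flat h₁ h₂ x) :=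
          lintegral_mono_set (box_subset_cylinder D ht)
      _ ≤ ENNReal.ofReal c⁻¹ * ∫⁻ x in horiz ⁻¹' D ∩ layer h₁ h₂,
            (flat h₁ h₂ '' box D t).indicator J x :=
          lintegral_flat_le L₁.continuous L₂.continuous hlt hD.measurableSet
            (mJ.indicator hKm) hc hcl
      _ ≤ _ := by
          refine mul_le_mul_right ?_ _
          refine (setLIntegral_le_lintegral _ _).trans ?_
          rw [lintegral_indicator hKm]
          refine lintegral_moll_le η mW hKm
            ((continuous_horiz.measurable Metric.isClosed_cthickening.measurableSet).inter
              hΩ.measurableSet) fun x hx y hy => ⟨?_, hball x hx ?_⟩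
          · refine Metric.mem_cthickening_of_dist_le (horiz y) (horiz x) _ _ (hKΩ hx).1 ?_
            rw [dist_comm, dist_eq_norm, ← horiz_sub]
            exact (norm_horiz_le _).trans hy.le
          · rw [Metric.mem_closedBall, dist_comm, dist_eq_norm]; exact hy.le
  refine s1.trans (s2.trans ?_)
  refine mul_le_mul' (measure_mono (box_subset_cylinder D ht)) ?_
  refine (mul_le_mul_right s3 _).trans (le_of_eq ?_)
  rw [← mul_assoc, ← mul_assoc]
  norm_num

/-- Mollifiers shrink while the boxes exhaust the cylinder. Fatou's lemma handles the left side, and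
continuity from above on the shrinking thickenings of D handles the right side. -/
theorem lintegral_cylinder_pair_le
    (hfin : ∫⁻ x in horiz ⁻¹' ω ∩ layer h₁ h₂, gradDensity ℓ (Λ * ℓ + T) g x ≠ ⊤)
    (hFm : Measurable F) :
    ∫⁻ p in cylinder D, ∫⁻ q in cylinder D, ‖F (flat h₁ h₂ q) - F (flat h₁ h₂ p)‖ₑ ^ 2
      ≤ volume (cylinder D) * (24 * ENNReal.ofReal c⁻¹ *
        ∫⁻ x in horiz ⁻¹' D ∩ (horiz ⁻¹' ω ∩ layer h₁ h₂), gradDensity ℓ (Λ * ℓ + T) g x) := by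
  have hlt : ∀ y, h₁ y < h₂ y := fun y => by linarith [hcl y]
  have cf := continuous_flat L₁.continuous L₂.continuous
  have mf := cf.measurable
  have hFl : LocallyIntegrable F := hF.locallyIntegrable (by norm_num)
  have hDm := hD.measurableSet
  have ht : ∀ k : ℕ, (0 : ℝ) < 1 / (k + 3) := fun k => by positivity
  choose r₀ hr0 hr using fun k : ℕ =>
    lintegral_box_moll_le L₁ L₂ hc hcl hT hω hF hg hF0 hg0 hw hD hDc hDω hℓ (ht k)
  have hρ : ∀ k : ℕ, 0 < min (r₀ k / 2) (1 / ((k : ℝ) + 1)) := fun k =>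
    lt_min (half_pos (hr0 k)) (by positivity)
  -- The outer radius is twice the inner one, the bounded ratio needed for almost everywhere
  -- convergence of mollifications. It is also below r₀ k and tends to zero.
  set η : ℕ → ContDiffBump (0 : E3) := fun k =>
    ⟨min (r₀ k / 2) (1 / ((k : ℝ) + 1)) / 2, min (r₀ k / 2) (1 / ((k : ℝ) + 1)),
      half_pos (hρ k), half_lt_self (hρ k)⟩ with hη
  have hηr : ∀ k, (η k).rOut < r₀ k := fun k =>
    (min_le_left _ _).trans_lt (half_lt_self (hr0 k))
  have hη0 : Tendsto (fun k => (η k).rOut) atTop (𝓝 0) :=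
    squeeze_zero (fun k => (hρ k).le) (fun k => min_le_right _ _)
      tendsto_one_div_add_atTop_nhds_zero_nat
  have hlim : ∀ᵐ x, Tendsto (fun k => moll (η k) F x) atTop (𝓝 (F x)) :=
    ContDiffBump.ae_convolution_tendsto_right_of_locallyIntegrable (K := 2) hη0
      (Eventually.of_forall fun k => le_of_eq (by simp only [hη]; ring)) hFl
  set μ := volume.restrict (cylinder D)
  have hlim' : ∀ᵐ x ∂μ, Tendsto (fun k => moll (η k) F (flat h₁ h₂ x)) atTop
      (𝓝 (F (flat h₁ h₂ x))) :=
    ae_flat L₁.continuous L₂.continuous hlt hDm hc hcl (ae_restrict_of_ae hlim)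
  have hmem : ∀ᵐ x ∂μ, x ∈ cylinder D := ae_restrict_mem (measurableSet_cylinder hDm)
  have hbox : ∀ x ∈ cylinder D, ∀ᶠ k : ℕ in atTop, x ∈ box D (1 / ((k : ℝ) + 3)) := by
    intro x hx
    have h1 : Tendsto (fun k : ℕ => 1 / ((k : ℝ) + 3)) atTop (𝓝 0) :=
      Tendsto.const_div_atTop (tendsto_atTop_add_const_right _ _ tendsto_natCast_atTop_atTop) 1
    have h2 : 0 < x 2 := hx.2.1
    have h3 : x 2 < 1 := hx.2.2
    filter_upwards [h1.eventually_lt_const h2, h1.eventually_lt_const (sub_pos.2 h3)]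
      with k hk1 hk2
    exact ⟨hx.1, hk1.le, by linarith⟩
  set f : ℕ → E3 × E3 → ENNReal := fun k =>
    (box D (1 / ((k : ℝ) + 3)) ×ˢ box D (1 / ((k : ℝ) + 3))).indicator fun r =>
      ‖moll (η k) F (flat h₁ h₂ r.2) - moll (η k) F (flat h₁ h₂ r.1)‖ₑ ^ 2 with hf
  have mB : ∀ k : ℕ, MeasurableSet (box D (1 / ((k : ℝ) + 3))) := fun k =>
    (isCompact_box hD _).measurableSet
  have mv : ∀ k, Measurable fun r : E3 × E3 =>
      ‖moll (η k) F (flat h₁ h₂ r.2) - moll (η k) F (flat h₁ h₂ r.1)‖ₑ ^ 2 := fun k => by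
    have := (contDiff_moll (η k) hFl).continuous
    exact Measurable.pow_const (Measurable.enorm (Continuous.measurable (by fun_prop))) 2
  have mf : ∀ k, Measurable (f k) := fun k => (mv k).indicator ((mB k).prod (mB k))
  have mF : Measurable fun r : E3 × E3 => ‖F (flat h₁ h₂ r.2) - F (flat h₁ h₂ r.1)‖ₑ ^ 2 := by
    fun_prop
  have elim : ∀ᵐ r ∂(μ.prod μ), ‖F (flat h₁ h₂ r.2) - F (flat h₁ h₂ r.1)‖ₑ ^ 2
      = liminf (fun k => f k r) atTop := by
    filter_upwards [Measure.quasiMeasurePreserving_fst.ae hlim',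
      Measure.quasiMeasurePreserving_snd.ae hlim', Measure.quasiMeasurePreserving_fst.ae hmem,
      Measure.quasiMeasurePreserving_snd.ae hmem] with r h1 h2 h3 h4
    have h5 : Tendsto (fun k => ‖moll (η k) F (flat h₁ h₂ r.2)
        - moll (η k) F (flat h₁ h₂ r.1)‖ₑ ^ 2) atTop
        (𝓝 (‖F (flat h₁ h₂ r.2) - F (flat h₁ h₂ r.1)‖ₑ ^ 2)) :=
      ((ENNReal.continuous_pow 2).tendsto _).comp ((continuous_enorm.tendsto _).comp (h2.sub h1))
    refine (Tendsto.liminf_eq (h5.congr' ?_)).symm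
    filter_upwards [hbox _ h3, hbox _ h4] with k hk1 hk2
    simp only [hf]
    rw [Set.indicator_of_mem (Set.mk_mem_prod hk1 hk2)]
  -- The gradient energy is pushed forward to a finite measure on the plane, so that the thickenings
  -- of D decrease to D in measure.
  set ν : Measure E2 := Measure.map horiz
    ((volume.restrict (horiz ⁻¹' ω ∩ layer h₁ h₂)).withDensity (gradDensity ℓ (Λ * ℓ + T) g))
  have hν : ∀ S, MeasurableSet S → ν S
      = ∫⁻ x in horiz ⁻¹' S ∩ (horiz ⁻¹' ω ∩ layer h₁ h₂), gradDensity ℓ (Λ * ℓ + T) g x := by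
    intro S hS
    have hS' := continuous_horiz.measurable hS
    rw [Measure.map_apply continuous_horiz.measurable hS, withDensity_apply _ hS',
      Measure.restrict_restrict hS']
  have hνfin : ∀ S, MeasurableSet S → ν S ≠ ⊤ := fun S hS => by
    rw [hν S hS]
    exact ((lintegral_mono_set Set.inter_subset_right).trans_lt hfin.lt_top).ne
  have hvol : volume (cylinder D) ≠ ⊤ := by
    rw [volume_cylinder hDm]; exact hD.measure_lt_top.ne
  have hR : Tendsto (fun k => volume (cylinder D) * (24 * ENNReal.ofReal c⁻¹ *
      ν (Metric.cthickening (η k).rOut D))) atTop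
      (𝓝 (volume (cylinder D) * (24 * ENNReal.ofReal c⁻¹ * ν D))) := by
    have h1 := (tendsto_measure_cthickening_of_isClosed (μ := ν) (s := D)
      ⟨1, one_pos, hνfin _ Metric.isClosed_cthickening.measurableSet⟩ hD.isClosed).comp hη0
    refine ENNReal.Tendsto.const_mul (ENNReal.Tendsto.const_mul h1 (Or.inr ?_)) (Or.inr hvol)
    exact ENNReal.mul_ne_top (by norm_num) ENNReal.ofReal_ne_top
  have hint : ∀ k, ∫⁻ r, f k r ∂(μ.prod μ) ≤ volume (cylinder D) * (24 * ENNReal.ofReal c⁻¹ *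
      ν (Metric.cthickening (η k).rOut D)) := by
    intro k
    have e : μ.restrict (box D (1 / ((k : ℝ) + 3))) = volume.restrict (box D (1 / ((k : ℝ) + 3))) := by
      rw [Measure.restrict_restrict (mB k),
        Set.inter_eq_left.2 (box_subset_cylinder D (ht k))]
    rw [hf, lintegral_indicator ((mB k).prod (mB k)), ← Measure.prod_restrict, e,
      lintegral_prod _ (mv k).aemeasurable, hν _ Metric.isClosed_cthickening.measurableSet]
    exact hr k (η k) (hηr k)
  rw [← hν D hDm, ← hR.liminf_eq]
  have e0 : ∫⁻ p in cylinder D, ∫⁻ q in cylinder D, ‖F (flat h₁ h₂ q) - F (flat h₁ h₂ p)‖ₑ ^ 2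
      = ∫⁻ r, ‖F (flat h₁ h₂ r.2) - F (flat h₁ h₂ r.1)‖ₑ ^ 2 ∂(μ.prod μ) :=
    (lintegral_prod _ mF.aemeasurable).symm
  rw [e0, lintegral_congr_ae elim]
  exact (lintegral_liminf_le mf).trans (liminf_le_liminf (Eventually.of_forall hint))

/-- Some base point p does at least as well as the average in the double integral. It can be chosen
off the null set where |F| ≠ 1, so the approximating constant F(p) is a unit vector, which a mean
value need not be. -/
theorem exists_unit_lintegral_sub_le
    (hfin : ∫⁻ x in horiz ⁻¹' ω ∩ layer h₁ h₂, gradDensity ℓ (Λ * ℓ + T) g x ≠ ⊤)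
    (hFm : Measurable F) (hD0 : volume D ≠ 0)
    (hF1 : ∀ᵐ x ∂(volume.restrict (horiz ⁻¹' ω ∩ layer h₁ h₂)), ‖F x‖ = 1) :
    ∃ a : E3, ‖a‖ = 1 ∧ ∫⁻ x in horiz ⁻¹' D ∩ layer h₁ h₂, ‖F x - a‖ₑ ^ 2
      ≤ ENNReal.ofReal T * (24 * ENNReal.ofReal c⁻¹ *
        ∫⁻ x in horiz ⁻¹' D ∩ layer h₁ h₂, gradDensity ℓ (Λ * ℓ + T) g x) := by
  have hlt : ∀ y, h₁ y < h₂ y := fun y => by linarith [hcl y]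
  have cf := continuous_flat L₁.continuous L₂.continuous
  have mf := cf.measurable
  have hDm := hD.measurableSet
  have hpair := lintegral_cylinder_pair_le L₁ L₂ hc hcl hT hω hF hg hF0 hg0 hw hD hDc hDω hℓ
    hfin hFm
  have hsub : horiz ⁻¹' D ⊆ (horiz ⁻¹' ω : Set E3) := Set.preimage_mono hDω
  have eS : horiz ⁻¹' D ∩ (horiz ⁻¹' ω ∩ layer h₁ h₂) = horiz ⁻¹' D ∩ layer h₁ h₂ := by
    rw [← Set.inter_assoc, Set.inter_eq_left.2 hsub]
  rw [eS] at hpair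
  set μ := volume.restrict (cylinder D)
  have hμu : μ Set.univ = volume D := by
    rw [Measure.restrict_apply_univ, volume_cylinder hDm]
  have hμ : μ ≠ 0 := fun h0 => hD0 (by rw [← hμu, h0]; rfl)
  have hF1' : ∀ᵐ x ∂μ, ‖F (flat h₁ h₂ x)‖ = 1 :=
    ae_flat L₁.continuous L₂.continuous hlt hDm hc hcl
      (ae_restrict_of_ae_restrict_of_subset (Set.inter_subset_inter_left _ hsub) hF1)
  have mF : Measurable fun r : E3 × E3 => ‖F (flat h₁ h₂ r.2) - F (flat h₁ h₂ r.1)‖ₑ ^ 2 := by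
    fun_prop
  have : IsFiniteMeasure μ := ⟨by rw [hμu]; exact hD.measure_lt_top⟩
  obtain ⟨p, hp1, hp2⟩ := exists_notMem_null_le_laverage
    (f := fun p => ∫⁻ q, ‖F (flat h₁ h₂ q) - F (flat h₁ h₂ p)‖ₑ ^ 2 ∂μ) hμ
    mF.lintegral_prod_right'.aemeasurable hF1'
  have hp1' : ‖F (flat h₁ h₂ p)‖ = 1 := by simpa using hp1
  refine ⟨F (flat h₁ h₂ p), hp1', ?_⟩
  refine (lintegral_layer_le_flat L₁.continuous L₂.continuous hlt hDm
    (ψ := fun x => ‖F x - F (flat h₁ h₂ p)‖ₑ ^ 2) (by fun_prop) hT).trans ?_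
  gcongr
  refine hp2.trans ?_
  rw [laverage_eq, hμu]
  rw [volume_cylinder hDm] at hpair
  refine ENNReal.div_le_of_le_mul ?_
  rw [mul_comm]
  exact hpair

end

/-! ### The Poincaré inequality in thin films -/

theorem filmΩ_eq (f₁ f₂ : E2 → ℝ) (ω : Set E2) (ε : ℝ) :
    filmΩ f₁ f₂ ω ε
      = horiz ⁻¹' ω ∩ layer (fun y => f₁ (ε⁻¹ • y)) (fun y => f₂ (ε⁻¹ • y)) := rfl

theorem IsFilm.measurableSet_filmΩ {f₁ f₂ : E2 → ℝ} (H : IsFilm f₁ f₂) {D : Set E2}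
    (hD : MeasurableSet D) (ε : ℝ) : MeasurableSet (filmΩ f₁ f₂ D ε) := by
  have c1 := H.bot.continuous
  have c2 := H.top.continuous
  rw [filmΩ_eq]
  exact (continuous_horiz.measurable hD).inter
    (isOpen_layer (by fun_prop) (by fun_prop)).measurableSet

theorem filmΩ_mono (f₁ f₂ : E2 → ℝ) {D D' : Set E2} (h : D ⊆ D') (ε : ℝ) :
    filmΩ f₁ f₂ D ε ⊆ filmΩ f₁ f₂ D' ε := fun _ hx => ⟨h hx.1, hx.2⟩

theorem gradDensity_le {β γ s ε : ℝ} (hβ : β ^ 2 ≤ s ^ 2) (hγ : γ ^ 2 ≤ s ^ 2 * (1 / ε) ^ 2)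
    (g : Fin 3 → E3 → E3) (x : E3) :
    gradDensity β γ g x ≤ ENNReal.ofReal (s ^ 2) * gradDensity 1 (1 / ε) g x := by
  have h1 := ENNReal.ofReal_le_ofReal hβ
  have h2 := ENNReal.ofReal_le_ofReal hγ
  rw [ENNReal.ofReal_mul (by positivity)] at h2
  rw [gradDensity, gradDensity, mul_add, mul_add, one_pow, ENNReal.ofReal_one, one_mul, one_mul,
    ← mul_assoc]
  gcongr

theorem lintegral_gradDensity_lt_top {μ : Measure E3} {g : Fin 3 → E3 → E3}
    (hg : ∀ i, MemLp (g i) 2 μ) (β γ : ℝ) : ∫⁻ x, gradDensity β γ g x ∂μ < ⊤ := by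
  have h : ∀ i, ∫⁻ x, ‖g i x‖ₑ ^ 2 ∂μ < ⊤ := fun i =>
    (memLp_two_iff_lintegral (hg i).1).1 (hg i)
  have m : ∀ (t : ℝ) (i), AEMeasurable (fun x => ENNReal.ofReal t * ‖g i x‖ₑ ^ 2) μ := fun t i =>
    ((hg i).1.enorm.pow_const 2).const_mul _
  simp only [gradDensity]
  rw [lintegral_add_left' (f := fun x => ENNReal.ofReal (β ^ 2) * ‖g 0 x‖ₑ ^ 2
    + ENNReal.ofReal (β ^ 2) * ‖g 1 x‖ₑ ^ 2) ((m _ _).add (m _ _)), lintegral_add_left' (m _ _),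
    lintegral_const_mul' _ _ ENNReal.ofReal_ne_top, lintegral_const_mul' _ _ ENNReal.ofReal_ne_top,
    lintegral_const_mul' _ _ ENNReal.ofReal_ne_top]
  exact ENNReal.add_lt_top.2 ⟨ENNReal.add_lt_top.2 ⟨ENNReal.mul_lt_top ENNReal.ofReal_lt_top (h 0),
    ENNReal.mul_lt_top ENNReal.ofReal_lt_top (h 1)⟩, ENNReal.mul_lt_top ENNReal.ofReal_lt_top (h 2)⟩

/-- In the rescaled film the graphs have slope K/ε, so a flattened segment over a ball of radius r
has horizontal speed at most 2r and vertical speed at most 2rK/ε + T. The weight ε⁻² on the vertical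
derivative exactly matches this, which gives the factor (r + ε)² with C independent of ε, r and the
ball. -/
theorem IsFilm.exists_unit_lintegral_ball_le {f₁ f₂ : E2 → ℝ} (H : IsFilm f₁ f₂) {c : ℝ}
    (hc : 0 < c) (hcl : ∀ y, c ≤ f₂ y - f₁ y) :
    ∃ C : ℝ, 0 < C ∧ ∀ (ω : Set E2) (ε : ℝ) (m : H1Sphere (filmΩ f₁ f₂ ω ε)) (y : E2) (r : ℝ),
      IsOpen ω → 0 < ε → 0 < r → Metric.closedBall y r ⊆ ω → ∃ a : E3, ‖a‖ = 1 ∧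
        ∫⁻ x in filmΩ f₁ f₂ (Metric.closedBall y r) ε, ‖m.toFun x - a‖ₑ ^ 2
          ≤ ENNReal.ofReal (C * (r + ε) ^ 2) *
            ∫⁻ x in filmΩ f₁ f₂ (Metric.closedBall y r) ε, gradDensity 1 (1 / ε) m.partials x := by
  obtain ⟨K₁, hK₁⟩ := H.bot.lip
  obtain ⟨K₂, hK₂⟩ := H.top.lip
  obtain ⟨T, hT0, hT, -⟩ := H.exists_thickness_le
  set K := max K₁ K₂
  refine ⟨T * (24 * c⁻¹ * (2 + 2 * K + T) ^ 2), by positivity,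
    fun ω ε m y r hω hε hr hD => ?_⟩
  have L : ∀ {f : E2 → ℝ} {k : NNReal}, LipschitzWith k f → k ≤ K →
      LipschitzWith (K * ‖ε⁻¹‖₊) fun y => f (ε⁻¹ • y) := fun hf hk =>
    (hf.weaken hk).comp (lipschitzWith_smul ε⁻¹)
  have hm := (H.measurableSet_filmΩ hω.measurableSet ε)
  -- Measurable representatives, extended by zero outside the film, as the mollification argument
  -- requires.
  set F := (filmΩ f₁ f₂ ω ε).indicator (m.memLp_toFun.1.mk m.toFun) with hF
  set g : Fin 3 → E3 → E3 := fun i =>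
    (filmΩ f₁ f₂ ω ε).indicator ((m.memLp_partials i).1.mk (m.partials i)) with hg
  have mF : Measurable F := (m.memLp_toFun.1.stronglyMeasurable_mk.measurable).indicator hm
  have mg : ∀ i, Measurable (g i) := fun i =>
    ((m.memLp_partials i).1.stronglyMeasurable_mk.measurable).indicator hm
  have eF : m.toFun =ᵐ[volume.restrict (filmΩ f₁ f₂ ω ε)] F := by
    filter_upwards [m.memLp_toFun.1.ae_eq_mk, ae_restrict_mem hm] with x h1 h2
    rw [hF, Set.indicator_of_mem h2, ← h1]
  have eg : ∀ i, m.partials i =ᵐ[volume.restrict (filmΩ f₁ f₂ ω ε)] g i := fun i => by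
    filter_upwards [(m.memLp_partials i).1.ae_eq_mk, ae_restrict_mem hm] with x h1 h2
    simp only [hg]
    rw [Set.indicator_of_mem h2, ← h1]
  have hF2 : MemLp F 2 volume :=
    (memLp_indicator_iff_restrict hm).2 (m.memLp_toFun.ae_eq m.memLp_toFun.1.ae_eq_mk)
  have hg2 : ∀ i, MemLp (g i) 2 (volume.restrict (filmΩ f₁ f₂ ω ε)) := fun i => (m.memLp_partials i).ae_eq (eg i)
  have hw : ∀ i, IsWeakPartial (filmΩ f₁ f₂ ω ε) i F (g i) := fun i φ hφ hs => by
    have := m.isWeakPartial i φ hφ hs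
    rw [integral_congr_ae (g := fun x => fderiv ℝ φ x (EuclideanSpace.single i 1) • F x),
      integral_congr_ae (f := fun x => φ x • m.partials i x) (g := fun x => φ x • g i x)] at this
    · exact this
    · filter_upwards [eg i] with x hx; rw [hx]
    · filter_upwards [eF] with x hx; rw [hx]
  have hr0 : volume (Metric.closedBall y r) ≠ 0 := (Metric.measure_closedBall_pos _ _ hr).ne'
  obtain ⟨a, ha, hle⟩ := exists_unit_lintegral_sub_le (L hK₁ (le_max_left _ _))
    (L hK₂ (le_max_right _ _)) hc (fun z => hcl (ε⁻¹ • z)) (fun z => hT (ε⁻¹ • z)) hω hF2 mg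
    (fun x hx => Set.indicator_of_notMem hx _) (fun i x hx => Set.indicator_of_notMem hx _) hw
    (isCompact_closedBall y r) (convex_closedBall y r) hD (ℓ := 2 * r)
    (fun u hu v hv => by
      rw [← dist_eq_norm]
      linarith [dist_triangle_right u v y, Metric.mem_closedBall.1 hu, Metric.mem_closedBall.1 hv])
    (lintegral_gradDensity_lt_top hg2 _ _).ne mF hr0
    (by filter_upwards [m.norm_eq_one, eF] with x h1 h2; rw [← h2, h1])
  refine ⟨a, ha, ?_⟩
  have hsub : filmΩ f₁ f₂ (Metric.closedBall y r) ε ⊆ filmΩ f₁ f₂ ω ε := filmΩ_mono f₁ f₂ hD ε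
  rw [← filmΩ_eq] at hle
  have e1 : ∫⁻ x in filmΩ f₁ f₂ (Metric.closedBall y r) ε, ‖m.toFun x - a‖ₑ ^ 2
      = ∫⁻ x in filmΩ f₁ f₂ (Metric.closedBall y r) ε, ‖F x - a‖ₑ ^ 2 := by
    refine lintegral_congr_ae ?_
    filter_upwards [ae_restrict_of_ae_restrict_of_subset hsub eF] with x hx
    rw [hx]
  have e2 : ∫⁻ x in filmΩ f₁ f₂ (Metric.closedBall y r) ε, gradDensity 1 (1 / ε) m.partials x
      = ∫⁻ x in filmΩ f₁ f₂ (Metric.closedBall y r) ε, gradDensity 1 (1 / ε) g x := by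
    refine lintegral_congr_ae ?_
    filter_upwards [ae_restrict_of_ae_restrict_of_subset hsub (eg 0),
      ae_restrict_of_ae_restrict_of_subset hsub (eg 1),
      ae_restrict_of_ae_restrict_of_subset hsub (eg 2)] with x h0 h1 h2
    rw [gradDensity, gradDensity, h0, h1, h2]
  rw [e1, e2]
  refine hle.trans ?_
  -- Both 2r and ε times the vertical speed, namely 2Kr + Tε, are at most (2 + 2K + T)(r + ε).
  have h3 : ∫⁻ x in filmΩ f₁ f₂ (Metric.closedBall y r) ε,
        gradDensity (2 * r) (↑(K * ‖ε⁻¹‖₊) * (2 * r) + T) g x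
      ≤ ENNReal.ofReal (((2 + 2 * K + T) * (r + ε)) ^ 2) *
        ∫⁻ x in filmΩ f₁ f₂ (Metric.closedBall y r) ε, gradDensity 1 (1 / ε) g x := by
    rw [← lintegral_const_mul _ (measurable_gradDensity _ _ mg)]
    have hK0 : (0 : ℝ) ≤ K := K.2
    refine lintegral_mono fun x => gradDensity_le ?_ ?_ g x
    · refine pow_le_pow_left₀ (by positivity) ?_ 2
      nlinarith [mul_nonneg hK0 hr.le, mul_nonneg hK0 hε.le, mul_pos hT0 hr, mul_pos hT0 hε]
    · rw [← mul_pow]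
      have e : (↑(K * ‖ε⁻¹‖₊) : ℝ) = K / ε := by
        rw [NNReal.coe_mul, coe_nnnorm, Real.norm_of_nonneg (by positivity)]; rfl
      rw [e]
      gcongr
      rw [mul_one_div, le_div_iff₀ hε]
      have : (K / ε * (2 * r) + T) * ε = K * (2 * r) + T * ε := by field_simp
      rw [this]
      nlinarith [mul_nonneg hK0 hr.le, mul_nonneg hK0 hε.le, mul_pos hT0 hr, mul_pos hT0 hε]
  have e4 : ENNReal.ofReal (T * (24 * c⁻¹ * (2 + 2 * K + T) ^ 2) * (r + ε) ^ 2)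
      = ENNReal.ofReal T * (24 * ENNReal.ofReal c⁻¹ *
        ENNReal.ofReal (((2 + 2 * K + T) * (r + ε)) ^ 2)) := by
    rw [show T * (24 * c⁻¹ * (2 + 2 * K + T) ^ 2) * (r + ε) ^ 2
      = T * (24 * c⁻¹ * (((2 + 2 * K + T) * (r + ε)) ^ 2)) by ring,
      ENNReal.ofReal_mul hT0.le, ENNReal.ofReal_mul (by positivity),
      ENNReal.ofReal_mul (by norm_num)]
    norm_num
  rw [e4, mul_assoc (ENNReal.ofReal T)]
  exact mul_le_mul_right ((mul_le_mul_right h3 _).trans_eq (mul_assoc _ _ _).symm) _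

/-! ### Rescaling of the film -/

theorem continuous_rescale (ε : ℝ) : Continuous (rescale ε) := by unfold rescale; fun_prop

@[simp] theorem horiz_rescale (ε : ℝ) (x : E3) : horiz (rescale ε x) = horiz x := by
  ext i; fin_cases i <;> simp [rescale]

theorem rescale_join (ε : ℝ) (y : E2) (t : ℝ) : rescale ε (join y t) = join y (t / ε) := by
  ext i; fin_cases i <;> simp [rescale]

theorem filmV_eq (f₁ f₂ : E2 → ℝ) (ω : Set E2) (ε : ℝ) :
    filmV f₁ f₂ ω ε = horiz ⁻¹' ω ∩ layer (scaleProfile ε f₁) (scaleProfile ε f₂) := rfl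

section
variable {f₁ f₂ : E2 → ℝ} (H : IsFilm f₁ f₂) {D : Set E2} (hD : MeasurableSet D) {ε : ℝ}
include H hD

theorem IsFilm.lintegral_filmΩ {ψ : E3 → ENNReal} (hψ : Measurable ψ) (ε : ℝ) :
    ∫⁻ x in filmΩ f₁ f₂ D ε, ψ x
      = ∫⁻ y in D, ENNReal.ofReal (f₂ (ε⁻¹ • y) - f₁ (ε⁻¹ • y)) *
          ∫⁻ t in Set.Ioo (0 : ℝ) 1,
            ψ (join y (f₁ (ε⁻¹ • y) + t * (f₂ (ε⁻¹ • y) - f₁ (ε⁻¹ • y)))) := by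
  have c1 := H.bot.continuous
  have c2 := H.top.continuous
  exact lintegral_layer (h₁ := fun y => f₁ (ε⁻¹ • y)) (h₂ := fun y => f₂ (ε⁻¹ • y))
    (by fun_prop) (by fun_prop) (fun y => H.lt _) hD hψ

theorem IsFilm.volume_filmΩ_eq (ε : ℝ) :
    volume (filmΩ f₁ f₂ D ε) = ∫⁻ y in D, ENNReal.ofReal (f₂ (ε⁻¹ • y) - f₁ (ε⁻¹ • y)) := by
  have := H.lintegral_filmΩ hD (ψ := fun _ => 1) measurable_const ε
  simpa using this

theorem IsFilm.volume_filmΩ_le {T : ℝ} (hT : ∀ y, f₂ y - f₁ y ≤ T) (ε : ℝ) :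
    volume (filmΩ f₁ f₂ D ε) ≤ ENNReal.ofReal T * volume D := by
  rw [H.volume_filmΩ_eq hD, ← setLIntegral_const]
  exact lintegral_mono fun y => ENNReal.ofReal_le_ofReal (hT _)

theorem IsFilm.le_volume_filmΩ {c : ℝ} (hc : ∀ y, c ≤ f₂ y - f₁ y) (ε : ℝ) :
    ENNReal.ofReal c * volume D ≤ volume (filmΩ f₁ f₂ D ε) := by
  rw [H.volume_filmΩ_eq hD, ← setLIntegral_const]
  exact lintegral_mono fun y => ENNReal.ofReal_le_ofReal (hc _)

theorem IsFilm.lintegral_filmV_rescale (hε : 0 < ε) {ψ : E3 → ENNReal} (hψ : Measurable ψ) :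
    ∫⁻ x in filmV f₁ f₂ D ε, ψ (rescale ε x)
      = ENNReal.ofReal ε * ∫⁻ x in filmΩ f₁ f₂ D ε, ψ x := by
  have Hε := H.scale hε
  have c1 := H.bot.continuous
  have c2 := H.top.continuous
  rw [filmV_eq, lintegral_layer Hε.bot.continuous Hε.top.continuous Hε.lt hD
    (ψ := fun x => ψ (rescale ε x)) (hψ.comp (continuous_rescale ε).measurable),
    H.lintegral_filmΩ hD hψ, ← lintegral_const_mul']
  · refine lintegral_congr fun y => ?_
    simp only [scaleProfile, rescale_join]
    rw [← mul_sub, ENNReal.ofReal_mul hε.le, mul_assoc]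
    congr 3
    funext t
    congr 2
    field_simp
  · exact ENNReal.ofReal_ne_top

theorem IsFilm.map_rescale (hε : 0 < ε) :
    Measure.map (rescale ε) (volume.restrict (filmV f₁ f₂ D ε))
      = ENNReal.ofReal ε • volume.restrict (filmΩ f₁ f₂ D ε) := by
  have mr := (continuous_rescale ε).measurable
  refine Measure.ext fun S hS => ?_
  rw [Measure.map_apply mr hS, Measure.smul_apply, smul_eq_mul, ← lintegral_indicator_one hS,
    ← H.lintegral_filmV_rescale hD hε (measurable_one.indicator hS),
    ← lintegral_indicator_one (mr hS)]
  rfl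

end

/-! ### The two parts of the energy -/

section
variable {f₁ f₂ : E2 → ℝ} {ω : Set E2} {ε : ℝ}

/-- The square root of the rescaled magnetostatic energy. -/
noncomputable def magNorm (f₁ f₂ : E2 → ℝ) (ω : Set E2) (ε : ℝ) (m : E3 → E3) : ℝ :=
  √(1 / ε) * ‖strayGradient (magnetization f₁ f₂ ω ε m)‖

theorem magNorm_nonneg (m : E3 → E3) : 0 ≤ magNorm f₁ f₂ ω ε m :=
  mul_nonneg (Real.sqrt_nonneg _) (norm_nonneg _)

theorem magNorm_sq (hε : 0 < ε) (m : E3 → E3) : magNorm f₁ f₂ ω ε m ^ 2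
    = 1 / ε * magEnergy (magnetization f₁ f₂ ω ε m) := by
  rw [magNorm, mul_pow, Real.sq_sqrt (by positivity), magEnergy_eq_norm_sq]

/-- The rescaled exchange energy. -/
noncomputable def exchange (m : H1Sphere (filmΩ f₁ f₂ ω ε)) : ENNReal :=
  ∫⁻ x in filmΩ f₁ f₂ ω ε, gradDensity 1 (1 / ε) m.partials x

theorem exchange_lt_top (m : H1Sphere (filmΩ f₁ f₂ ω ε)) : exchange m < ⊤ :=
  lintegral_gradDensity_lt_top m.memLp_partials _ _

theorem energy_eq (hε : 0 < ε) (d : ℝ) (m : H1Sphere (filmΩ f₁ f₂ ω ε)) :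
    energy d f₁ f₂ ω ε m = d ^ 2 * (exchange m).toReal + magNorm f₁ f₂ ω ε m.toFun ^ 2 := by
  rw [magNorm_sq hε, energy, magEnergy, exchange]
  congr 2
  have h : ∀ i, AEStronglyMeasurable (fun x => ‖m.partials i x‖ ^ 2)
      (volume.restrict (filmΩ f₁ f₂ ω ε)) := fun i => (m.memLp_partials i).1.norm.pow 2
  rw [integral_eq_lintegral_of_nonneg_ae (f := fun x => ‖m.partials 0 x‖ ^ 2
    + ‖m.partials 1 x‖ ^ 2 + 1 / ε ^ 2 * ‖m.partials 2 x‖ ^ 2)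
    (Eventually.of_forall fun x => by positivity) (((h 0).add (h 1)).add ((h 2).const_mul _))]
  congr 1
  refine lintegral_congr fun x => ?_
  rw [ENNReal.ofReal_add (by positivity) (by positivity), ENNReal.ofReal_add (by positivity)
    (by positivity), ENNReal.ofReal_mul (by positivity), ENNReal.ofReal_pow (norm_nonneg _),
    ENNReal.ofReal_pow (norm_nonneg _), ENNReal.ofReal_pow (norm_nonneg _), ofReal_norm,
    ofReal_norm, ofReal_norm, gradDensity]
  simp

/-- The vertical rescaling has Jacobian ε, which cancels the prefactor 1/ε. Closeness in L² on the
rescaled film therefore controls the magnetostatic norm with constant one. -/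
theorem IsFilm.abs_magNorm_sub_layerNorm_le (H : IsFilm f₁ f₂) (hε : 0 < ε) (hω : IsOpen ω)
    (m : H1Sphere (filmΩ f₁ f₂ ω ε)) {a : E2 → E3} (ha : Measurable a) (ha2 : MemLp a 2 volume)
    (ha0 : ∀ y ∉ ω, a y = 0) :
    |magNorm f₁ f₂ ω ε m.toFun - layerNorm f₁ f₂ ε a|
      ≤ √(∫⁻ x in filmΩ f₁ f₂ ω ε, ‖m.toFun x - a (horiz x)‖ₑ ^ 2).toReal := by
  obtain ⟨T, -, -, hT⟩ := H.exists_thickness_le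
  have Hε := H.scale hε
  have hM := memLp_magnetization hε H.bot.continuous H.top.continuous hω m
  have hL := (memLp_layerField Hε ha ha2 (hT ε hε)).1
  have hV : MeasurableSet (filmV f₁ f₂ ω ε) := by
    rw [filmV_eq]
    exact (continuous_horiz.measurable hω.measurableSet).inter
      (isOpen_layer Hε.bot.continuous Hε.top.continuous).measurableSet
  have e : ∀ x, magnetization f₁ f₂ ω ε m.toFun x
        - layerField (scaleProfile ε f₁) (scaleProfile ε f₂) a x
      = (filmV f₁ f₂ ω ε).indicator
        (fun x => m.toFun (rescale ε x) - a (horiz (rescale ε x))) x := by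
    intro x
    by_cases hx : x ∈ filmV f₁ f₂ ω ε
    · rw [magnetization, layerField, Set.indicator_of_mem hx, Set.indicator_of_mem hx,
        Set.indicator_of_mem (show x ∈ layer (scaleProfile ε f₁) (scaleProfile ε f₂) from hx.2),
        horiz_rescale]
    · rw [magnetization, layerField, Set.indicator_of_notMem hx, Set.indicator_of_notMem hx,
        zero_sub, neg_eq_zero]
      by_cases hx2 : x ∈ layer (scaleProfile ε f₁) (scaleProfile ε f₂)
      · rw [Set.indicator_of_mem hx2]
        exact ha0 _ fun h => hx ⟨h, hx2⟩
      · rw [Set.indicator_of_notMem hx2]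
  have hψ : AEMeasurable (fun x => ‖m.toFun x - a (horiz x)‖ₑ ^ 2)
      (volume.restrict (filmΩ f₁ f₂ ω ε)) :=
    ((m.memLp_toFun.1.sub (ha.comp continuous_horiz.measurable).aestronglyMeasurable).enorm).pow_const 2
  have hint : ∫ x, ‖magnetization f₁ f₂ ω ε m.toFun x
        - layerField (scaleProfile ε f₁) (scaleProfile ε f₂) a x‖ ^ 2
      = ε * (∫⁻ x in filmΩ f₁ f₂ ω ε, ‖m.toFun x - a (horiz x)‖ₑ ^ 2).toReal := by
    rw [integral_norm_sq_eq (F := fun x => magnetization f₁ f₂ ω ε m.toFun x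
      - layerField (scaleProfile ε f₁) (scaleProfile ε f₂) a x) (hM.sub hL).1]
    have e1 : ∀ x, ‖magnetization f₁ f₂ ω ε m.toFun x
          - layerField (scaleProfile ε f₁) (scaleProfile ε f₂) a x‖ₑ ^ 2
        = (filmV f₁ f₂ ω ε).indicator (fun x => (fun z => ‖m.toFun z - a (horiz z)‖ₑ ^ 2)
          (rescale ε x)) x := by
      intro x
      rw [e]
      by_cases hx : x ∈ filmV f₁ f₂ ω ε
      · simp [hx]
      · simp [hx]
    rw [lintegral_congr e1, lintegral_indicator hV, ← lintegral_map' (μ := volume.restrict _)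
      (f := fun z => ‖m.toFun z - a (horiz z)‖ₑ ^ 2) (g := rescale ε) ?_
      (continuous_rescale ε).measurable.aemeasurable, H.map_rescale hω.measurableSet hε,
      lintegral_smul_measure, smul_eq_mul, ENNReal.toReal_mul, ENNReal.toReal_ofReal hε.le]
    rw [H.map_rescale hω.measurableSet hε]
    exact hψ.smul_measure _
  rw [magNorm, layerNorm, ← mul_sub, abs_mul, abs_of_nonneg (Real.sqrt_nonneg _)]
  refine (mul_le_mul_of_nonneg_left (norm_strayGradient_sub_le hM hL)
    (Real.sqrt_nonneg _)).trans (le_of_eq ?_)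
  rw [hint, ← Real.sqrt_mul (by positivity), ← mul_assoc, one_div_mul_cancel hε.ne', one_mul]

end

/-! ### Constant competitors -/

theorem IsTest.setIntegral_fderiv_eq_zero {φ : E3 → ℝ} (hφ : IsTest φ) {U : Set E3}
    (hU : tsupport φ ⊆ U) (v : E3) : ∫ x in U, fderiv ℝ φ x v = 0 := by
  rw [setIntegral_eq_integral_of_forall_compl_eq_zero fun x hx => by
    rw [fderiv_of_notMem_tsupport (𝕜 := ℝ) fun h => hx (hU h)]; rfl]
  have hc : Continuous fun x => fderiv ℝ φ x v :=
    (hφ.contDiff_one.continuous_fderiv one_ne_zero).clm_apply continuous_const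
  have hs : HasCompactSupport fun x => fderiv ℝ φ x v :=
    (hφ.2.fderiv ℝ).comp_left (g := fun L : E3 →L[ℝ] ℝ => L v) rfl
  have := integral_mul_fderiv_eq_neg_fderiv_mul_of_integrable (μ := (volume : Measure E3))
    (f := fun _ : E3 => (1 : ℝ)) (g := φ) (v := v) (by simp)
    (by simpa using hc.integrable_of_hasCompactSupport hs)
    (by simpa using hφ.contDiff_one.continuous.integrable_of_hasCompactSupport hφ.2)
    (fun x _ => differentiableAt_const _)
    (fun x _ => hφ.contDiff_one.differentiable one_ne_zero x)
  simpa using this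

/-- The constant map `e`. -/
noncomputable def H1Sphere.const {U : Set E3} (hU : volume U < ⊤) {e : E3} (he : ‖e‖ = 1) :
    H1Sphere U where
  toFun _ := e
  partials _ _ := 0
  memLp_toFun := by
    have : IsFiniteMeasure (volume.restrict U) := ⟨by rwa [Measure.restrict_apply_univ]⟩
    exact memLp_const e
  memLp_partials _ := MemLp.zero
  isWeakPartial i φ hφ hs := by
    rw [integral_smul_const, hφ.setIntegral_fderiv_eq_zero hs]
    simp
  norm_eq_one := Eventually.of_forall fun _ => he

/-- A constant map has no exchange energy, so the limit of its full energy is known. -/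
theorem energy_const {f₁ f₂ : E2 → ℝ} {ω : Set E2} {ε : ℝ} (hε : 0 < ε) (d : ℝ)
    (hU : volume (filmΩ f₁ f₂ ω ε) < ⊤) {e : E3} (he : ‖e‖ = 1) :
    energy d f₁ f₂ ω ε (H1Sphere.const hU he) = layerNorm f₁ f₂ ε (ω.indicator fun _ => e) ^ 2 := by
  have e1 : exchange (H1Sphere.const hU he) = 0 := by
    simp [exchange, gradDensity, H1Sphere.const]
  have e2 : magnetization f₁ f₂ ω ε (H1Sphere.const hU he).toFun
      = layerField (scaleProfile ε f₁) (scaleProfile ε f₂) (ω.indicator fun _ => e) := by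
    funext x
    rw [magnetization, layerField, filmV_eq, Set.inter_comm, ← Set.indicator_indicator]
    rfl
  rw [energy_eq hε, e1, magNorm_sq hε, layerNorm_sq hε, e2]
  simp

/-! ### Filling a planar open set with finitely many balls -/

/-- Besicovitch's covering theorem fills ω up to a null set with countably many disjoint small
closed balls. Since the area is finite, finitely many of them already miss at most η. -/
theorem exists_finset_disjoint_closedBall {ω : Set E2} (hω : IsOpen ω) (hfin : volume ω ≠ ⊤)
    {δ : ℝ} (hδ : 0 < δ) {η : ENNReal} (hη : η ≠ 0) :
    ∃ (s : Finset E2) (r : E2 → ℝ),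
      (∀ y ∈ s, 0 < r y ∧ r y < δ ∧ Metric.closedBall y (r y) ⊆ ω) ∧
      (s : Set E2).PairwiseDisjoint (fun y => Metric.closedBall y (r y)) ∧
      volume (ω \ ⋃ y ∈ s, Metric.closedBall y (r y)) ≤ η := by
  have hR : ∀ y ∈ ω, ∃ R : ℝ, 0 < R ∧ R ≤ δ ∧ Metric.closedBall y R ⊆ ω := fun y hy => by
    obtain ⟨R, hR, h⟩ := Metric.nhds_basis_closedBall.mem_iff.1 (hω.mem_nhds hy)
    exact ⟨min R δ, lt_min hR hδ, min_le_right _ _,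
      (Metric.closedBall_subset_closedBall (min_le_left _ _)).trans h⟩
  choose! R hR0 hRδ hRω using hR
  obtain ⟨t, r, htc, htω, hr, hcov, hdis⟩ := Besicovitch.exists_disjoint_closedBall_covering_ae
    (volume : Measure E2) (fun _ => Set.univ) ω
    (fun x _ κ hκ => ⟨κ / 2, Set.mem_univ _, half_pos hκ, half_lt_self hκ⟩) R hR0
  have hrR : ∀ y ∈ t, 0 < r y ∧ r y < R y := fun y hy => (hr y hy).2
  have hsub : ∀ y ∈ t, Metric.closedBall y (r y) ⊆ ω := fun y hy =>
    (Metric.closedBall_subset_closedBall (hrR y hy).2.le).trans (hRω y (htω hy))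
  have hm : ∀ y ∈ t, MeasurableSet (Metric.closedBall y (r y)) := fun y _ =>
    Metric.isClosed_closedBall.measurableSet
  have hsum : ∑' y : t, volume (Metric.closedBall (y : E2) (r y)) = volume ω := by
    rw [← measure_biUnion htc hdis hm]
    refine le_antisymm (measure_mono (Set.iUnion₂_subset hsub)) ?_
    rw [← Set.sdiff_union_inter ω (⋃ y ∈ t, Metric.closedBall y (r y))]
    refine (measure_union_le _ _).trans ?_
    rw [hcov, zero_add]
    exact measure_mono Set.inter_subset_right
  have hlim := ENNReal.summable.hasSum (f := fun y : t => volume (Metric.closedBall (y : E2) (r y)))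
  rw [hsum] at hlim
  have hev : ∀ᶠ F : Finset t in atTop, volume ω
      ≤ ∑ y ∈ F, volume (Metric.closedBall (y : E2) (r y)) + η := by
    rcases eq_or_ne (volume ω) 0 with h0 | h0
    · exact Eventually.of_forall fun F => by rw [h0]; exact zero_le
    · filter_upwards [hlim.eventually_const_lt (ENNReal.sub_lt_self hfin h0 hη)] with F hF
      exact tsub_le_iff_right.1 hF.le
  obtain ⟨F, hF⟩ := hev.exists
  refine ⟨F.map (Function.Embedding.subtype _), r, ?_, ?_, ?_⟩
  · intro y hy
    obtain ⟨⟨z, hz⟩, -, rfl⟩ := Finset.mem_map.1 hy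
    exact ⟨(hrR z hz).1, (hrR z hz).2.trans_le (hRδ z (htω hz)), hsub z hz⟩
  · refine hdis.subset fun y hy => ?_
    obtain ⟨z, -, rfl⟩ := Finset.mem_map.1 (Finset.mem_coe.1 hy)
    exact z.2
  · have hFt : ∀ y ∈ F.map (Function.Embedding.subtype _), y ∈ t := fun y hy => by
      obtain ⟨z, -, rfl⟩ := Finset.mem_map.1 hy
      exact z.2
    have hU : volume (⋃ y ∈ F.map (Function.Embedding.subtype _), Metric.closedBall y (r y))
        = ∑ y ∈ F, volume (Metric.closedBall (y : E2) (r y)) := by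
      rw [measure_biUnion_finset (hdis.subset fun y hy => hFt y hy) fun y hy => hm y (hFt y hy),
        Finset.sum_map]
      rfl
    rw [measure_sdiff (Set.iUnion₂_subset fun y hy => hsub y (hFt y hy))
      (Finset.measurableSet_biUnion _ fun y hy => hm y (hFt y hy)).nullMeasurableSet
      (by rw [hU]; exact (ENNReal.sum_lt_top.2 fun y _ => measure_closedBall_lt_top).ne), hU,
      tsub_le_iff_left]
    exact hF

/-! ### Maps that are constant on finitely many balls -/

/-- The map equal to `c y` on the ball of centre `y ∈ s` and radius `r y`. -/
noncomputable def ballStep (s : Finset E2) (r : E2 → ℝ) (c : E2 → E3) (x : E2) : E3 :=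
  ∑ y ∈ s, (Metric.closedBall y (r y)).indicator (fun _ => c y) x

section
variable {s : Finset E2} {r : E2 → ℝ} {c : E2 → E3}

theorem measurable_ballStep : Measurable (ballStep s r c) :=
  Finset.measurable_fun_sum _ fun _ _ =>
    measurable_const.indicator Metric.isClosed_closedBall.measurableSet

theorem memLp_ballStep : MemLp (ballStep s r c) 2 volume :=
  memLp_finsetSum _ fun _ _ => memLp_indicator_const 2 Metric.isClosed_closedBall.measurableSet _
    (Or.inr measure_closedBall_lt_top.ne)

theorem ballStep_of_notMem {x : E2} (hx : ∀ y ∈ s, x ∉ Metric.closedBall y (r y)) :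
    ballStep s r c x = 0 :=
  Finset.sum_eq_zero fun y hy => Set.indicator_of_notMem (hx y hy) _

variable (hd : (s : Set E2).PairwiseDisjoint fun y => Metric.closedBall y (r y))
include hd

theorem ballStep_of_mem {x y : E2} (hy : y ∈ s) (hx : x ∈ Metric.closedBall y (r y)) :
    ballStep s r c x = c y := by
  rw [ballStep, Finset.sum_eq_single y, Set.indicator_of_mem hx]
  · intro z hz hzy
    exact Set.indicator_of_notMem (fun h => Set.disjoint_left.1 (hd hz hy hzy) h hx) _
  · exact fun h => (h hy).elim

theorem le_integral_quadForm_ballStep (A : Matrix (Fin 3) (Fin 3) ℝ) {l : ℝ}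
    (hl : ∀ y ∈ s, l ≤ quadForm A (c y)) :
    l * volume.real (⋃ y ∈ s, Metric.closedBall y (r y))
      ≤ ∫ x, quadForm A (ballStep s r c x) := by
  have hm : ∀ y : E2, MeasurableSet (Metric.closedBall y (r y)) := fun y =>
    Metric.isClosed_closedBall.measurableSet
  have e : ∀ x, quadForm A (ballStep s r c x)
      = ∑ y ∈ s, (Metric.closedBall y (r y)).indicator (fun _ => quadForm A (c y)) x := by
    intro x
    by_cases hx : ∃ y ∈ s, x ∈ Metric.closedBall y (r y)
    · obtain ⟨y, hy, hxy⟩ := hx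
      rw [ballStep_of_mem hd hy hxy, Finset.sum_eq_single y, Set.indicator_of_mem hxy]
      · intro z hz hzy
        exact Set.indicator_of_notMem (fun h => Set.disjoint_left.1 (hd hz hy hzy) h hxy) _
      · exact fun h => (h hy).elim
    · push Not at hx
      rw [ballStep_of_notMem hx, Finset.sum_eq_zero fun y hy => Set.indicator_of_notMem (hx y hy) _]
      simp [quadForm]
  simp only [e]
  rw [integral_finsetSum _ fun y _ => (integrable_indicator_iff (hm y)).2
    (integrableOn_const measure_closedBall_lt_top.ne), Measure.real,
    measure_biUnion_finset hd fun y _ => hm y,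
    ENNReal.toReal_sum fun y _ => measure_closedBall_lt_top.ne, Finset.mul_sum]
  refine Finset.sum_le_sum fun y hy => ?_
  rw [integral_indicator_const _ (hm y), smul_eq_mul, mul_comm]
  exact mul_le_mul_of_nonneg_left (hl y hy) ENNReal.toReal_nonneg

end

theorem enorm_sub_sq_le (u v w : E3) : ‖u - w‖ₑ ^ 2 ≤ 2 * ‖u - v‖ₑ ^ 2 + 2 * ‖v - w‖ₑ ^ 2 := by
  have h : ‖u - w‖ ^ 2 ≤ 2 * ‖u - v‖ ^ 2 + 2 * ‖v - w‖ ^ 2 := by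
    have h1 := norm_sub_le_norm_sub_add_norm_sub u v w
    nlinarith [norm_nonneg (u - w), sq_nonneg (‖u - v‖ - ‖v - w‖)]
  have := ENNReal.ofReal_le_ofReal h
  rw [ENNReal.ofReal_add (by positivity) (by positivity), ENNReal.ofReal_mul (by norm_num),
    ENNReal.ofReal_mul (by norm_num), ENNReal.ofReal_pow (norm_nonneg _),
    ENNReal.ofReal_pow (norm_nonneg _), ENNReal.ofReal_pow (norm_nonneg _), ofReal_norm,
    ofReal_norm, ofReal_norm] at this
  simpa using this

section
variable {f₁ f₂ : E2 → ℝ} (H : IsFilm f₁ f₂) {T : ℝ} (hT : ∀ y, f₂ y - f₁ y ≤ T)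
  {ω : Set E2} {ε : ℝ} (m : H1Sphere (filmΩ f₁ f₂ ω ε))
include H hT

theorem lintegral_sub_const_le {D : Set E2} (hD : MeasurableSet D) (a b : E3) :
    ∫⁻ x in filmΩ f₁ f₂ D ε, ‖m.toFun x - b‖ₑ ^ 2
      ≤ 2 * (∫⁻ x in filmΩ f₁ f₂ D ε, ‖m.toFun x - a‖ₑ ^ 2)
        + 2 * (‖a - b‖ₑ ^ 2 * (ENNReal.ofReal T * volume D)) := by
  calc ∫⁻ x in filmΩ f₁ f₂ D ε, ‖m.toFun x - b‖ₑ ^ 2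
      ≤ ∫⁻ x in filmΩ f₁ f₂ D ε, (2 * ‖m.toFun x - a‖ₑ ^ 2 + 2 * ‖a - b‖ₑ ^ 2) :=
        lintegral_mono fun x => enorm_sub_sq_le _ _ _
    _ = 2 * (∫⁻ x in filmΩ f₁ f₂ D ε, ‖m.toFun x - a‖ₑ ^ 2)
          + 2 * (‖a - b‖ₑ ^ 2 * volume (filmΩ f₁ f₂ D ε)) := by
        rw [lintegral_add_right _ measurable_const, lintegral_const_mul' _ _ (by norm_num),
          setLIntegral_const, mul_assoc]
    _ ≤ _ := by
        gcongr
        exact H.volume_filmΩ_le hD hT ε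

theorem lintegral_sub_le_of_norm_le_one {D : Set E2} (hD : MeasurableSet D) (hDω : D ⊆ ω)
    {a : E2 → E3} (ha : ∀ y ∈ D, ‖a y‖ ≤ 1) :
    ∫⁻ x in filmΩ f₁ f₂ D ε, ‖m.toFun x - a (horiz x)‖ₑ ^ 2
      ≤ 4 * (ENNReal.ofReal T * volume D) := by
  have h1 : ∀ᵐ x ∂(volume.restrict (filmΩ f₁ f₂ D ε)), ‖m.toFun x - a (horiz x)‖ₑ ^ 2 ≤ 4 := by
    filter_upwards [ae_restrict_of_ae_restrict_of_subset (filmΩ_mono f₁ f₂ hDω ε) m.norm_eq_one,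
      ae_restrict_mem (H.measurableSet_filmΩ hD ε)] with x hx hx2
    have h2 : ‖m.toFun x - a (horiz x)‖ ≤ 2 := by
      have := norm_sub_le (m.toFun x) (a (horiz x))
      linarith [ha _ hx2.1]
    have h3 : ‖m.toFun x - a (horiz x)‖ₑ ≤ 2 := by
      rw [← ofReal_norm]
      exact (ENNReal.ofReal_le_ofReal h2).trans (by norm_num)
    calc _ ≤ (2 : ENNReal) ^ 2 := by gcongr
      _ = 4 := by norm_num
  refine (lintegral_mono_ae h1).trans ?_
  rw [setLIntegral_const]
  gcongr
  exact H.volume_filmΩ_le hD hT ε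

/-- On the part not covered by the balls only |m - a| ≤ 2 is used, which gives the factor 4. -/
theorem lintegral_sub_le_sum_balls (hω : IsOpen ω) {s : Finset E2} {r : E2 → ℝ}
    {a : E2 → E3} (ha : ∀ y, ‖a y‖ ≤ 1) :
    ∫⁻ x in filmΩ f₁ f₂ ω ε, ‖m.toFun x - a (horiz x)‖ₑ ^ 2
      ≤ ∑ y ∈ s, (∫⁻ x in filmΩ f₁ f₂ (Metric.closedBall y (r y)) ε,
          ‖m.toFun x - a (horiz x)‖ₑ ^ 2)
        + 4 * (ENNReal.ofReal T * volume (ω \ ⋃ y ∈ s, Metric.closedBall y (r y))) := by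
  have hm : MeasurableSet (⋃ y ∈ s, Metric.closedBall y (r y)) :=
    Finset.measurableSet_biUnion _ fun y _ => Metric.isClosed_closedBall.measurableSet
  have hsub : filmΩ f₁ f₂ ω ε ⊆ (⋃ y ∈ s, filmΩ f₁ f₂ (Metric.closedBall y (r y)) ε)
      ∪ filmΩ f₁ f₂ (ω \ ⋃ y ∈ s, Metric.closedBall y (r y)) ε := by
    intro x hx
    by_cases h : horiz x ∈ ⋃ y ∈ s, Metric.closedBall y (r y)
    · obtain ⟨y, hy, hxy⟩ := Set.mem_iUnion₂.1 h
      exact Or.inl (Set.mem_iUnion₂.2 ⟨y, hy, hxy, hx.2⟩)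
    · exact Or.inr ⟨⟨hx.1, h⟩, hx.2⟩
  refine (lintegral_mono_set hsub).trans ((lintegral_union_le _ _ _).trans ?_)
  refine add_le_add ?_ (lintegral_sub_le_of_norm_le_one H hT m (hω.measurableSet.diff hm)
    Set.sdiff_subset fun y _ => ha y)
  clear hsub hm
  induction s using Finset.induction_on with
  | empty => simp
  | insert z s hz ih =>
    rw [Finset.set_biUnion_insert, Finset.sum_insert hz]
    exact (lintegral_union_le _ _ _).trans (add_le_add_right ih _)

end

/-! ### A lower bound for the magnetostatic energy -/

theorem exists_subseq_tendsto_of_norm_eq_one (s : Finset E2) {u : ℕ → E2 → E3}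
    (hu : ∀ n y, ‖u n y‖ = 1) : ∃ (φ : ℕ → ℕ) (c : E2 → E3), StrictMono φ ∧
      ∀ y ∈ s, ‖c y‖ = 1 ∧ Tendsto (fun k => u (φ k) y) atTop (𝓝 (c y)) := by
  classical
  obtain ⟨c, hc, φ, hφ, hlim⟩ := (isCompact_univ_pi fun _ : s =>
    isCompact_sphere (0 : E3) 1).tendsto_subseq (x := fun n (y : s) => u n y)
    (fun n y _ => by simpa using hu n y)
  refine ⟨φ, fun y => if h : y ∈ s then c ⟨y, h⟩ else 0, hφ, fun y hy => ?_⟩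
  simp only [dif_pos hy]
  exact ⟨by simpa using hc ⟨y, hy⟩ trivial, (tendsto_pi_nhds.1 hlim) ⟨y, hy⟩⟩

theorem tendsto_layerNorm {f₁ f₂ : E2 → ℝ} (H : IsFilm f₁ f₂) (p₁ : IsQPeriodic f₁)
    (p₂ : IsQPeriodic f₂) {ε : ℕ → ℝ} (hε0 : ∀ n, 0 < ε n) (hε : Tendsto ε atTop (𝓝 0))
    {a : E2 → E3} (ha : Measurable a) (ha2 : MemLp a 2 volume) :
    Tendsto (fun n => layerNorm f₁ f₂ (ε n) a ^ 2) atTop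
      (𝓝 (∫ x, quadForm (Ahom f₁ f₂) (a x))) := by
  have h : Tendsto ε atTop (𝓝[>] 0) :=
    tendsto_nhdsWithin_iff.2 ⟨hε, Eventually.of_forall hε0⟩
  simp only [fun n => layerNorm_sq (f₁ := f₁) (f₂ := f₂) (hε0 n) a]
  exact (tendsto_magEnergy_layerField H p₁ p₂ ha ha2).comp h

theorem layerNorm_nonneg (f₁ f₂ : E2 → ℝ) (ε : ℝ) (a : E2 → E3) : 0 ≤ layerNorm f₁ f₂ ε a :=
  mul_nonneg (Real.sqrt_nonneg _) (norm_nonneg _)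

section
variable {f₁ f₂ : E2 → ℝ} (H : IsFilm f₁ f₂) {c : ℝ} (hc : 0 < c) (hcl : ∀ y, c ≤ f₂ y - f₁ y)
  {ω : Set E2} (hω : IsOpen ω)
  {ε : ℕ → ℝ} (hε0 : ∀ n, 0 < ε n) (hε : Tendsto ε atTop (𝓝 0))
  (m : ∀ n, H1Sphere (filmΩ f₁ f₂ ω (ε n)))
include H hc hcl hω hε0 hε

/-- On finitely many small balls the Poincaré inequality replaces each map by unit vectors, which
converge along a subsequence. The resulting step function is independent of n, so its energy has a
known limit, at least `l` times the covered area. The uniform Lipschitz bound transfers this to the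
maps. A convergent majorant σ stands in for a lower limit of the magnetostatic norms. -/
theorem sqrt_le_of_magNorm_le (hfin : volume ω ≠ ⊤) (p₁ : IsQPeriodic f₁) (p₂ : IsQPeriodic f₂)
    {E : ENNReal} (hE : E ≠ ⊤) (hex : ∀ n, exchange (m n) ≤ E) {l : ℝ} (hl0 : 0 ≤ l)
    (hl : ∀ e : E3, ‖e‖ = 1 → l ≤ quadForm (Ahom f₁ f₂) e) {σ : ℕ → ℝ} {σ₀ : ℝ}
    (hσ : Tendsto σ atTop (𝓝 σ₀)) (hm : ∀ n, magNorm f₁ f₂ ω (ε n) (m n).toFun ≤ σ n) :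
    √(l * volume.real ω) ≤ σ₀ := by
  obtain ⟨C, hC, hP⟩ := H.exists_unit_lintegral_ball_le hc hcl
  obtain ⟨T, hT0, hT, -⟩ := H.exists_thickness_le
  -- The same δ bounds the radii of the balls and the area left uncovered. The error consists of the
  -- Poincaré term 2Cδ²E and the uncovered term 4Tδ, and both vanish as δ → 0.
  have key : ∀ δ : ℝ, 0 < δ → √(l * (volume.real ω - δ))
      ≤ σ₀ + √(2 * (C * (δ + 0) ^ 2 * E.toReal) + 4 * (T * δ)) := by
    intro δ hδ
    obtain ⟨s, r, hs, hd, hvol⟩ := exists_finset_disjoint_closedBall hω hfin hδ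
      (ENNReal.ofReal_pos.2 hδ).ne'
    have hu : ∀ n y, ∃ a : E3, ‖a‖ = 1 ∧ (y ∈ s →
        ∫⁻ x in filmΩ f₁ f₂ (Metric.closedBall y (r y)) (ε n), ‖(m n).toFun x - a‖ₑ ^ 2
          ≤ ENNReal.ofReal (C * (r y + ε n) ^ 2) * ∫⁻ x in filmΩ f₁ f₂
            (Metric.closedBall y (r y)) (ε n), gradDensity 1 (1 / ε n) (m n).partials x) := by
      intro n y
      by_cases hy : y ∈ s
      · obtain ⟨a, h1, h2⟩ := hP ω (ε n) (m n) y (r y) hω (hε0 n) (hs y hy).1 (hs y hy).2.2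
        exact ⟨a, h1, fun _ => h2⟩
      · exact ⟨EuclideanSpace.single 0 1, by simp, fun h => (hy h).elim⟩
    choose u hu1 hu2 using hu
    obtain ⟨φ, e, hφ, he⟩ := exists_subseq_tendsto_of_norm_eq_one s hu1
    set a := ballStep s r e
    have ha1 : ∀ x, ‖a x‖ ≤ 1 := by
      intro x
      by_cases hx : ∃ y ∈ s, x ∈ Metric.closedBall y (r y)
      · obtain ⟨y, hy, hxy⟩ := hx
        rw [show a x = e y from ballStep_of_mem hd hy hxy, (he y hy).1]
      · push Not at hx
        rw [show a x = 0 from ballStep_of_notMem hx]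
        simp
    have ha0 : ∀ x ∉ ω, a x = 0 := fun x hx =>
      ballStep_of_notMem fun y hy hxy => hx ((hs y hy).2.2 hxy)
    have hεφ := hε.comp hφ.tendsto_atTop
    set U : ℕ → ENNReal := fun k =>
      2 * (ENNReal.ofReal (C * (δ + ε (φ k)) ^ 2) * E)
        + ∑ y ∈ s, 2 * (‖u (φ k) y - e y‖ₑ ^ 2 *
          (ENNReal.ofReal T * volume (Metric.closedBall y (r y))))
        + 4 * (ENNReal.ofReal T * ENNReal.ofReal δ) with hU
    have hUb : ∀ k, ∫⁻ x in filmΩ f₁ f₂ ω (ε (φ k)), ‖(m (φ k)).toFun x - a (horiz x)‖ₑ ^ 2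
        ≤ U k := by
      intro k
      refine (lintegral_sub_le_sum_balls H hT (m (φ k)) hω (s := s) (r := r) ha1).trans ?_
      refine add_le_add ?_ (mul_le_mul_right (mul_le_mul_right hvol _) _)
      have h1 : ∀ y ∈ s, ∫⁻ x in filmΩ f₁ f₂ (Metric.closedBall y (r y)) (ε (φ k)),
            ‖(m (φ k)).toFun x - a (horiz x)‖ₑ ^ 2
          ≤ 2 * (ENNReal.ofReal (C * (δ + ε (φ k)) ^ 2) * ∫⁻ x in filmΩ f₁ f₂
              (Metric.closedBall y (r y)) (ε (φ k)),
                gradDensity 1 (1 / ε (φ k)) (m (φ k)).partials x)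
            + 2 * (‖u (φ k) y - e y‖ₑ ^ 2 *
              (ENNReal.ofReal T * volume (Metric.closedBall y (r y)))) := by
        intro y hy
        have hB : MeasurableSet (Metric.closedBall y (r y)) :=
          Metric.isClosed_closedBall.measurableSet
        rw [setLIntegral_congr_fun (g := fun x => ‖(m (φ k)).toFun x - e y‖ₑ ^ 2)
          (H.measurableSet_filmΩ hB _) fun x hx => by
            simp only [a]; rw [ballStep_of_mem hd hy hx.1]]
        refine (lintegral_sub_const_le H hT (m (φ k)) hB (u (φ k) y) (e y)).trans ?_
        refine add_le_add_left (mul_le_mul_right ((hu2 _ _ hy).trans ?_) _) _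
        gcongr
        · have := hε0 (φ k)
          have := (hs y hy).1
          positivity
        · exact (hs y hy).2.1.le
      refine (Finset.sum_le_sum h1).trans ?_
      rw [Finset.sum_add_distrib, ← Finset.mul_sum, ← Finset.mul_sum]
      gcongr
      rw [← lintegral_biUnion_finset]
      · refine (lintegral_mono_set ?_).trans (hex (φ k))
        exact Set.iUnion₂_subset fun y hy => filmΩ_mono f₁ f₂ (hs y hy).2.2 _
      · exact fun y hy z hz hyz => Set.disjoint_left.2 fun x hx hx' =>
          Set.disjoint_left.1 (hd hy hz hyz) hx.1 hx'.1
      · exact fun y _ => H.measurableSet_filmΩ Metric.isClosed_closedBall.measurableSet _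
    have hUlim : Tendsto U atTop (𝓝 (2 * (ENNReal.ofReal (C * (δ + 0) ^ 2) * E)
        + ∑ y ∈ s, 2 * (‖e y - e y‖ₑ ^ 2 *
          (ENNReal.ofReal T * volume (Metric.closedBall y (r y))))
        + 4 * (ENNReal.ofReal T * ENNReal.ofReal δ))) := by
      refine ((ENNReal.Tendsto.const_mul (ENNReal.Tendsto.mul_const ?_ (Or.inr hE))
        (Or.inr (by norm_num))).add (tendsto_finsetSum _ fun y hy => ?_)).add_const _
      · exact (ENNReal.continuous_ofReal.tendsto _).comp
          (((hεφ.const_add δ).pow 2).const_mul C)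
      · refine ENNReal.Tendsto.const_mul (ENNReal.Tendsto.mul_const ?_
          (Or.inr (ENNReal.mul_ne_top ENNReal.ofReal_ne_top measure_closedBall_lt_top.ne)))
          (Or.inr (by norm_num))
        exact ((ENNReal.continuous_pow 2).tendsto _).comp
          ((continuous_enorm.tendsto _).comp ((he y hy).2.sub_const _))
    have e0 : 2 * (ENNReal.ofReal (C * (δ + 0) ^ 2) * E)
        + ∑ y ∈ s, 2 * (‖e y - e y‖ₑ ^ 2 *
          (ENNReal.ofReal T * volume (Metric.closedBall y (r y))))
        + 4 * (ENNReal.ofReal T * ENNReal.ofReal δ)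
        = ENNReal.ofReal (2 * (C * (δ + 0) ^ 2 * E.toReal) + 4 * (T * δ)) := by
      rw [ENNReal.ofReal_add (by positivity) (by positivity),
        ENNReal.ofReal_mul (p := 2) (by norm_num), ENNReal.ofReal_mul (p := C * (δ + 0) ^ 2) (by positivity), ENNReal.ofReal_toReal hE,
        ENNReal.ofReal_mul (p := 4) (by norm_num), ENNReal.ofReal_mul hT0.le]
      simp
    rw [e0] at hUlim
    have hlim := (tendsto_layerNorm H p₁ p₂ (fun k => hε0 (φ k)) hεφ
      (measurable_ballStep (s := s) (r := r) (c := e)) memLp_ballStep).sqrt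
    simp only [Real.sqrt_sq (layerNorm_nonneg _ _ _ _)] at hlim
    have hrhs := (hσ.comp hφ.tendsto_atTop).add
      ((ENNReal.tendsto_toReal ENNReal.ofReal_ne_top).comp hUlim).sqrt
    rw [ENNReal.toReal_ofReal (by positivity)] at hrhs
    refine le_trans ?_ (le_of_tendsto_of_tendsto hlim hrhs ?_)
    · refine Real.sqrt_le_sqrt (le_trans ?_
        (le_integral_quadForm_ballStep hd _ fun y hy => hl _ (he y hy).1))
      refine mul_le_mul_of_nonneg_left ?_ hl0
      have hUf : volume (⋃ y ∈ s, Metric.closedBall y (r y)) ≠ ⊤ :=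
        ((measure_mono (Set.iUnion₂_subset fun y hy => (hs y hy).2.2)).trans_lt
          hfin.lt_top).ne
      have h1 : volume ω ≤ volume (⋃ y ∈ s, Metric.closedBall y (r y)) + ENNReal.ofReal δ := by
        refine le_trans (measure_mono ?_) ((measure_union_le _ _).trans (add_le_add_right hvol _))
        rw [Set.union_sdiff_self]
        exact Set.subset_union_right
      have h2 := ENNReal.toReal_mono (by finiteness) h1
      rw [ENNReal.toReal_add hUf (by finiteness), ENNReal.toReal_ofReal hδ.le] at h2
      simp only [Measure.real]
      linarith
    · filter_upwards [hUlim.eventually_lt_const ENNReal.ofReal_lt_top] with k hk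
      have h1 := H.abs_magNorm_sub_layerNorm_le (hε0 (φ k)) hω (m (φ k))
        (measurable_ballStep (s := s) (r := r) (c := e)) memLp_ballStep ha0
      have h2 := Real.sqrt_le_sqrt (ENNReal.toReal_mono hk.ne (hUb k))
      have h3 := hm (φ k)
      have h4 := (abs_le.1 h1).1
      simp only [Function.comp_apply]
      linarith
  have t1 : Tendsto (fun δ : ℝ => √(l * (volume.real ω - δ))) (𝓝[>] 0)
      (𝓝 (√(l * volume.real ω))) :=
    (Continuous.tendsto' (by fun_prop) _ _ (by simp)).mono_left nhdsWithin_le_nhds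
  have t2 : Tendsto (fun δ : ℝ => σ₀ + √(2 * (C * (δ + 0) ^ 2 * E.toReal) + 4 * (T * δ)))
      (𝓝[>] 0) (𝓝 σ₀) :=
    (Continuous.tendsto' (by fun_prop) _ _ (by simp)).mono_left nhdsWithin_le_nhds
  exact le_of_tendsto_of_tendsto t1 t2 (eventually_mem_nhdsWithin.mono key)

/-! ### Propagation of the limit -/

variable (hex : Tendsto (fun n => exchange (m n)) atTop (𝓝 0))
include hex

/-- Poincaré inequality with vanishing exchange energy. The approximating unit vector may still vary
with n. -/
theorem exists_unit_tendsto_ball {y : E2} {r : ℝ} (hr : 0 < r) (hB : Metric.closedBall y r ⊆ ω) :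
    ∃ u : ℕ → E3, (∀ n, ‖u n‖ = 1) ∧ Tendsto (fun n => ∫⁻ x in filmΩ f₁ f₂
      (Metric.closedBall y r) (ε n), ‖(m n).toFun x - u n‖ₑ ^ 2) atTop (𝓝 0) := by
  obtain ⟨C, hC, hP⟩ := H.exists_unit_lintegral_ball_le hc hcl
  choose u hu1 hu2 using fun n => hP ω (ε n) (m n) y r hω (hε0 n) hr hB
  refine ⟨u, hu1, ?_⟩
  have h1 : Tendsto (fun n => ENNReal.ofReal (C * (r + ε n) ^ 2) * exchange (m n)) atTop
      (𝓝 (ENNReal.ofReal (C * (r + 0) ^ 2) * 0)) :=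
    ENNReal.Tendsto.mul ((ENNReal.continuous_ofReal.tendsto _).comp
      (((hε.const_add r).pow 2).const_mul C)) (Or.inr (by norm_num)) hex
      (Or.inr ENNReal.ofReal_ne_top)
  rw [mul_zero] at h1
  refine tendsto_of_tendsto_of_tendsto_of_le_of_le tendsto_const_nhds h1 (fun _ => zero_le)
    fun n => (hu2 n).trans (mul_le_mul_right (lintegral_mono_set (filmΩ_mono f₁ f₂ hB _)) _)

/-- The two balls share a smaller ball over which the film has volume bounded below uniformly in ε.
There the approximating vectors u n must approach e, and this extends to the whole ball. -/
theorem tendsto_ball_of_tendsto_ball {y z : E2} {r ρ : ℝ} (hr : 0 < r) (hρ : 0 < ρ)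
    (hB : Metric.closedBall y r ⊆ ω) (hz : z ∈ Metric.ball y r) {e : E3}
    (hlim : Tendsto (fun n => ∫⁻ x in filmΩ f₁ f₂ (Metric.closedBall z ρ) (ε n),
      ‖(m n).toFun x - e‖ₑ ^ 2) atTop (𝓝 0)) :
    Tendsto (fun n => ∫⁻ x in filmΩ f₁ f₂ (Metric.closedBall y r) (ε n),
      ‖(m n).toFun x - e‖ₑ ^ 2) atTop (𝓝 0) := by
  obtain ⟨T, hT0, hT, -⟩ := H.exists_thickness_le
  obtain ⟨u, -, hu⟩ := exists_unit_tendsto_ball H hc hcl hω hε0 hε m hex hr hB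
  have hzr : 0 < r - dist z y := sub_pos.2 hz
  -- This ball around z lies in both given balls.
  set D := Metric.closedBall z (min ρ (r - dist z y)) with hD
  have mD : MeasurableSet D := Metric.isClosed_closedBall.measurableSet
  have hD1 : D ⊆ Metric.closedBall z ρ := Metric.closedBall_subset_closedBall (min_le_left _ _)
  have hD2 : D ⊆ Metric.closedBall y r :=
    Metric.closedBall_subset_closedBall' (by linarith [min_le_right ρ (r - dist z y)])
  set κ := ENNReal.ofReal c * volume D
  have hκ0 : κ ≠ 0 := mul_ne_zero (ENNReal.ofReal_pos.2 hc).ne'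
    (Metric.measure_closedBall_pos _ _ (lt_min hρ hzr)).ne'
  have hκt : κ ≠ ⊤ := ENNReal.mul_ne_top ENNReal.ofReal_ne_top measure_closedBall_lt_top.ne
  set P := fun n => ∫⁻ x in filmΩ f₁ f₂ (Metric.closedBall y r) (ε n),
    ‖(m n).toFun x - u n‖ₑ ^ 2
  set Z := fun n => ∫⁻ x in filmΩ f₁ f₂ (Metric.closedBall z ρ) (ε n), ‖(m n).toFun x - e‖ₑ ^ 2
  have h1 : ∀ n, ‖u n - e‖ₑ ^ 2 ≤ κ⁻¹ * (2 * P n + 2 * Z n) := by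
    intro n
    rw [← ENNReal.div_eq_inv_mul, ENNReal.le_div_iff_mul_le (Or.inl hκ0) (Or.inl hκt)]
    calc ‖u n - e‖ₑ ^ 2 * κ ≤ ‖u n - e‖ₑ ^ 2 * volume (filmΩ f₁ f₂ D (ε n)) :=
          mul_le_mul_right (H.le_volume_filmΩ mD hcl _) _
      _ = ∫⁻ x in filmΩ f₁ f₂ D (ε n), ‖u n - e‖ₑ ^ 2 := by rw [setLIntegral_const]
      _ ≤ ∫⁻ x in filmΩ f₁ f₂ D (ε n),
            (2 * ‖(m n).toFun x - u n‖ₑ ^ 2 + 2 * ‖(m n).toFun x - e‖ₑ ^ 2) :=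
          lintegral_mono fun x => by
            have := enorm_sub_sq_le (u n) ((m n).toFun x) e
            rwa [enorm_sub_rev (u n) ((m n).toFun x)] at this
      _ = 2 * (∫⁻ x in filmΩ f₁ f₂ D (ε n), ‖(m n).toFun x - u n‖ₑ ^ 2)
            + 2 * ∫⁻ x in filmΩ f₁ f₂ D (ε n), ‖(m n).toFun x - e‖ₑ ^ 2 := by
          have hs := (m n).memLp_toFun.1.mono_set
            (filmΩ_mono f₁ f₂ (hD2.trans hB) (ε n))
          have hs1 : AEMeasurable (fun x => 2 * ‖(m n).toFun x - u n‖ₑ ^ 2)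
              (volume.restrict (filmΩ f₁ f₂ D (ε n))) :=
            (((hs.sub aestronglyMeasurable_const).enorm).pow_const 2).const_mul 2
          rw [lintegral_add_left' hs1, lintegral_const_mul' _ _ (by norm_num),
            lintegral_const_mul' _ _ (by norm_num)]
      _ ≤ 2 * P n + 2 * Z n := add_le_add
          (mul_le_mul_right (lintegral_mono_set (filmΩ_mono f₁ f₂ hD2 _)) _)
          (mul_le_mul_right (lintegral_mono_set (filmΩ_mono f₁ f₂ hD1 _)) _)
  have hPZ : Tendsto (fun n => 2 * P n + 2 * Z n) atTop (𝓝 (2 * 0 + 2 * 0)) :=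
    (ENNReal.Tendsto.const_mul hu (Or.inr (by norm_num))).add
      (ENNReal.Tendsto.const_mul hlim (Or.inr (by norm_num)))
  set V := ENNReal.ofReal T * volume (Metric.closedBall y r)
  have hV : V ≠ ⊤ := ENNReal.mul_ne_top ENNReal.ofReal_ne_top measure_closedBall_lt_top.ne
  have h2 : Tendsto (fun n => 2 * P n + 2 * (κ⁻¹ * (2 * P n + 2 * Z n) * V)) atTop
      (𝓝 (2 * 0 + 2 * (κ⁻¹ * (2 * 0 + 2 * 0) * V))) :=
    (ENNReal.Tendsto.const_mul hu (Or.inr (by norm_num))).add (ENNReal.Tendsto.const_mul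
      (ENNReal.Tendsto.mul_const (ENNReal.Tendsto.const_mul hPZ
        (Or.inr (ENNReal.inv_ne_top.2 hκ0))) (Or.inr hV)) (Or.inr (by norm_num)))
  simp only [mul_zero, add_zero, zero_mul] at h2
  refine tendsto_of_tendsto_of_tendsto_of_le_of_le tendsto_const_nhds h2 (fun _ => zero_le)
    fun n => (lintegral_sub_const_le H hT (m n) Metric.isClosed_closedBall.measurableSet
      (u n) e).trans ?_
  exact add_le_add_right (mul_le_mul_right (mul_le_mul_left (h1 n) _) _) _

/-- The set of points having a neighbourhood with limit e is open, and relatively closed in ω by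
passing between overlapping balls; connectedness makes it contain ω. -/
theorem tendsto_ball_of_isPreconnected (hconn : IsPreconnected ω) {y₀ : E2} {r₀ : ℝ}
    (hr₀ : 0 < r₀) (hB₀ : Metric.closedBall y₀ r₀ ⊆ ω) {e : E3}
    (hlim : Tendsto (fun n => ∫⁻ x in filmΩ f₁ f₂ (Metric.closedBall y₀ r₀) (ε n),
      ‖(m n).toFun x - e‖ₑ ^ 2) atTop (𝓝 0))
    {y : E2} {r : ℝ} (hr : 0 < r) (hB : Metric.closedBall y r ⊆ ω) :
    Tendsto (fun n => ∫⁻ x in filmΩ f₁ f₂ (Metric.closedBall y r) (ε n),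
      ‖(m n).toFun x - e‖ₑ ^ 2) atTop (𝓝 0) := by
  set G : Set E2 := {z | ∃ ρ : ℝ, 0 < ρ ∧ Tendsto (fun n => ∫⁻ x in filmΩ f₁ f₂
    (Metric.closedBall z ρ) (ε n), ‖(m n).toFun x - e‖ₑ ^ 2) atTop (𝓝 0)} with hG
  have hGo : IsOpen G := by
    refine Metric.isOpen_iff.2 fun z ⟨ρ, hρ, hz⟩ => ⟨ρ / 2, half_pos hρ, fun w hw =>
      ⟨ρ / 2, half_pos hρ, ?_⟩⟩
    refine tendsto_of_tendsto_of_tendsto_of_le_of_le tendsto_const_nhds hz (fun _ => zero_le)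
      fun n => lintegral_mono_set (filmΩ_mono f₁ f₂ (Metric.closedBall_subset_closedBall' ?_) _)
    linarith [Metric.mem_ball.1 hw]
  have hy₀ : y₀ ∈ ω := hB₀ (Metric.mem_closedBall_self hr₀.le)
  have hωG : ω ⊆ G := by
    refine hconn.subset_of_closure_inter_subset hGo ⟨y₀, hy₀, r₀, hr₀, hlim⟩ ?_
    rintro w ⟨hw, hwω⟩
    obtain ⟨ρ, hρ, hρω⟩ := Metric.nhds_basis_closedBall.mem_iff.1 (hω.mem_nhds hwω)
    obtain ⟨z, hzw, τ, hτ, hz⟩ := mem_closure_iff.1 hw _ Metric.isOpen_ball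
      (Metric.mem_ball_self hρ)
    exact ⟨ρ, hρ, tendsto_ball_of_tendsto_ball H hc hcl hω hε0 hε m hex hρ hτ hρω hzw hz⟩
  obtain ⟨ρ, hρ, h⟩ := hωG (hB (Metric.mem_closedBall_self hr.le))
  exact tendsto_ball_of_tendsto_ball H hc hcl hω hε0 hε m hex hr hρ hB
    (Metric.mem_ball_self hr) h

theorem tendsto_lintegral_sub_of_isPreconnected (hfin : volume ω ≠ ⊤) (hconn : IsPreconnected ω)
    {y₀ : E2} {r₀ : ℝ} (hr₀ : 0 < r₀) (hB₀ : Metric.closedBall y₀ r₀ ⊆ ω) {e : E3}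
    (he : ‖e‖ = 1) (hlim : Tendsto (fun n => ∫⁻ x in filmΩ f₁ f₂ (Metric.closedBall y₀ r₀) (ε n),
      ‖(m n).toFun x - e‖ₑ ^ 2) atTop (𝓝 0)) :
    Tendsto (fun n => ∫⁻ x in filmΩ f₁ f₂ ω (ε n), ‖(m n).toFun x - e‖ₑ ^ 2) atTop (𝓝 0) := by
  obtain ⟨T, hT0, hT, -⟩ := H.exists_thickness_le
  rw [ENNReal.tendsto_nhds_zero]
  intro η hη
  -- With this uncovered area the remainder 4T · (area) is at most η/2.
  have hη' : η / 2 / (4 * ENNReal.ofReal T) ≠ 0 :=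
    (ENNReal.div_pos (ENNReal.half_pos hη.ne').ne' (by finiteness)).ne'
  obtain ⟨s, r, hs, -, hvol⟩ := exists_finset_disjoint_closedBall hω hfin one_pos hη'
  have hsum : Tendsto (fun n => ∑ y ∈ s, ∫⁻ x in filmΩ f₁ f₂ (Metric.closedBall y (r y)) (ε n),
      ‖(m n).toFun x - e‖ₑ ^ 2) atTop (𝓝 (∑ y ∈ s, 0)) :=
    tendsto_finsetSum _ fun y hy => tendsto_ball_of_isPreconnected H hc hcl hω hε0 hε m hex hconn
      hr₀ hB₀ hlim (hs y hy).1 (hs y hy).2.2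
  rw [Finset.sum_const_zero] at hsum
  filter_upwards [ENNReal.tendsto_nhds_zero.1 hsum _ (ENNReal.half_pos hη.ne')] with n hn
  refine (lintegral_sub_le_sum_balls H hT (m n) hω (s := s) (r := r) (a := fun _ => e)
    fun _ => he.le).trans ?_
  rw [← ENNReal.add_halves η]
  refine add_le_add hn ?_
  rw [← mul_assoc]
  exact (mul_le_mul_right hvol _).trans (ENNReal.mul_div_le)

end

/-! ### Convergence of minimizers -/

theorem exists_isMinOn_quadForm (A : Matrix (Fin 3) (Fin 3) ℝ) :
    ∃ e : E3, ‖e‖ = 1 ∧ ∀ v : E3, ‖v‖ = 1 → quadForm A e ≤ quadForm A v := by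
  have hc : Continuous (quadForm A) := by
    simp only [funext fun e => quadForm_eq A e]
    fun_prop
  obtain ⟨e, he, hmin⟩ := (isCompact_sphere (0 : E3) 1).exists_isMinOn
    ⟨EuclideanSpace.single 0 1, by simp⟩ hc.continuousOn
  exact ⟨e, by simpa using he, fun v hv => hmin (by simpa using hv)⟩

theorem integral_quadForm_indicator {A : Matrix (Fin 3) (Fin 3) ℝ} {ω : Set E2}
    (hω : MeasurableSet ω) (e : E3) :
    ∫ x, quadForm A (ω.indicator (fun _ => e) x) = quadForm A e * volume.real ω := by
  have h : ∀ x, quadForm A (ω.indicator (fun _ => e) x)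
      = ω.indicator (fun _ => quadForm A e) x := by
    intro x
    by_cases hx : x ∈ ω
    · simp [hx]
    · simp [hx, quadForm]
  simp only [h]
  rw [integral_indicator_const _ hω, smul_eq_mul, mul_comm]

section
variable {d : ℝ} (hd : 0 < d) {f₁ f₂ : E2 → ℝ} (H : IsFilm f₁ f₂) (p₁ : IsQPeriodic f₁)
  (p₂ : IsQPeriodic f₂) {c : ℝ} (hc : 0 < c) (hcl : ∀ y, c ≤ f₂ y - f₁ y)
  {ω : Set E2} (hω : IsOpen ω) (hfin : volume ω ≠ ⊤) (hne : ω.Nonempty)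
  {ε : ℕ → ℝ} (hε0 : ∀ n, 0 < ε n) (hε : Tendsto ε atTop (𝓝 0))
  {m : ∀ n, H1Sphere (filmΩ f₁ f₂ ω (ε n))}
  (hm : ∀ n, IsEnergyMinimizer d f₁ f₂ ω (ε n) (m n))
  {e : E3} (he : ‖e‖ = 1)
  (hmin : ∀ v : E3, ‖v‖ = 1 → quadForm (Ahom f₁ f₂) e ≤ quadForm (Ahom f₁ f₂) v)

include H hω hfin hε0 hm he in
theorem energy_le_layerNorm_sq (n : ℕ) :
    d ^ 2 * (exchange (m n)).toReal + magNorm f₁ f₂ ω (ε n) (m n).toFun ^ 2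
      ≤ layerNorm f₁ f₂ (ε n) (ω.indicator fun _ => e) ^ 2 := by
  obtain ⟨T, -, hT, -⟩ := H.exists_thickness_le
  have hU : volume (filmΩ f₁ f₂ ω (ε n)) < ⊤ :=
    (H.volume_filmΩ_le hω.measurableSet hT _).trans_lt
      (ENNReal.mul_lt_top ENNReal.ofReal_lt_top hfin.lt_top)
  rw [← energy_eq (hε0 n), ← energy_const (hε0 n) d hU he]
  exact hm n _

include H p₁ p₂ hω hfin hε0 hε in
theorem tendsto_layerNorm_indicator (v : E3) :
    Tendsto (fun n => layerNorm f₁ f₂ (ε n) (ω.indicator fun _ => v) ^ 2) atTop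
      (𝓝 (quadForm (Ahom f₁ f₂) v * volume.real ω)) := by
  rw [← integral_quadForm_indicator hω.measurableSet]
  exact tendsto_layerNorm H p₁ p₂ hε0 hε (measurable_const.indicator hω.measurableSet)
    (memLp_indicator_const 2 hω.measurableSet _ (Or.inr hfin))

include H p₁ p₂ hω hfin hne hε0 hε in
-- Up to the positive factor |ω| it is a limit of squares, the energies of constant maps.
theorem quadForm_Ahom_nonneg (v : E3) : 0 ≤ quadForm (Ahom f₁ f₂) v := by
  have h := ge_of_tendsto' (tendsto_layerNorm_indicator H p₁ p₂ hω hfin hε0 hε v)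
    fun n => sq_nonneg _
  have h1 : 0 < volume.real ω :=
    ENNReal.toReal_pos (hω.measure_pos volume hne).ne' hfin
  exact nonneg_of_mul_nonneg_left h h1

include hd H p₁ p₂ hc hcl hω hfin hne hε0 hε hm he hmin

/-- If the exchange energy exceeded θ > 0 along a subsequence, comparison with the constant map e
would bound the squared magnetostatic norm by a quantity tending to q(e)|ω| - d²θ, where q is the
quadratic form of `Ahom`. The lower bound forces the limit to be at least q(e)|ω|. -/
theorem tendsto_exchange : Tendsto (fun n => exchange (m n)) atTop (𝓝 0) := by
  set b := fun n => layerNorm f₁ f₂ (ε n) (ω.indicator fun _ => e) ^ 2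
  have hb : Tendsto b atTop (𝓝 (quadForm (Ahom f₁ f₂) e * volume.real ω)) :=
    tendsto_layerNorm_indicator H p₁ p₂ hω hfin hε0 hε e
  have hle := energy_le_layerNorm_sq H hω hfin hε0 hm he
  have hl0 := quadForm_Ahom_nonneg H p₁ p₂ hω hfin hne hε0 hε e
  have hd2 : 0 < d ^ 2 := by positivity
  obtain ⟨B, hB⟩ := hb.bddAbove_range
  have hexB : ∀ n, exchange (m n) ≤ ENNReal.ofReal (B / d ^ 2) := fun n => by
    rw [ENNReal.le_ofReal_iff_toReal_le (exchange_lt_top _).ne, le_div_iff₀ hd2]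
    · have := hle n
      have h2 : b n ≤ B := hB ⟨n, rfl⟩
      nlinarith [sq_nonneg (magNorm f₁ f₂ ω (ε n) (m n).toFun)]
    · exact div_nonneg ((sq_nonneg _).trans (hB ⟨0, rfl⟩)) hd2.le
  by_contra hcon
  rw [ENNReal.tendsto_nhds_zero] at hcon
  push Not at hcon
  obtain ⟨θ, hθ0, hθ⟩ := hcon
  obtain ⟨φ, hφ, hθφ⟩ := extraction_of_frequently_atTop hθ
  have hθt : θ ≠ ⊤ := ((hθφ 0).trans (exchange_lt_top _)).ne
  have hθr : 0 < θ.toReal := ENNReal.toReal_pos hθ0.ne' hθt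
  have hbφ := hb.comp hφ.tendsto_atTop
  have hsq : ∀ k, magNorm f₁ f₂ ω (ε (φ k)) (m (φ k)).toFun ^ 2
      ≤ b (φ k) - d ^ 2 * θ.toReal := fun k => by
    have h1 := ENNReal.toReal_mono (exchange_lt_top _).ne (hθφ k).le
    have h2 := hle (φ k)
    have h3 := mul_le_mul_of_nonneg_left h1 hd2.le
    simp only [b]
    linarith
  have hlim := sqrt_le_of_magNorm_le H hc hcl hω (fun k => hε0 (φ k))
    (hε.comp hφ.tendsto_atTop) (fun k => m (φ k)) hfin p₁ p₂ ENNReal.ofReal_ne_top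
    (fun k => hexB (φ k)) hl0 hmin (hbφ.sub_const (d ^ 2 * θ.toReal)).sqrt
    fun k => Real.le_sqrt_of_sq_le (hsq k)
  have hnn : 0 ≤ quadForm (Ahom f₁ f₂) e * volume.real ω - d ^ 2 * θ.toReal :=
    ge_of_tendsto' (hbφ.sub_const (d ^ 2 * θ.toReal)) fun k => (sq_nonneg _).trans (hsq k)
  rw [Real.sqrt_le_sqrt_iff hnn] at hlim
  nlinarith [mul_pos hd2 hθr]

/-- The limit direction is fixed by compactness of the sphere on a single ball and then propagated
over ω. Its optimality follows from comparing magnetostatic norms: that of e₀ is the limit of those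
of the minimizers, which never exceed that of the constant competitor e. -/
theorem exists_subseq_tendsto_minimizer (hconn : IsPreconnected ω) :
    ∃ e₀ : E3, ‖e₀‖ = 1 ∧
      (∃ φ : ℕ → ℕ, StrictMono φ ∧
        Tendsto (fun k => ∫ x in filmΩ f₁ f₂ ω (ε (φ k)), ‖(m (φ k)).toFun x - e₀‖ ^ 2)
          atTop (𝓝 0)) ∧
      (∀ v : E3, ‖v‖ = 1 → quadForm (Ahom f₁ f₂) e₀ ≤ quadForm (Ahom f₁ f₂) v) := by
  have hex := tendsto_exchange hd H p₁ p₂ hc hcl hω hfin hne hε0 hε hm he hmin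
  obtain ⟨T, hT0, hT, -⟩ := H.exists_thickness_le
  obtain ⟨y, hy⟩ := hne
  obtain ⟨r, hr, hB⟩ := Metric.nhds_basis_closedBall.mem_iff.1 (hω.mem_nhds hy)
  obtain ⟨u, hu1, hu⟩ := exists_unit_tendsto_ball H hc hcl hω hε0 hε m hex hr hB
  obtain ⟨e₀, he₀, φ, hφ, hlim⟩ := (isCompact_sphere (0 : E3) 1).tendsto_subseq (x := u)
    fun n => by simpa using hu1 n
  have he₀' : ‖e₀‖ = 1 := by simpa using he₀
  have hball : Tendsto (fun k => ∫⁻ x in filmΩ f₁ f₂ (Metric.closedBall y r) (ε (φ k)),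
      ‖(m (φ k)).toFun x - e₀‖ₑ ^ 2) atTop (𝓝 0) := by
    have hV : ENNReal.ofReal T * volume (Metric.closedBall y r) ≠ ⊤ :=
      ENNReal.mul_ne_top ENNReal.ofReal_ne_top measure_closedBall_lt_top.ne
    have h1 : Tendsto (fun k => ‖u (φ k) - e₀‖ₑ ^ 2) atTop (𝓝 (‖e₀ - e₀‖ₑ ^ 2)) :=
      ((ENNReal.continuous_pow 2).tendsto _).comp
        ((continuous_enorm.tendsto _).comp (hlim.sub_const _))
    have h2 := (ENNReal.Tendsto.const_mul (hu.comp hφ.tendsto_atTop)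
      (Or.inr (ENNReal.ofNat_ne_top (n := 2)))).add
      (ENNReal.Tendsto.const_mul (ENNReal.Tendsto.mul_const h1 (Or.inr hV))
        (Or.inr (ENNReal.ofNat_ne_top (n := 2))))
    simp only [sub_self, enorm_zero, ne_eq, OfNat.ofNat_ne_zero, not_false_eq_true, zero_pow,
      zero_mul, mul_zero, add_zero] at h2
    exact tendsto_of_tendsto_of_tendsto_of_le_of_le tendsto_const_nhds h2 (fun _ => zero_le)
      fun k => lintegral_sub_const_le H hT (m (φ k)) Metric.isClosed_closedBall.measurableSet _ _
  have hεφ := hε.comp hφ.tendsto_atTop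
  have hall := tendsto_lintegral_sub_of_isPreconnected H hc hcl hω (fun k => hε0 (φ k)) hεφ
    (fun k => m (φ k)) (hex.comp hφ.tendsto_atTop) hfin hconn hr hB he₀' hball
  have hreal := (ENNReal.tendsto_toReal ENNReal.zero_ne_top).comp hall
  rw [ENNReal.toReal_zero] at hreal
  refine ⟨e₀, he₀', ⟨φ, hφ, ?_⟩, fun v hv => le_trans ?_ (hmin v hv)⟩
  · refine hreal.congr fun k => ?_
    rw [integral_norm_sq_eq (F := fun x => (m (φ k)).toFun x - e₀) ((m (φ k)).memLp_toFun.1.sub aestronglyMeasurable_const)]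
    rfl
  have hpos : 0 < volume.real ω := ENNReal.toReal_pos (hω.measure_pos volume ⟨y, hy⟩).ne' hfin
  have t0 := (tendsto_layerNorm_indicator H p₁ p₂ hω hfin (fun k => hε0 (φ k)) hεφ e₀).sqrt
  have t1 := (tendsto_layerNorm_indicator H p₁ p₂ hω hfin (fun k => hε0 (φ k)) hεφ e).sqrt
  simp only [Real.sqrt_sq (layerNorm_nonneg _ _ _ _)] at t0 t1
  have t2 := t1.add hreal.sqrt
  rw [Real.sqrt_zero, add_zero] at t2
  have hle := le_of_tendsto_of_tendsto' t0 t2 fun k => by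
    have h1 := H.abs_magNorm_sub_layerNorm_le (hε0 (φ k)) hω (m (φ k))
      (measurable_const.indicator hω.measurableSet (f := fun _ => e₀))
      (memLp_indicator_const 2 hω.measurableSet _ (Or.inr hfin))
      (fun z hz => Set.indicator_of_notMem hz _)
    have h2 : ∫⁻ x in filmΩ f₁ f₂ ω (ε (φ k)),
        ‖(m (φ k)).toFun x - ω.indicator (fun _ => e₀) (horiz x)‖ₑ ^ 2
        = ∫⁻ x in filmΩ f₁ f₂ ω (ε (φ k)), ‖(m (φ k)).toFun x - e₀‖ₑ ^ 2 :=
      setLIntegral_congr_fun (H.measurableSet_filmΩ hω.measurableSet _) fun x hx => by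
        simp only [Set.indicator_of_mem hx.1]
    rw [h2] at h1
    have h3 := energy_le_layerNorm_sq H hω hfin hε0 hm he (φ k)
    have h4 : magNorm f₁ f₂ ω (ε (φ k)) (m (φ k)).toFun
        ≤ layerNorm f₁ f₂ (ε (φ k)) (ω.indicator fun _ => e) := by
      refine (sq_le_sq₀ (magNorm_nonneg _) (layerNorm_nonneg _ _ _ _)).1 (le_trans ?_ h3)
      exact le_add_of_nonneg_left (by positivity)
    have h5 := (abs_le.1 h1).1
    simp only [Function.comp_apply] at *
    linarith
  rw [Real.sqrt_le_sqrt_iff (mul_nonneg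
    (quadForm_Ahom_nonneg H p₁ p₂ hω hfin ⟨y, hy⟩ hε0 hε e) hpos.le)] at hle
  exact le_of_mul_le_mul_right hle hpos

end

end ThinFilm

/-! ### Proof of the theorem -/

theorem corollary2
    (d : ℝ) (hd : 0 < d)
    (f₁ f₂ : ThinFilm.E2 → ℝ)
    (hf₁_lip : ∃ K : NNReal, LipschitzWith K f₁) (hf₂_lip : ∃ K : NNReal, LipschitzWith K f₂)
    (hf₁_per : ThinFilm.IsQPeriodic f₁) (hf₂_per : ThinFilm.IsQPeriodic f₂)
    (hf₁_pos : ∀ x, 0 < f₁ x) (hf₁₂ : ∀ x, f₁ x < f₂ x)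
    (ω : Set ThinFilm.E2) (hω_open : IsOpen ω) (hω_bdd : Bornology.IsBounded ω)
    (hω_conn : IsPreconnected ω) (hω_lip : ThinFilm.HasLipschitzBoundary ω)
    (ε : ℕ → ℝ) (hε_pos : ∀ n, 0 < ε n) (hε : Tendsto ε atTop (𝓝 0))
    (m : ∀ n, ThinFilm.H1Sphere (ThinFilm.filmΩ f₁ f₂ ω (ε n)))
    (hm : ∀ n, ThinFilm.IsEnergyMinimizer d f₁ f₂ ω (ε n) (m n)) :
    ∃ e₀ : ThinFilm.E3, ‖e₀‖ = 1 ∧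
      (∃ φ : ℕ → ℕ, StrictMono φ ∧
        Tendsto (fun k => ∫ x in ThinFilm.filmΩ f₁ f₂ ω (ε (φ k)), ‖(m (φ k)).toFun x - e₀‖ ^ 2)
          atTop (𝓝 0)) ∧
      (∀ e : ThinFilm.E3, ‖e‖ = 1 →
        ThinFilm.quadForm (ThinFilm.Ahom f₁ f₂) e₀ ≤ ThinFilm.quadForm (ThinFilm.Ahom f₁ f₂) e) := by
  have H : ThinFilm.IsFilm f₁ f₂ := ⟨hf₁_per.isProfile hf₁_lip, hf₂_per.isProfile hf₂_lip, hf₁₂⟩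
  have hper : ThinFilm.IsQPeriodic fun y => f₂ y - f₁ y := fun x k => by
    simp only [hf₁_per x k, hf₂_per x k]
  obtain ⟨c, hc, hcl⟩ := hper.exists_pos_le (H.top.continuous.sub H.bot.continuous)
    fun x => sub_pos.2 (hf₁₂ x)
  obtain ⟨e, he, hmin⟩ := ThinFilm.exists_isMinOn_quadForm (ThinFilm.Ahom f₁ f₂)
  -- A preconnected set may be empty; then every integral vanishes and any minimizing direction will
  -- do.
  rcases ω.eq_empty_or_nonempty with rfl | hne
  · refine ⟨e, he, ⟨id, strictMono_id, ?_⟩, hmin⟩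
    simp [ThinFilm.filmΩ]
  · exact ThinFilm.exists_subseq_tendsto_minimizer hd H hf₁_per hf₂_per hc hcl hω_open
      hω_bdd.measure_lt_top.ne hne hε_pos hε hm he hmin hω_conn
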